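/- \textbf{Setting.} Let $F_v$ be a finite extension of $\mathbb{Q}_p$ with ring of integers $\mathcal{O}_{F_v}$, residue cardinality $N_v$, normalized valuation $v$ and $|x|=N_v^{-v(x)}$. Let $\psi=\psi_{\mathbb{Q}_p}\circ\mathrm{tr}_{F_v/\mathbb{Q}_p}$, where $\psi_{\mathbb{Q}_p}(x)=e^{-2\pi i\iota(x)}$ and $\iota:\mathbb{Q}_p/\mathbb{Z}_p\hookrightarrow\mathbb{Q}/\mathbb{Z}$, and let $d_v$ be a generator of the different of $F_v/\mathbb{Q}_p$. Let $E_v$ be a quadratic extension of $F_v$ (the inert and ramified cases) or $E_v\cong F_v\oplus F_v$ (the split case), with its nontrivial involution $\tau$, and let $\eta_v:F_v^\times\to\{\pm1\}$ be the associated quadratic character. Let $n\ge 1$, let $(\mathbb{V}_v,\langle\cdot,\cdot\rangle)$ be a nondegenerate Hermitian space over $E_v$ of dimension $n+1$, $q(x)=\langle x,x\rangle\in F_v$, with Hermitian determinant $d_{\mathbb{V}}\in F_v^\times/\mathrm{Nm}(E_v^\times)$. Use the self-dual Haar measures on $F_v$ (for $\psi(xy)$) and on $\mathbb{V}_v$ (for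 $\psi(\mathrm{tr}_{E_v/F_v}\langle x,y\rangle)$), and let $\gamma=\gamma(\mathbb{V}_v,q)$ be the Weil index, i.e. the value of $\int_L\psi(q(x))\,dx$ for all sufficiently large compact open subgroups $L\subset \mathbb{V}_v$. For an $\mathcal{O}_{E_v}$-lattice $\Lambda_v\subset\mathbb{V}_v$ let $\Lambda_v^\vee=\{x:\langle x,\Lambda_v\rangle\subset\mathcal{O}_{E_v}\}$. Assume: (i) if $v$ is unramified in $E$ (split or inert), $\Lambda_v^\vee=\Lambda_v$; (ii) if $v$ is ramified in $E$, then $p\neq2$, $|d_v|=1$, and, for a uniformizer $\varpi$ of $E_v$, $\Lambda_v^\vee=\varpi^{-1}\Lambda_v$ if $n$ is odd, while $\Lambda_v^\vee\subset\varpi^{-1}\Lambda_v$ with colength $1$ if $n$ is even. Put $\Phi_v=1_{\Lambda_v}$. For $a\in F_v^\times$, $r=v(a)$, let $$W_{a,v}(s,1,\Phi_v)=\int_{F_v}\delta_v(wn(b))^s\,\big(r(wn(b))\Phi_v\big)(0)\,\psi(-ab)\,db ,$$ where $w=\begin{pmatrix}0&1\\-1&0\end{pmatrix}$, $n(b)=\begin{pmatrix}1&b\\0&1\end{pmatrix}$,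 $\delta_v$ is the function on $\mathrm{U}(1,1)(F_v)$ with $\delta_v(n(b)m(x)k)=|\mathrm{Nm}(x)|^{1/2}$ for $m(x)=\mathrm{diag}(x,\tau(x)^{-1})$ and $k\in\mathrm{U}(1,1)\cap\mathrm{GL}_2(\mathcal{O}_{E_v})$, and $r(n(b))\Phi(x)=\psi(bq(x))\Phi(x)$, $r(w)\Phi=\gamma\,\widehat\Phi$ with $\widehat\Phi(x)=\int_{\mathbb{V}_v}\Phi(y)\psi(\mathrm{tr}\langle x,y\rangle)\,dy$. Let $\zeta_v$ and $L(s,\eta_v^{n+1})$ be the local Euler factors. \textbf{Statement.} The integral converges absolutely for $\mathrm{Re}(s)>-n$ and continues to an entire function of $s$, again denoted $W_{a,v}(s,1,\Phi_v)$; a prime denotes $d/ds$. Formulas that are quotients hold at every $s$ at which their denominators are nonzero. (1) Let $v$ be unramified in $E$. Then $\gamma=\eta_v(d_v)^{n+1}$; in particular $\gamma=1$ if $2\nmid n$ or $v$ is split. The function $W_{a,v}(s,1,\Phi_v)$ is nonzero only if $r\ge -v(d_v)$. Let $a\in\mathcal{O}_{F_v}$. If $2\nmid n$ or $v$ is split,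 then $$W_{a,v}(s,1,\Phi_v)=|d_v|^{s+n+\frac12}\frac{(1-N_v^{-(s+n+1)})(1-N_v^{-(r+1)(s+n)})}{1-N_v^{-(s+n)}}+|d_v|^{n+\frac32}\frac{(1-N_v^{-s})(1-|d_v|^{s-1})}{1-N_v^{-(s-1)}},$$ $$\begin{aligned}&W'_{a,v}(0,1,\Phi_v)-\tfrac12\log|a|\,W_{a,v}(0,1,\Phi_v)=\Big(-\tfrac{L'(n+1,\eta_v^{n+1})}{L(n+1,\eta_v^{n+1})}+\log|d_v|\Big)W_{a,v}(0,1,\Phi_v)\\&+|d_v|^{n+\frac12}\tfrac{1-N_v^{-(n+1)}}{2(1-N_v^{-n})^2}\big(r(1-N_v^{-(r+2)n})-(r+2)(N_v^{-n}-N_v^{-(r+1)n})\big)\log N_v+|d_v|^{n+\frac12}\tfrac{1-|d_v|}{N_v-1}\log N_v,\end{aligned}$$ and here $\frac{\zeta_v'(n+1)}{\zeta_v(n+1)}=\frac{L'(n+1,\eta_v^{n+1})}{L(n+1,\eta_v^{n+1})}$. If $2\mid n$ and $v$ is inert, then $$W_{a,v}(s,1,\Phi_v)=\gamma\Big(|d_v|^{s+n+\frac12}\tfrac{(1+N_v^{-(s+n+1)})(1-(-1)^{r+1}N_v^{-(r+1)(s+n)})}{1+N_v^{-(s+n)}}+|d_v|^{n+\frac32}\tfrac{(1-N_v^{-s})(1-|d_v|^{s-1})}{1-N_v^{-(s-1)}}\Big),$$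 $$\begin{aligned}&W'_{a,v}(0,1,\Phi_v)-\tfrac12\log|a|\,W_{a,v}(0,1,\Phi_v)=\Big(-\tfrac{L'(n+1,\eta_v^{n+1})}{L(n+1,\eta_v^{n+1})}+\log|d_v|\Big)W_{a,v}(0,1,\Phi_v)\\&+\gamma|d_v|^{n+\frac12}\tfrac{1+N_v^{-(n+1)}}{2(1+N_v^{-n})^2}\big(r(1-(-1)^rN_v^{-(r+2)n})+(r+2)(N_v^{-n}-(-1)^rN_v^{-(r+1)n})\big)\log N_v+\gamma|d_v|^{n+\frac12}\tfrac{1-|d_v|}{N_v-1}\log N_v.\end{aligned}$$ (2) Let $v$ be ramified in $E$. The function $W_{a,v}(s,1,\Phi_v)$ is nonzero only if $r\ge0$. Let $a\in\mathcal{O}_{F_v}$. If $2\nmid n$, then $\gamma=1$, $$W_{a,v}(s,1,\Phi_v)=\frac{(1-N_v^{-(s+n+1)})(1-N_v^{-(r+1)(s+n)})}{1-N_v^{-(s+n)}}-(1-N_v^{-(n+1)}),$$ $$\begin{aligned}&W'_{a,v}(0,1,\Phi_v)-\tfrac12\log|a|\,W_{a,v}(0,1,\Phi_v)=-\tfrac{\zeta'_v(n+1)}{\zeta_v(n+1)}W_{a,v}(0,1,\Phi_v)-\tfrac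 r2(1-N_v^{-(n+1)})\log N_v+N_v^{-(n+1)}\log N_v\\&+\tfrac{1-N_v^{-(n+1)}}{2(1-N_v^{-n})^2}\big(r-(r+2)N_v^{-n}+(r+2)N_v^{-(r+1)n}-rN_v^{-(r+2)n}\big)\log N_v.\end{aligned}$$ If $2\mid n$, then $\gamma^2=\eta_v(-1)$ and $L(s,\eta_v^{n+1})=1$. Put $\varepsilon=1$ if $a\in\mathrm{Nm}(E_v^\times)\cdot(-1)^{n/2}d_{\mathbb{V}}$ and $\varepsilon=-1$ otherwise. Then $$W_{a,v}(s,1,\Phi_v)=\gamma\big(N_v^{-(n+\frac12)}+\varepsilon N_v^{-(r+1)(s+n)-\frac12}\big),$$ $$W'_{a,v}(0,1,\Phi_v)-\tfrac12\log|a|\,W_{a,v}(0,1,\Phi_v)=\gamma\Big(-\varepsilon\,\tfrac{r+2}2N_v^{-(r+1)n-\frac12}+\tfrac r2N_v^{-(n+\frac12)}\Big)\log N_v .$$ Moreover, if $r=0$, then $a\in q(\Lambda_v)$ if and only if $\varepsilon=1$. -/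

import Mathlib

open MeasureTheory Filter Topology
open scoped ValuativeRel

noncomputable section

namespace LocalWhittaker

/-! ### The additive character of `ℚ_p` and of a finite extension `F` -/

theorem exists_padicFrac (p : ℕ) [hp : Fact p.Prime] (x : ℚ_[p]) :
    ∃ r : ℚ, (∃ (m : ℤ) (k : ℕ), r = m / (p : ℚ) ^ k) ∧ ‖x - (r : ℚ_[p])‖ ≤ 1 := by
  have hp0 : (p : ℚ_[p]) ≠ 0 := by exact_mod_cast hp.out.ne_zero
  have hp1 : (1 : ℝ) < p := by exact_mod_cast hp.out.one_lt
  have hpos : (0 : ℝ) < p := by linarith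
  obtain ⟨k, hk⟩ := pow_unbounded_of_one_lt ‖x‖ hp1
  have hy : ‖x * (p : ℚ_[p]) ^ k‖ ≤ 1 := by
    rw [norm_mul, norm_pow, Padic.norm_p, inv_pow, ← div_eq_mul_inv,
      div_le_one (by positivity)]
    exact hk.le
  let y : ℤ_[p] := ⟨x * (p : ℚ_[p]) ^ k, hy⟩
  refine ⟨((y.appr k : ℤ) : ℚ) / (p : ℚ) ^ k, ⟨_, _, rfl⟩, ?_⟩
  have h1 : ‖y - (y.appr k : ℤ_[p])‖ ≤ (p : ℝ) ^ (-k : ℤ) :=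
    (PadicInt.norm_le_pow_iff_mem_span_pow _ _).mpr (y.appr_spec k)
  have h2 : ‖x * (p : ℚ_[p]) ^ k - (y.appr k : ℚ_[p])‖ ≤ (p : ℝ) ^ (-k : ℤ) := by
    rw [PadicInt.norm_def] at h1
    push_cast at h1
    exact h1
  have h3 : x - (((((y.appr k : ℤ) : ℚ) / (p : ℚ) ^ k : ℚ)) : ℚ_[p])
      = (x * (p : ℚ_[p]) ^ k - (y.appr k : ℚ_[p])) / (p : ℚ_[p]) ^ k := by
    push_cast
    field_simp
  rw [h3, norm_div, norm_pow, Padic.norm_p, inv_pow, div_inv_eq_mul]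
  calc _ ≤ (p : ℝ) ^ (-k : ℤ) * (p : ℝ) ^ k := by gcongr
    _ = 1 := by
      rw [zpow_neg, zpow_natCast]
      exact inv_mul_cancel₀ (by positivity)

/-- A representative in `ℤ[1/p]` of the image of `x` under `ℚ_p / ℤ_p ↪ ℚ / ℤ`. -/
def padicFrac (p : ℕ) [Fact p.Prime] (x : ℚ_[p]) : ℚ := (exists_padicFrac p x).choose

/-- `ψ_{ℚ_p}(x) = exp(-2πi ι(x))`, with `ι : ℚ_p / ℤ_p ↪ ℚ / ℤ`. -/
def padicChar (p : ℕ) [Fact p.Prime] (x : ℚ_[p]) : ℂ :=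
  Complex.exp (-(2 * Real.pi * Complex.I * (padicFrac p x : ℂ)))

/-- `ψ = ψ_{ℚ_p} ∘ tr_{F/ℚ_p}`. -/
def addChar (p : ℕ) [Fact p.Prime] {F : Type*} [Field F] [Algebra ℚ_[p] F] (x : F) : ℂ :=
  padicChar p (Algebra.trace ℚ_[p] F x)

/-! ### Schwartz-Bruhat functions, Fourier transform, self-dual measures -/

section Fourier

variable {A : Type*} [AddCommGroup A] [TopologicalSpace A] [MeasurableSpace A]

/-- Locally constant functions with compact support. -/
def IsSchwartzBruhat (Φ : A → ℂ) : Prop := IsLocallyConstant Φ ∧ HasCompactSupport Φ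

/-- Fourier transform with respect to the pairing `β : A × A → ℂ^×` and the measure `μ`. -/
def fourier (β : A → A → ℂ) (μ : Measure A) (Φ : A → ℂ) (x : A) : ℂ := ∫ y, Φ y * β x y ∂μ

/-- `μ` is the Haar measure for which Fourier inversion holds. -/
def IsSelfDualMeasure (β : A → A → ℂ) (μ : Measure A) : Prop :=
  μ.IsAddHaarMeasure ∧
    ∀ Φ : A → ℂ, IsSchwartzBruhat Φ → ∀ x, fourier β μ (fourier β μ Φ) x = Φ (-x)

end Fourier

/-! ### The local field `F` -/

section Field

variable (F : Type*) [Field F] [ValuativeRel F] [TopologicalSpace F] [IsNonarchimedeanLocalField F]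

/-- The cardinality `N_v` of the residue field. -/
def resCard : ℕ := Nat.card 𝓀[F]

variable {F}

/-- The normalized (surjective onto `ℤ`) additive valuation; the value at `0` is not used. -/
def ord (x : F) : ℤ :=
  -WithZero.log (IsNonarchimedeanLocalField.valueGroupWithZeroIsoInt F (ValuativeRel.valuation F x))

open Classical in
/-- The normalized absolute value `|x| = N_v ^ (-v(x))`. -/
def absV (x : F) : ℝ := if x = 0 then 0 else (resCard F : ℝ) ^ (-ord x)

/-- `d` generates the different of `F` over `ℚ_p`: `d⁻¹ 𝒪_F` is the dual of `𝒪_F` under the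
trace form. -/
def IsDifferent (p : ℕ) [Fact p.Prime] [Algebra ℚ_[p] F] (d : F) : Prop :=
  d ≠ 0 ∧ ∀ x : F, x * d ∈ 𝒪[F] ↔ ∀ y ∈ 𝒪[F], ‖Algebra.trace ℚ_[p] F (x * y)‖ ≤ 1

variable (F) in
/-- A uniformizer of `F`. -/
def unif : F := ((IsDiscreteValuationRing.exists_irreducible 𝒪[F]).choose : 𝒪[F])

open Classical in
/-- Local Euler factor of a character `χ` of `F^×`: `(1 - χ(ϖ) N^{-s})⁻¹` if `χ` is unramified,
and `1` otherwise. -/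
def localL (χ : F → ℂ) (s : ℂ) : ℂ :=
  if ∀ u : F, absV u = 1 → χ u = 1 then (1 - χ (unif F) * (resCard F : ℂ) ^ (-s))⁻¹ else 1

variable (F) in
/-- The local zeta factor `(1 - N^{-s})⁻¹`. -/
def localZeta (s : ℂ) : ℂ := (1 - (resCard F : ℂ) ^ (-s))⁻¹

variable (E : Type*) [CommRing E] [Algebra F E]

variable (F) in
/-- The ring of integers of the quadratic algebra `E`. -/
abbrev intE : Subalgebra 𝒪[F] E := integralClosure 𝒪[F] E

open Classical in
/-- The quadratic character of `F^×` attached to `E/F`: it is `1` on norms from `E^×`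
and `-1` elsewhere. -/
def eta (x : F) : ℂ := if ∃ z : Eˣ, Algebra.norm F (z : E) = x then 1 else -1

variable (F)

/-- `E ≅ F × F`. -/
def IsSplit : Prop := Nonempty (E ≃ₐ[F] F × F)

/-- `E` is a field in which the prime of `F` stays prime. -/
def IsInert : Prop :=
  IsField E ∧ (Ideal.map (algebraMap 𝒪[F] (intE F E)) 𝓂[F]).IsPrime

/-- `E` is a field in which the prime of `F` is the square of a prime. -/
def IsRamified : Prop :=
  IsField E ∧ ∃ P : Ideal (intE F E), P.IsPrime ∧
    Ideal.map (algebraMap 𝒪[F] (intE F E)) 𝓂[F] = P ^ 2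

end Field

/-! ### The group `U(1,1)` -/

section Unitary

variable {F : Type*} [Field F] [ValuativeRel F] [TopologicalSpace F] [IsNonarchimedeanLocalField F]
  {E : Type*} [CommRing E] [Algebra F E] (τ : E ≃ₐ[F] E)

variable (E) in
/-- `w`. -/
def wMat : Matrix (Fin 2) (Fin 2) E := !![0, 1; -1, 0]

variable (E) in
/-- `n(b)`. -/
def nMat (b : F) : Matrix (Fin 2) (Fin 2) E := !![1, algebraMap F E b; 0, 1]

/-- `m(a) = diag(a, \bar a⁻¹)`. -/
def mMat (a : Eˣ) : Matrix (Fin 2) (Fin 2) E := !![(a : E), 0; 0, τ ((a⁻¹ : Eˣ) : E)]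

/-- The unitary group of the standard skew-Hermitian plane, as a set of matrices. -/
def U11 : Set (Matrix (Fin 2) (Fin 2) E) :=
  {g | g * wMat E * (g.map τ).transpose = wMat E}

/-- `K = U(1,1) ∩ GL₂(𝒪_E)`. -/
def maxCompact : Set (Matrix (Fin 2) (Fin 2) E) :=
  {g | g ∈ U11 τ ∧ ∃ k : GL (Fin 2) (intE F E),
    (k : Matrix (Fin 2) (Fin 2) (intE F E)).map (algebraMap (intE F E) E) = g}

open Classical in
/-- The modulus function: `δ(n(b) m(a) k) = |Nm_{E/F}(a)|^{1/2}` for `k ∈ K`. -/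
def modulus (g : Matrix (Fin 2) (Fin 2) E) : ℝ :=
  if h : ∃ t : ℝ, ∃ (b : F) (a : Eˣ) (k : Matrix (Fin 2) (Fin 2) E), k ∈ maxCompact τ ∧
      g = nMat E b * mMat τ a * k ∧ t = Real.sqrt (absV (Algebra.norm F (a : E)))
  then h.choose else 0

end Unitary

/-! ### Hermitian spaces, lattices, the Weil representation -/

section Hermitian

variable {F : Type*} [Field F] [ValuativeRel F] [TopologicalSpace F] [IsNonarchimedeanLocalField F]
  {E : Type*} [CommRing E] [Algebra F E] {τ : E ≃ₐ[F] E}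
  {V : Type*} [AddCommGroup V] [Module E V]

/-- `H` is Hermitian and nondegenerate. -/
structure IsHermitian (H : V →ₗ[E] V →ₛₗ[(τ : E →+* E)] E) : Prop where
  symm : ∀ x y, H y x = τ (H x y)
  nondeg : ∀ x, (∀ y, H x y = 0) → x = 0

/-- The Hermitian norm `q(x) = ⟨x, x⟩ ∈ F`. As `⟨x, x⟩` is fixed by `τ`, it is half of its trace. -/
def herm (H : V →ₗ[E] V →ₛₗ[(τ : E →+* E)] E) (x : V) : F := Algebra.trace F E (H x x) / 2

/-- `c ∈ F` is the determinant of a Gram matrix of `H`, i.e. it represents the Hermitian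
determinant in `F^× / Nm(E^×)`. -/
def IsHermDet (n : ℕ) (H : V →ₗ[E] V →ₛₗ[(τ : E →+* E)] E) (c : F) : Prop :=
  ∃ B : Module.Basis (Fin (n + 1)) E V,
    algebraMap F E c = Matrix.det (Matrix.of fun i j => H (B i) (B j))

/-- `Λ` is an `𝒪_E`-lattice in `V`. -/
def IsLattice (Λ : Submodule (intE F E) V) : Prop :=
  Λ.FG ∧ Submodule.span E (Λ : Set V) = ⊤

/-- The dual lattice `{x : ⟨x, Λ⟩ ⊆ 𝒪_E}`. -/
def dualLattice (H : V →ₗ[E] V →ₛₗ[(τ : E →+* E)] E) (Λ : Submodule (intE F E) V) :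
    Submodule (intE F E) V where
  carrier := {x | ∀ y ∈ Λ, H x y ∈ intE F E}
  zero_mem' := fun y _ => by simp
  add_mem' := fun {x x'} hx hx' y hy => by
    simpa using add_mem (hx y hy) (hx' y hy)
  smul_mem' := fun c x hx y hy => by
    have h : H (c • x) y = (c : E) * H x y := by
      rw [Subalgebra.smul_def, map_smul, LinearMap.smul_apply, smul_eq_mul]
    rw [h]
    exact mul_mem c.2 (hx y hy)

/-- `ϖ⁻¹ Λ`, as the preimage of `Λ` under multiplication by `ϖ`. -/
def invScale (ϖ : intE F E) (Λ : Submodule (intE F E) V) : Submodule (intE F E) V :=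
  Λ.comap (LinearMap.lsmul (intE F E) V ϖ)

/-- Self-dual lattices. -/
def IsSelfDualLattice (H : V →ₗ[E] V →ₛₗ[(τ : E →+* E)] E) (Λ : Submodule (intE F E) V) : Prop :=
  dualLattice H Λ = Λ

/-- `ϖ`-modular lattices. -/
def IsModular (ϖ : intE F E) (H : V →ₗ[E] V →ₛₗ[(τ : E →+* E)] E)
    (Λ : Submodule (intE F E) V) : Prop :=
  dualLattice H Λ = invScale ϖ Λ

/-- Almost `ϖ`-modular lattices. The covering relation says that the inclusion has colength 1. -/
def IsAlmostModular (ϖ : intE F E) (H : V →ₗ[E] V →ₛₗ[(τ : E →+* E)] E)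
    (Λ : Submodule (intE F E) V) : Prop :=
  dualLattice H Λ ⋖ invScale ϖ Λ

section Weil

variable (p : ℕ) [Fact p.Prime] [Algebra ℚ_[p] F] (H : V →ₗ[E] V →ₛₗ[(τ : E →+* E)] E)

/-- The pairing `ψ_E(⟨x, y⟩) = ψ(tr_{E/F} ⟨x, y⟩)` on `V`. -/
def pairingV (x y : V) : ℂ := addChar p (Algebra.trace F E (H x y))

variable [TopologicalSpace V] [MeasurableSpace V]

/-- The Weil index of the quadratic space `(V, q)` for `ψ`: the (eventually constant) value of
`∫_L ψ(q(x)) dx` for large compact open subgroups `L`. -/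
def weilIndex (μV : Measure V) : ℂ :=
  limUnder (atTop : Filter {L : AddSubgroup V // IsOpen (L : Set V) ∧ IsCompact (L : Set V)})
    fun L => ∫ x in (L.1 : Set V), addChar p (herm H x) ∂μV

/-- `r(n(b)) Φ (x) = ψ(b q(x)) Φ(x)`. -/
def weilN (b : F) (Φ : V → ℂ) (x : V) : ℂ := addChar p (b * herm H x) * Φ x

/-- `r(w) Φ = γ(V, q) \hat Φ`. -/
def weilW (μV : Measure V) (Φ : V → ℂ) (x : V) : ℂ :=
  weilIndex p H μV * fourier (pairingV p H) μV Φ x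

/-- The integrand `δ(w n(b))^s · r(w n(b)) Φ (0) · ψ(-a b)` of the local Whittaker integral
`W_a(s, 1, Φ)`. -/
def whittakerIntegrand (μV : Measure V) (Φ : V → ℂ) (a : F) (s : ℂ) (b : F) : ℂ :=
  ((modulus τ (wMat E * nMat E b) : ℝ) : ℂ) ^ s * weilW p H μV (weilN p H b Φ) 0
    * addChar p (-(a * b))

/-- `W` is the function `s ↦ W_a(s, 1, Φ)`: it is given by the absolutely convergent Whittaker
integral for `Re s > σ`, and it is the analytic continuation of that integral to `ℂ`. -/
def IsWhittaker [MeasurableSpace F] (μF : Measure F) (μV : Measure V) (Φ : V → ℂ) (a : F) (σ : ℝ)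
    (W : ℂ → ℂ) : Prop :=
  Differentiable ℂ W ∧ ∀ s : ℂ, σ < s.re →
    Integrable (whittakerIntegrand p H μV Φ a s) μF ∧
      W s = ∫ b, whittakerIntegrand p H μV Φ a s b ∂μF

end Weil

end Hermitian

end LocalWhittaker

end

/-!
Write `q(x) = ⟨x, x⟩`, `N` for the residue cardinality and `G(b) = ∫_Λ ψ(b q(x)) dx`. The value at `0`
of `r(w n(b)) 1_Λ` is `γ G(b)`, and `δ(w n(b))` is `1` on `𝒪_F` and `|b|⁻¹` elsewhere. The Whittaker
integral is therefore a sum over the shells `𝒪_F` and `{v(b) = -k}`, `k ≥ 1`, of `N^{-ks}` times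
`c_k = ∫ γ G(b) ψ(-ab) db`. The lattices in question satisfy `|G(b)| ≤ C |b|^{-(n + 1)}`, which gives
absolute convergence for `Re s > -n`, and `c_k = 0` for large `k`, so that the sum is a polynomial in
`N^{-s}` (`isWhittaker_of_shells`). Everything rests on the evaluation of `G` and of `γ`.

Both come from one reduction. If `ψ(b q)` is trivial on `L ⊆ Λ`, translation by `L` multiplies
`ψ(b q)` by the characters `l ↦ ψ(b tr ⟨x, l⟩)`, so only those `x ∈ Λ` for which `b x` annihilates `L`
contribute to `G(b)` (`setIntegral_psi_herm`). In the same way `γ` is the integral of `ψ(q)` over the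
annihilator of any lattice on which `ψ(q)` is trivial (`weilIndex_eq`), and self-duality of the
measure gives `vol(L) vol(L^⊥) = 1` (`measureReal_mul_perp`).

* At a split place `E` contains an idempotent, which takes the role of an isotropic direction;
  choosing `L` accordingly gives `G(b) = N^{-(n + 1) k} vol(Λ)` for `v(b d) = -k ≤ 0`
  (`setIntegral_split`).
* At an inert place the reduction leaves `v(b d) = -1`, a Hermitian Gauss sum over the residue field.
  It equals `(-N)^{n + 1}`: its square is a standard computation, and its sign follows from the
  congruence modulo `N^2 - 1` for the number of isotropic vectors (`sum_hermitian_eq`). Hence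
  `G(b) = (-N)^{-(n + 1) k} vol(Λ)` (`setIntegral_inert`).
* At a ramified place and for odd `n` the reduction leaves `v(b) = -1`, where `ψ(b q)` is trivial on
  `Λ` (`ramified_modular`).
* At a ramified place and for even `n` the form `q` modulo the maximal ideal is `c α²` in a single
  coordinate `α`, and `G(b)` is a quadratic Gauss sum; it depends on the class of `b` modulo squares
  through the residual quadratic character (`ramified_almostModular`). The class of `c` modulo norms
  is that of `(-1)^{n / 2} d_V`: for an orthogonal basis with unit values of `q` the Weil index is
  also a product of `n + 1` Gauss sums, and the two expressions for it are compared
  (`resChar_eq_of_isHermDet`).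

In the first three cases `G` is constant on shells, so that `c_k` only involves integrals of
`ψ(-ab)` over balls, and summation by parts yields the function `whittakerModel`; its closed form is
a sum of two geometric series, and its derivative at `0` is computed directly
(`deriv_whittakerModel`). In the last case `c_k` is, for `k ≥ 1`, a multiple of the integral of a
quadratic character against an additive one, which vanishes unless the conductors match, that is
unless `k = v(a) + 1`; the product of the two Gauss sums involved gives the sign `ε`
(`isWhittaker_almostModular`).
-/

noncomputable section

set_option linter.unusedSectionVars false

namespace LocalWhittaker

/-! ### The additive character -/

section Character

variable (p : ℕ) [hp : Fact p.Prime]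

theorem padicFrac_spec (x : ℚ_[p]) :
    (∃ (m : ℤ) (k : ℕ), padicFrac p x = m / (p : ℚ) ^ k) ∧ ‖x - (padicFrac p x : ℚ_[p])‖ ≤ 1 :=
  (exists_padicFrac p x).choose_spec

theorem exists_int_of_norm_le_one {r : ℚ} (hr : ∃ (m : ℤ) (k : ℕ), r = m / (p : ℚ) ^ k)
    (h : ‖(r : ℚ_[p])‖ ≤ 1) : ∃ j : ℤ, r = j := by
  obtain ⟨m, k, rfl⟩ := hr
  have hp0 : (p : ℚ) ≠ 0 := by exact_mod_cast hp.out.ne_zero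
  have hpr : (0 : ℝ) < p := by exact_mod_cast hp.out.pos
  have h1 : ‖(m : ℚ_[p])‖ ≤ (p : ℝ) ^ (-k : ℤ) := by
    push_cast at h
    rw [norm_div, norm_pow, Padic.norm_p, inv_pow, div_inv_eq_mul] at h
    rw [zpow_neg, zpow_natCast, ← one_div, le_div_iff₀ (by positivity)]
    linarith
  rw [Padic.norm_int_le_pow_iff_dvd] at h1
  obtain ⟨j, hj⟩ := h1
  refine ⟨j, ?_⟩
  rw [hj]
  push_cast
  field_simp

theorem padicChar_eq_one_of_int (x : ℚ_[p]) (j : ℤ) (h : padicFrac p x = j) :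
    padicChar p x = 1 := by
  rw [padicChar, h, Complex.exp_eq_one_iff]
  exact ⟨-j, by push_cast; ring⟩

theorem padicChar_eq_one_iff (x : ℚ_[p]) : padicChar p x = 1 ↔ ‖x‖ ≤ 1 := by
  obtain ⟨h1, h2⟩ := padicFrac_spec p x
  constructor
  · intro h
    rw [padicChar, Complex.exp_eq_one_iff] at h
    obtain ⟨j, hj⟩ := h
    have hpi : (2 * Real.pi * Complex.I : ℂ) ≠ 0 := Complex.two_pi_I_ne_zero
    have h3 : (padicFrac p x : ℂ) = ((-j : ℤ) : ℂ) := by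
      apply mul_left_cancel₀ hpi
      push_cast
      linear_combination -hj
    have h4 : padicFrac p x = ((-j : ℤ) : ℚ) := by exact_mod_cast h3
    rw [h4] at h2
    have h5 : ‖(((-j : ℤ) : ℚ) : ℚ_[p])‖ ≤ 1 := by
      have := Padic.norm_int_le_one (p := p) (-j)
      exact_mod_cast this
    calc ‖x‖ = ‖(x - (((-j : ℤ) : ℚ) : ℚ_[p])) + (((-j : ℤ) : ℚ) : ℚ_[p])‖ := by ring_nf
      _ ≤ max _ _ := Padic.nonarchimedean _ _
      _ ≤ 1 := max_le h2 h5
  · intro h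
    have h5 : ‖(padicFrac p x : ℚ_[p])‖ ≤ 1 := by
      calc ‖(padicFrac p x : ℚ_[p])‖ = ‖x + -(x - (padicFrac p x : ℚ_[p]))‖ := by ring_nf
        _ ≤ max _ _ := Padic.nonarchimedean _ _
        _ ≤ 1 := max_le h (by rwa [norm_neg])
    obtain ⟨j, hj⟩ := exists_int_of_norm_le_one p h1 h5
    exact padicChar_eq_one_of_int p x j hj

theorem padicChar_add (x y : ℚ_[p]) : padicChar p (x + y) = padicChar p x * padicChar p y := by
  obtain ⟨⟨m1, k1, h1⟩, h1'⟩ := padicFrac_spec p x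
  obtain ⟨⟨m2, k2, h2⟩, h2'⟩ := padicFrac_spec p y
  obtain ⟨⟨m3, k3, h3⟩, h3'⟩ := padicFrac_spec p (x + y)
  have hp0 : (p : ℚ) ≠ 0 := by exact_mod_cast hp.out.ne_zero
  obtain ⟨j, hj⟩ : ∃ j : ℤ, padicFrac p (x + y) - padicFrac p x - padicFrac p y = j := by
    apply exists_int_of_norm_le_one p
    · refine ⟨m3 * p ^ (k1 + k2) - m1 * p ^ (k2 + k3) - m2 * p ^ (k1 + k3), k1 + k2 + k3, ?_⟩
      rw [h1, h2, h3]
      push_cast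
      field_simp
      ring
    · have : (((padicFrac p (x + y) - padicFrac p x - padicFrac p y : ℚ)) : ℚ_[p]) =
          (x - (padicFrac p x : ℚ_[p])) + ((y - (padicFrac p y : ℚ_[p])) +
            -((x + y) - (padicFrac p (x + y) : ℚ_[p]))) := by push_cast; ring
      rw [this]
      refine (Padic.nonarchimedean _ _).trans (max_le h1' ?_)
      exact (Padic.nonarchimedean _ _).trans (max_le h2' (by rwa [norm_neg]))
  have h4 : (padicFrac p (x + y) : ℂ) = padicFrac p x + padicFrac p y + j := by
    have : padicFrac p (x + y) = padicFrac p x + padicFrac p y + j := by linarith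
    rw [this]; push_cast; ring
  rw [padicChar, padicChar, padicChar, h4, ← Complex.exp_add, Complex.exp_eq_exp_iff_exists_int]
  exact ⟨-j, by push_cast; ring⟩

theorem norm_padicChar (x : ℚ_[p]) : ‖padicChar p x‖ = 1 := by
  rw [padicChar, Complex.norm_exp]
  simp

variable (F : Type*) [Field F] [Algebra ℚ_[p] F]

/-- The additive character `ψ = ψ_{ℚ_p} ∘ tr_{F/ℚ_p}`, as a bundled `AddChar`. -/
def psi : AddChar F ℂ where
  toFun := addChar p
  map_zero_eq_one' := by
    rw [addChar, map_zero, padicChar_eq_one_iff]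
    simp
  map_add_eq_mul' x y := by simp only [addChar, map_add, padicChar_add]

variable {F}

theorem addChar_eq_psi (x : F) : addChar p x = psi p F x := rfl

theorem norm_psi (x : F) : ‖psi p F x‖ = 1 := norm_padicChar p _

variable [ValuativeRel F] [TopologicalSpace F] [IsNonarchimedeanLocalField F] {p} {d : F}

theorem IsDifferent.psi_iff (hd : IsDifferent p d) (x : F) :
    (∀ y ∈ 𝒪[F], psi p F (x * y) = 1) ↔ x * d ∈ 𝒪[F] := by
  rw [hd.2 x]
  exact forall₂_congr fun y _ => padicChar_eq_one_iff p _

theorem IsDifferent.psi_eq_one (hd : IsDifferent p d) {x : F} (hx : x * d ∈ 𝒪[F]) :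
    psi p F x = 1 := by
  have := (hd.psi_iff x).2 hx 1 (one_mem _)
  rwa [mul_one] at this

end Character

/-! ### The valuation of a local field -/

section Valuation

variable {F : Type*} [Field F] [ValuativeRel F] [TopologicalSpace F] [IsNonarchimedeanLocalField F]

theorem isOpen_integer : IsOpen (𝒪[F] : Set F) := by
  let := IsTopologicalAddGroup.rightUniformSpace F
  have := isUniformAddGroup_of_addCommGroup (G := F)
  exact Valued.isOpen_integer F

theorem isCompact_integer : IsCompact (𝒪[F] : Set F) :=
  IsNonarchimedeanLocalField.isCompact_closedBall F 1

theorem ord_one : ord (1 : F) = 0 := by simp [ord]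

theorem ord_mul {x y : F} (hx : x ≠ 0) (hy : y ≠ 0) : ord (x * y) = ord x + ord y := by
  rw [ord, map_mul, map_mul, WithZero.log_mul (by simpa using hx) (by simpa using hy), ord, ord]
  ring

theorem ord_inv {x : F} (hx : x ≠ 0) : ord x⁻¹ = -ord x := by
  have := ord_mul hx (inv_ne_zero hx)
  rw [mul_inv_cancel₀ hx, ord_one] at this
  omega

theorem ord_pow {x : F} (hx : x ≠ 0) (k : ℕ) : ord (x ^ k) = k * ord x := by
  induction k with
  | zero => simp [ord_one]
  | succ k ih => rw [pow_succ, ord_mul (pow_ne_zero _ hx) hx, ih]; push_cast; ring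

theorem ord_zpow {x : F} (hx : x ≠ 0) (k : ℤ) : ord (x ^ k) = k * ord x := by
  obtain ⟨k, rfl | rfl⟩ := k.eq_nat_or_neg
  · rw [zpow_natCast, ord_pow hx]
  · rw [zpow_neg, zpow_natCast, ord_inv (pow_ne_zero _ hx), ord_pow hx]; ring

theorem ord_neg (x : F) : ord (-x) = ord x := by rw [ord, ord, Valuation.map_neg]

theorem ord_div {x y : F} (hx : x ≠ 0) (hy : y ≠ 0) : ord (x / y) = ord x - ord y := by
  rw [div_eq_mul_inv, ord_mul hx (inv_ne_zero hy), ord_inv hy]; ring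

theorem mem_integer_iff_ord {x : F} (hx : x ≠ 0) : x ∈ 𝒪[F] ↔ 0 ≤ ord x := by
  have h0 : IsNonarchimedeanLocalField.valueGroupWithZeroIsoInt F (ValuativeRel.valuation F x) ≠ 0 := by
    simpa using hx
  rw [Valuation.mem_integer_iff, ord, Left.nonneg_neg_iff, ← WithZero.log_one (M := ℤ),
    WithZero.log_le_log h0 one_ne_zero, ← map_one (IsNonarchimedeanLocalField.valueGroupWithZeroIsoInt F)]
  exact (OrderIso.le_iff_le
    (IsNonarchimedeanLocalField.valueGroupWithZeroIsoInt F).toOrderIso).symm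

theorem exists_ord_eq_one : ∃ x : F, x ≠ 0 ∧ ord x = 1 := by
  obtain ⟨x, hx⟩ := ValuativeRel.valuation_surjective
    ((IsNonarchimedeanLocalField.valueGroupWithZeroIsoInt F).symm (WithZero.exp (-1)))
  have : ord x = 1 := by rw [ord, hx]; simp
  refine ⟨x, ?_, this⟩
  rintro rfl
  simp [ord] at this

theorem isUnit_integer_iff {x : 𝒪[F]} : IsUnit x ↔ (x : F) ≠ 0 ∧ ord (x : F) = 0 := by
  constructor
  · rintro ⟨u, rfl⟩
    have h1 : ((u : 𝒪[F]) : F) * ((u⁻¹ : 𝒪[F]ˣ) : 𝒪[F]) = 1 := by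
      exact_mod_cast congrArg Subtype.val u.mul_inv
    have h2 : ((u : 𝒪[F]) : F) ≠ 0 := left_ne_zero_of_mul_eq_one h1
    have h3 : (((u⁻¹ : 𝒪[F]ˣ) : 𝒪[F]) : F) ≠ 0 := right_ne_zero_of_mul_eq_one h1
    have h4 := ord_mul h2 h3
    rw [h1, ord_one] at h4
    have := (mem_integer_iff_ord h2).1 (u : 𝒪[F]).2
    have := (mem_integer_iff_ord h3).1 ((u⁻¹ : 𝒪[F]ˣ) : 𝒪[F]).2
    exact ⟨h2, by omega⟩
  · rintro ⟨h1, h2⟩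
    refine IsUnit.of_mul_eq_one ⟨(x : F)⁻¹, ?_⟩ ?_
    · rw [mem_integer_iff_ord (inv_ne_zero h1), ord_inv h1, h2, neg_zero]
    · exact Subtype.ext (mul_inv_cancel₀ h1)

theorem mem_maximalIdeal_iff_ord {x : 𝒪[F]} (hx : (x : F) ≠ 0) : x ∈ 𝓂[F] ↔ 1 ≤ ord (x : F) := by
  rw [IsLocalRing.mem_maximalIdeal, mem_nonunits_iff, isUnit_integer_iff]
  have := (mem_integer_iff_ord hx).1 x.2
  simp only [ne_eq, hx, not_false_eq_true, true_and]
  omega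

variable (F) in
theorem unif_mem : unif F ∈ 𝒪[F] :=
  ((IsDiscreteValuationRing.exists_irreducible 𝒪[F]).choose).2

variable (F) in
theorem irreducible_unif : Irreducible (⟨unif F, unif_mem F⟩ : 𝒪[F]) :=
  (IsDiscreteValuationRing.exists_irreducible 𝒪[F]).choose_spec

variable (F) in
theorem unif_ne_zero : unif F ≠ 0 := fun h =>
  (irreducible_unif F).ne_zero (Subtype.ext h)

variable (F) in
theorem ord_unif : ord (unif F) = 1 := by
  obtain ⟨x, hx0, hx⟩ := exists_ord_eq_one (F := F)
  have hxm : x ∈ 𝒪[F] := (mem_integer_iff_ord hx0).2 (by omega)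
  have h1 : (⟨x, hxm⟩ : 𝒪[F]) ∈ 𝓂[F] := (mem_maximalIdeal_iff_ord hx0).2 (by simp [hx])
  have h2 : (⟨unif F, unif_mem F⟩ : 𝒪[F]) ∈ 𝓂[F] := by
    rw [(IsDiscreteValuationRing.irreducible_iff_uniformizer _).1 (irreducible_unif F)]
    exact Ideal.mem_span_singleton_self _
  rw [(IsDiscreteValuationRing.irreducible_iff_uniformizer _).1 (irreducible_unif F),
    Ideal.mem_span_singleton] at h1
  obtain ⟨⟨y, hy⟩, h⟩ := h1
  have h : x = unif F * y := congrArg Subtype.val h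
  have hy0 : y ≠ 0 := by rintro rfl; simp at h; exact hx0 h
  have := ord_mul (unif_ne_zero F) hy0
  rw [← h, hx] at this
  have := (mem_integer_iff_ord hy0).1 hy
  have : 1 ≤ ord (unif F) := (mem_maximalIdeal_iff_ord (unif_ne_zero F)).1 h2
  omega

theorem ord_unif_zpow (k : ℤ) : ord (unif F ^ k) = k := by
  rw [ord_zpow (unif_ne_zero F), ord_unif, mul_one]

theorem mul_mem_integer_iff {x y : F} (hx : x ≠ 0) (hy : y ≠ 0) :
    x * y ∈ 𝒪[F] ↔ 0 ≤ ord x + ord y := by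
  rw [mem_integer_iff_ord (mul_ne_zero hx hy), ord_mul hx hy]

theorem integer_of_ord {x : F} (h : x = 0 ∨ 0 ≤ ord x) : x ∈ 𝒪[F] := by
  rcases eq_or_ne x 0 with rfl | hx
  · exact zero_mem _
  · exact (mem_integer_iff_ord hx).2 (h.resolve_left hx)

theorem ord_nonneg {x : F} (h : x ∈ 𝒪[F]) : 0 ≤ ord x := by
  rcases eq_or_ne x 0 with rfl | hx
  · simp [ord]
  · exact (mem_integer_iff_ord hx).1 h

/-- Elements of positive valuation. -/
theorem div_unif_mem_iff {x : F} (hx : x ≠ 0) : x / unif F ∈ 𝒪[F] ↔ 1 ≤ ord x := by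
  rw [mem_integer_iff_ord (div_ne_zero hx (unif_ne_zero F)), ord_div hx (unif_ne_zero F), ord_unif]
  omega

/-- The residue of an integer vanishes iff it is divisible by a uniformizer. -/
theorem residue_eq_zero_iff (x : 𝒪[F]) :
    IsLocalRing.residue 𝒪[F] x = 0 ↔ (x : F) / unif F ∈ 𝒪[F] := by
  rw [IsLocalRing.residue_eq_zero_iff]
  rcases eq_or_ne (x : F) 0 with hx | hx
  · have : x = 0 := Subtype.ext hx
    simp [this]
  · rw [mem_maximalIdeal_iff_ord hx, div_unif_mem_iff hx]

theorem residue_ne_zero_iff (x : 𝒪[F]) :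
    IsLocalRing.residue 𝒪[F] x ≠ 0 ↔ (x : F) ≠ 0 ∧ ord (x : F) = 0 := by
  rw [IsLocalRing.residue_ne_zero_iff_isUnit, isUnit_integer_iff]

variable (F) in
theorem one_lt_resCard : 1 < resCard F := Finite.one_lt_card

theorem absV_eq {x : F} (hx : x ≠ 0) : absV x = (resCard F : ℝ) ^ (-ord x) := if_neg hx

variable (F) in
theorem resCard_pos : (0 : ℝ) < resCard F := by exact_mod_cast (one_lt_resCard F).le

theorem absV_pos {x : F} (hx : x ≠ 0) : 0 < absV x := by
  rw [absV_eq hx]; exact zpow_pos (resCard_pos F) _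

theorem absV_mul (x y : F) : absV (x * y) = absV x * absV y := by
  rcases eq_or_ne x 0 with rfl | hx
  · simp [absV]
  rcases eq_or_ne y 0 with rfl | hy
  · simp [absV]
  rw [absV_eq hx, absV_eq hy, absV_eq (mul_ne_zero hx hy), ord_mul hx hy,
    ← zpow_add₀ (resCard_pos F).ne']
  ring_nf

theorem absV_inv (x : F) : absV x⁻¹ = (absV x)⁻¹ := by
  rcases eq_or_ne x 0 with rfl | hx
  · simp [absV]
  rw [absV_eq hx, absV_eq (inv_ne_zero hx), ord_inv hx, ← zpow_neg]

theorem absV_eq_one_iff {x : F} : absV x = 1 ↔ x ≠ 0 ∧ ord x = 0 := by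
  rcases eq_or_ne x 0 with rfl | hx
  · simp [absV]
  rw [absV_eq hx, zpow_eq_one_iff_right₀ (resCard_pos F).le
    (by exact_mod_cast (one_lt_resCard F).ne')]
  simp [hx]

instance : T2Space F := by
  let := IsTopologicalAddGroup.rightUniformSpace F
  have := isUniformAddGroup_of_addCommGroup (G := F)
  infer_instance

instance : HenselianLocalRing 𝒪[F] := by
  let := IsTopologicalAddGroup.rightUniformSpace F
  have := isUniformAddGroup_of_addCommGroup (G := F)
  have h : HenselianRing 𝒪[F] 𝓂[F] := inferInstance
  refine ⟨fun f hf a₀ h1 h2 => ?_⟩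
  exact h.is_henselian f hf a₀ h1 (h2.map _)

theorem prime_mem_maximalIdeal (p : ℕ) [hp : Fact p.Prime] [Algebra ℚ_[p] F] [ContinuousSMul ℚ_[p] F] :
    (p : 𝒪[F]) ∈ 𝓂[F] := by
  have h1 : Tendsto (fun k : ℕ => ((p : ℚ_[p]) ^ k) • (1 : F)) atTop (𝓝 ((0 : ℚ_[p]) • (1 : F))) := by
    refine Tendsto.smul_const ?_ _
    refine tendsto_pow_atTop_nhds_zero_of_norm_lt_one ?_
    exact Padic.norm_p_lt_one
  rw [zero_smul] at h1
  have h2 : {x : F | x / unif F ∈ 𝒪[F]} ∈ 𝓝 (0 : F) := by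
    refine (IsOpen.preimage (continuous_id.div_const (unif F)) isOpen_integer).mem_nhds ?_
    simp
  obtain ⟨k, hk⟩ := (h1.eventually h2).exists
  have h3 : ((p : ℚ_[p]) ^ k) • (1 : F) = ((p ^ k : 𝒪[F]) : F) := by
    rw [Algebra.smul_def, mul_one]
    simp
  simp only [h3] at hk
  have := (residue_eq_zero_iff _).2 hk
  rw [map_pow] at this
  exact (IsLocalRing.residue_eq_zero_iff _).1 (eq_zero_of_pow_eq_zero this)

theorem isUnit_two (p : ℕ) [hp : Fact p.Prime] [Algebra ℚ_[p] F] [ContinuousSMul ℚ_[p] F] (hp2 : p ≠ 2) :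
    IsUnit (2 : 𝒪[F]) := by
  obtain ⟨k, hk⟩ := hp.out.odd_of_ne_two hp2
  by_contra h
  have h1 : (2 : 𝒪[F]) ∈ 𝓂[F] := h
  have h2 := prime_mem_maximalIdeal (F := F) p
  have h3 : (1 : 𝒪[F]) = p - k * 2 := by rw [hk]; push_cast; ring
  have h4 : (1 : 𝒪[F]) ∈ 𝓂[F] := by
    rw [h3]; exact sub_mem h2 (Ideal.mul_mem_left _ _ h1)
  exact h4 isUnit_one

end Valuation

/-! ### Integration over compact open subgroups -/

section Integration

variable {A : Type*} [AddCommGroup A] [TopologicalSpace A] [IsTopologicalAddGroup A] [T2Space A]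
  [MeasurableSpace A] [BorelSpace A] (μ : Measure A) [μ.IsAddHaarMeasure]

theorem relIndex_ne_zero_of_isOpen {K M : AddSubgroup A} (hK : IsOpen (K : Set A))
    (hM : IsCompact (M : Set A)) : K.relIndex M ≠ 0 := by
  have : CompactSpace M := isCompact_iff_compactSpace.1 hM
  have h1 : IsOpen ((K.addSubgroupOf M : AddSubgroup M) : Set M) :=
    hK.preimage continuous_subtype_val
  have : Finite (M ⧸ K.addSubgroupOf M) := AddSubgroup.quotient_finite_of_isOpen _ h1
  have := AddSubgroup.finiteIndex_of_finite_quotient (H := K.addSubgroupOf M)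
  exact this.index_ne_zero

theorem setIntegral_translate {M : AddSubgroup A} (hM : MeasurableSet (M : Set A)) (f : A → ℂ) {l : A}
    (hl : l ∈ M) : ∫ x in (M : Set A), f (x + l) ∂μ = ∫ x in (M : Set A), f x ∂μ := by
  rw [← integral_indicator hM, ← integral_indicator hM]
  refine Eq.trans ?_ (integral_add_right_eq_self ((M : Set A).indicator f) l)
  congr 1
  ext x
  by_cases hx : x ∈ M
  · have h : x + l ∈ (M : Set A) := M.add_mem hx hl
    rw [Set.indicator_of_mem h, Set.indicator_of_mem (show x ∈ (M : Set A) from hx)]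
  · have h : x + l ∉ (M : Set A) := fun h => hx (by simpa using M.sub_mem h hl)
    rw [Set.indicator_of_notMem h, Set.indicator_of_notMem (show x ∉ (M : Set A) from hx)]

/-- An integral vanishes when translation by some element multiplies the integrand by a constant
different from `1`. -/
theorem setIntegral_eq_zero_of_translate {M : AddSubgroup A} (hM : MeasurableSet (M : Set A)) (f : A → ℂ)
    {l : A} (hl : l ∈ M) {c : ℂ} (hc : c ≠ 1) (hf : ∀ x ∈ M, f (x + l) = f x * c) :
    ∫ x in (M : Set A), f x ∂μ = 0 := by
  have h1 := setIntegral_translate μ hM f hl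
  rw [setIntegral_congr_fun hM (g := fun x => f x * c) hf, integral_mul_const] at h1
  have h2 : (∫ x in (M : Set A), f x ∂μ) * (c - 1) = 0 := by linear_combination h1
  exact (mul_eq_zero.1 h2).resolve_right (sub_ne_zero.2 hc)

/-- Orthogonality of characters, for a sum over representatives of the cosets of a subgroup `K`
on which the character is trivial. -/
theorem sum_addChar_reps (L K : AddSubgroup A) [Fintype (L ⧸ K.addSubgroupOf L)] (β : AddChar A ℂ)
    (hK : ∀ k ∈ K, k ∈ L → β k = 1) {l : A} (hl : l ∈ L) (hβ : β l ≠ 1) :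
    ∑ q : L ⧸ K.addSubgroupOf L, β (q.out : L) = 0 := by
  have h1 : ∀ q : L ⧸ K.addSubgroupOf L,
      β ((q + ((⟨l, hl⟩ : L) : L ⧸ K.addSubgroupOf L)).out : L) = β (q.out : L) * β l := by
    intro q
    set a := q.out
    set b := (q + ((⟨l, hl⟩ : L) : L ⧸ K.addSubgroupOf L)).out
    have h2 : ((a + ⟨l, hl⟩ : L) : L ⧸ K.addSubgroupOf L) = (b : L ⧸ K.addSubgroupOf L) := by
      rw [QuotientAddGroup.mk_add, QuotientAddGroup.out_eq', QuotientAddGroup.out_eq']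
    rw [QuotientAddGroup.eq] at h2
    have h3 := hK _ (AddSubgroup.mem_addSubgroupOf.1 h2) (-(a + ⟨l, hl⟩ : L) + b : L).2
    have h4 : (b : A) = a + l + ((-(a + ⟨l, hl⟩ : L) + b : L) : A) := by
      push_cast; abel
    rw [h4, AddChar.map_add_eq_mul, AddChar.map_add_eq_mul, h3, mul_one]
  have h2 := Fintype.sum_equiv (Equiv.addRight ((⟨l, hl⟩ : L) : L ⧸ K.addSubgroupOf L))
    (fun q => β (q.out : L) * β l) (fun q => β (q.out : L)) (fun q => (h1 q).symm)
  rw [← Finset.sum_mul] at h2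
  have h3 : (∑ q : L ⧸ K.addSubgroupOf L, β (q.out : L)) * (β l - 1) = 0 := by
    linear_combination h2
  exact (mul_eq_zero.1 h3).resolve_right (sub_ne_zero.2 hβ)

/-- If translation by elements `l` of a subgroup `L` of `M` multiplies the integrand `f` by
characters `β x l`, then only those `x` with `β x` trivial on `L` contribute to the integral. -/
theorem setIntegral_eq_inter_annihilator {M L K T : AddSubgroup A} (hM : IsOpen (M : Set A))
    (hMc : IsCompact (M : Set A)) (hLM : L ≤ M) (hK : IsOpen (K : Set A))
    (hT : MeasurableSet (T : Set A)) {f : A → ℂ} (hfc : Continuous f) (β : A → AddChar A ℂ)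
    (hf : ∀ x ∈ M, ∀ l ∈ L, f (x + l) = f x * β x l)
    (hKβ : ∀ x ∈ M, ∀ k ∈ K, k ∈ L → β x k = 1)
    (hTβ : ∀ x ∈ M, x ∈ T ↔ ∀ l ∈ L, β x l = 1) :
    ∫ x in (M : Set A), f x ∂μ = ∫ x in ((M ⊓ T : AddSubgroup A) : Set A), f x ∂μ := by
  classical
  have h0 : K.relIndex L ≠ 0 := fun h =>
    relIndex_ne_zero_of_isOpen hK hMc (AddSubgroup.relIndex_eq_zero_of_le_right hLM h)
  have : (K.addSubgroupOf L).FiniteIndex := ⟨h0⟩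
  have : Fintype (L ⧸ K.addSubgroupOf L) := Fintype.ofFinite _
  set m := Fintype.card (L ⧸ K.addSubgroupOf L)
  have hm : (m : ℂ) ≠ 0 := by exact_mod_cast Fintype.card_ne_zero
  have hint : IntegrableOn f (M : Set A) μ := hfc.continuousOn.integrableOn_compact hMc
  have h1 : ∀ q : L ⧸ K.addSubgroupOf L,
      ∫ x in (M : Set A), f x * β x (q.out : L) ∂μ = ∫ x in (M : Set A), f x ∂μ := by
    intro q
    rw [← setIntegral_translate μ hM.measurableSet f (hLM (q.out : L).2)]
    exact setIntegral_congr_fun hM.measurableSet fun x hx => (hf x hx _ (q.out : L).2).symm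
  have h2 : ∀ q ∈ (Finset.univ : Finset (L ⧸ K.addSubgroupOf L)),
      IntegrableOn (fun x => f x * β x (q.out : L)) (M : Set A) μ := by
    intro q _
    have : IntegrableOn (fun x => f (x + (q.out : L))) (M : Set A) μ :=
      (hfc.comp (continuous_id.add continuous_const)).continuousOn.integrableOn_compact hMc
    exact this.congr_fun (fun x hx => hf x hx _ (q.out : L).2) hM.measurableSet
  have h3 : (m : ℂ) * ∫ x in (M : Set A), f x ∂μ =
      ∫ x in (M : Set A), ∑ q : L ⧸ K.addSubgroupOf L, f x * β x (q.out : L) ∂μ := by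
    rw [integral_finsetSum _ h2, Finset.sum_congr rfl (fun q _ => h1 q)]
    simp [m]
  have h4 : ∫ x in (M : Set A), ∑ q : L ⧸ K.addSubgroupOf L, f x * β x (q.out : L) ∂μ =
      ∫ x in (M : Set A), (m : ℂ) * (T : Set A).indicator f x ∂μ := by
    refine setIntegral_congr_fun hM.measurableSet fun x hx => ?_
    rw [← Finset.mul_sum]
    by_cases hxT : x ∈ T
    · rw [Set.indicator_of_mem (show x ∈ (T : Set A) from hxT), mul_comm]
      congr 1
      rw [Finset.sum_congr rfl (fun q _ => (hTβ x hx).1 hxT _ (q.out : L).2)]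
      simp [m]
    · rw [Set.indicator_of_notMem (show x ∉ (T : Set A) from hxT), mul_zero]
      have : ∃ l ∈ L, β x l ≠ 1 := by
        by_contra! h
        exact hxT ((hTβ x hx).2 h)
      obtain ⟨l, hl, hl'⟩ := this
      rw [sum_addChar_reps L K (β x) (hKβ x hx) hl hl', mul_zero]
  rw [h4, integral_const_mul, setIntegral_indicator hT] at h3
  simpa using mul_left_cancel₀ hm h3

/-- Integration of a function factoring through a homomorphism onto a finite group. -/
theorem setIntegral_fiber_of_integrableOn {W : Type*} [AddCommGroup W] [Fintype W] {M : AddSubgroup A}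
    (φ : M →+ W) (hφ : Function.Surjective φ) {K : AddSubgroup A} (hK : IsOpen (K : Set A))
    (hKφ : ∀ x : M, φ x = 0 ↔ (x : A) ∈ K) (hKM : K ≤ M) (f : A → ℂ)
    (hint : IntegrableOn f (M : Set A) μ)
    (g : W → ℂ) (hfg : ∀ x : M, f x = g (φ x)) :
    ∫ x in (M : Set A), f x ∂μ = (μ.real (K : Set A) : ℂ) * ∑ w, g w := by
  choose s hs using hφ
  let S : W → Set A := fun w => (fun x => x + -(s w : A)) ⁻¹' (K : Set A)
  have hS : ∀ w x, x ∈ S w ↔ ∃ h : x ∈ M, φ ⟨x, h⟩ = w := by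
    intro w x
    constructor
    · intro h
      have h' : x + -(s w : A) ∈ K := h
      have hx : x ∈ M := by simpa using M.add_mem (hKM h') (s w).2
      refine ⟨hx, ?_⟩
      have := (hKφ (⟨x, hx⟩ - s w)).2 (by simpa [sub_eq_add_neg] using h')
      rw [map_sub, hs] at this
      exact sub_eq_zero.1 this
    · rintro ⟨h, hw⟩
      have := (hKφ (⟨x, h⟩ - s w)).1 (by rw [map_sub, hs, hw, sub_self])
      simpa [sub_eq_add_neg, S] using this
  have hSm : ∀ w, MeasurableSet (S w) := fun w =>
    (hK.preimage (continuous_id.add continuous_const)).measurableSet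
  have hU : (M : Set A) = ⋃ w, S w := by
    ext x
    simp only [Set.mem_iUnion, hS]
    exact ⟨fun h => ⟨_, h, rfl⟩, fun ⟨_, h, _⟩ => h⟩
  have hdisj : Pairwise (Function.onFun Disjoint S) := by
    intro w w' hw
    rw [Function.onFun, Set.disjoint_left]
    intro x h1 h2
    obtain ⟨_, h1⟩ := (hS _ _).1 h1
    obtain ⟨_, h2⟩ := (hS _ _).1 h2
    exact hw (h1.symm.trans h2)
  rw [hU, integral_iUnion_fintype hSm hdisj fun w =>
    hint.mono_set (hU ▸ Set.subset_iUnion S w), Finset.mul_sum]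
  refine Finset.sum_congr rfl fun w _ => ?_
  rw [setIntegral_congr_fun (hSm w) (g := fun _ => g w)]
  · rw [setIntegral_const, measureReal_def, measure_preimage_add_right, ← measureReal_def]
    simp
  · intro x hx
    obtain ⟨h, hw⟩ := (hS _ _).1 hx
    have := hfg ⟨x, h⟩
    simpa [hw] using this

theorem setIntegral_fiber {W : Type*} [AddCommGroup W] [Fintype W] {M : AddSubgroup A}
    (hMc : IsCompact (M : Set A))
    (φ : M →+ W) (hφ : Function.Surjective φ) {K : AddSubgroup A} (hK : IsOpen (K : Set A))
    (hKφ : ∀ x : M, φ x = 0 ↔ (x : A) ∈ K) (hKM : K ≤ M) (f : A → ℂ) (hfc : Continuous f)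
    (g : W → ℂ) (hfg : ∀ x : M, f x = g (φ x)) :
    ∫ x in (M : Set A), f x ∂μ = (μ.real (K : Set A) : ℂ) * ∑ w, g w :=
  setIntegral_fiber_of_integrableOn μ φ hφ hK hKφ hKM f
    (hfc.continuousOn.integrableOn_compact hMc) g hfg

theorem measureReal_fiber {W : Type*} [AddCommGroup W] [Fintype W] {M : AddSubgroup A}
    (hMc : IsCompact (M : Set A))
    (φ : M →+ W) (hφ : Function.Surjective φ) {K : AddSubgroup A} (hK : IsOpen (K : Set A))
    (hKφ : ∀ x : M, φ x = 0 ↔ (x : A) ∈ K) (hKM : K ≤ M) :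
    μ.real (M : Set A) = μ.real (K : Set A) * Fintype.card W := by
  have h := setIntegral_fiber μ hMc φ hφ hK hKφ hKM (fun _ => 1) continuous_const
    (fun _ => 1) (fun _ => rfl)
  rw [setIntegral_const] at h
  simp only [Complex.real_smul, mul_one, Finset.sum_const, Finset.card_univ, nsmul_eq_mul] at h
  exact_mod_cast h

theorem measureReal_pos {M : AddSubgroup A} (hMo : IsOpen (M : Set A))
    (hMc : IsCompact (M : Set A)) : 0 < μ.real (M : Set A) :=
  ENNReal.toReal_pos (hMo.measure_pos μ ⟨0, M.zero_mem⟩).ne' hMc.measure_ne_top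

/-- `μ.real (φ⁻¹ S) = c * μ.real S` for a Haar measure `μ`, for all measurable sets, together with
the corresponding formula for integrals. -/
def ScalesBy (φ : A → A) (c : ℝ) : Prop :=
  μ.map φ = ENNReal.ofReal c • μ

theorem exists_scalesBy [LocallyCompactSpace A] [SecondCountableTopology A]
    (φ : A ≃+ A) (h1 : Continuous φ) (h2 : Continuous φ.symm) :
    ∃ c : ℝ, 0 < c ∧ ScalesBy μ φ c := by
  let e : A ≃ₜ A := ⟨φ.toEquiv, h1, h2⟩
  have h : (μ.map φ).IsAddHaarMeasure := φ.isAddHaarMeasure_map μ h1 h2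
  have h3 := Measure.isAddLeftInvariant_eq_smul (μ.map φ) μ
  have h4 := Measure.addHaarScalarFactor_pos_of_isAddHaarMeasure (μ.map φ) μ
  refine ⟨(μ.map φ).addHaarScalarFactor μ, by exact_mod_cast h4, ?_⟩
  rw [ScalesBy, ENNReal.ofReal_coe_nnreal]
  exact h3

variable {μ}

theorem ScalesBy.setIntegral {φ : A → A} {c : ℝ} (h : ScalesBy μ φ c) (hc : 0 < c) (φm : Continuous φ)
    {S : Set A} (hS : MeasurableSet S) {f : A → ℂ} (hf : Continuous f) [SecondCountableTopology A] :
    ∫ x in φ ⁻¹' S, f (φ x) ∂μ = c * ∫ x in S, f x ∂μ := by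
  rw [← setIntegral_map hS hf.aestronglyMeasurable φm.aemeasurable, h, Measure.restrict_smul,
    integral_smul_measure, ENNReal.toReal_ofReal hc.le]
  simp

theorem ScalesBy.measureReal {φ : A → A} {c : ℝ} (h : ScalesBy μ φ c) (hc : 0 < c) (φm : Continuous φ)
    {S : Set A} (hS : MeasurableSet S) : μ.real (φ ⁻¹' S) = c * μ.real S := by
  rw [measureReal_def, ← Measure.map_apply φm.measurable hS, h]
  simp [measureReal_def, hc.le]

theorem ScalesBy.comp {φ φ' : A → A} {c c' : ℝ} (h : ScalesBy μ φ c) (h' : ScalesBy μ φ' c')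
    (hc : 0 ≤ c) (φm : Continuous φ) (φm' : Continuous φ') : ScalesBy μ (φ ∘ φ') (c * c') := by
  rw [ScalesBy, ← Measure.map_map φm.measurable φm'.measurable, h', Measure.map_smul, h, smul_smul,
    ENNReal.ofReal_mul hc, mul_comm]

theorem ScalesBy.unique [LocallyCompactSpace A] {φ : A → A} {c c' : ℝ} (h : ScalesBy μ φ c) (h' : ScalesBy μ φ c')
    (hc : 0 ≤ c) (hc' : 0 ≤ c') : c = c' := by
  obtain ⟨s, hs, hs'⟩ := exists_compact_mem_nhds (0 : A)
  have h0 : μ s ≠ 0 := (Measure.measure_pos_of_mem_nhds μ hs').ne'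
  have h1 : μ s ≠ ⊤ := hs.measure_ne_top
  have h2 : (ENNReal.ofReal c • μ) s = (ENNReal.ofReal c' • μ) s := by
    rw [← h, ← h']
  simp only [Measure.smul_apply, smul_eq_mul] at h2
  rw [ENNReal.mul_left_inj h0 h1] at h2
  rwa [ENNReal.ofReal_eq_ofReal_iff hc hc'] at h2

end Integration

/-! ### Topological vector spaces over a local field -/

section VectorSpace

variable (p : ℕ) [hp : Fact p.Prime] {F : Type*} [Field F] [ValuativeRel F] [TopologicalSpace F]
  [IsNonarchimedeanLocalField F] [Algebra ℚ_[p] F] [ContinuousSMul ℚ_[p] F]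
  [FiniteDimensional ℚ_[p] F]
  {V : Type*} [AddCommGroup V] [Module F V] [Module.Finite F V] [TopologicalSpace V]
  [IsTopologicalAddGroup V] [ContinuousSMul F V] [T2Space V]

include p in
/-- Linear maps out of a finite-dimensional space are continuous, by restriction of scalars to the
complete normed field `ℚ_p`. -/
theorem continuous_linearMap {V' : Type*} [AddCommGroup V'] [Module F V'] [TopologicalSpace V']
    [IsTopologicalAddGroup V'] [ContinuousSMul F V'] (f : V →ₗ[F] V') : Continuous f := by
  let : Module ℚ_[p] V := Module.compHom V (algebraMap ℚ_[p] F)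
  let : Module ℚ_[p] V' := Module.compHom V' (algebraMap ℚ_[p] F)
  have : IsScalarTower ℚ_[p] F V := IsScalarTower.of_algebraMap_smul fun _ _ => rfl
  have : IsScalarTower ℚ_[p] F V' := IsScalarTower.of_algebraMap_smul fun _ _ => rfl
  have hc : Continuous (algebraMap ℚ_[p] F) := continuous_algebraMap ℚ_[p] F
  have : ContinuousSMul ℚ_[p] V :=
    ⟨(continuous_smul (M := F) (X := V)).comp ((hc.comp continuous_fst).prodMk continuous_snd)⟩
  have : ContinuousSMul ℚ_[p] V' :=
    ⟨(continuous_smul (M := F) (X := V')).comp ((hc.comp continuous_fst).prodMk continuous_snd)⟩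
  have : Module.Finite ℚ_[p] V := Module.Finite.trans F V
  exact (f.restrictScalars ℚ_[p]).continuous_of_finiteDimensional

include p in
theorem isOpenMap_linearMap {V' : Type*} [AddCommGroup V'] [Module F V'] [TopologicalSpace V']
    [IsTopologicalAddGroup V'] [ContinuousSMul F V'] (f : V' →ₗ[F] V)
    (hf : Function.Surjective f) : IsOpenMap f := by
  let : Module ℚ_[p] V := Module.compHom V (algebraMap ℚ_[p] F)
  let : Module ℚ_[p] V' := Module.compHom V' (algebraMap ℚ_[p] F)
  have : IsScalarTower ℚ_[p] F V := IsScalarTower.of_algebraMap_smul fun _ _ => rfl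
  have : IsScalarTower ℚ_[p] F V' := IsScalarTower.of_algebraMap_smul fun _ _ => rfl
  have hc : Continuous (algebraMap ℚ_[p] F) := continuous_algebraMap ℚ_[p] F
  have : ContinuousSMul ℚ_[p] V :=
    ⟨(continuous_smul (M := F) (X := V)).comp ((hc.comp continuous_fst).prodMk continuous_snd)⟩
  have : ContinuousSMul ℚ_[p] V' :=
    ⟨(continuous_smul (M := F) (X := V')).comp ((hc.comp continuous_fst).prodMk continuous_snd)⟩
  have : Module.Finite ℚ_[p] V := Module.Finite.trans F V
  exact (f.restrictScalars ℚ_[p]).isOpenMap_of_finiteDimensional hf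

variable (F) in
include p in
theorem secondCountable_field : SecondCountableTopology F :=
  (Module.finBasis ℚ_[p] F).equivFun.toContinuousLinearEquiv.toHomeomorph.secondCountableTopology

variable (F V) in
/-- Coordinates on a finite-dimensional space, as a homeomorphism. -/
def coordHomeo : V ≃ₜ (Fin (Module.finrank F V) → F) where
  toEquiv := (Module.finBasis F V).equivFun.toEquiv
  continuous_toFun := continuous_linearMap p (Module.finBasis F V).equivFun.toLinearMap
  continuous_invFun := continuous_linearMap p (Module.finBasis F V).equivFun.symm.toLinearMap

variable (F V) in
include p F in
theorem secondCountable_space : SecondCountableTopology V := by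
  have := secondCountable_field p F
  exact (coordHomeo p F V).secondCountableTopology

variable (F V) in
include p F in
theorem locallyCompact_space : LocallyCompactSpace V :=
  (coordHomeo p F V).isOpenEmbedding.locallyCompactSpace

variable [MeasurableSpace F] [BorelSpace F] [MeasurableSpace V] [BorelSpace V]

/-- The ideal `π 𝒪_F`, as an additive subgroup of `F`. -/
def unifMulInteger (F : Type*) [Field F] [ValuativeRel F] [TopologicalSpace F]
    [IsNonarchimedeanLocalField F] : AddSubgroup F :=
  𝒪[F].toAddSubgroup.comap (AddMonoidHom.mulLeft (unif F)⁻¹)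

theorem mem_unifMulInteger {x : F} : x ∈ unifMulInteger F ↔ x / unif F ∈ 𝒪[F] := by
  rw [div_eq_inv_mul]; rfl

theorem unifMulInteger_le : unifMulInteger F ≤ 𝒪[F].toAddSubgroup := by
  intro x hx
  rw [mem_unifMulInteger] at hx
  have := mul_mem hx (unif_mem F)
  rwa [div_mul_cancel₀ _ (unif_ne_zero F)] at this

theorem isOpen_unifMulInteger : IsOpen (unifMulInteger F : Set F) :=
  isOpen_integer.preimage (continuous_const.mul continuous_id)

/-- The residue map as a homomorphism on the additive group of integers. -/
def residueAdd (F : Type*) [Field F] [ValuativeRel F] [TopologicalSpace F]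
    [IsNonarchimedeanLocalField F] : 𝒪[F].toAddSubgroup →+ 𝓀[F] where
  toFun x := IsLocalRing.residue 𝒪[F] (x : 𝒪[F])
  map_zero' := map_zero (IsLocalRing.residue 𝒪[F])
  map_add' x y := map_add (IsLocalRing.residue 𝒪[F]) (x : 𝒪[F]) (y : 𝒪[F])

instance : Fintype 𝓀[F] := Fintype.ofFinite _

theorem card_residueField : Fintype.card 𝓀[F] = resCard F := by
  rw [resCard, Nat.card_eq_fintype_card]

theorem residueAdd_surjective : Function.Surjective (residueAdd F) :=
  (IsLocalRing.residue_surjective : Function.Surjective (IsLocalRing.residue 𝒪[F]))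

theorem residueAdd_eq_zero_iff (x : 𝒪[F].toAddSubgroup) :
    residueAdd F x = 0 ↔ (x : F) ∈ unifMulInteger F := by
  rw [mem_unifMulInteger]; exact residue_eq_zero_iff x

theorem measureReal_integer (μ : Measure F) [μ.IsAddHaarMeasure] :
    μ.real (𝒪[F] : Set F) = μ.real (unifMulInteger F : Set F) * resCard F := by
  rw [← card_residueField]
  exact measureReal_fiber μ (M := 𝒪[F].toAddSubgroup) isCompact_integer (residueAdd F)
    residueAdd_surjective isOpen_unifMulInteger residueAdd_eq_zero_iff unifMulInteger_le

include p in
theorem exists_scalesBy_smul (μ : Measure V) [μ.IsAddHaarMeasure] {c : F} (hc : c ≠ 0) :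
    ∃ r : ℝ, 0 < r ∧ ScalesBy μ (fun x : V => c • x) r := by
  have := secondCountable_space p F V
  have := locallyCompact_space p F V
  exact exists_scalesBy μ (DistribMulAction.toAddEquiv₀ V c hc) (continuous_const_smul c)
    (continuous_const_smul c⁻¹)

include p in
theorem scalesBy_smul_unit (μ : Measure V) [μ.IsAddHaarMeasure] {u : F} (hu : u ≠ 0)
    (hu0 : ord u = 0) : ScalesBy μ (fun x : V => u • x) 1 := by
  have := secondCountable_space p F V
  have := secondCountable_field p F
  obtain ⟨r, hr, h⟩ := exists_scalesBy_smul p μ hu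
  let B : Set V := coordHomeo p F V ⁻¹' (Set.univ.pi fun _ => (𝒪[F] : Set F))
  have hBo : IsOpen B := (isOpen_set_pi Set.finite_univ fun _ _ => isOpen_integer).preimage
    (coordHomeo p F V).continuous
  have hBc : IsCompact B := (coordHomeo p F V).isCompact_preimage.2
    (isCompact_univ_pi fun _ => isCompact_integer)
  have hB : (fun x : V => u • x) ⁻¹' B = B := by
    ext x
    simp only [B, Set.mem_preimage, Set.mem_univ_pi]
    refine forall_congr' fun i => ?_
    have : coordHomeo p F V (u • x) i = u * coordHomeo p F V x i := by
      change (Module.finBasis F V).equivFun (u • x) i = _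
      rw [map_smul]; rfl
    rw [this]
    rcases eq_or_ne (coordHomeo p F V x i) 0 with h0 | h0
    · simp [h0]
    · simp only [SetLike.mem_coe]
      rw [mul_mem_integer_iff hu h0, hu0, zero_add, mem_integer_iff_ord h0]
  have h1 := h.measureReal hr (continuous_const_smul u) hBo.measurableSet
  rw [hB] at h1
  have hB0 : μ.real B ≠ 0 := (ENNReal.toReal_pos
    (hBo.measure_pos μ ⟨0, by simp [B, coordHomeo]⟩).ne' hBc.measure_ne_top).ne'
  have : r = 1 := by
    have : (r - 1) * μ.real B = 0 := by linear_combination -h1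
    linarith [(mul_eq_zero.1 this).resolve_right hB0]
  rwa [this] at h

include p in
theorem scalesBy_smul_unif (μ : Measure V) [μ.IsAddHaarMeasure] :
    ScalesBy μ (fun x : V => unif F • x) ((resCard F : ℝ) ^ Module.finrank F V) := by
  have := secondCountable_space p F V
  have := secondCountable_field p F
  obtain ⟨r, hr, h⟩ := exists_scalesBy_smul p μ (unif_ne_zero F)
  set m := Module.finrank F V
  let e := coordHomeo p F V
  -- a Haar measure on `F`, for comparison with the product measure on `F ^ m`
  obtain ⟨K0⟩ : Nonempty (TopologicalSpace.PositiveCompacts F) := inferInstance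
  let ν : Measure F := Measure.addHaarMeasure K0
  have hlc := locallyCompact_space p F V
  have hmap : (μ.map e).IsAddHaarMeasure :=
    (Module.finBasis F V).equivFun.toAddEquiv.isAddHaarMeasure_map μ e.continuous e.symm.continuous
  have h3 := Measure.isAddLeftInvariant_eq_smul (μ.map e) (Measure.pi fun _ : Fin m => ν)
  have h4 := Measure.addHaarScalarFactor_pos_of_isAddHaarMeasure (μ.map e) (Measure.pi fun _ : Fin m => ν)
  set k := (μ.map e).addHaarScalarFactor (Measure.pi fun _ : Fin m => ν)
  have hbox : ∀ S : Set F, MeasurableSet S →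
      μ.real (e ⁻¹' (Set.univ.pi fun _ => S)) = k * ν.real S ^ m := by
    intro S hS
    have hm : MeasurableSet (Set.univ.pi fun _ : Fin m => S) :=
      MeasurableSet.univ_pi fun _ => hS
    rw [measureReal_def, ← Measure.map_apply e.continuous.measurable hm, h3]
    rw [Measure.smul_apply, Measure.pi_pi, Finset.prod_const, Finset.card_univ, Fintype.card_fin,
      ENNReal.smul_def, smul_eq_mul, ENNReal.toReal_mul, ENNReal.toReal_pow, ENNReal.coe_toReal,
      measureReal_def]
  have h1 := h.measureReal hr (continuous_const_smul (unif F))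
    (S := e ⁻¹' (Set.univ.pi fun _ => (unifMulInteger F : Set F)))
    ((MeasurableSet.univ_pi fun _ => isOpen_unifMulInteger.measurableSet).preimage
      e.continuous.measurable)
  have h2 : (fun x : V => unif F • x) ⁻¹' (e ⁻¹' (Set.univ.pi fun _ => (unifMulInteger F : Set F))) =
      e ⁻¹' (Set.univ.pi fun _ => (𝒪[F] : Set F)) := by
    ext x
    simp only [Set.mem_preimage, Set.mem_univ_pi]
    refine forall_congr' fun i => ?_
    have : e (unif F • x) i = unif F * e x i := by
      change (Module.finBasis F V).equivFun (unif F • x) i = _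
      rw [map_smul]; rfl
    rw [this, SetLike.mem_coe, mem_unifMulInteger, mul_div_cancel_left₀ _ (unif_ne_zero F)]
    rfl
  have h5 : 0 < ν.real (unifMulInteger F : Set F) := by
    have := measureReal_pos ν (M := 𝒪[F].toAddSubgroup) isOpen_integer isCompact_integer
    have h6 := measureReal_integer ν
    change 0 < ν.real (𝒪[F] : Set F) at this
    rw [h6] at this
    exact pos_of_mul_pos_left this (resCard_pos F).le
  rw [h2, hbox _ isOpen_integer.measurableSet, hbox _ isOpen_unifMulInteger.measurableSet,
    measureReal_integer, mul_pow] at h1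
  have : r = (resCard F : ℝ) ^ m := by
    have h7 : (k : ℝ) * ν.real (unifMulInteger F : Set F) ^ m ≠ 0 :=
      mul_ne_zero (by exact_mod_cast h4.ne') (pow_ne_zero _ h5.ne')
    apply mul_right_cancel₀ h7
    linear_combination -h1
  rwa [this] at h

include p in
/-- Multiplication by a scalar `c` pulls Haar measure back by the factor `|c| ^ (-dim V)`. -/
theorem scalesBy_smul (μ : Measure V) [μ.IsAddHaarMeasure] {c : F} (hc : c ≠ 0) :
    ScalesBy μ (fun x : V => c • x) (absV c ^ Module.finrank F V)⁻¹ := by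
  have := secondCountable_space p F V
  have := locallyCompact_space p F V
  have hN := resCard_pos F
  have hnat : ∀ k : ℕ, ScalesBy μ (fun x : V => unif F ^ k • x)
      (((resCard F : ℝ) ^ Module.finrank F V) ^ k) := by
    intro k
    induction k with
    | zero => simp [ScalesBy]
    | succ k ih =>
      have := ih.comp (scalesBy_smul_unif p μ) (by positivity) (continuous_const_smul _)
        (continuous_const_smul (unif F))
      convert this using 1
      · ext v
        rw [Function.comp, smul_smul, pow_succ]
      · rw [pow_succ]
  have key : ∀ x : F, x ≠ 0 → 0 ≤ ord x →
      ScalesBy μ (fun v : V => x • v) (absV x ^ Module.finrank F V)⁻¹ := by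
    intro x hx hx0
    obtain ⟨k, hk⟩ := Int.eq_ofNat_of_zero_le hx0
    have h1 : ScalesBy μ (fun v : V => (x / unif F ^ k) • v) 1 := by
      apply scalesBy_smul_unit p μ (div_ne_zero hx (pow_ne_zero _ (unif_ne_zero F)))
      rw [ord_div hx (pow_ne_zero _ (unif_ne_zero F)), ord_pow (unif_ne_zero F), ord_unif, hk]
      ring
    have h2 := (hnat k).comp h1 (by positivity) (continuous_const_smul _) (continuous_const_smul _)
    have h3 : ((fun v : V => unif F ^ k • v) ∘ fun v => (x / unif F ^ k) • v) = fun v => x • v := by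
      ext v
      simp only [Function.comp]
      rw [smul_smul, mul_div_cancel₀ _ (pow_ne_zero _ (unif_ne_zero F))]
    rw [h3, mul_one] at h2
    convert h2 using 1
    rw [absV_eq hx, hk, zpow_neg, inv_pow, inv_inv, zpow_natCast, pow_right_comm]
  rcases le_total 0 (ord c) with h | h
  · exact key c hc h
  · have h1 := key c⁻¹ (inv_ne_zero hc) (by rw [ord_inv hc]; omega)
    obtain ⟨r, hr, h2⟩ := exists_scalesBy_smul p μ hc (V := V)
    have h3 := h1.comp h2 (by have := absV_pos (inv_ne_zero hc); positivity) (continuous_const_smul _) (continuous_const_smul c)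
    have h4 : ((fun v : V => c⁻¹ • v) ∘ fun v => c • v) = fun v => v := by
      ext v; simp [smul_smul, inv_mul_cancel₀ hc]
    rw [h4] at h3
    have h5 : ScalesBy μ (fun v : V => v) 1 := by simp [ScalesBy]
    have h6 := h3.unique h5 (by have := absV_pos (inv_ne_zero hc); positivity) zero_le_one
    have h7 : r = (absV c ^ Module.finrank F V)⁻¹ := by
      rw [absV_inv, inv_pow, inv_inv] at h6
      exact eq_inv_of_mul_eq_one_right h6
    rwa [h7] at h2

end VectorSpace

/-! ### Quadratic algebras with involution -/

section Quadratic

variable {F : Type*} [Field F] {E : Type*} [CommRing E] [Algebra F E]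

/-- The involution `τ` computes trace and norm of the quadratic algebra `E`. -/
structure IsQuadInvolution (τ : E ≃ₐ[F] E) : Prop where
  nontrivial : Nontrivial E
  trace_eq : ∀ z, algebraMap F E (Algebra.trace F E z) = z + τ z
  norm_eq : ∀ z, algebraMap F E (Algebra.norm F z) = z * τ z

theorem exists_basis_one (hE : Module.finrank F E = 2) :
    ∃ b : Module.Basis (Fin 2) F E, b 0 = 1 := by
  have hnt : Nontrivial E := Module.nontrivial_of_finrank_pos (R := F) (by omega)
  have hfin : Module.Finite F E := Module.finite_of_finrank_pos (by omega)
  obtain ⟨e, he⟩ : ∃ e : E, e ∉ Submodule.span F {(1 : E)} := by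
    by_contra! h
    have h1 : Submodule.span F {(1 : E)} = ⊤ := Submodule.eq_top_iff'.2 h
    have h2 := finrank_span_singleton (K := F) (one_ne_zero (α := E))
    rw [h1, finrank_top] at h2
    omega
  have hli : LinearIndependent F ![(1 : E), e] := by
    rw [LinearIndependent.pair_iff' one_ne_zero]
    intro a ha
    exact he (ha ▸ Submodule.smul_mem _ a (Submodule.mem_span_singleton_self _))
  refine ⟨basisOfLinearIndependentOfCardEqFinrank hli (by simp [hE]), by simp⟩

/-- A reduced quadratic algebra with a nontrivial automorphism `τ` is `F[√D]` with `D ≠ 0`, and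
`τ(√D) = -√D`. -/
theorem exists_sqrt_gen [CharZero F] (hE : Module.finrank F E = 2) (hred : IsReduced E)
    (τ : E ≃ₐ[F] E) (hτ : τ ≠ AlgEquiv.refl) :
    ∃ (δ : E) (D : F) (b : Module.Basis (Fin 2) F E), D ≠ 0 ∧ b 0 = 1 ∧ b 1 = δ ∧
      δ * δ = algebraMap F E D ∧ τ δ = -δ := by
  obtain ⟨b, hb⟩ := exists_basis_one hE
  have hnt : Nontrivial E := Module.nontrivial_of_finrank_pos (R := F) (by omega)
  have hrep : ∀ z : E, z = algebraMap F E (b.repr z 0) + b.repr z 1 • b 1 := by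
    intro z
    conv_lhs => rw [← b.sum_repr z, Fin.sum_univ_two, hb, Algebra.smul_def, mul_one]
  set β := b.repr (b 1 * b 1) 1 / 2 with hβ
  set δ := b 1 - algebraMap F E β with hδ
  have hli : LinearIndependent F ![(1 : E), δ] := by
    have := b.linearIndependent
    have hbv : (b : Fin 2 → E) = ![1, b 1] := by
      ext i; fin_cases i <;> simp [hb]
    rw [hbv, LinearIndependent.pair_iff] at this
    rw [LinearIndependent.pair_iff]
    intro s t h
    have h2 : (s - t * β) • (1 : E) + t • b 1 = 0 := by
      rw [← h, hδ, Algebra.smul_def, Algebra.smul_def, Algebra.smul_def, Algebra.smul_def, map_sub,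
        map_mul]
      ring
    obtain ⟨h3, rfl⟩ := this _ _ h2
    simpa using h3
  let b' := basisOfLinearIndependentOfCardEqFinrank hli (by simp [hE])
  have hb0 : b' 0 = 1 := by simp [b']
  have hb1 : b' 1 = δ := by simp [b']
  have hrep' : ∀ z : E, z = algebraMap F E (b'.repr z 0) + b'.repr z 1 • δ := by
    intro z
    conv_lhs => rw [← b'.sum_repr z, Fin.sum_univ_two, hb0, hb1, Algebra.smul_def, mul_one]
  have hzero : ∀ x y : F, algebraMap F E x + y • δ = 0 → x = 0 ∧ y = 0 := by
    intro x y h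
    rw [LinearIndependent.pair_iff] at hli
    exact hli x y (by rw [← h, Algebra.smul_def, mul_one])
  obtain ⟨D, hD⟩ : ∃ D : F, δ * δ = algebraMap F E D := by
    refine ⟨b.repr (b 1 * b 1) 0 + β ^ 2, ?_⟩
    have h1 := hrep (b 1 * b 1)
    rw [show b.repr (b 1 * b 1) 1 = 2 * β by rw [hβ]; ring] at h1
    rw [hδ]
    simp only [Algebra.smul_def, map_mul, map_ofNat, map_add, map_pow] at h1 ⊢
    linear_combination h1
  have hδ0 : δ ≠ 0 := by
    intro h
    have := hzero 0 1 (by simp [h])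
    exact one_ne_zero this.2
  have hD0 : D ≠ 0 := by
    rintro rfl
    rw [map_zero] at hD
    exact hδ0 ((pow_eq_zero_iff two_ne_zero).1 (by rw [sq, hD]))
  refine ⟨δ, D, b', hD0, hb0, hb1, hD, ?_⟩
  set x := b'.repr (τ δ) 0
  set y := b'.repr (τ δ) 1
  have hxy : τ δ = algebraMap F E x + y • δ := hrep' _
  have h1 : algebraMap F E (x ^ 2 + y ^ 2 * D - D) + (2 * x * y) • δ = 0 := by
    have h2 : τ δ * τ δ = algebraMap F E D := by rw [← map_mul, hD, AlgEquiv.commutes]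
    rw [hxy] at h2
    simp only [Algebra.smul_def, map_mul, map_ofNat, map_add, map_sub, map_pow] at h2 ⊢
    linear_combination h2 - (algebraMap F E y) ^ 2 * hD
  obtain ⟨h2, h3⟩ := hzero _ _ h1
  have hy : y ≠ 0 := by
    intro hy
    rw [hy, zero_smul, add_zero, ← τ.commutes] at hxy
    have h4 : δ = algebraMap F E x := τ.injective hxy
    have := hzero (-x) 1 (by rw [h4]; simp)
    exact one_ne_zero this.2
  have hx : x = 0 := by
    have h4 : (2 : F) ≠ 0 := two_ne_zero
    rcases mul_eq_zero.1 h3 with h | h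
    · exact (mul_eq_zero.1 h).resolve_left h4
    · exact absurd h hy
  rw [hx, map_zero, zero_add] at hxy
  have h5 : (y - 1) * (y + 1) = 0 := by
    have : D * ((y - 1) * (y + 1)) = 0 := by rw [hx] at h2; linear_combination h2
    exact (mul_eq_zero.1 this).resolve_left hD0
  rcases mul_eq_zero.1 h5 with h | h
  · exfalso
    apply hτ
    have hy1 : y = 1 := by linear_combination h
    ext z
    rw [hrep' z, map_add, map_smul, AlgEquiv.commutes, hxy, hy1, one_smul]
    rfl
  · rw [hxy, show y = -1 by linear_combination h]; simp

theorem isQuadInvolution_of_sqrt {δ : E} {D : F} {b : Module.Basis (Fin 2) F E} {τ : E ≃ₐ[F] E}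
    (hb0 : b 0 = 1) (hb1 : b 1 = δ) (hD : δ * δ = algebraMap F E D) (hτ : τ δ = -δ) :
    IsQuadInvolution τ := by
  have hrep : ∀ z : E, z = algebraMap F E (b.repr z 0) + b.repr z 1 • δ := by
    intro z
    conv_lhs => rw [← b.sum_repr z, Fin.sum_univ_two, hb0, hb1, Algebra.smul_def, mul_one]
  have hnt : Nontrivial E := ⟨b 0, b 1, fun h => by simpa using b.injective h⟩
  have hr0 : ∀ x y : F, b.repr (algebraMap F E x + y • δ) 0 = x := by
    intro x y
    rw [← mul_one (algebraMap F E x), ← Algebra.smul_def, ← hb0, ← hb1]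
    simp
  have hr1 : ∀ x y : F, b.repr (algebraMap F E x + y • δ) 1 = y := by
    intro x y
    rw [← mul_one (algebraMap F E x), ← Algebra.smul_def, ← hb0, ← hb1]
    simp
  have hmat : ∀ x y : F, Algebra.leftMulMatrix b (algebraMap F E x + y • δ) = !![x, y * D; y, x] := by
    intro x y
    have h1 : (algebraMap F E x + y • δ) * δ = algebraMap F E (y * D) + x • δ := by
      simp only [Algebra.smul_def, map_mul]
      linear_combination (algebraMap F E y) * hD
    ext i j
    rw [Algebra.leftMulMatrix_eq_repr_mul]
    fin_cases i <;> fin_cases j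
    · simpa [hb0] using hr0 x y
    · simpa [hb1, h1] using hr0 (y * D) x
    · simpa [hb0] using hr1 x y
    · simpa [hb1, h1] using hr1 (y * D) x
  refine ⟨hnt, fun z => ?_, fun z => ?_⟩
  · obtain ⟨x, y, rfl⟩ : ∃ x y : F, z = algebraMap F E x + y • δ := ⟨_, _, hrep z⟩
    rw [Algebra.trace_eq_matrix_trace b, hmat, map_add τ, map_smul, AlgEquiv.commutes, hτ,
      Matrix.trace_fin_two]
    simp only [Matrix.of_apply, Matrix.cons_val', Matrix.cons_val_zero, Matrix.cons_val_one,
      Matrix.cons_val_fin_one, map_add, smul_neg]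
    ring
  · obtain ⟨x, y, rfl⟩ : ∃ x y : F, z = algebraMap F E x + y • δ := ⟨_, _, hrep z⟩
    rw [Algebra.norm_eq_matrix_det b, hmat, map_add τ, map_smul, AlgEquiv.commutes, hτ,
      Matrix.det_fin_two]
    simp only [Matrix.of_apply, Matrix.cons_val', Matrix.cons_val_zero, Matrix.cons_val_one,
      Matrix.cons_val_fin_one, map_mul, map_sub, Algebra.smul_def]
    linear_combination (algebraMap F E y) ^ 2 * hD

namespace IsQuadInvolution

variable {τ : E ≃ₐ[F] E} (h : IsQuadInvolution τ)
include h

theorem algebraMap_injective : Function.Injective (algebraMap F E) :=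
  have := h.nontrivial
  FaithfulSMul.algebraMap_injective F E

theorem invol (z : E) : τ (τ z) = z := by
  have h1 := congrArg τ (h.trace_eq z)
  rw [AlgEquiv.commutes, h.trace_eq z, map_add] at h1
  linear_combination h1.symm

theorem trace_conj (z : E) : Algebra.trace F E (τ z) = Algebra.trace F E z := by
  apply h.algebraMap_injective
  rw [h.trace_eq, h.trace_eq, h.invol, add_comm]

theorem norm_conj (z : E) : Algebra.norm F (τ z) = Algebra.norm F z := by
  apply h.algebraMap_injective
  rw [h.norm_eq, h.norm_eq, h.invol, mul_comm]

theorem norm_algebraMap (x : F) : Algebra.norm F (algebraMap F E x) = x ^ 2 := by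
  apply h.algebraMap_injective
  rw [h.norm_eq, AlgEquiv.commutes, map_pow, sq]

theorem isUnit_iff (z : E) : IsUnit z ↔ Algebra.norm F z ≠ 0 := by
  have := h.nontrivial
  constructor
  · intro hz
    exact (hz.map (Algebra.norm F)).ne_zero
  · intro hz
    have h1 : IsUnit (algebraMap F E (Algebra.norm F z)) := (Ne.isUnit hz).map _
    rw [h.norm_eq] at h1
    exact isUnit_of_mul_isUnit_left h1

theorem quadratic_eq (z : E) :
    z * z = algebraMap F E (Algebra.trace F E z) * z - algebraMap F E (Algebra.norm F z) := by
  rw [h.trace_eq, h.norm_eq]; ring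

end IsQuadInvolution

/-! ### The ring of integers of a quadratic algebra -/

variable [ValuativeRel F] [TopologicalSpace F] [IsNonarchimedeanLocalField F]

theorem conj_mem_intE {τ : E ≃ₐ[F] E} {z : E} (hz : z ∈ intE F E) : τ z ∈ intE F E :=
  IsIntegral.map ((τ : E →ₐ[F] E).restrictScalars 𝒪[F]) hz

theorem algebraMap_mem_intE {x : F} (hx : x ∈ 𝒪[F]) : algebraMap F E x ∈ intE F E := by
  have : algebraMap F E x = algebraMap 𝒪[F] E ⟨x, hx⟩ := rfl
  rw [this]
  exact Subalgebra.algebraMap_mem _ _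

theorem algebraMap_mem_intE_iff [Nontrivial E] {x : F} : algebraMap F E x ∈ intE F E ↔ x ∈ 𝒪[F] := by
  refine ⟨fun h => ?_, algebraMap_mem_intE⟩
  have h1 : IsIntegral 𝒪[F] x :=
    (isIntegral_algHom_iff ((Algebra.ofId F E).restrictScalars 𝒪[F])
      (FaithfulSMul.algebraMap_injective F E)).1 h
  obtain ⟨y, hy⟩ := IsIntegrallyClosed.isIntegral_iff.1 h1
  rw [← hy]; exact y.2

theorem smul_mem_intE {x : F} (hx : x ∈ 𝒪[F]) {z : E} (hz : z ∈ intE F E) : x • z ∈ intE F E := by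
  rw [Algebra.smul_def]; exact mul_mem (algebraMap_mem_intE hx) hz

namespace IsQuadInvolution

variable {τ : E ≃ₐ[F] E} (h : IsQuadInvolution τ)
include h

theorem trace_mem {z : E} (hz : z ∈ intE F E) : Algebra.trace F E z ∈ 𝒪[F] := by
  have := h.nontrivial
  rw [← algebraMap_mem_intE_iff (E := E), h.trace_eq]
  exact add_mem hz (conj_mem_intE hz)

theorem norm_mem {z : E} (hz : z ∈ intE F E) : Algebra.norm F z ∈ 𝒪[F] := by
  have := h.nontrivial
  rw [← algebraMap_mem_intE_iff (E := E), h.norm_eq]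
  exact mul_mem hz (conj_mem_intE hz)

theorem mem_intE_iff {z : E} :
    z ∈ intE F E ↔ Algebra.trace F E z ∈ 𝒪[F] ∧ Algebra.norm F z ∈ 𝒪[F] := by
  refine ⟨fun hz => ⟨h.trace_mem hz, h.norm_mem hz⟩, fun ⟨h1, h2⟩ => ?_⟩
  let P : Polynomial 𝒪[F] := Polynomial.X ^ 2 - (Polynomial.C ⟨_, h1⟩ * Polynomial.X - Polynomial.C ⟨_, h2⟩)
  refine ⟨P, ?_, ?_⟩
  · apply Polynomial.monic_X_pow_sub
    refine lt_of_le_of_lt (b := 1) (by compute_degree) (by norm_num)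
  · simp only [P, Polynomial.eval₂_sub, Polynomial.eval₂_pow, Polynomial.eval₂_X,
      Polynomial.eval₂_mul, Polynomial.eval₂_C]
    have e1 : algebraMap 𝒪[F] E ⟨_, h1⟩ = algebraMap F E (Algebra.trace F E z) := rfl
    have e2 : algebraMap 𝒪[F] E ⟨_, h2⟩ = algebraMap F E (Algebra.norm F z) := rfl
    rw [e1, e2]
    linear_combination h.quadratic_eq z

theorem unit_norm {z w : E} (hz : z ∈ intE F E) (hw : w ∈ intE F E) (hzw : z * w = 1) :
    Algebra.norm F z ≠ 0 ∧ ord (Algebra.norm F z) = 0 := by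
  have h1 : Algebra.norm F z * Algebra.norm F w = 1 := by rw [← map_mul, hzw, map_one]
  have h2 := left_ne_zero_of_mul_eq_one h1
  have h3 := right_ne_zero_of_mul_eq_one h1
  have h4 := ord_mul h2 h3
  rw [h1, ord_one] at h4
  have := ord_nonneg (h.norm_mem hz)
  have := ord_nonneg (h.norm_mem hw)
  exact ⟨h2, by omega⟩

end IsQuadInvolution

/-- `𝒪_E = 𝒪_F ⊕ 𝒪_F e` with `e² = t e - m` and `τ e = t - e`. -/
structure IsIntGen (τ : E ≃ₐ[F] E) (e : E) (t m : F) : Prop where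
  rep : ∀ z : E, ∃ x y : F, z = algebraMap F E x + y • e
  int_iff : ∀ x y : F, algebraMap F E x + y • e ∈ intE F E ↔ x ∈ 𝒪[F] ∧ y ∈ 𝒪[F]
  conj : τ e = algebraMap F E t - e
  sq : e * e = algebraMap F E t * e - algebraMap F E m

namespace IsIntGen

variable {τ : E ≃ₐ[F] E} {e : E} {t m : F} (g : IsIntGen τ e t m)
include g

theorem mem : e ∈ intE F E := by
  have := (g.int_iff 0 1).2 ⟨zero_mem _, one_mem _⟩
  simpa using this

theorem coeff_mem : t ∈ 𝒪[F] ∧ m ∈ 𝒪[F] := by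
  have h1 := mul_mem g.mem g.mem
  have h2 : e * e = algebraMap F E (-m) + t • e := by
    rw [g.sq, map_neg, Algebra.smul_def]; ring
  rw [h2, g.int_iff] at h1
  exact ⟨h1.2, neg_mem_iff.1 h1.1⟩

theorem trace_add (h : IsQuadInvolution τ) (x y : F) :
    Algebra.trace F E (algebraMap F E x + y • e) = 2 * x + t * y := by
  apply h.algebraMap_injective
  rw [h.trace_eq, map_add τ, map_smul, AlgEquiv.commutes, g.conj]
  simp only [Algebra.smul_def, map_add, map_mul, map_ofNat]
  ring

theorem norm_add (h : IsQuadInvolution τ) (x y : F) :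
    Algebra.norm F (algebraMap F E x + y • e) = x ^ 2 + t * x * y + m * y ^ 2 := by
  apply h.algebraMap_injective
  rw [h.norm_eq, map_add τ, map_smul, AlgEquiv.commutes, g.conj]
  simp only [Algebra.smul_def, map_add, map_mul, map_pow]
  linear_combination -(algebraMap F E y) ^ 2 * g.sq

theorem norm_gen (h : IsQuadInvolution τ) : Algebra.norm F e = m := by
  have := g.norm_add h 0 1
  simpa using this

theorem exists_int_rep (z : E) (hz : z ∈ intE F E) :
    ∃ x y : 𝒪[F], z = algebraMap F E x + (y : F) • e := by
  obtain ⟨x, y, rfl⟩ := g.rep z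
  obtain ⟨hx, hy⟩ := (g.int_iff x y).1 hz
  exact ⟨⟨x, hx⟩, ⟨y, hy⟩, rfl⟩

/-- When the discriminant is a unit, `𝒪_E` is its own dual for the trace form. -/
theorem mem_of_trace (h : IsQuadInvolution τ) (hdisc : (t ^ 2 - 4 * m)⁻¹ ∈ 𝒪[F])
    (hdisc0 : t ^ 2 - 4 * m ≠ 0) {z : E} (hz : ∀ w ∈ intE F E, Algebra.trace F E (w * z) ∈ 𝒪[F]) :
    z ∈ intE F E := by
  obtain ⟨x, y, rfl⟩ := g.rep z
  obtain ⟨ht, hm⟩ := g.coeff_mem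
  have h1 := hz 1 (one_mem _)
  rw [one_mul, g.trace_add h] at h1
  have h2 := hz e g.mem
  have h3 : e * (algebraMap F E x + y • e) = algebraMap F E (-m * y) + (x + t * y) • e := by
    simp only [Algebra.smul_def, map_add, map_mul, map_neg]
    linear_combination algebraMap F E y * g.sq
  rw [h3, g.trace_add h] at h2
  rw [g.int_iff]
  have h4 : (2 : F) ∈ 𝒪[F] := by
    have : (2 : F) = 1 + 1 := by norm_num
    rw [this]; exact add_mem (one_mem _) (one_mem _)
  have hx : x = (t ^ 2 - 4 * m)⁻¹ * ((t * t - 2 * m) * (2 * x + t * y) * (1 : F) -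
      t * (2 * (-m * y) + t * (x + t * y))) := by
    rw [eq_inv_mul_iff_mul_eq₀ hdisc0]; ring
  have hy : y = (t ^ 2 - 4 * m)⁻¹ * (2 * (2 * (-m * y) + t * (x + t * y)) - t * (2 * x + t * y)) := by
    rw [eq_inv_mul_iff_mul_eq₀ hdisc0]; ring
  constructor
  · rw [hx]
    exact mul_mem hdisc (sub_mem (mul_mem (mul_mem (sub_mem (mul_mem ht ht) (mul_mem h4 hm)) h1)
      (one_mem _)) (mul_mem ht h2))
  · rw [hy]
    exact mul_mem hdisc (sub_mem (mul_mem h4 h2) (mul_mem ht h1))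

end IsIntGen

end Quadratic

section Unramified

variable {F : Type*} [Field F] {E : Type*} [CommRing E] [Algebra F E]
  [ValuativeRel F] [TopologicalSpace F] [IsNonarchimedeanLocalField F] {τ : E ≃ₐ[F] E}

theorem isReduced_of_isField (hE : IsField E) : IsReduced E := by
  let := hE.toField
  infer_instance

theorem isReduced_of_isSplit (hS : IsSplit F E) : IsReduced E := by
  obtain ⟨φ⟩ := hS
  exact isReduced_of_injective φ φ.injective

theorem mem_integer_of_unit_mul {x y : F} (hx0 : x ≠ 0) (hx : ord x = 0) : x * y ∈ 𝒪[F] ↔ y ∈ 𝒪[F] := by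
  rcases eq_or_ne y 0 with rfl | hy
  · simp
  · rw [mul_mem_integer_iff hx0 hy, hx, zero_add, mem_integer_iff_ord hy]

/-! ### Split algebras -/

theorem IsSplit.exists_intGen [CharZero F] (hS : IsSplit F E) (hE : Module.finrank F E = 2)
    (hτ : τ ≠ AlgEquiv.refl) : ∃ e : E, IsIntGen τ e 1 0 := by
  obtain ⟨δ, D, b, hD0, hb0, hb1, hD, hτδ⟩ := exists_sqrt_gen hE (isReduced_of_isSplit hS) τ hτ
  have h := isQuadInvolution_of_sqrt hb0 hb1 hD hτδ
  obtain ⟨φ⟩ := hS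
  have hint : ∀ z : E, z ∈ intE F E ↔ (φ z).1 ∈ 𝒪[F] ∧ (φ z).2 ∈ 𝒪[F] := by
    intro z
    have key : ∀ x : F, IsIntegral 𝒪[F] x → x ∈ 𝒪[F] := by
      intro x hx
      obtain ⟨y, hy⟩ := IsIntegrallyClosed.isIntegral_iff.1 hx
      rw [← hy]; exact y.2
    constructor
    · intro hz
      exact ⟨key _ (IsIntegral.map (((AlgHom.fst F F F).comp (φ : E →ₐ[F] F × F)).restrictScalars 𝒪[F]) hz),
        key _ (IsIntegral.map (((AlgHom.snd F F F).comp (φ : E →ₐ[F] F × F)).restrictScalars 𝒪[F]) hz)⟩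
    · rintro ⟨h1, h2⟩
      have hid : ∀ w : E, w * w = w → w ∈ intE F E := by
        intro w hw
        refine ⟨Polynomial.X ^ 2 - Polynomial.X, ?_, ?_⟩
        · exact Polynomial.monic_X_pow_sub (by simp [Polynomial.degree_X])
        · simp [sq, hw]
      have h3 : z = (φ z).1 • φ.symm (1, 0) + (φ z).2 • φ.symm (0, 1) := by
        apply φ.injective
        ext <;> simp
      rw [h3]
      exact add_mem (smul_mem_intE h1 (hid _ (by rw [← map_mul]; simp)))
        (smul_mem_intE h2 (hid _ (by rw [← map_mul]; simp)))
  set e : E := φ.symm (1, 0) with he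
  have hee : e * e = e := by rw [he, ← map_mul]; simp
  have hτe : τ e = 1 - e := by
    obtain ⟨u, v, huv⟩ : ∃ u v : F, φ (τ e) = (u, v) := ⟨_, _, rfl⟩
    have h1 : φ (τ e) * φ (τ e) = φ (τ e) := by rw [← map_mul, ← map_mul, hee]
    have h2 := congrArg φ (h.trace_eq e)
    rw [map_add, AlgEquiv.commutes, huv, he, AlgEquiv.apply_symm_apply] at h2
    have h3 := congrArg φ (h.norm_eq e)
    rw [huv] at h1
    simp only [Prod.mk_mul_mk, Prod.mk.injEq] at h1
    have h4 : Algebra.trace F E e = 1 + u := congrArg Prod.fst h2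
    have h5 : Algebra.trace F E e = 0 + v := congrArg Prod.snd h2
    have h6 : v = 1 + u := by rw [zero_add] at h5; rw [← h5, h4]
    have hu : u = 0 := by
      have h7 := h1.2
      rw [h6] at h7
      have : 2 * u = 0 := by linear_combination h7 - h1.1
      exact (mul_eq_zero.1 this).resolve_left two_ne_zero
    apply φ.injective
    rw [huv, map_sub, map_one, he, AlgEquiv.apply_symm_apply, h6, hu]
    ext <;> simp
  refine ⟨e, ⟨fun z => ⟨(φ z).2, (φ z).1 - (φ z).2, ?_⟩, fun x y => ?_, by simp [hτe], by simp [hee]⟩⟩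
  · apply φ.injective
    ext <;> simp [he]
  · rw [hint]
    have : φ (algebraMap F E x + y • e) = (x + y, x) := by
      ext <;> simp [he]
    rw [this]
    constructor
    · rintro ⟨h1, h2⟩
      exact ⟨h2, by simpa using sub_mem h1 h2⟩
    · rintro ⟨h1, h2⟩
      exact ⟨add_mem h1 h2, h1⟩

theorem IsIntGen.eta_split {e : E} (g : IsIntGen τ e 1 0) (h : IsQuadInvolution τ) {x : F}
    (hx : x ≠ 0) : eta E x = 1 := by
  have h1 : Algebra.norm F (algebraMap F E 1 + (x - 1) • e) = x := by
    rw [g.norm_add h]; ring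
  have h2 : IsUnit (algebraMap F E 1 + (x - 1) • e) := by rw [h.isUnit_iff, h1]; exact hx
  exact if_pos ⟨h2.unit, h1⟩

/-! ### Inert algebras -/

/-- The ideal `𝔪_F 𝒪_E` consists of the multiples of a uniformizer of `F`. -/
theorem mem_map_maximalIdeal_iff (u : intE F E) :
    u ∈ Ideal.map (algebraMap 𝒪[F] (intE F E)) 𝓂[F] ↔ (unif F)⁻¹ • (u : E) ∈ intE F E := by
  rw [(IsDiscreteValuationRing.irreducible_iff_uniformizer _).1 (irreducible_unif F), Ideal.map_span,
    Set.image_singleton, Ideal.mem_span_singleton']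
  have hcoe : ((algebraMap 𝒪[F] (intE F E) ⟨unif F, unif_mem F⟩ : intE F E) : E) =
      algebraMap F E (unif F) := rfl
  constructor
  · rintro ⟨a, rfl⟩
    have : (unif F)⁻¹ • ((a * algebraMap 𝒪[F] (intE F E) ⟨unif F, unif_mem F⟩ : intE F E) : E) = a := by
      rw [Subalgebra.coe_mul, hcoe, mul_comm, ← Algebra.smul_def, inv_smul_smul₀ (unif_ne_zero F)]
    rw [this]; exact a.2
  · intro hu
    refine ⟨⟨_, hu⟩, Subtype.ext ?_⟩
    rw [Subalgebra.coe_mul, hcoe, mul_comm, ← Algebra.smul_def, smul_inv_smul₀ (unif_ne_zero F)]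

theorem IsInert.prime (hI : IsInert F E) {u v : E} (hu : u ∈ intE F E) (hv : v ∈ intE F E)
    (huv : (unif F)⁻¹ • (u * v) ∈ intE F E) :
    (unif F)⁻¹ • u ∈ intE F E ∨ (unif F)⁻¹ • v ∈ intE F E := by
  have h1 := (mem_map_maximalIdeal_iff ((⟨u, hu⟩ : intE F E) * ⟨v, hv⟩)).2 huv
  rcases hI.2.mem_or_mem h1 with h | h
  · exact Or.inl ((mem_map_maximalIdeal_iff _).1 h)
  · exact Or.inr ((mem_map_maximalIdeal_iff _).1 h)

theorem IsQuadInvolution.exists_smul_mem (h : IsQuadInvolution τ) (z : E) :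
    ∃ k : ℕ, unif F ^ k • z ∈ intE F E := by
  have h0 := unif_ne_zero F
  refine ⟨(ord (Algebra.trace F E z)).natAbs + (ord (Algebra.norm F z)).natAbs, ?_⟩
  set k := (ord (Algebra.trace F E z)).natAbs + (ord (Algebra.norm F z)).natAbs with hk
  have hk0 := pow_ne_zero k h0
  rw [h.mem_intE_iff, map_smul, Algebra.smul_def (unif F ^ k) z, map_mul (Algebra.norm F),
    h.norm_algebraMap, smul_eq_mul]
  constructor
  · rcases eq_or_ne (Algebra.trace F E z) 0 with h1 | h1
    · simp [h1]
    · rw [mul_mem_integer_iff hk0 h1, ord_pow h0, ord_unif]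
      omega
  · rcases eq_or_ne (Algebra.norm F z) 0 with h1 | h1
    · simp [h1]
    · rw [mul_mem_integer_iff (pow_ne_zero 2 hk0) h1, ord_pow hk0, ord_pow h0, ord_unif]
      push_cast
      omega

theorem IsQuadInvolution.unif_inv_notMem (h : IsQuadInvolution τ) :
    (unif F)⁻¹ • (1 : E) ∉ intE F E := by
  have := h.nontrivial
  rw [← Algebra.algebraMap_eq_smul_one, algebraMap_mem_intE_iff,
    mem_integer_iff_ord (inv_ne_zero (unif_ne_zero F)), ord_inv (unif_ne_zero F), ord_unif]
  norm_num

theorem IsQuadInvolution.div_unif_mem_iff (h : IsQuadInvolution τ) (x : F) :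
    (unif F)⁻¹ • algebraMap F E x ∈ intE F E ↔ x / unif F ∈ 𝒪[F] := by
  have := h.nontrivial
  rw [← algebraMap_mem_intE_iff (E := E), Algebra.smul_def, ← map_mul, div_eq_inv_mul]

/-- The residue field of `𝒪_E` is strictly larger than that of `𝒪_F`: otherwise `u - τ u` would be
divisible by arbitrary powers of a uniformizer for all integral `u`. -/
theorem IsQuadInvolution.exists_residue_gen (h : IsQuadInvolution τ) (hf : IsField E)
    (hτ : τ ≠ AlgEquiv.refl) :
    ∃ e ∈ intE F E, ∀ c ∈ 𝒪[F], (unif F)⁻¹ • (e - algebraMap F E c) ∉ intE F E := by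
  by_contra! hcon
  have h0 := unif_ne_zero F
  have key : ∀ (k : ℕ) (u : E), u ∈ intE F E →
      ∃ w ∈ intE F E, u - τ u = unif F ^ k • (w - τ w) := by
    intro k
    induction k with
    | zero => exact fun u hu => ⟨u, hu, by simp⟩
    | succ k ih =>
      intro u hu
      obtain ⟨w, hw, hw'⟩ := ih u hu
      obtain ⟨c, hc, hc'⟩ := hcon w hw
      refine ⟨_, hc', ?_⟩
      rw [hw', map_smul, map_sub, AlgEquiv.commutes, ← smul_sub, smul_smul, pow_succ,
        mul_inv_cancel_right₀ h0]
      congr 1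
      ring
  obtain ⟨z, hz⟩ : ∃ z, τ z ≠ z := by
    by_contra! h1
    exact hτ (AlgEquiv.ext h1)
  obtain ⟨j, hj⟩ := h.exists_smul_mem z
  set u := unif F ^ j • z
  have hu : u - τ u ≠ 0 := by
    rw [map_smul, ← smul_sub, smul_ne_zero_iff]
    exact ⟨pow_ne_zero _ h0, sub_ne_zero.2 (Ne.symm hz)⟩
  let := hf.toField
  have hM : Algebra.norm F (u - τ u) ≠ 0 := (h.isUnit_iff _).1 (Ne.isUnit hu)
  set M := Algebra.norm F (u - τ u)
  obtain ⟨w, hw, hw'⟩ := key ((ord M).natAbs + 1) u hj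
  have h1 : M = (unif F ^ ((ord M).natAbs + 1)) ^ 2 * Algebra.norm F (w - τ w) := by
    rw [← h.norm_algebraMap, ← map_mul, ← Algebra.smul_def, ← hw']
  have h2 : Algebra.norm F (w - τ w) ≠ 0 := by
    intro h2
    rw [h2, mul_zero] at h1
    exact hM h1
  have h3 := congrArg ord h1
  rw [ord_mul (pow_ne_zero _ (pow_ne_zero _ h0)) h2, ord_pow (pow_ne_zero _ h0), ord_pow h0,
    ord_unif] at h3
  have h4 := ord_nonneg (h.norm_mem (sub_mem hw (conj_mem_intE (τ := τ) hw)))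
  have h5 := le_abs_self (ord M)
  have h6 := abs_nonneg (ord M)
  push_cast at h3
  linarith

theorem exists_sq_residue_of_two (h2 : ¬ IsUnit (2 : 𝒪[F])) (x : 𝒪[F]) :
    ∃ c : 𝒪[F], IsLocalRing.residue 𝒪[F] (c ^ 2 - x) = 0 := by
  have : CharP 𝓀[F] 2 := by
    have h3 : (2 : 𝓀[F]) = 0 := by
      have : IsLocalRing.residue 𝒪[F] 2 = 0 := (IsLocalRing.residue_eq_zero_iff _).2 h2
      rwa [map_ofNat] at this
    exact CharTwo.of_one_ne_zero_of_two_eq_zero one_ne_zero h3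
  obtain ⟨c, hc⟩ := (FiniteField.isSquare_of_char_two (F := 𝓀[F]) (ringChar.eq 𝓀[F] 2 ▸ rfl)
    (IsLocalRing.residue 𝒪[F] x))
  obtain ⟨c, rfl⟩ := IsLocalRing.residue_surjective c
  exact ⟨c, by rw [map_sub, map_pow, hc, sq, sub_self]⟩

/-- The ring of integers of an inert algebra: `𝒪_E = 𝒪_F[e]` with unit discriminant, and the norm form
is anisotropic over the residue field. -/
structure IsInertGen (τ : E ≃ₐ[F] E) (e : E) (t m : F) : Prop extends IsIntGen τ e t m where
  disc : t ^ 2 - 4 * m ≠ 0 ∧ ord (t ^ 2 - 4 * m) = 0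
  anisotropic : ∀ x ∈ 𝒪[F], ∀ y ∈ 𝒪[F], (x ^ 2 + t * x * y + m * y ^ 2) / unif F ∈ 𝒪[F] →
    x / unif F ∈ 𝒪[F] ∧ y / unif F ∈ 𝒪[F]

theorem unit_of_not_div {x : F} (hx : x ∈ 𝒪[F]) (h : x / unif F ∉ 𝒪[F]) : x ≠ 0 ∧ ord x = 0 := by
  have hx0 : x ≠ 0 := by rintro rfl; simp at h
  rw [div_unif_mem_iff hx0] at h
  have := ord_nonneg hx
  exact ⟨hx0, by omega⟩

theorem not_div_of_unit {x : F} (hx : x ≠ 0) (h : ord x = 0) : x / unif F ∉ 𝒪[F] := by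
  rw [div_unif_mem_iff hx]; omega

theorem two_mem_integer : (2 : F) ∈ 𝒪[F] := by
  have : (2 : F) = 1 + 1 := by norm_num
  rw [this]; exact add_mem (one_mem _) (one_mem _)

theorem IsInert.exists_intGen (hI : IsInert F E) (h : IsQuadInvolution τ) (hδ : ∃ (δ : E)
      (b : Module.Basis (Fin 2) F E), b 0 = 1 ∧ b 1 = δ)
    (hτ : τ ≠ AlgEquiv.refl) : ∃ (e : E) (t m : F), IsInertGen τ e t m := by
  obtain ⟨e, he, hgen⟩ := h.exists_residue_gen hI.1 hτ
  have h0 := unif_ne_zero F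
  have hnt := h.nontrivial
  set t := Algebra.trace F E e
  set m := Algebra.norm F e
  have ht : t ∈ 𝒪[F] := h.trace_mem he
  have hm : m ∈ 𝒪[F] := h.norm_mem he
  have hconj : τ e = algebraMap F E t - e := by rw [h.trace_eq]; ring
  have hsq : e * e = algebraMap F E t * e - algebraMap F E m := h.quadratic_eq e
  have hrep : ∀ z : E, ∃ x y : F, z = algebraMap F E x + y • e := by
    obtain ⟨δ, b, hb0, hb1⟩ := hδ
    have hb : ∀ z : E, ∃ x y : F, z = algebraMap F E x + y • δ := by
      intro z
      refine ⟨b.repr z 0, b.repr z 1, ?_⟩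
      conv_lhs => rw [← b.sum_repr z, Fin.sum_univ_two, hb0, hb1, Algebra.smul_def, mul_one]
    obtain ⟨x0, y0, hxy⟩ := hb e
    have hy0 : y0 ≠ 0 := by
      rintro rfl
      rw [zero_smul, add_zero] at hxy
      have hx0 : x0 ∈ 𝒪[F] := by rwa [hxy, algebraMap_mem_intE_iff] at he
      exact hgen x0 hx0 (by rw [hxy]; simp)
    intro z
    obtain ⟨x, y, rfl⟩ := hb z
    refine ⟨x - y * y0⁻¹ * x0, y * y0⁻¹, ?_⟩
    rw [hxy, smul_add, smul_smul, inv_mul_cancel_right₀ hy0]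
    simp only [Algebra.smul_def, map_sub, map_mul]
    ring
  have hint : ∀ x y : F, algebraMap F E x + y • e ∈ intE F E ↔ x ∈ 𝒪[F] ∧ y ∈ 𝒪[F] := by
    intro x y
    constructor
    · intro hz
      have hy : y ∈ 𝒪[F] := by
        by_contra hy
        have hy0 : y ≠ 0 := by rintro rfl; exact hy (zero_mem _)
        have hyo : ord y < 0 := by rw [mem_integer_iff_ord hy0] at hy; omega
        have hyi : y⁻¹ / unif F ∈ 𝒪[F] := by
          rw [div_unif_mem_iff (inv_ne_zero hy0), ord_inv hy0]; omega
        by_cases hxy : x / y ∈ 𝒪[F]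
        · apply hgen (-(x / y)) (neg_mem hxy)
          have : (unif F)⁻¹ • (e - algebraMap F E (-(x / y))) =
              (y⁻¹ / unif F) • (algebraMap F E x + y • e) := by
            rw [map_neg, sub_neg_eq_add, smul_add, smul_add, smul_smul,
              show y⁻¹ / unif F * y = (unif F)⁻¹ by field_simp, Algebra.smul_def _ (algebraMap F E x),
              Algebra.smul_def _ (algebraMap F E (x / y)), ← map_mul, ← map_mul,
              show y⁻¹ / unif F * x = (unif F)⁻¹ * (x / y) by field_simp, add_comm]
          rw [this]
          exact smul_mem_intE hyi hz
        · have hx0 : x ≠ 0 := by rintro rfl; simp at hxy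
          rw [mem_integer_iff_ord (div_ne_zero hx0 hy0), ord_div hx0 hy0] at hxy
          have hxi : x⁻¹ / unif F ∈ 𝒪[F] := by
            rw [div_unif_mem_iff (inv_ne_zero hx0), ord_inv hx0]; omega
          have hyx : y / x / unif F ∈ 𝒪[F] := by
            rw [div_unif_mem_iff (div_ne_zero hy0 hx0), ord_div hy0 hx0]; omega
          apply h.unif_inv_notMem
          have : (unif F)⁻¹ • (1 : E) =
              (x⁻¹ / unif F) • (algebraMap F E x + y • e) - (y / x / unif F) • e := by
            rw [smul_add, smul_smul]
            simp only [Algebra.smul_def, ← map_mul, mul_one]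
            rw [show x⁻¹ / unif F * x = (unif F)⁻¹ by field_simp,
              show x⁻¹ / unif F * y = y / x / unif F by field_simp]
            ring
          rw [this]
          exact sub_mem (smul_mem_intE hxi hz) (smul_mem_intE hyx he)
      refine ⟨?_, hy⟩
      rw [← algebraMap_mem_intE_iff (E := E)]
      have := sub_mem hz (smul_mem_intE hy he)
      rwa [add_sub_cancel_right] at this
    · rintro ⟨hx, hy⟩
      exact add_mem (algebraMap_mem_intE hx) (smul_mem_intE hy he)
  have g : IsIntGen τ e t m := ⟨hrep, hint, hconj, hsq⟩
  have hdivint : ∀ x y : F, (unif F)⁻¹ • (algebraMap F E x + y • e) ∈ intE F E ↔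
      x / unif F ∈ 𝒪[F] ∧ y / unif F ∈ 𝒪[F] := by
    intro x y
    rw [← hint, smul_add, smul_smul, Algebra.smul_def (unif F)⁻¹, ← map_mul, div_eq_inv_mul,
      div_eq_inv_mul]
  refine ⟨e, t, m, ⟨g, ?_, ?_⟩⟩
  · have hdm : t ^ 2 - 4 * m ∈ 𝒪[F] := by
      have : t ^ 2 - 4 * m = t * t - 2 * 2 * m := by ring
      rw [this]
      exact sub_mem (mul_mem ht ht) (mul_mem (mul_mem two_mem_integer two_mem_integer) hm)
    apply unit_of_not_div hdm
    intro hd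
    have h1 : (unif F)⁻¹ • ((algebraMap F E (-t) + (2 : F) • e) * (algebraMap F E (-t) + (2 : F) • e)) ∈ intE F E := by
      have : (algebraMap F E (-t) + (2 : F) • e) * (algebraMap F E (-t) + (2 : F) • e) =
          algebraMap F E (t ^ 2 - 4 * m) := by
        simp only [Algebra.smul_def, map_sub, map_mul, map_pow, map_ofNat, map_neg]
        linear_combination 4 * hsq
      rw [this, h.div_unif_mem_iff]
      exact hd
    have h2 : algebraMap F E (-t) + (2 : F) • e ∈ intE F E :=
      (hint _ _).2 ⟨neg_mem ht, two_mem_integer⟩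
    have h3 : (-t) / unif F ∈ 𝒪[F] ∧ 2 / unif F ∈ 𝒪[F] := by
      rw [← hdivint]
      rcases hI.prime h2 h2 h1 with h | h <;> exact h
    have h4 : ¬ IsUnit (2 : 𝒪[F]) := by
      rw [← mem_nonunits_iff, ← IsLocalRing.mem_maximalIdeal, ← IsLocalRing.residue_eq_zero_iff,
        residue_eq_zero_iff]
      exact h3.2
    obtain ⟨c, hc⟩ := exists_sq_residue_of_two h4 ⟨-m, neg_mem hm⟩
    rw [residue_eq_zero_iff] at hc
    have hc : ((c : F) ^ 2 - -m) / unif F ∈ 𝒪[F] := hc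
    have h5 : (unif F)⁻¹ • ((e - algebraMap F E c) * (e - algebraMap F E c)) ∈ intE F E := by
      have : (e - algebraMap F E c) * (e - algebraMap F E c) =
          algebraMap F E ((c : F) ^ 2 - -m - 2 * m) + (t - 2 * c) • e := by
        simp only [Algebra.smul_def, map_sub, map_mul, map_pow, map_ofNat, map_neg]
        linear_combination hsq
      rw [this, hdivint]
      constructor
      · rw [sub_div, mul_comm 2 m, mul_div_assoc]
        exact sub_mem hc (mul_mem hm h3.2)
      · rw [sub_div, mul_comm, mul_div_assoc]
        refine sub_mem ?_ (mul_mem c.2 h3.2)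
        have := neg_mem h3.1
        rwa [neg_div, neg_neg] at this
    have h6 : e - algebraMap F E c ∈ intE F E := sub_mem he (algebraMap_mem_intE c.2)
    rcases hI.prime h6 h6 h5 with h | h <;> exact hgen c c.2 h
  · intro x hx y hy hxy
    have hz := (hint x y).2 ⟨hx, hy⟩
    rw [← g.norm_add h, ← h.div_unif_mem_iff, h.norm_eq] at hxy
    rw [← hdivint]
    rcases hI.prime hz (conj_mem_intE hz) hxy with h1 | h1
    · exact h1
    · have := conj_mem_intE (τ := τ) h1
      rwa [map_smul, h.invol] at this

end Unramified

section Norms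

variable {F : Type*} [Field F] {E : Type*} [CommRing E] [Algebra F E]
  [ValuativeRel F] [TopologicalSpace F] [IsNonarchimedeanLocalField F] {τ : E ≃ₐ[F] E}

/-! ### Norms from inert algebras -/

theorem hensel_quadratic (b c a₀ : 𝒪[F])
    (h1 : IsLocalRing.residue 𝒪[F] (a₀ ^ 2 + b * a₀ + c) = 0)
    (h2 : IsLocalRing.residue 𝒪[F] (2 * a₀ + b) ≠ 0) : ∃ a : 𝒪[F], a ^ 2 + b * a + c = 0 := by
  let f : Polynomial 𝒪[F] := Polynomial.X ^ 2 + (Polynomial.C b * Polynomial.X + Polynomial.C c)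
  have hf : f.Monic := by
    apply Polynomial.monic_X_pow_add
    exact lt_of_le_of_lt (b := 1) (by compute_degree) (by norm_num)
  have e1 : ∀ a, f.eval a = a ^ 2 + b * a + c := by
    intro a; simp [f]; ring
  have e2 : f.derivative.eval a₀ = 2 * a₀ + b := by
    simp [f]; norm_num
  obtain ⟨a, ha, -⟩ := HenselianLocalRing.is_henselian f hf a₀
    (by rw [e1]; exact (IsLocalRing.residue_eq_zero_iff _).1 h1)
    (by rw [e2]; exact (IsLocalRing.residue_ne_zero_iff_isUnit _).1 h2)
  exact ⟨a, by rw [← e1]; exact ha⟩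

theorem exists_binary_rep {k : Type*} [Field k] [Fintype k] (T M U : k) (hD : T ^ 2 - 4 * M ≠ 0) :
    ∃ X Y : k, X ^ 2 + T * X * Y + M * Y ^ 2 = U := by
  by_cases h2 : ringChar k = 2
  · obtain ⟨c, hc⟩ := FiniteField.isSquare_of_char_two h2 U
    exact ⟨c, 0, by rw [hc]; ring⟩
  · have h2' : (2 : k) ≠ 0 := Ring.two_ne_zero h2
    have h4 : (4 : k) ≠ 0 := by
      have : (4 : k) = 2 * 2 := by norm_num
      rw [this]; exact mul_ne_zero h2' h2'
    obtain ⟨a, b, hab⟩ := FiniteField.exists_root_sum_quadratic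
      (f := (Polynomial.C 1 * Polynomial.X ^ 2 + Polynomial.C 0 * Polynomial.X + Polynomial.C 0 : Polynomial k))
      (g := Polynomial.C (-((T ^ 2 - 4 * M) / 4)) * Polynomial.X ^ 2 + Polynomial.C 0 * Polynomial.X +
        Polynomial.C (-U))
      (Polynomial.degree_quadratic one_ne_zero)
      (Polynomial.degree_quadratic (neg_ne_zero.2 (div_ne_zero hD h4)))
      (FiniteField.odd_card_of_char_ne_two h2)
    simp only [Polynomial.eval_add, Polynomial.eval_mul, Polynomial.eval_C, Polynomial.eval_pow,
      Polynomial.eval_X] at hab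
    refine ⟨a - T * b / 2, b, ?_⟩
    field_simp at hab ⊢
    linear_combination hab

theorem residue_ne_zero_of_ord {x : 𝒪[F]} (hx : (x : F) ≠ 0) (h : ord (x : F) = 0) :
    IsLocalRing.residue 𝒪[F] x ≠ 0 := (residue_ne_zero_iff x).2 ⟨hx, h⟩

namespace IsInertGen

variable {e : E} {t m : F} (g : IsInertGen τ e t m)
include g

theorem unit_m : m ≠ 0 ∧ ord m = 0 := by
  apply unit_of_not_div g.coeff_mem.2
  intro hm
  have := (g.anisotropic 0 (zero_mem _) 1 (one_mem _) (by simpa using hm)).2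
  exact not_div_of_unit one_ne_zero ord_one this

/-- Units of `F` are norms from an unramified extension. -/
theorem exists_norm_eq (h : IsQuadInvolution τ) {u : F} (hu : u ≠ 0) (hu0 : ord u = 0) :
    ∃ z ∈ intE F E, Algebra.norm F z = u := by
  obtain ⟨ht, hm⟩ := g.coeff_mem
  obtain ⟨hm0, hmo⟩ := g.unit_m
  have hmi : m⁻¹ ∈ 𝒪[F] := by rw [mem_integer_iff_ord (inv_ne_zero hm0), ord_inv hm0, hmo, neg_zero]
  let t' : 𝒪[F] := ⟨t, ht⟩
  let m' : 𝒪[F] := ⟨m, hm⟩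
  let mi : 𝒪[F] := ⟨m⁻¹, hmi⟩
  have hmm : m' * mi = 1 := Subtype.ext (mul_inv_cancel₀ hm0)
  let u' : 𝒪[F] := ⟨u, (mem_integer_iff_ord hu).2 hu0.ge⟩
  set R := IsLocalRing.residue 𝒪[F]
  have hU : R u' ≠ 0 := residue_ne_zero_of_ord hu hu0
  have hD : R t' ^ 2 - 4 * R m' ≠ 0 := by
    have : R (t' ^ 2 - 4 * m') ≠ 0 := residue_ne_zero_of_ord g.disc.1 g.disc.2
    rwa [map_sub, map_mul, map_pow, map_ofNat] at this
  obtain ⟨X, Y, hXY⟩ := exists_binary_rep _ _ (R u') hD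
  obtain ⟨x, rfl⟩ := IsLocalRing.residue_surjective X
  obtain ⟨y, rfl⟩ := IsLocalRing.residue_surjective Y
  suffices ∃ x y : 𝒪[F], x ^ 2 + t' * x * y + m' * y ^ 2 = u' by
    obtain ⟨x, y, hxy⟩ := this
    refine ⟨_, (g.int_iff x y).2 ⟨x.2, y.2⟩, ?_⟩
    rw [g.norm_add h]
    exact congrArg Subtype.val hxy
  by_cases h1 : R (2 * x + t' * y) = 0
  · have h2 : R (2 * y + t' * x * mi) ≠ 0 := by
      intro h2
      have h3 : R m' * R mi = 1 := by rw [← map_mul, hmm, map_one]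
      simp only [map_add, map_mul, map_ofNat] at h1 h2
      have h2' : 2 * R m' * R y + R t' * R x = 0 := by
        linear_combination R m' * h2 - R t' * R x * h3
      have hy : (R t' ^ 2 - 4 * R m') * R y = 0 := by
        linear_combination R t' * h1 - 2 * h2'
      have hx : (R t' ^ 2 - 4 * R m') * R x = 0 := by
        linear_combination R t' * h2' - 2 * R m' * h1
      have hy0 := (mul_eq_zero.1 hy).resolve_left hD
      have hx0 := (mul_eq_zero.1 hx).resolve_left hD
      apply hU
      change R x ^ 2 + R t' * R x * R y + R m' * R y ^ 2 = R u' at hXY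
      rw [← hXY, hx0, hy0]
      ring
    obtain ⟨a, ha⟩ := hensel_quadratic (t' * x * mi) ((x ^ 2 - u') * mi) y (by
      have h3 : R m' * R mi = 1 := by rw [← map_mul, hmm, map_one]
      change R x ^ 2 + R t' * R x * R y + R m' * R y ^ 2 = R u' at hXY
      simp only [map_add, map_mul, map_sub, map_pow]
      linear_combination R mi * hXY - R y ^ 2 * h3) h2
    refine ⟨x, a, ?_⟩
    linear_combination m' * ha - (x * t' * a + x ^ 2 - u') * hmm
  · obtain ⟨a, ha⟩ := hensel_quadratic (t' * y) (m' * y ^ 2 - u') x (by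
      change R x ^ 2 + R t' * R x * R y + R m' * R y ^ 2 = R u' at hXY
      simp only [map_add, map_mul, map_sub, map_pow]
      linear_combination hXY) h1
    exact ⟨a, y, by linear_combination ha⟩

theorem even_ord_norm (h : IsQuadInvolution τ) {z : E} (hz : Algebra.norm F z ≠ 0) :
    Even (ord (Algebra.norm F z)) := by
  obtain ⟨x, y, rfl⟩ := g.rep z
  have key : ∀ c : F, c ≠ 0 → c⁻¹ * x ∈ 𝒪[F] → c⁻¹ * y ∈ 𝒪[F] →
      (c⁻¹ * x = 1 ∨ c⁻¹ * y = 1) → Even (ord (Algebra.norm F (algebraMap F E x + y • e))) := by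
    intro c hc hx hy hxy
    have h1 : Algebra.norm F (algebraMap F E x + y • e) =
        c ^ 2 * ((c⁻¹ * x) ^ 2 + t * (c⁻¹ * x) * (c⁻¹ * y) + m * (c⁻¹ * y) ^ 2) := by
      rw [g.norm_add h]; field_simp
    obtain ⟨ht, hm⟩ := g.coeff_mem
    have h2 : (c⁻¹ * x) ^ 2 + t * (c⁻¹ * x) * (c⁻¹ * y) + m * (c⁻¹ * y) ^ 2 ∈ 𝒪[F] :=
      add_mem (add_mem (pow_mem hx 2) (mul_mem (mul_mem ht hx) hy)) (mul_mem hm (pow_mem hy 2))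
    obtain ⟨h3, h4⟩ := unit_of_not_div h2 (fun h5 => by
      obtain ⟨h6, h7⟩ := g.anisotropic _ hx _ hy h5
      rcases hxy with h8 | h8
      · rw [h8] at h6; exact not_div_of_unit one_ne_zero ord_one h6
      · rw [h8] at h7; exact not_div_of_unit one_ne_zero ord_one h7)
    rw [h1, ord_mul (pow_ne_zero 2 hc) h3, ord_pow hc, h4]
    exact ⟨ord c, by push_cast; ring⟩
  rcases eq_or_ne x 0 with hx | hx
  · have hy : y ≠ 0 := by
      rintro rfl
      apply hz
      rw [hx]
      have := h.nontrivial
      simp only [map_zero, zero_smul, add_zero]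
      have := h.norm_algebraMap 0
      simpa using this
    refine key y hy ?_ ?_ (Or.inr (inv_mul_cancel₀ hy))
    · rw [hx, mul_zero]; exact zero_mem _
    · rw [inv_mul_cancel₀ hy]; exact one_mem _
  · rcases eq_or_ne y 0 with hy | hy
    · refine key x hx ?_ ?_ (Or.inl (inv_mul_cancel₀ hx))
      · rw [inv_mul_cancel₀ hx]; exact one_mem _
      · rw [hy, mul_zero]; exact zero_mem _
    · rcases le_total (ord x) (ord y) with hle | hle
      · refine key x hx ?_ ?_ (Or.inl (inv_mul_cancel₀ hx))
        · rw [inv_mul_cancel₀ hx]; exact one_mem _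
        · rw [mul_mem_integer_iff (inv_ne_zero hx) hy, ord_inv hx]; omega
      · refine key y hy ?_ ?_ (Or.inr (inv_mul_cancel₀ hy))
        · rw [mul_mem_integer_iff (inv_ne_zero hy) hx, ord_inv hy]; omega
        · rw [inv_mul_cancel₀ hy]; exact one_mem _

theorem eta_eq (h : IsQuadInvolution τ) {x : F} (hx : x ≠ 0) : eta E x = (-1 : ℂ) ^ ord x := by
  by_cases hev : Even (ord x)
  · rw [hev.neg_one_zpow]
    obtain ⟨k, hk⟩ := hev
    have hπ := unif_ne_zero F
    obtain ⟨z, -, hz⟩ := g.exists_norm_eq h (u := x / (unif F ^ k) ^ 2)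
      (div_ne_zero hx (pow_ne_zero 2 (zpow_ne_zero k hπ)))
      (by rw [ord_div hx (pow_ne_zero 2 (zpow_ne_zero k hπ)), ord_pow (zpow_ne_zero k hπ),
            ord_unif_zpow, hk]; push_cast; ring)
    have hN : Algebra.norm F (algebraMap F E (unif F ^ k) * z) = x := by
      rw [map_mul, h.norm_algebraMap, hz, mul_div_cancel₀ _ (pow_ne_zero 2 (zpow_ne_zero k hπ))]
    have hu : IsUnit (algebraMap F E (unif F ^ k) * z) := by rw [h.isUnit_iff, hN]; exact hx
    exact if_pos ⟨hu.unit, hN⟩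
  · rw [(Int.not_even_iff_odd.1 hev).neg_one_zpow]
    refine if_neg ?_
    rintro ⟨z, hz⟩
    apply hev
    rw [← hz]
    exact g.even_ord_norm h (by rw [hz]; exact hx)

end IsInertGen

/-! ### Ramified algebras -/

/-- The ring of integers of a tamely ramified algebra: `𝒪_E = 𝒪_F[e]` with `e² = -m` and `m` a
uniformizer of `F`. -/
structure IsRamGen (τ : E ≃ₐ[F] E) (e : E) (m : F) : Prop extends IsIntGen τ e 0 m where
  m_ne : m ≠ 0
  ord_m : ord m = 1
  two : IsUnit (2 : 𝒪[F])

theorem IsRamified.exists_intGen (hR : IsRamified F E) (h : IsQuadInvolution τ)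
    (hδ : ∃ (δ : E) (D : F) (b : Module.Basis (Fin 2) F E), D ≠ 0 ∧ b 0 = 1 ∧ b 1 = δ ∧
      δ * δ = algebraMap F E D ∧ τ δ = -δ) (h2 : IsUnit (2 : 𝒪[F])) :
    ∃ (e : E) (m : F), IsRamGen τ e m := by
  obtain ⟨δ, D, b, hD0, hb0, hb1, hD, hτδ⟩ := hδ
  have hπ := unif_ne_zero F
  have hnt := h.nontrivial
  obtain ⟨hE, P, hP, hP2⟩ := hR
  set k : ℤ := ord D / 2
  have hc : unif F ^ (-k) ≠ 0 := zpow_ne_zero _ hπ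
  set c := unif F ^ (-k)
  set e : E := c • δ
  set D' : F := c ^ 2 * D
  have hD' : D' ≠ 0 := mul_ne_zero (pow_ne_zero 2 hc) hD0
  have hoD : ord D' = 0 ∨ ord D' = 1 := by
    rw [ord_mul (pow_ne_zero 2 hc) hD0, ord_pow hc, ord_unif_zpow]
    push_cast
    omega
  have hee : e * e = algebraMap F E D' := by
    simp only [e, D', Algebra.smul_def, map_mul, map_pow]
    linear_combination (algebraMap F E c) ^ 2 * hD
  have hτe : τ e = -e := by simp only [e, map_smul, hτδ, smul_neg]
  have h2F : (2 : F) ≠ 0 ∧ ord (2 : F) = 0 := isUnit_integer_iff.1 h2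
  have htr : ∀ x y : F, Algebra.trace F E (algebraMap F E x + y • e) = 2 * x := by
    intro x y
    apply h.algebraMap_injective
    rw [h.trace_eq, map_add τ, map_smul, AlgEquiv.commutes, hτe]
    simp only [map_mul, map_ofNat, smul_neg]
    ring
  have hno : ∀ x y : F, Algebra.norm F (algebraMap F E x + y • e) = x ^ 2 - D' * y ^ 2 := by
    intro x y
    apply h.algebraMap_injective
    rw [h.norm_eq, map_add τ, map_smul, AlgEquiv.commutes, hτe]
    simp only [map_mul, map_sub, map_pow, Algebra.smul_def]
    linear_combination -(algebraMap F E y) ^ 2 * hee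
  have hint : ∀ x y : F, algebraMap F E x + y • e ∈ intE F E ↔ x ∈ 𝒪[F] ∧ y ∈ 𝒪[F] := by
    intro x y
    rw [h.mem_intE_iff, htr, hno, mem_integer_of_unit_mul h2F.1 h2F.2]
    refine and_congr_right fun hx => ?_
    rw [show x ^ 2 - D' * y ^ 2 = -(D' * y ^ 2) + x ^ 2 by ring,
      add_mem_cancel_right (pow_mem hx 2), neg_mem_iff]
    rcases eq_or_ne y 0 with rfl | hy
    · simp
    · rw [mul_mem_integer_iff hD' (pow_ne_zero 2 hy), ord_pow hy, mem_integer_iff_ord hy]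
      push_cast
      omega
  have hrep : ∀ z : E, ∃ x y : F, z = algebraMap F E x + y • e := by
    intro z
    refine ⟨b.repr z 0, b.repr z 1 * c⁻¹, ?_⟩
    rw [smul_smul, inv_mul_cancel_right₀ hc]
    conv_lhs => rw [← b.sum_repr z, Fin.sum_univ_two, hb0, hb1, Algebra.smul_def, mul_one]
  have hdivint : ∀ x y : F, (unif F)⁻¹ • (algebraMap F E x + y • e) ∈ intE F E ↔
      x / unif F ∈ 𝒪[F] ∧ y / unif F ∈ 𝒪[F] := by
    intro x y
    rw [← hint, smul_add, smul_smul, Algebra.smul_def (unif F)⁻¹, ← map_mul, div_eq_inv_mul,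
      div_eq_inv_mul]
  refine ⟨e, -D', ⟨⟨hrep, hint, by simp [hτe], by simp [hee]⟩, neg_ne_zero.2 hD', ?_, h2⟩⟩
  rw [ord_neg]
  refine hoD.resolve_left fun ho => ?_
  -- if `D` were a unit, `𝒪_E / 𝔪_F 𝒪_E` would be reduced, contradicting `𝔪_F 𝒪_E = P ^ 2`
  set I := Ideal.map (algebraMap 𝒪[F] (intE F E)) 𝓂[F] with hI
  have hred : ∀ z : intE F E, z * z ∈ I → z ∈ I := by
    rintro ⟨z, hz⟩ hzz
    obtain ⟨x, y, rfl⟩ := hrep z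
    obtain ⟨hx, hy⟩ := (hint x y).1 hz
    rw [mem_map_maximalIdeal_iff] at hzz ⊢
    have h3 : (algebraMap F E x + y • e) * (algebraMap F E x + y • e) =
        algebraMap F E (x ^ 2 + D' * y ^ 2) + (2 * (x * y)) • e := by
      simp only [Algebra.smul_def, map_mul, map_add, map_pow, map_ofNat]
      linear_combination (algebraMap F E y) ^ 2 * hee
    rw [Subalgebra.coe_mul, h3, hdivint] at hzz
    rw [hdivint]
    obtain ⟨h4, h5⟩ := hzz
    rw [mul_div_assoc, mem_integer_of_unit_mul h2F.1 h2F.2] at h5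
    have hsq : ∀ w : F, (w ^ 2) / unif F ∈ 𝒪[F] → w / unif F ∈ 𝒪[F] := by
      intro w hw
      rcases eq_or_ne w 0 with rfl | hw0
      · simp
      · rw [div_unif_mem_iff (pow_ne_zero 2 hw0), ord_pow hw0] at hw
        rw [div_unif_mem_iff hw0]
        push_cast at hw; omega
    have hor : x / unif F ∈ 𝒪[F] ∨ y / unif F ∈ 𝒪[F] := by
      rcases eq_or_ne x 0 with rfl | hx0
      · left; simp
      rcases eq_or_ne y 0 with rfl | hy0
      · right; simp
      rw [div_unif_mem_iff (mul_ne_zero hx0 hy0), ord_mul hx0 hy0] at h5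
      rw [div_unif_mem_iff hx0, div_unif_mem_iff hy0]
      have := ord_nonneg hx
      have := ord_nonneg hy
      omega
    rcases hor with h6 | h6
    · refine ⟨h6, hsq y ?_⟩
      have : D' * (y ^ 2 / unif F) = (x ^ 2 + D' * y ^ 2) / unif F - x * (x / unif F) := by
        field_simp; ring
      rw [← mem_integer_of_unit_mul hD' ho, this]
      exact sub_mem h4 (mul_mem hx h6)
    · refine ⟨hsq x ?_, h6⟩
      have : x ^ 2 / unif F = (x ^ 2 + D' * y ^ 2) / unif F - D' * y * (y / unif F) := by
        field_simp; ring
      rw [this]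
      exact sub_mem h4 (mul_mem (mul_mem ((mem_integer_iff_ord hD').2 ho.ge) hy) h6)
  have hPI : P = I := by
    apply le_antisymm
    · intro z hz
      apply hred
      rw [hP2, sq]
      exact Ideal.mul_mem_mul hz hz
    · rw [hP2]; exact Ideal.pow_le_self two_ne_zero
  let u : intE F E := ⟨algebraMap F E (unif F), algebraMap_mem_intE (unif_mem F)⟩
  have hspan : I = Ideal.span {u} := by
    rw [hI, (IsDiscreteValuationRing.irreducible_iff_uniformizer _).1 (irreducible_unif F),
      Ideal.map_span, Set.image_singleton]
    rfl
  have hu : u ∈ I := by rw [hspan]; exact Ideal.mem_span_singleton_self u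
  have hu2 : u ∈ I ^ 2 := by rw [← hPI, ← hP2]; exact hu
  rw [hspan, sq, Ideal.span_singleton_mul_span_singleton, Ideal.mem_span_singleton'] at hu2
  obtain ⟨a, ha⟩ := hu2
  have h3 : (a : E) * (algebraMap F E (unif F) * algebraMap F E (unif F)) = algebraMap F E (unif F) :=
    congrArg Subtype.val ha
  apply h.unif_inv_notMem
  have h4 : (unif F)⁻¹ • (1 : E) = a := by
    have h5 : algebraMap F E (unif F)⁻¹ * algebraMap F E (unif F) = 1 := by
      rw [← map_mul, inv_mul_cancel₀ hπ, map_one]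
    rw [Algebra.smul_def, mul_one]
    linear_combination (-(algebraMap F E (unif F)⁻¹) ^ 2) * h3 + (-algebraMap F E (unif F)⁻¹ + (a : E) * (1 + algebraMap F E (unif F)⁻¹ * algebraMap F E (unif F))) * h5
  rw [h4]; exact a.2

instance : DecidableEq 𝓀[F] := Classical.decEq _

/-- The quadratic character of the residue field, as a function on integers of `F`. -/
def resChar (u : 𝒪[F]) : ℂ := ((quadraticChar 𝓀[F] (IsLocalRing.residue 𝒪[F] u) : ℤ) : ℂ)

namespace IsRamGen

variable {e : E} {m : F} (g : IsRamGen τ e m)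
include g

theorem norm_e (h : IsQuadInvolution τ) : Algebra.norm F e = m := g.norm_gen h

theorem conj_e : τ e = -e := by rw [g.conj, map_zero, zero_sub]

theorem isUnit_e (h : IsQuadInvolution τ) : IsUnit e := by
  rw [h.isUnit_iff, g.norm_e h]; exact g.m_ne

theorem ringChar_ne_two : ringChar 𝓀[F] ≠ 2 := by
  intro h
  have h1 : (2 : 𝓀[F]) ≠ 0 := by
    have := (IsLocalRing.residue_ne_zero_iff_isUnit (2 : 𝒪[F])).2 g.two
    rwa [map_ofNat] at this
  have h2 := ringChar.Nat.cast_ringChar (R := 𝓀[F])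
  rw [h] at h2
  exact h1 (by exact_mod_cast h2)

theorem exists_sq_eq {u : 𝒪[F]} (hu : IsLocalRing.residue 𝒪[F] u ≠ 0)
    (hs : IsSquare (IsLocalRing.residue 𝒪[F] u)) : ∃ a : 𝒪[F], a ^ 2 = u := by
  obtain ⟨c, hc⟩ := hs
  obtain ⟨c, rfl⟩ := IsLocalRing.residue_surjective c
  have hc0 : IsLocalRing.residue 𝒪[F] c ≠ 0 := by
    intro h; rw [h, mul_zero] at hc; exact hu hc
  obtain ⟨a, ha⟩ := hensel_quadratic 0 (-u) c (by simp [hc, sq]) (by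
    rw [add_zero, map_mul]
    exact mul_ne_zero ((IsLocalRing.residue_ne_zero_iff_isUnit _).2 g.two) hc0)
  exact ⟨a, by linear_combination ha⟩

/-- A unit times a power of the norm `m` of a uniformizer is a norm iff the unit is a square in the
residue field. -/
theorem eta_eq (h : IsQuadInvolution τ) (u : 𝒪[F]) (hu : IsLocalRing.residue 𝒪[F] u ≠ 0) (k : ℤ) :
    eta E ((u : F) * m ^ k) = resChar u := by
  obtain ⟨hu0, huo⟩ := (residue_ne_zero_iff u).1 hu
  obtain ⟨e', he'⟩ := g.isUnit_e h
  have hnk : Algebra.norm F (((e' ^ k : Eˣ)) : E) = m ^ k := by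
    have h1 : Units.map (Algebra.norm F : E →* F) e' = Units.mk0 m g.m_ne :=
      Units.ext (by simp [he', g.norm_e h])
    have h2 : ((Units.map (Algebra.norm F : E →* F) (e' ^ k) : Fˣ) : F) = m ^ k := by
      rw [map_zpow, h1, Units.val_zpow_eq_zpow_val, Units.val_mk0]
    exact h2
  rw [resChar]
  by_cases hs : IsSquare (IsLocalRing.residue 𝒪[F] u)
  · rw [(quadraticChar_one_iff_isSquare hu).2 hs, Int.cast_one]
    obtain ⟨a, ha⟩ := g.exists_sq_eq hu hs
    have ha' : Algebra.norm F (algebraMap F E (a : F) * ((e' ^ k : Eˣ) : E)) = (u : F) * m ^ k := by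
      rw [map_mul, h.norm_algebraMap, hnk, ← ha]
      rfl
    have : IsUnit (algebraMap F E (a : F) * ((e' ^ k : Eˣ) : E)) := by
      rw [h.isUnit_iff, ha']
      exact mul_ne_zero hu0 (zpow_ne_zero _ g.m_ne)
    exact if_pos ⟨this.unit, ha'⟩
  · rw [(quadraticChar_neg_one_iff_not_isSquare (F := 𝓀[F])).2 hs]
    push_cast
    refine if_neg ?_
    rintro ⟨z, hz⟩
    apply hs
    have h1 : Algebra.norm F ((z * (e' ^ k)⁻¹ : Eˣ) : E) = u := by
      have h3 : Algebra.norm F ((z * (e' ^ k)⁻¹ : Eˣ) : E) * Algebra.norm F (((e' ^ k : Eˣ)) : E) = Algebra.norm F (z : E) := by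
        rw [← map_mul, ← Units.val_mul, inv_mul_cancel_right]
      rw [hz, hnk] at h3
      exact mul_right_cancel₀ (zpow_ne_zero _ g.m_ne) h3
    obtain ⟨x, y, hxy⟩ := g.rep ((z * (e' ^ k)⁻¹ : Eˣ) : E)
    rw [hxy, g.norm_add h] at h1
    have h1 : x ^ 2 + m * y ^ 2 = u := by rw [← h1]; ring
    have hint : algebraMap F E x + y • e ∈ intE F E := by
      rw [h.mem_intE_iff, g.norm_add h, g.trace_add h]
      have : x ^ 2 + 0 * x * y + m * y ^ 2 = u := by rw [← h1]; ring
      rw [this]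
      refine ⟨?_, u.2⟩
      rw [zero_mul, add_zero]
      refine mul_mem two_mem_integer ?_
      by_contra hx
      have hx0 : x ≠ 0 := by rintro rfl; exact hx (zero_mem _)
      rw [mem_integer_iff_ord hx0] at hx
      -- otherwise `-m y² = x² (1 - u x⁻²)` has even valuation
      have hw : (u : F) * (x⁻¹) ^ 2 / unif F ∈ 𝒪[F] := by
        rw [div_unif_mem_iff (mul_ne_zero hu0 (pow_ne_zero 2 (inv_ne_zero hx0))),
          ord_mul hu0 (pow_ne_zero 2 (inv_ne_zero hx0)), ord_pow (inv_ne_zero hx0), ord_inv hx0, huo]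
        push_cast; omega
      have hw' : (u : F) * (x⁻¹) ^ 2 ∈ 𝒪[F] := by
        have := mul_mem hw (unif_mem F)
        rwa [div_mul_cancel₀ _ (unif_ne_zero F)] at this
      obtain ⟨h5, h6⟩ := unit_of_not_div (sub_mem (one_mem _) hw') (fun h5 => by
        have := add_mem h5 hw
        rw [← add_div, sub_add_cancel] at this
        exact not_div_of_unit one_ne_zero ord_one this)
      have h7 : -(m * y ^ 2) = x ^ 2 * (1 - u * (x⁻¹) ^ 2) := by
        rw [← h1]; field_simp; ring
      have hy0 : y ≠ 0 := by
        rintro rfl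
        apply mul_ne_zero (pow_ne_zero 2 hx0) h5
        rw [← h7]; simp
      have h8 := congrArg ord h7
      rw [ord_neg, ord_mul g.m_ne (pow_ne_zero 2 hy0), ord_mul (pow_ne_zero 2 hx0) h5, ord_pow hx0,
        ord_pow hy0, h6, g.ord_m] at h8
      push_cast at h8
      omega
    obtain ⟨hx, hy⟩ := (g.int_iff x y).1 hint
    have h2 : u - (⟨x, hx⟩ : 𝒪[F]) ^ 2 ∈ 𝓂[F] := by
      rw [← IsLocalRing.residue_eq_zero_iff, residue_eq_zero_iff]
      have h3 : ((u - (⟨x, hx⟩ : 𝒪[F]) ^ 2 : 𝒪[F]) : F) = m * y ^ 2 := by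
        change (u : F) - x ^ 2 = m * y ^ 2
        rw [← h1]; ring
      rw [h3, mul_comm, mul_div_assoc]
      refine mul_mem (pow_mem hy 2) ?_
      rw [div_unif_mem_iff g.m_ne, g.ord_m]
    rw [← IsLocalRing.residue_eq_zero_iff, map_sub, sub_eq_zero] at h2
    rw [h2, map_pow]
    exact IsSquare.sq _

end IsRamGen

end Norms

/-! ### Hermitian spaces -/

theorem isSchwartzBruhat_indicator {A : Type*} [AddCommGroup A] [TopologicalSpace A] [T2Space A]
    {S : Set A} (hSo : IsOpen S) (hSc : IsCompact S) :
    IsSchwartzBruhat (S.indicator (1 : A → ℂ)) := by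
  constructor
  · have hcl : IsClopen S := ⟨hSc.isClosed, hSo⟩
    rw [IsLocallyConstant.iff_eventually_eq]
    intro x
    by_cases hx : x ∈ S
    · filter_upwards [hcl.isOpen.mem_nhds hx] with y hy
      rw [Set.indicator_of_mem hx, Set.indicator_of_mem hy]; rfl
    · filter_upwards [hcl.compl.isOpen.mem_nhds hx] with y hy
      rw [Set.indicator_of_notMem hx, Set.indicator_of_notMem hy]
  · exact HasCompactSupport.of_support_subset_isCompact hSc Set.support_indicator_subset

section HermitianAlgebra

variable {F : Type*} [Field F] {E : Type*} [CommRing E] [Algebra F E] {τ : E ≃ₐ[F] E}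
  {V : Type*} [AddCommGroup V] [Module F V] [Module E V] [IsScalarTower F E V]
  (H : V →ₗ[E] V →ₛₗ[(τ : E →+* E)] E)

theorem form_smul_left (z : E) (x y : V) : H (z • x) y = z * H x y := by
  rw [map_smul, LinearMap.smul_apply, smul_eq_mul]

theorem form_smul_right (z : E) (x y : V) : H x (z • y) = τ z * H x y := by
  rw [LinearMap.map_smulₛₗ, smul_eq_mul]; rfl

/-- The symmetric `F`-bilinear form `tr ⟨x, y⟩`. -/
def trForm : V →ₗ[F] V →ₗ[F] F :=
  LinearMap.mk₂ F (fun x y => Algebra.trace F E (H x y))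
    (fun x x' y => by rw [map_add, LinearMap.add_apply, map_add])
    (fun c x y => by
      rw [← algebraMap_smul E c x, form_smul_left, ← Algebra.smul_def, map_smul])
    (fun x y y' => by rw [map_add, map_add])
    (fun c x y => by
      rw [← algebraMap_smul E c y, form_smul_right, AlgEquiv.commutes, ← Algebra.smul_def, map_smul])

theorem trForm_apply (x y : V) : trForm H x y = Algebra.trace F E (H x y) := rfl

variable {H} (h : IsQuadInvolution τ) (hH : IsHermitian H)
include h hH

theorem trForm_symm (x y : V) : trForm H x y = trForm H y x := by
  rw [trForm_apply, trForm_apply, hH.symm x y, h.trace_conj]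

theorem trForm_smul_left (z : E) (x y : V) : trForm H (z • x) y = trForm H x (τ z • y) := by
  rw [trForm_apply, trForm_apply, form_smul_left, form_smul_right, h.invol]

variable [CharZero F]

theorem algebraMap_herm (x : V) : algebraMap F E (herm H x) = H x x := by
  have h2 : algebraMap F E 2 * algebraMap F E (herm H x) = algebraMap F E 2 * H x x := by
    rw [← map_mul, herm, mul_div_cancel₀ _ (two_ne_zero (α := F)), h.trace_eq, ← hH.symm, map_ofNat]
    ring
  have h3 : algebraMap F E 2⁻¹ * algebraMap F E 2 = 1 := by
    rw [← map_mul, inv_mul_cancel₀ two_ne_zero, map_one]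
  linear_combination (algebraMap F E 2⁻¹) * h2 + (H x x - algebraMap F E (herm H x)) * h3

theorem trForm_self (x : V) : trForm H x x = 2 * herm H x := by
  rw [trForm_apply, herm, mul_div_cancel₀ _ (two_ne_zero (α := F))]

theorem herm_add (x y : V) : herm H (x + y) = herm H x + herm H y + trForm H x y := by
  have h2 : 2 * herm H (x + y) = 2 * (herm H x + herm H y + trForm H x y) := by
    rw [← trForm_self h hH, mul_add, mul_add, ← trForm_self h hH, ← trForm_self h hH, map_add (trForm H),
      LinearMap.add_apply, map_add (trForm H x), map_add (trForm H y), trForm_symm h hH y x]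
    ring
  exact mul_left_cancel₀ two_ne_zero h2

theorem herm_smul (z : E) (x : V) : herm H (z • x) = Algebra.norm F z * herm H x := by
  apply h.algebraMap_injective
  rw [algebraMap_herm h hH, form_smul_left, form_smul_right, map_mul, h.norm_eq,
    algebraMap_herm h hH]
  ring

end HermitianAlgebra

/-! ### Annihilators, the Weil index and self-dual measures -/

section Annihilator

variable {p : ℕ} [hp : Fact p.Prime] {F : Type*} [Field F] [Algebra ℚ_[p] F]
  {E : Type*} [CommRing E] [Algebra F E] {τ : E ≃ₐ[F] E}
  {V : Type*} [AddCommGroup V] [Module F V] [Module E V] [IsScalarTower F E V]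
  {H : V →ₗ[E] V →ₛₗ[(τ : E →+* E)] E}

variable (p H) in
/-- The annihilator of a subgroup of `V` for the pairing `ψ(tr ⟨x, y⟩)`. -/
def perp (S : AddSubgroup V) : AddSubgroup V where
  carrier := {x | ∀ y ∈ S, psi p F (trForm H x y) = 1}
  zero_mem' := fun y _ => by simp
  add_mem' := fun {x x'} hx hx' y hy => by
    rw [map_add, LinearMap.add_apply, AddChar.map_add_eq_mul, hx y hy, hx' y hy, mul_one]
  neg_mem' := fun {x} hx y hy => by
    rw [map_neg, LinearMap.neg_apply, AddChar.map_neg_eq_inv, hx y hy, inv_one]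

theorem mem_perp {S : AddSubgroup V} {x : V} :
    x ∈ perp p H S ↔ ∀ y ∈ S, psi p F (trForm H x y) = 1 := Iff.rfl

variable (p H) in
/-- The character `y ↦ ψ(tr ⟨x, y⟩)`. -/
def pairingChar (x : V) : AddChar V ℂ :=
  (psi p F).compAddMonoidHom (trForm H x).toAddMonoidHom

theorem pairingChar_apply (x y : V) : pairingChar p H x y = psi p F (trForm H x y) := rfl

theorem pairingV_eq (x y : V) : pairingV p H x y = psi p F (trForm H x y) := rfl

/-- Compact open subsets. -/
def IsCompactOpen [TopologicalSpace V] (S : Set V) : Prop := IsOpen S ∧ IsCompact S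

variable [ValuativeRel F] [TopologicalSpace F] [IsNonarchimedeanLocalField F]
  [ContinuousSMul ℚ_[p] F] [FiniteDimensional ℚ_[p] F]
  {d : F} (hd : IsDifferent p d)
  (h : IsQuadInvolution τ) (hH : IsHermitian H)

include hd in
theorem IsDifferent.continuous_psi : Continuous (psi p F) := by
  rw [continuous_iff_continuousAt]
  intro x
  have h1 : {y : F | (y - x) * d ∈ 𝒪[F]} ∈ 𝓝 x :=
    (isOpen_integer.preimage ((continuous_id.sub continuous_const).mul continuous_const)).mem_nhds
      (by simp)
  refine (continuousAt_const (y := psi p F x)).congr ?_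
  filter_upwards [h1] with y hy
  have h2 := hd.psi_eq_one hy
  rw [show y = x + (y - x) by ring, AddChar.map_add_eq_mul, h2, mul_one]

variable [Module.Finite F V] [TopologicalSpace V]
  [IsTopologicalAddGroup V] [ContinuousSMul F V] [T2Space V]

include p in
theorem continuous_trForm (x : V) : Continuous (trForm H x) := continuous_linearMap p (trForm H x)

include p h hH in
theorem continuous_herm : Continuous (herm H) := by
  have : CharZero F := charZero_of_injective_algebraMap (algebraMap ℚ_[p] F).injective
  let b := Module.finBasis F V
  have h1 : ∀ x, herm H x = (∑ i, b.coord i x * trForm H (b i) x) / 2 := by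
    intro x
    rw [eq_div_iff two_ne_zero, mul_comm, ← trForm_self h hH]
    calc trForm H x x = trForm H (∑ i, b.repr x i • b i) x := by rw [b.sum_repr]
      _ = ∑ i, b.coord i x * trForm H (b i) x := by
        rw [map_sum, LinearMap.sum_apply]
        refine Finset.sum_congr rfl fun i _ => ?_
        rw [map_smul, LinearMap.smul_apply, smul_eq_mul, Module.Basis.coord_apply]
  have h2 : herm H = fun x => (∑ i, b.coord i x * trForm H (b i) x) / 2 := funext h1
  rw [h2]
  refine Continuous.div_const (continuous_finsetSum _ fun i _ => ?_) 2
  exact (continuous_linearMap p (b.coord i)).mul (continuous_trForm (p := p) (b i))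

include hd h hH in
theorem continuous_psi_herm (b : F) : Continuous fun x : V => psi p F (b * herm H x) :=
  hd.continuous_psi.comp (continuous_const.mul (continuous_herm (p := p) h hH))

include hd in
theorem isClosed_perp (S : AddSubgroup V) (h : IsQuadInvolution τ) (hH : IsHermitian H) :
    IsClosed (perp p H S : Set V) := by
  have h1 : (perp p H S : Set V) = ⋂ y ∈ S, (fun x => psi p F (trForm H y x)) ⁻¹' {1} := by
    ext x
    simp only [SetLike.mem_coe, mem_perp, Set.mem_iInter, Set.mem_preimage, Set.mem_singleton_iff,
      trForm_symm h hH x]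
  rw [h1]
  exact isClosed_biInter fun y _ =>
    isClosed_singleton.preimage (hd.continuous_psi.comp (continuous_trForm (p := p) y))

include p in
/-- A compact set is contained in `p⁻ᵏ M` for every open subgroup `M`. -/
theorem exists_prime_pow_smul_mem {M : AddSubgroup V} (hM : IsOpen (M : Set V)) {S : Set V}
    (hS : IsCompact S) : ∃ k : ℕ, ∀ x ∈ S, ((p : F) ^ k) • x ∈ M := by
  have hp0 : Tendsto (fun k : ℕ => (p : F) ^ k) atTop (𝓝 0) := by
    have h1 : Tendsto (fun k : ℕ => ((p : ℚ_[p]) ^ k) • (1 : F)) atTop (𝓝 ((0 : ℚ_[p]) • (1 : F))) :=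
      (tendsto_pow_atTop_nhds_zero_of_norm_lt_one Padic.norm_p_lt_one).smul_const _
    rw [zero_smul] at h1
    refine h1.congr fun k => ?_
    rw [Algebra.smul_def, mul_one, map_pow, map_natCast]
  have hmono : ∀ (j : ℕ) (x : V), ((p : F) ^ j) • x ∈ M → ((p : F) ^ (j + 1)) • x ∈ M := by
    intro j x hx
    have : ((p : F) ^ (j + 1)) • x = p • (((p : F) ^ j) • x) := by
      rw [pow_succ', mul_smul, Nat.cast_smul_eq_nsmul]
    rw [this]
    exact AddSubgroup.nsmul_mem _ hx _
  have hmono' : Monotone fun (k : ℕ) => {x : V | ((p : F) ^ k) • x ∈ M} :=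
    monotone_nat_of_le_succ fun k x hx => hmono k x hx
  obtain ⟨k, hk⟩ := hS.elim_directed_cover (fun k : ℕ => {x : V | ((p : F) ^ k) • x ∈ M})
    (fun k => hM.preimage (continuous_const_smul _)) (fun x _ => by
      have h2 : Tendsto (fun k : ℕ => ((p : F) ^ k) • x) atTop (𝓝 ((0 : F) • x)) :=
        hp0.smul_const x
      rw [zero_smul] at h2
      obtain ⟨k, hk⟩ := (h2.eventually (hM.mem_nhds M.zero_mem)).exists
      exact Set.mem_iUnion.2 ⟨k, hk⟩) hmono'.directed_le
  exact ⟨k, fun x hx => hk hx⟩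

variable [MeasurableSpace V] [BorelSpace V] (μ : Measure V) [μ.IsAddHaarMeasure]

include hd h hH in
/-- Only the part of a compact open subgroup `M` where `b x` annihilates `L` contributes to
`∫_M ψ(b q(x)) dx`, provided that `ψ(b q)` is trivial on the subgroup `L`. -/
theorem setIntegral_psi_herm {M L P : AddSubgroup V} (hM : IsCompactOpen (M : Set V))
    (hP : IsCompactOpen (P : Set V)) (hLM : L ≤ M) {M₀ : AddSubgroup V} (hM₀ : IsOpen (M₀ : Set V))
    (hPM₀ : P ≤ perp p H M₀) {b : F}
    (hL : ∀ x ∈ L, psi p F (b * herm H x) = 1) {T : AddSubgroup V}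
    (hTm : MeasurableSet (T : Set V)) (hT : ∀ x ∈ M, x ∈ T ↔ ∀ y ∈ L, psi p F (b * trForm H x y) = 1) :
    ∫ x in (M : Set V), psi p F (b * herm H x) ∂μ =
      ∫ x in ((M ⊓ T : AddSubgroup V) : Set V), psi p F (b * herm H x) ∂μ := by
  have : CharZero F := charZero_of_injective_algebraMap (algebraMap ℚ_[p] F).injective
  have hp0 : (p : F) ≠ 0 := by exact_mod_cast hp.out.ne_zero
  rcases eq_or_ne b 0 with rfl | hb
  · have hMT : M ⊓ T = M := inf_eq_left.2 fun x hx => (hT x hx).2 (by simp)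
    rw [hMT]
  -- `ψ(b tr ⟨x, y⟩) = 1` for `x ∈ M` and `y` in the open subgroup `{y | p⁻ᵏ b y ∈ P}`
  obtain ⟨k, hk⟩ := exists_prime_pow_smul_mem (p := p) (F := F) hM₀ hM.2
  set c : F := b * ((p : F) ^ k)⁻¹
  have hc : c ≠ 0 := mul_ne_zero hb (inv_ne_zero (pow_ne_zero _ hp0))
  let K : AddSubgroup V := P.comap (DistribSMul.toAddMonoidHom V c)
  have hKo : IsOpen (K : Set V) := hP.1.preimage (continuous_const_smul c)
  have key : ∀ x y : V, psi p F (b * trForm H x y) = pairingChar p H (b • x) y := by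
    intro x y
    rw [pairingChar_apply, map_smul, LinearMap.smul_apply, smul_eq_mul]
  refine setIntegral_eq_inter_annihilator μ (K := K) hM.1 hM.2 hLM hKo hTm
    (continuous_psi_herm hd h hH b) (fun x => pairingChar p H (b • x)) ?_ ?_ ?_
  · intro x _ l hl
    rw [herm_add h hH, mul_add, mul_add, AddChar.map_add_eq_mul, AddChar.map_add_eq_mul, hL l hl,
      mul_one, key]
  · intro x hx y hy _
    have h1 := hPM₀ (show c • y ∈ P from hy) _ (hk x hx)
    rw [← key, trForm_symm h hH]
    rw [map_smul (trForm H), LinearMap.smul_apply, map_smul (trForm H y), smul_eq_mul, smul_eq_mul,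
      ← mul_assoc, inv_mul_cancel_right₀ (pow_ne_zero _ hp0)] at h1
    exact h1
  · intro x hx
    rw [hT x hx]
    simp only [key]

theorem isCompactOpen_sup {L L' : AddSubgroup V} (hL : IsCompactOpen (L : Set V))
    (hL' : IsCompactOpen (L' : Set V)) : IsCompactOpen ((L ⊔ L' : AddSubgroup V) : Set V) := by
  refine ⟨AddSubgroup.isOpen_mono le_sup_left hL.1, ?_⟩
  rw [AddSubgroup.add_normal]
  exact hL.2.add hL'.2

include hd h hH in
/-- The Weil index is the integral of `ψ ∘ q` over the annihilator of any compact open subgroup on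
which `ψ ∘ q` is trivial. -/
theorem weilIndex_eq {M₀ P : AddSubgroup V} (hM₀ : IsCompactOpen (M₀ : Set V))
    (hP : IsCompactOpen (P : Set V)) (hPM₀ : perp p H M₀ = P)
    (hq : ∀ x ∈ M₀, psi p F (herm H x) = 1) :
    weilIndex p H μ = ∫ x in (P : Set V), psi p F (herm H x) ∂μ := by
  have : CharZero F := charZero_of_injective_algebraMap (algebraMap ℚ_[p] F).injective
  have hMP : M₀ ≤ P := by
    rw [← hPM₀]
    intro x hx y hy
    have h1 := hq _ (M₀.add_mem hx hy)
    rw [herm_add h hH, AddChar.map_add_eq_mul, AddChar.map_add_eq_mul, hq x hx, hq y hy] at h1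
    simpa using h1
  let P' : {L : AddSubgroup V // IsOpen (L : Set V) ∧ IsCompact (L : Set V)} := ⟨P, hP⟩
  have hne : Nonempty {L : AddSubgroup V // IsOpen (L : Set V) ∧ IsCompact (L : Set V)} := ⟨P'⟩
  have hdir : IsDirectedOrder {L : AddSubgroup V // IsOpen (L : Set V) ∧ IsCompact (L : Set V)} :=
    ⟨fun L L' => ⟨⟨L.1 ⊔ L'.1, isCompactOpen_sup L.2 L'.2⟩,
      (le_sup_left : L.1 ≤ L.1 ⊔ L'.1), (le_sup_right : L'.1 ≤ L.1 ⊔ L'.1)⟩⟩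
  rw [weilIndex]
  refine Tendsto.limUnder_eq (tendsto_const_nhds.congr' ?_)
  filter_upwards [eventually_ge_atTop P'] with L hL
  have hPL : P ≤ L.1 := hL
  have h1 := setIntegral_psi_herm hd h hH μ (M := L.1) (L := M₀) (P := P) L.2 hP (hMP.trans hPL)
    hM₀.1 hPM₀.ge (b := 1) (by simpa using hq) (T := P) hP.1.measurableSet (fun x _ => by
      rw [← hPM₀, mem_perp]; simp)
  simp only [one_mul] at h1
  rw [inf_eq_right.2 hPL] at h1
  exact h1.symm

variable {μ} (hμ : IsSelfDualMeasure (pairingV p H) μ)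

omit [μ.IsAddHaarMeasure] in
include hd h hH hμ in
/-- Fourier inversion for the indicator function of a compact open subgroup. -/
theorem selfDual_indicator {S : AddSubgroup V} (hS : IsCompactOpen (S : Set V)) (x : V) :
    (μ.real (S : Set V) : ℂ) * ((μ.real (perp p H S : Set V) : ℂ) *
      (perp p H (perp p H S) : Set V).indicator 1 x) = (S : Set V).indicator 1 x := by
  obtain ⟨hμ1, hμ2⟩ := hμ
  have hsb := isSchwartzBruhat_indicator hS.1 hS.2
  have hchar : ∀ (T : AddSubgroup V), IsClosed (T : Set V) → ∀ x : V,
      ∫ y, (T : Set V).indicator (1 : V → ℂ) y * pairingV p H x y ∂μ =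
        (μ.real (T : Set V) : ℂ) * (perp p H T : Set V).indicator 1 x := by
    intro T hT x
    have h1 : (fun y => (T : Set V).indicator (1 : V → ℂ) y * pairingV p H x y) =
        (T : Set V).indicator (fun y => pairingChar p H x y) := by
      ext y
      by_cases hy : y ∈ (T : Set V)
      · rw [Set.indicator_of_mem hy, Set.indicator_of_mem hy, Pi.one_apply, one_mul]; rfl
      · rw [Set.indicator_of_notMem hy, Set.indicator_of_notMem hy, zero_mul]
    rw [h1, integral_indicator hT.measurableSet]
    by_cases hx : x ∈ perp p H T
    · rw [Set.indicator_of_mem (show x ∈ (perp p H T : Set V) from hx), Pi.one_apply, mul_one,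
        setIntegral_congr_fun hT.measurableSet (g := fun _ => (1 : ℂ))
          (fun y hy => (pairingChar_apply x y).trans (hx y hy)),
        setIntegral_const]
      simp
    · rw [Set.indicator_of_notMem (show x ∉ (perp p H T : Set V) from hx), mul_zero]
      obtain ⟨l, hl, hl'⟩ : ∃ l ∈ T, psi p F (trForm H x l) ≠ 1 := by
        by_contra! hcon
        exact hx hcon
      exact setIntegral_eq_zero_of_translate μ hT.measurableSet _ hl hl'
        (fun y _ => by rw [AddChar.map_add_eq_mul]; rfl)
  have hcS := hchar S hS.2.isClosed
  have hinv := hμ2 _ hsb (-x)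
  rw [neg_neg] at hinv
  have h2 : fourier (pairingV p H) μ ((S : Set V).indicator 1) = fun y =>
      (μ.real (S : Set V) : ℂ) * (perp p H S : Set V).indicator 1 y := funext hcS
  rw [h2, fourier] at hinv
  simp only [mul_assoc] at hinv
  rw [integral_const_mul, hchar _ (isClosed_perp hd S h hH)] at hinv
  rw [← hinv]
  congr 2
  by_cases hx : x ∈ perp p H (perp p H S)
  · rw [Set.indicator_of_mem (show x ∈ (perp p H (perp p H S) : Set V) from hx),
      Set.indicator_of_mem (show -x ∈ (perp p H (perp p H S) : Set V) from neg_mem hx)]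
    rfl
  · rw [Set.indicator_of_notMem (show x ∉ (perp p H (perp p H S) : Set V) from hx),
      Set.indicator_of_notMem (show -x ∉ (perp p H (perp p H S) : Set V) from
        fun hn => hx (neg_mem_iff.1 hn))]

omit [μ.IsAddHaarMeasure] in
include hd h hH hμ in
theorem measureReal_mul_perp {S : AddSubgroup V} (hS : IsCompactOpen (S : Set V)) :
    μ.real (S : Set V) * μ.real (perp p H S : Set V) = 1 := by
  have h1 := selfDual_indicator hd h hH hμ hS 0
  rw [Set.indicator_of_mem (zero_mem (perp p H (perp p H S))), Set.indicator_of_mem (zero_mem S),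
    Pi.one_apply, mul_one] at h1
  exact_mod_cast h1

omit [μ.IsAddHaarMeasure] in
include hd h hH hμ in
theorem perp_perp {S : AddSubgroup V} (hS : IsCompactOpen (S : Set V)) :
    perp p H (perp p H S) = S := by
  have h2 := measureReal_mul_perp hd h hH hμ hS
  ext x
  have h1 := selfDual_indicator hd h hH hμ hS x
  rw [← mul_assoc, ← Complex.ofReal_mul, h2, Complex.ofReal_one, one_mul] at h1
  by_contra hcon
  by_cases hx : x ∈ S
  · have hx' : x ∉ perp p H (perp p H S) := fun hh => hcon ⟨fun _ => hx, fun _ => hh⟩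
    rw [Set.indicator_of_mem (show x ∈ (S : Set V) from hx), Set.indicator_of_notMem
      (show x ∉ (perp p H (perp p H S) : Set V) from hx')] at h1
    exact zero_ne_one h1
  · have hx' : x ∈ perp p H (perp p H S) := by
      by_contra hh
      exact hcon ⟨fun h3 => absurd h3 hh, fun h3 => absurd h3 hx⟩
    rw [Set.indicator_of_notMem (show x ∉ (S : Set V) from hx), Set.indicator_of_mem
      (show x ∈ (perp p H (perp p H S) : Set V) from hx')] at h1
    exact one_ne_zero h1

end Annihilator

/-! ### Lattices -/

section Lattice

variable {F : Type*} [Field F] [ValuativeRel F] [TopologicalSpace F] [IsNonarchimedeanLocalField F]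
  {E : Type*} [CommRing E] [Algebra F E] {τ : E ≃ₐ[F] E}
  {V : Type*} [AddCommGroup V] [Module F V] [Module E V] [IsScalarTower F E V]
  {H : V →ₗ[E] V →ₛₗ[(τ : E →+* E)] E}

/-- The preimage `z⁻¹ Λ` of a lattice under multiplication by `z`. -/
def scal (z : E) (Λ : Submodule (intE F E) V) : Submodule (intE F E) V where
  carrier := {x | z • x ∈ Λ}
  zero_mem' := by simp
  add_mem' := fun {x y} hx hy => by
    change z • (x + y) ∈ Λ
    rw [smul_add]; exact add_mem hx hy
  smul_mem' := fun c x hx => by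
    change z • (c • x) ∈ Λ
    have : z • (c • x) = c • (z • x) := by
      rw [Subalgebra.smul_def, Subalgebra.smul_def, smul_smul, smul_smul, mul_comm]
    rw [this]; exact Λ.smul_mem c hx

theorem mem_scal {z : E} {Λ : Submodule (intE F E) V} {x : V} : x ∈ scal z Λ ↔ z • x ∈ Λ := Iff.rfl

theorem invScale_eq_scal (ϖ : intE F E) (Λ : Submodule (intE F E) V) :
    invScale ϖ Λ = scal (ϖ : E) Λ := rfl

theorem smul_mem_lattice {Λ : Submodule (intE F E) V} {z : E} (hz : z ∈ intE F E) {x : V}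
    (hx : x ∈ Λ) : z • x ∈ Λ := Λ.smul_mem (⟨z, hz⟩ : intE F E) hx

theorem base_smul_mem_lattice {Λ : Submodule (intE F E) V} {c : F} (hc : c ∈ 𝒪[F]) {x : V}
    (hx : x ∈ Λ) : c • x ∈ Λ := by
  rw [← algebraMap_smul E]; exact smul_mem_lattice (algebraMap_mem_intE hc) hx

theorem scal_mul_unit {z u v : E} (hu : u ∈ intE F E) (hv : v ∈ intE F E) (huv : u * v = 1)
    (Λ : Submodule (intE F E) V) : scal (z * u) Λ = scal z Λ := by
  ext x
  rw [mem_scal, mem_scal]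
  refine ⟨fun h => ?_, fun h => ?_⟩
  · have := smul_mem_lattice hv h
    rwa [smul_smul, show v * (z * u) = z * (u * v) by ring, huv, mul_one] at this
  · rw [mul_comm, ← smul_smul]; exact smul_mem_lattice hu h

theorem mem_dualLattice {Λ : Submodule (intE F E) V} {x : V} :
    x ∈ dualLattice H Λ ↔ ∀ y ∈ Λ, H x y ∈ intE F E := Iff.rfl

theorem le_dualLattice_dualLattice (hH : IsHermitian H) (Λ : Submodule (intE F E) V) :
    Λ ≤ dualLattice H (dualLattice H Λ) := fun x hx y hy => by
  rw [hH.symm y x]; exact conj_mem_intE (hy x hx)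

variable {p : ℕ} [hp : Fact p.Prime] [Algebra ℚ_[p] F]
  {d : F} (hd : IsDifferent p d) (h : IsQuadInvolution τ) (hH : IsHermitian H)

include hd h hH in
/-- If `δ⁻¹ 𝒪_E` is the dual of `𝒪_E` for the trace form of `E / F`, then the annihilator of a
lattice for `ψ(tr ⟨x, y⟩)` is `(δ d)⁻¹` times the Hermitian dual. -/
theorem perp_eq_scal {δ : E} (hδ : ∀ w : E, (∀ z ∈ intE F E, Algebra.trace F E (z * w) ∈ 𝒪[F]) ↔
    δ * w ∈ intE F E) (S : Submodule (intE F E) V) :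
    perp p H S.toAddSubgroup = (scal (δ * algebraMap F E d) (dualLattice H S)).toAddSubgroup := by
  ext x
  have h1 : x ∈ scal (δ * algebraMap F E d) (dualLattice H S) ↔
      ∀ y ∈ S, ∀ z ∈ intE F E, Algebra.trace F E (z * (algebraMap F E d * H x y)) ∈ 𝒪[F] := by
    rw [mem_scal, mem_dualLattice]
    refine forall₂_congr fun y _ => ?_
    rw [hδ, form_smul_left, mul_assoc]
  have h2 : ∀ (y : V) (z : E), Algebra.trace F E (z * (algebraMap F E d * H x y)) =
      trForm H x (τ z • y) * d := by
    intro y z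
    rw [trForm_apply, form_smul_right, h.invol, mul_left_comm, ← Algebra.smul_def, map_smul,
      smul_eq_mul, mul_comm]
  change x ∈ perp p H S.toAddSubgroup ↔ x ∈ scal (δ * algebraMap F E d) (dualLattice H S)
  rw [h1]
  constructor
  · intro hx y hy z hz
    rw [h2, ← hd.psi_iff]
    intro c hc
    have h3 := hx (c • τ z • y) (base_smul_mem_lattice hc (smul_mem_lattice (conj_mem_intE hz) hy))
    rwa [map_smul (trForm H x), smul_eq_mul, mul_comm] at h3
  · intro hx y hy
    have h3 := hx y hy 1 (one_mem _)
    rw [h2, map_one, one_smul] at h3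
    exact hd.psi_eq_one h3

theorem IsIntGen.trace_dual {e : E} {t m : F} (g : IsIntGen τ e t m) (h : IsQuadInvolution τ)
    (hdisc0 : t ^ 2 - 4 * m ≠ 0) (hdisc : (t ^ 2 - 4 * m)⁻¹ ∈ 𝒪[F]) (w : E) :
    (∀ z ∈ intE F E, Algebra.trace F E (z * w) ∈ 𝒪[F]) ↔ 1 * w ∈ intE F E := by
  rw [one_mul]
  exact ⟨g.mem_of_trace h hdisc hdisc0, fun hw z hz => h.trace_mem (mul_mem hz hw)⟩

theorem IsRamGen.two_inv {e : E} {m : F} (g : IsRamGen τ e m) :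
    ∃ c ∈ 𝒪[F], c * (2 : F) = 1 := by
  obtain ⟨u, hu⟩ := g.two
  refine ⟨((u⁻¹ : 𝒪[F]ˣ) : 𝒪[F]), SetLike.coe_mem _, ?_⟩
  have h1 : ((u⁻¹ : 𝒪[F]ˣ) : 𝒪[F]) * 2 = 1 := by rw [← hu, Units.inv_mul]
  exact congrArg Subtype.val h1

theorem IsRamGen.sq_eq {e : E} {m : F} (g : IsRamGen τ e m) : e * e = -algebraMap F E m := by
  rw [g.sq, map_zero, zero_mul, zero_sub]

theorem IsRamGen.gen_mul {e : E} {m : F} (g : IsRamGen τ e m) (x y : F) :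
    e * (algebraMap F E x + y • e) = algebraMap F E (-m * y) + x • e := by
  simp only [Algebra.smul_def, map_mul, map_neg]
  linear_combination algebraMap F E y * g.sq_eq

theorem IsRamGen.trace_dual {e : E} {m : F} (g : IsRamGen τ e m) (h : IsQuadInvolution τ) (w : E) :
    (∀ z ∈ intE F E, Algebra.trace F E (z * w) ∈ 𝒪[F]) ↔ e * w ∈ intE F E := by
  obtain ⟨c, hc, hc2⟩ := g.two_inv
  obtain ⟨x, y, rfl⟩ := g.rep w
  rw [g.gen_mul, g.int_iff]
  have ht : ∀ x y : F, Algebra.trace F E (algebraMap F E x + y • e) = 2 * x := fun x y => by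
    rw [g.trace_add h]; ring
  have hc' : ∀ z : F, 2 * z ∈ 𝒪[F] ↔ z ∈ 𝒪[F] := fun z =>
    ⟨fun hz => by
      have := mul_mem hc hz
      rwa [← mul_assoc, hc2, one_mul] at this, fun hz => by rw [two_mul]; exact add_mem hz hz⟩
  constructor
  · intro hz
    have h1 := hz 1 (one_mem _)
    rw [one_mul, ht, hc'] at h1
    have h2 := hz e g.mem
    rw [g.gen_mul, ht, hc'] at h2
    exact ⟨h2, h1⟩
  · rintro ⟨h1, h2⟩ z hz
    obtain ⟨a, b, rfl⟩ := g.exists_int_rep z hz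
    have : (algebraMap F E (a : F) + (b : F) • e) * (algebraMap F E x + y • e) =
        algebraMap F E (a * x + b * (-m * y)) + (a * y + b * x) • e := by
      have := g.gen_mul x y
      simp only [Algebra.smul_def, map_mul, map_neg, map_add] at this ⊢
      linear_combination algebraMap F E b * this
    rw [this, ht, hc']
    exact add_mem (mul_mem a.2 h2) (mul_mem b.2 h1)

/-- Every irreducible element of `𝒪_E` is a unit multiple of the chosen uniformizer. -/
theorem IsRamGen.irreducible_eq {e : E} {m : F} (g : IsRamGen τ e m) (h : IsQuadInvolution τ)
    (ϖ : intE F E) (hϖ : Irreducible ϖ) :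
    ∃ u v : E, u ∈ intE F E ∧ v ∈ intE F E ∧ u * v = 1 ∧ (ϖ : E) = e * u := by
  obtain ⟨x, y, hxy⟩ := g.exists_int_rep ϖ ϖ.2
  have hmO : m ∈ 𝒪[F] := integer_of_ord (Or.inr (by rw [g.ord_m]; norm_num))
  have hx : (x : F) / m ∈ 𝒪[F] := by
    rcases eq_or_ne (x : F) 0 with h0 | h0
    · rw [h0, zero_div]; exact zero_mem _
    refine integer_of_ord (Or.inr ?_)
    rw [ord_div h0 g.m_ne, g.ord_m]
    by_contra hcon
    have hx0 : ord (x : F) = 0 := by have := ord_nonneg x.2; omega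
    -- otherwise the norm of `ϖ` is a unit
    have hn : Algebra.norm F (ϖ : E) = x ^ 2 + m * y ^ 2 := by
      rw [hxy, g.norm_add h]; ring
    have hu : IsUnit (⟨Algebra.norm F (ϖ : E), h.norm_mem ϖ.2⟩ : 𝒪[F]) := by
      rw [← IsLocalRing.residue_ne_zero_iff_isUnit]
      have : (⟨Algebra.norm F (ϖ : E), h.norm_mem ϖ.2⟩ : 𝒪[F]) = x ^ 2 + ⟨m, hmO⟩ * y ^ 2 :=
        Subtype.ext hn
      have hm : IsLocalRing.residue 𝒪[F] ⟨m, hmO⟩ = 0 := by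
        rw [IsLocalRing.residue_eq_zero_iff, mem_maximalIdeal_iff_ord g.m_ne, g.ord_m]
      rw [this, map_add, map_mul, hm, zero_mul, add_zero, map_pow]
      exact pow_ne_zero _ ((residue_ne_zero_iff x).2 ⟨h0, hx0⟩)
    obtain ⟨w, hw⟩ := hu.exists_right_inv
    apply hϖ.not_isUnit
    refine IsUnit.of_mul_eq_one (⟨τ ϖ * algebraMap F E w,
      mul_mem (conj_mem_intE ϖ.2) (algebraMap_mem_intE w.2)⟩ : intE F E) (Subtype.ext ?_)
    change (ϖ : E) * (τ ϖ * algebraMap F E w) = 1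
    rw [← mul_assoc, ← h.norm_eq, ← map_mul]
    have hw' : Algebra.norm F (ϖ : E) * (w : F) = 1 := congrArg Subtype.val hw
    rw [hw', map_one]
  let u : intE F E := ⟨algebraMap F E y + (-((x : F) / m)) • e,
    (g.int_iff _ _).2 ⟨y.2, neg_mem hx⟩⟩
  have hϖu : ϖ = ⟨e, g.mem⟩ * u := by
    apply Subtype.ext
    change (ϖ : E) = e * (algebraMap F E y + (-((x : F) / m)) • e)
    rw [g.gen_mul, hxy, mul_neg, neg_mul, neg_neg, mul_div_cancel₀ _ g.m_ne, add_comm]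
  rcases hϖ.isUnit_or_isUnit hϖu with hu | hu
  · obtain ⟨v, hv⟩ := hu.exists_right_inv
    have := h.unit_norm g.mem v.2 (congrArg Subtype.val hv)
    rw [g.norm_e h, g.ord_m] at this
    exact absurd this.2 one_ne_zero
  · obtain ⟨v, hv⟩ := hu.exists_right_inv
    exact ⟨u, v, u.2, v.2, congrArg Subtype.val hv, congrArg Subtype.val hϖu⟩

variable [ContinuousSMul ℚ_[p] F] [FiniteDimensional ℚ_[p] F]
  [Module.Finite F V] [TopologicalSpace V]
  [IsTopologicalAddGroup V] [ContinuousSMul F V] [T2Space V]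

include p in
theorem IsLattice.isCompactOpen {e : E} {t m : F} (g : IsIntGen τ e t m)
    {Λ : Submodule (intE F E) V} (hΛ : IsLattice Λ) : IsCompactOpen (Λ : Set V) := by
  obtain ⟨⟨s, hs⟩, hspan⟩ := hΛ
  let v : s ⊕ s → V := Sum.elim (fun i => (i : V)) (fun i => e • (i : V))
  let f : (s ⊕ s → F) →ₗ[F] V := Fintype.linearCombination F v
  have hf : ∀ (a b : s → F), f (Sum.elim a b) =
      ∑ i : s, (algebraMap F E (a i) + b i • e) • (i : V) := by
    intro a b
    rw [Fintype.linearCombination_apply, Fintype.sum_sum_type, ← Finset.sum_add_distrib]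
    refine Finset.sum_congr rfl fun i _ => ?_
    simp only [v, Sum.elim_inl, Sum.elim_inr]
    rw [add_smul, algebraMap_smul, smul_assoc]
  have hs1 : Submodule.span (intE F E) (Set.range fun i : s => (i : V)) = Λ := by
    rw [← hs]; congr 1; exact Subtype.range_coe
  have hs2 : Submodule.span E (Set.range fun i : s => (i : V)) = ⊤ := by
    rw [eq_top_iff, ← hspan, Submodule.span_le, ← hs1]
    exact Submodule.span_subset_span (intE F E) E _
  have hsurj : Function.Surjective f := by
    intro x
    have hx : x ∈ Submodule.span E (Set.range fun i : s => (i : V)) := hs2 ▸ Submodule.mem_top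
    obtain ⟨c, rfl⟩ := (Submodule.mem_span_range_iff_exists_fun E).1 hx
    choose a b hab using fun i => g.rep (c i)
    exact ⟨Sum.elim a b, by rw [hf]; exact Finset.sum_congr rfl fun i _ => by rw [← hab]⟩
  let B : Set (s ⊕ s → F) := Set.univ.pi fun _ => (𝒪[F] : Set F)
  have hB : f '' B = (Λ : Set V) := by
    ext x
    constructor
    · rintro ⟨c, hc, rfl⟩
      have hc' : ∀ i, c i ∈ 𝒪[F] := fun i => hc i (Set.mem_univ i)
      rw [show c = Sum.elim (c ∘ Sum.inl) (c ∘ Sum.inr) from (Sum.elim_comp_inl_inr c).symm, hf]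
      refine sum_mem fun i _ => smul_mem_lattice ((g.int_iff _ _).2 ⟨hc' _, hc' _⟩) ?_
      rw [← hs]; exact Submodule.subset_span i.2
    · intro hx
      rw [← hs1] at hx
      obtain ⟨c, rfl⟩ := (Submodule.mem_span_range_iff_exists_fun _).1 hx
      choose a b hab using fun i => g.exists_int_rep (c i) (c i).2
      refine ⟨Sum.elim (fun i => (a i : F)) (fun i => (b i : F)), ?_, ?_⟩
      · rintro (i | i) _
        exacts [(a i).2, (b i).2]
      · rw [hf]
        exact Finset.sum_congr rfl fun i _ => by rw [← hab]; rfl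
  rw [← hB]
  exact ⟨isOpenMap_linearMap p f hsurj B (isOpen_set_pi Set.finite_univ fun _ _ => isOpen_integer),
    (isCompact_univ_pi fun _ => isCompact_integer).image (continuous_linearMap p f)⟩

variable (F) in
include p F in
theorem continuous_smul_E (z : E) : Continuous fun x : V => z • x :=
  continuous_linearMap p (Algebra.lsmul F F V z)

variable (F) in
include p F in
theorem isCompactOpen_preimage_smul {S : Set V} (hS : IsCompactOpen S) (z : Eˣ) :
    IsCompactOpen ((fun x : V => (z : E) • x) ⁻¹' S) := by
  refine ⟨hS.1.preimage (continuous_smul_E (p := p) F (z : E)), ?_⟩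
  have : (fun x : V => (z : E) • x) ⁻¹' S = (fun x : V => ((z⁻¹ : Eˣ) : E) • x) '' S := by
    ext x
    simp only [Set.mem_preimage, Set.mem_image]
    refine ⟨fun hx => ⟨_, hx, by rw [smul_smul, Units.inv_mul, one_smul]⟩, ?_⟩
    rintro ⟨y, hy, rfl⟩
    rwa [smul_smul, Units.mul_inv, one_smul]
  rw [this]
  exact hS.2.image (continuous_smul_E (p := p) F _)

variable [MeasurableSpace F] [BorelSpace F] [MeasurableSpace V] [BorelSpace V] {μ : Measure V} (hμ : IsSelfDualMeasure (pairingV p H) μ)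

variable (F) in
include p F in
theorem exists_scalesBy_unit [μ.IsAddHaarMeasure] (z : Eˣ) :
    ∃ c : ℝ, 0 < c ∧ ScalesBy μ (fun x : V => (z : E) • x) c := by
  have := secondCountable_space p F V
  have := locallyCompact_space p F V
  exact exists_scalesBy μ (DistribMulAction.toAddEquiv V z) (continuous_smul_E (p := p) F (z : E))
    (continuous_smul_E (p := p) F ((z⁻¹ : Eˣ) : E))

include hd h hH hμ in
/-- The module of multiplication by `z ∈ E^×`. Conjugate elements have the same module because
annihilators exchange `z⁻¹ S` and `\bar z S`. -/
theorem scalesBy_unit_smul {n : ℕ} (hn : Module.finrank F V = 2 * (n + 1)) {S : AddSubgroup V}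
    (hS : IsCompactOpen (S : Set V)) (z : Eˣ) :
    ScalesBy μ (fun x : V => (z : E) • x) (absV (Algebra.norm F (z : E)) ^ (n + 1))⁻¹ := by
  have := hμ.1
  have := secondCountable_space p F V
  have := locallyCompact_space p F V
  let zc : Eˣ := Units.map (τ : E →* E) z
  obtain ⟨c, hc, hz⟩ := exists_scalesBy_unit (p := p) F (μ := μ) z
  obtain ⟨c', hc', hzc⟩ := exists_scalesBy_unit (p := p) F (μ := μ) zc
  obtain ⟨c'', hc'', hzi⟩ := exists_scalesBy_unit (p := p) F (μ := μ) zc⁻¹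
  have hcont : ∀ w : E, Continuous fun x : V => w • x := continuous_smul_E (p := p) F
  -- `c' c'' = 1`
  have h1 : c' * c'' = 1 := by
    have h0 := hzc.comp hzi hc'.le (hcont _) (hcont _)
    have h00 : ((fun x : V => (zc : E) • x) ∘ fun x => ((zc⁻¹ : Eˣ) : E) • x) = fun x => x := by
      ext x; rw [Function.comp, smul_smul, Units.mul_inv, one_smul]
    rw [h00] at h0
    exact h0.unique (by simp [ScalesBy]) (by positivity) zero_le_one
  -- `c c'' = 1`, by duality
  have h2 : c * c'' = 1 := by
    let T : AddSubgroup V := S.comap (DistribSMul.toAddMonoidHom V (z : E))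
    have hT : IsCompactOpen (T : Set V) := isCompactOpen_preimage_smul (p := p) F hS z
    have hperp : (perp p H T : Set V) =
        (fun x : V => ((zc⁻¹ : Eˣ) : E) • x) ⁻¹' (perp p H S : Set V) := by
      have hτz : τ ((z⁻¹ : Eˣ) : E) = ((zc⁻¹ : Eˣ) : E) := by
        rw [← map_inv]; rfl
      ext x
      simp only [Set.mem_preimage, SetLike.mem_coe, mem_perp]
      constructor
      · intro hx y hy
        rw [← hτz, trForm_smul_left h hH, h.invol]
        refine hx _ ?_
        change (z : E) • ((z⁻¹ : Eˣ) : E) • y ∈ S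
        rwa [smul_smul, Units.mul_inv, one_smul]
      · intro hx y hy
        have := hx _ hy
        rw [← hτz, trForm_smul_left h hH, h.invol] at this
        change psi p F (trForm H x (((z⁻¹ : Eˣ) : E) • (z : E) • y)) = 1 at this
        rwa [smul_smul, Units.inv_mul, one_smul] at this
    have h3 := measureReal_mul_perp hd h hH hμ hT
    have h4 := measureReal_mul_perp hd h hH hμ hS
    rw [hperp, hzi.measureReal hc'' (hcont _) (isClosed_perp hd S h hH).measurableSet,
      show (T : Set V) = (fun x : V => (z : E) • x) ⁻¹' (S : Set V) from rfl,
      hz.measureReal hc (hcont _) hS.1.measurableSet] at h3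
    linear_combination h3 - c * c'' * h4
  have h3 : c = c' := by
    have : c'' ≠ 0 := hc''.ne'
    exact mul_right_cancel₀ this (h2.trans h1.symm)
  have hN : Algebra.norm F (z : E) ≠ 0 := (h.isUnit_iff _).1 z.isUnit
  have hNp := absV_pos hN
  have h4 : c * c' = (absV (Algebra.norm F (z : E)) ^ Module.finrank F V)⁻¹ := by
    refine (hz.comp hzc hc.le (hcont _) (hcont _)).unique ?_ (by positivity)
      (by positivity)
    convert scalesBy_smul p μ hN using 1
    ext x
    rw [Function.comp, smul_smul, ← algebraMap_smul E (Algebra.norm F (z : E)), h.norm_eq]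
    rfl
  rw [← h3, hn, two_mul, pow_add, mul_inv] at h4
  have : c = (absV (Algebra.norm F (z : E)) ^ (n + 1))⁻¹ :=
    (mul_self_inj hc.le (by positivity)).1 h4
  rwa [← this]

include hd h hH hμ in
theorem measureReal_scal {n : ℕ} (hn : Module.finrank F V = 2 * (n + 1))
    {Λ : Submodule (intE F E) V} (hΛ : IsCompactOpen (Λ : Set V)) (z : Eˣ) :
    μ.real (scal (z : E) Λ : Set V) =
      (absV (Algebra.norm F (z : E)) ^ (n + 1))⁻¹ * μ.real (Λ : Set V) := by
  have := hμ.1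
  have := absV_pos ((h.isUnit_iff _).1 z.isUnit)
  exact (scalesBy_unit_smul hd h hH hμ hn (S := Λ.toAddSubgroup) hΛ z).measureReal (by positivity)
    (continuous_smul_E (p := p) F (z : E)) hΛ.1.measurableSet

include hd h hH hμ in
theorem setIntegral_scal {n : ℕ} (hn : Module.finrank F V = 2 * (n + 1))
    {Λ : Submodule (intE F E) V} (hΛ : IsCompactOpen (Λ : Set V)) (z : Eˣ) (b : F) :
    ∫ x in (scal (z : E) Λ : Set V), psi p F (b * herm H x) ∂μ =
      ((absV (Algebra.norm F (z : E)) ^ (n + 1))⁻¹ : ℝ) *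
        ∫ x in (Λ : Set V), psi p F (b / Algebra.norm F (z : E) * herm H x) ∂μ := by
  have := hμ.1
  have : CharZero F := charZero_of_injective_algebraMap (algebraMap ℚ_[p] F).injective
  have := secondCountable_space p F V
  have hN := (h.isUnit_iff _).1 z.isUnit
  have := absV_pos hN
  rw [← (scalesBy_unit_smul hd h hH hμ hn (S := Λ.toAddSubgroup) hΛ z).setIntegral (by positivity)
    (continuous_smul_E (p := p) F (z : E)) hΛ.1.measurableSet
    (continuous_psi_herm hd h hH _)]
  refine setIntegral_congr_fun
    (hΛ.1.preimage (continuous_smul_E (p := p) F (z : E))).measurableSet fun x _ => ?_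
  rw [herm_smul h hH, ← mul_assoc, div_mul_cancel₀ _ hN]

end Lattice

/-! ### Hermitian Gauss sums over finite fields -/

universe u v

section FiniteField

/-- The number of nonzero vectors in a set which is stable under nonzero scalars is divisible by
`|K| - 1`. -/
theorem card_sub_one_dvd_card {K W : Type*} [Field K] [Fintype K] [AddCommGroup W] [Module K W]
    [Fintype W] (P : W → Prop) (hP : ∀ (u : Kˣ) (w : W), P w → P (u • w)) :
    (Fintype.card K - 1) ∣ Nat.card {w : W // w ≠ 0 ∧ P w} := by
  classical
  let act : MulAction Kˣ {w : W // w ≠ 0 ∧ P w} :=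
    { smul := fun u w => ⟨u • w.1, (smul_ne_zero_iff_ne u).2 w.2.1, hP u _ w.2.2⟩
      one_smul := fun w => Subtype.ext (one_smul _ _)
      mul_smul := fun u v w => Subtype.ext (mul_smul _ _ _) }
  have hst : ∀ w : {w : W // w ≠ 0 ∧ P w}, MulAction.stabilizer Kˣ w = ⊥ := by
    intro w
    rw [eq_bot_iff]
    intro u hu
    have h1 : u • w.1 = w.1 := congrArg Subtype.val hu
    have h2 : ((u : K) - 1) • w.1 = 0 := by rw [sub_smul, one_smul, ← Units.smul_def, h1, sub_self]
    have h3 := (smul_eq_zero.1 h2).resolve_right w.2.1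
    exact Units.ext (sub_eq_zero.1 h3)
  rw [Nat.card_congr (MulAction.selfEquivOrbitsQuotientProd hst), Nat.card_prod,
    Nat.card_eq_fintype_card (α := Kˣ), Fintype.card_units]
  exact dvd_mul_left _ _

/-- The Gauss sum of a nondegenerate Hermitian form `Q` of dimension `k` over the quadratic extension
`K` of the finite field `κ` with `N` elements is `(-N) ^ k`. Its square is computed as usual; the sign
comes from the number of isotropic vectors, which is `1` modulo `N ^ 2 - 1`. -/
theorem sum_hermitian_eq {κ K W : Type*} [Field κ] [Fintype κ] [Field K] [Fintype K]
    [AddCommGroup W] [Module K W] [Fintype W] {N k : ℕ} (hκ : Fintype.card κ = N)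
    (hK : Fintype.card K = N ^ 2) (hW : Fintype.card W = N ^ (2 * k))
    (χ : AddChar κ ℂ) (hχ : χ ≠ 1) (Q : W → κ)
    (hν : ∀ c : κ, c ≠ 0 → ∃ z : Kˣ, ∀ w, Q (z • w) = c * Q w)
    (hQν : ∀ (z : Kˣ) w, Q w = 0 → Q (z • w) = 0)
    (hQ0 : Q 0 = 0)
    (hadd : ∀ w x y, Q (w + (x + y)) - Q w - Q (x + y) =
      (Q (w + x) - Q w - Q x) + (Q (w + y) - Q w - Q y))
    (hnd : ∀ w, w ≠ 0 → ∃ x, χ (Q (w + x) - Q w - Q x) ≠ 1) :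
    ∑ w, χ (Q w) = (-(N : ℂ)) ^ k := by
  classical
  have hN : 2 ≤ N := hκ ▸ Fintype.one_lt_card
  have hprim : χ.IsPrimitive := AddChar.IsPrimitive.of_ne_one hχ
  set S : ℂ := ∑ w, χ (Q w) with hS
  have hind : ∀ c : κ, c ≠ 0 → ∑ w, χ (c * Q w) = S := by
    intro c hc
    obtain ⟨z, hz⟩ := hν c hc
    refine Eq.trans ?_ (Equiv.sum_comp (MulAction.toPerm z) fun w => χ (Q w))
    exact Finset.sum_congr rfl fun w _ => by rw [MulAction.toPerm_apply, hz]
  -- counting isotropic vectors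
  have hA : (N : ℂ) ^ (2 * k) + (N - 1) * S = N * Nat.card {w : W // Q w = 0} := by
    have h1 : ∑ c : κ, ∑ w, χ (c * Q w) = (N : ℂ) ^ (2 * k) + (N - 1) * S := by
      rw [← Finset.add_sum_erase _ _ (Finset.mem_univ (0 : κ)),
        Finset.sum_congr rfl fun c hc => hind c (Finset.ne_of_mem_erase hc), Finset.sum_const,
        Finset.card_erase_of_mem (Finset.mem_univ _), Finset.card_univ, hκ]
      simp only [zero_mul, AddChar.map_zero_eq_one, Finset.sum_const, Finset.card_univ, hW,
        nsmul_eq_mul, mul_one]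
      rw [Nat.cast_sub (by omega)]
      push_cast
      ring
    rw [← h1, Finset.sum_comm]
    simp only [AddChar.sum_mulShift _ hprim, hκ]
    rw [Nat.card_eq_fintype_card, Fintype.card_subtype]
    simp [apply_ite, Finset.sum_ite, mul_comm]
  -- the absolute value
  have hB : S * S = (N : ℂ) ^ (2 * k) := by
    have hconj : ∑ w, χ (-Q w) = S := by
      rw [← hind (-1) (neg_ne_zero.2 one_ne_zero)]
      simp
    have h1 : S * S = ∑ x, ∑ w, χ (Q (w + x)) * χ (-Q x) := by
      nth_rewrite 2 [← hconj]
      rw [Finset.mul_sum]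
      refine Finset.sum_congr rfl fun x _ => ?_
      rw [← Finset.sum_mul, hS, ← Equiv.sum_comp (Equiv.addRight x)]
      rfl
    have h2 : ∀ w, ∑ x, χ (Q (w + x)) * χ (-Q x) = if w = 0 then (N : ℂ) ^ (2 * k) else 0 := by
      intro w
      let β : AddChar W ℂ :=
        { toFun := fun x => χ (Q (w + x) - Q w - Q x)
          map_zero_eq_one' := by simp [hQ0]
          map_add_eq_mul' := fun x y => by rw [hadd, AddChar.map_add_eq_mul] }
      have h3 : ∀ x, χ (Q (w + x)) * χ (-Q x) = χ (Q w) * β x := fun x => by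
        change _ = χ (Q w) * χ _
        rw [← AddChar.map_add_eq_mul, ← AddChar.map_add_eq_mul]
        congr 1; ring
      simp only [h3, ← Finset.mul_sum]
      split_ifs with hw
      · subst hw
        have : β = 0 := by
          ext x
          change χ (Q (0 + x) - Q 0 - Q x) = 1
          rw [zero_add, hQ0, sub_zero, sub_self, AddChar.map_zero_eq_one]
        rw [this, hQ0]
        simp [hW]
      · obtain ⟨x, hx⟩ := hnd w hw
        have : β ≠ 0 := fun h0 => hx (by
          have := DFunLike.congr_fun h0 x
          exact this)
        rw [AddChar.sum_eq_zero_iff_ne_zero.2 this, mul_zero]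
    rw [h1, Finset.sum_comm]
    simp only [h2]
    simp
  obtain ⟨j, hj⟩ : (N ^ 2 - 1) ∣ Nat.card {w : W // w ≠ 0 ∧ Q w = 0} := by
    rw [← hK]
    exact card_sub_one_dvd_card (fun w => Q w = 0) hQν
  have hZ : Nat.card {w : W // Q w = 0} = (N ^ 2 - 1) * j + 1 := by
    rw [← hj, Nat.card_eq_fintype_card, Nat.card_eq_fintype_card, Fintype.card_subtype,
      Fintype.card_subtype, ← Finset.card_erase_add_one (a := (0 : W)) (by simpa using hQ0)]
    congr 2
    ext w
    simp [and_comm]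
  rw [hZ] at hA
  have hpos : 1 ≤ N ^ 2 := Nat.one_le_pow _ _ (by omega)
  rw [Nat.cast_add, Nat.cast_mul, Nat.cast_sub hpos] at hA
  have h4 : (S - (-(N : ℂ)) ^ k) * (S + (-(N : ℂ)) ^ k) = 0 := by
    have : (-(N : ℂ)) ^ k * (-(N : ℂ)) ^ k = (N : ℂ) ^ (2 * k) := by
      rw [← mul_pow, pow_mul]; ring
    linear_combination hB - this
  rcases mul_eq_zero.1 h4 with h5 | h5
  · exact sub_eq_zero.1 h5
  · exfalso
    have h6 : S = ((-(-(N : ℤ)) ^ k : ℤ) : ℂ) := by push_cast; linear_combination h5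
    rw [h6] at hA
    have h7 : (N : ℤ) ^ (2 * k) + (N - 1) * (-(-(N : ℤ)) ^ k) = N * ((N ^ 2 - 1) * j + 1) := by
      exact_mod_cast hA
    have h8 : ((N : ℤ) ^ 2 - 1) ∣ (N : ℤ) ^ (2 * k) - 1 := by
      rw [pow_mul]; exact by
        simpa using sub_dvd_pow_sub_pow ((N : ℤ) ^ 2) 1 k
    have h9 : ((N : ℤ) + 1) ∣ (-(N : ℤ)) ^ k - 1 := by
      have : (-(N : ℤ) - 1) ∣ (-(N : ℤ)) ^ k - 1 := by
        simpa using sub_dvd_pow_sub_pow (-(N : ℤ)) 1 k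
      rwa [← neg_dvd, neg_add']
    obtain ⟨u, hu⟩ := h8
    obtain ⟨v, hv⟩ := h9
    have h10 : ((N : ℤ) - 1) * ((N + 1) * (u - v - N * j) - 2) = 0 := by
      linear_combination h7 - hu + (N - 1) * hv
    have h11 := (mul_eq_zero.1 h10).resolve_left (by omega)
    have h12 : ((N : ℤ) + 1) ∣ 2 := ⟨u - v - N * j, by linear_combination -h11⟩
    have := Int.le_of_dvd (by norm_num) h12
    omega

/-- Reduction of a finite module modulo a prime element with finite residue ring. -/
theorem exists_reduction {R : Type u} {M : Type v} [CommRing R] [AddCommGroup M] [Module R M]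
    [Module.Finite R M] (I : Ideal R) (hI : I.IsPrime) (hfin : Finite (R ⧸ I)) (ϖ : R)
    (hϖ : I = Ideal.span {ϖ}) :
    ∃ (K : Type u) (W : Type v) (_ : Field K) (_ : Fintype K) (_ : AddCommGroup W) (_ : Fintype W)
      (_ : Module K W) (ρ : R →+* K) (φ : M →+ W), Function.Surjective ρ ∧ Function.Surjective φ ∧
      Fintype.card K = Nat.card (R ⧸ I) ∧ (∀ r, ρ r = 0 ↔ r ∈ I) ∧
      (∀ x, φ x = 0 ↔ ∃ y, ϖ • y = x) ∧ ∀ r x, φ (r • x) = ρ r • φ x := by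
  have hdom : IsDomain (R ⧸ I) := Ideal.Quotient.isDomain I
  have hmax : I.IsMaximal := Ideal.Quotient.maximal_of_isField I (Finite.isField_of_domain _)
  let : Field (R ⧸ I) := Ideal.Quotient.field I
  have hfinK : Module.Finite (R ⧸ I) (M ⧸ (I • (⊤ : Submodule R M))) :=
    Module.Finite.of_restrictScalars_finite R _ _
  have hWfin : Finite (M ⧸ (I • (⊤ : Submodule R M))) := Module.finite_of_finite (R ⧸ I)
  refine ⟨R ⧸ I, M ⧸ (I • (⊤ : Submodule R M)), inferInstance, Fintype.ofFinite _, inferInstance,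
    Fintype.ofFinite _, inferInstance, Ideal.Quotient.mk I,
    (Submodule.mkQ (I • (⊤ : Submodule R M))).toAddMonoidHom, Ideal.Quotient.mk_surjective,
    Submodule.mkQ_surjective _, ?_, fun r => Ideal.Quotient.eq_zero_iff_mem, fun x => ?_,
    fun r x => rfl⟩
  · exact (@Nat.card_eq_fintype_card _ (Fintype.ofFinite _)).symm
  · refine (Submodule.Quotient.mk_eq_zero _).trans ?_
    rw [hϖ, Submodule.ideal_span_singleton_smul, Submodule.mem_smul_pointwise_iff_exists]
    simp

end FiniteField

/-! ### Gauss sums of unimodular lattices at inert places -/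

section ResidueCharacter

variable {p : ℕ} [hp : Fact p.Prime] {F : Type*} [Field F] [Algebra ℚ_[p] F]
  [ValuativeRel F] [TopologicalSpace F] [IsNonarchimedeanLocalField F] {d : F}

/-- If `v(b d) = -1`, then `x ↦ ψ(b x)` induces a nontrivial character of the residue field. -/
theorem IsDifferent.exists_residueChar (hd : IsDifferent p d) {b : F} (hb : b ≠ 0)
    (hbd : ord (b * d) = -1) :
    ∃ χ : AddChar 𝓀[F] ℂ, χ ≠ 1 ∧ ∀ x : 𝒪[F], χ (IsLocalRing.residue 𝒪[F] x) = psi p F (b * x) := by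
  have hs : Function.Surjective (IsLocalRing.residue 𝒪[F]) := IsLocalRing.residue_surjective
  have hbd0 : b * d ≠ 0 := mul_ne_zero hb hd.1
  have hcongr : ∀ x y : 𝒪[F], IsLocalRing.residue 𝒪[F] x = IsLocalRing.residue 𝒪[F] y →
      psi p F (b * x) = psi p F (b * y) := by
    intro x y hxy
    have h1 : IsLocalRing.residue 𝒪[F] (x - y) = 0 := by rw [map_sub, hxy, sub_self]
    rw [residue_eq_zero_iff] at h1
    have h2 : psi p F (b * (x - y : 𝒪[F])) = 1 := by
      apply hd.psi_eq_one
      have h3 : b * d * unif F ∈ 𝒪[F] := by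
        rw [mul_mem_integer_iff hbd0 (unif_ne_zero F), hbd, ord_unif]; norm_num
      have := mul_mem h3 h1
      have h4 := unif_ne_zero F
      convert this using 1
      field_simp
    have h3 : b * (x : F) = b * (x - y : 𝒪[F]) + b * y := by push_cast; ring
    rw [h3, AddChar.map_add_eq_mul, h2, one_mul]
  let χ : AddChar 𝓀[F] ℂ :=
    { toFun := fun c => psi p F (b * (Function.surjInv hs c : 𝒪[F]))
      map_zero_eq_one' := by
        rw [hcongr _ 0 (by rw [Function.surjInv_eq hs, map_zero])]
        simp
      map_add_eq_mul' := fun c c' => by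
        rw [hcongr _ (Function.surjInv hs c + Function.surjInv hs c')
          (by rw [map_add]; simp only [Function.surjInv_eq hs])]
        push_cast
        rw [mul_add, AddChar.map_add_eq_mul] }
  have hχ : ∀ x : 𝒪[F], χ (IsLocalRing.residue 𝒪[F] x) = psi p F (b * x) := fun x =>
    hcongr _ _ (Function.surjInv_eq hs _)
  refine ⟨χ, fun h1 => ?_, hχ⟩
  have h2 : b * d ∈ 𝒪[F] := by
    rw [← hd.psi_iff]
    intro y hy
    have := hχ ⟨y, hy⟩
    rw [h1] at this
    exact this.symm
  rw [mem_integer_iff_ord hbd0] at h2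
  omega

end ResidueCharacter

section InertResidue

variable {F : Type*} [Field F] [ValuativeRel F] [TopologicalSpace F] [IsNonarchimedeanLocalField F]
  {E : Type*} [CommRing E] [Algebra F E] {τ : E ≃ₐ[F] E}

variable (F E) in
/-- The ideal `𝔪_F 𝒪_E`. -/
abbrev baseIdeal : Ideal (intE F E) := Ideal.map (algebraMap 𝒪[F] (intE F E)) 𝓂[F]

theorem IsInertGen.card_quotient {e : E} {t m : F} (g : IsInertGen τ e t m) :
    Finite (intE F E ⧸ baseIdeal F E) ∧ Nat.card (intE F E ⧸ baseIdeal F E) = resCard F ^ 2 := by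
  have hs : Function.Surjective (IsLocalRing.residue 𝒪[F]) := IsLocalRing.residue_surjective
  let q : 𝒪[F] × 𝒪[F] → intE F E := fun x =>
    ⟨algebraMap F E x.1 + (x.2 : F) • e, (g.int_iff _ _).2 ⟨x.1.2, x.2.2⟩⟩
  have hker : ∀ x y : 𝒪[F] × 𝒪[F], (Ideal.Quotient.mk (baseIdeal F E) (q x) =
      Ideal.Quotient.mk (baseIdeal F E) (q y)) ↔
      (IsLocalRing.residue 𝒪[F] x.1 = IsLocalRing.residue 𝒪[F] y.1 ∧
        IsLocalRing.residue 𝒪[F] x.2 = IsLocalRing.residue 𝒪[F] y.2) := by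
    intro x y
    rw [Ideal.Quotient.eq, mem_map_maximalIdeal_iff, ← sub_eq_zero, ← map_sub, residue_eq_zero_iff,
      ← sub_eq_zero (a := IsLocalRing.residue 𝒪[F] x.2), ← map_sub, residue_eq_zero_iff,
      ← g.int_iff]
    have : (unif F)⁻¹ • ((q x - q y : intE F E) : E) =
        algebraMap F E ((x.1 - y.1 : 𝒪[F]) / unif F) + ((x.2 - y.2 : 𝒪[F]) / unif F : F) • e := by
      change (unif F)⁻¹ • ((algebraMap F E x.1 + (x.2 : F) • e) -
        (algebraMap F E y.1 + (y.2 : F) • e)) = _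
      simp only [Algebra.smul_def, div_eq_mul_inv, map_mul, AddSubgroupClass.coe_sub, map_sub]
      ring
    rw [this]
  let f : 𝓀[F] × 𝓀[F] → intE F E ⧸ baseIdeal F E := fun c =>
    Ideal.Quotient.mk _ (q (Function.surjInv hs c.1, Function.surjInv hs c.2))
  have hf : Function.Bijective f := by
    constructor
    · intro c c' hcc
      have := (hker _ _).1 hcc
      simp only [Function.surjInv_eq hs] at this
      exact Prod.ext this.1 this.2
    · intro z
      obtain ⟨z, rfl⟩ := Ideal.Quotient.mk_surjective z
      obtain ⟨x, y, hxy⟩ := g.exists_int_rep z z.2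
      refine ⟨(IsLocalRing.residue 𝒪[F] x, IsLocalRing.residue 𝒪[F] y), ?_⟩
      have : z = q (x, y) := Subtype.ext hxy
      rw [this]
      refine (hker _ _).2 ⟨Function.surjInv_eq hs _, Function.surjInv_eq hs _⟩
  refine ⟨Finite.of_surjective f hf.2, ?_⟩
  rw [← Nat.card_congr (Equiv.ofBijective f hf), Nat.card_prod, sq]
  rfl

theorem baseIdeal_eq_span :
    baseIdeal F E = Ideal.span {algebraMap 𝒪[F] (intE F E) ⟨unif F, unif_mem F⟩} := by
  rw [baseIdeal, (IsDiscreteValuationRing.irreducible_iff_uniformizer _).1 (irreducible_unif F),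
    Ideal.map_span, Set.image_singleton]

end InertResidue

section Inert

variable {p : ℕ} [hp : Fact p.Prime] {F : Type*} [Field F] [Algebra ℚ_[p] F]
  [ValuativeRel F] [TopologicalSpace F] [IsNonarchimedeanLocalField F]
  {E : Type*} [CommRing E] [Algebra F E] {τ : E ≃ₐ[F] E}
  {V : Type*} [AddCommGroup V] [Module F V] [Module E V] [IsScalarTower F E V]
  {H : V →ₗ[E] V →ₛₗ[(τ : E →+* E)] E} {d : F} (hd : IsDifferent p d)
  (h : IsQuadInvolution τ) (hH : IsHermitian H) {Λ : Submodule (intE F E) V}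

include h hH in
theorem herm_mem_integer [CharZero F] {x : V} (hx : H x x ∈ intE F E) : herm H x ∈ 𝒪[F] := by
  have := h.nontrivial
  rw [← algebraMap_mem_intE_iff (E := E), algebraMap_herm h hH]
  exact hx

variable [ContinuousSMul ℚ_[p] F] [FiniteDimensional ℚ_[p] F]
  [Module.Finite F V] [TopologicalSpace V]
  [IsTopologicalAddGroup V] [ContinuousSMul F V] [T2Space V]
  [MeasurableSpace F] [BorelSpace F] [MeasurableSpace V] [BorelSpace V] {μ : Measure V}
  (hμ : IsSelfDualMeasure (pairingV p H) μ)

include hd h hH hμ in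
/-- The integral `∫_Λ ψ(b q(x)) dx` over a self-dual lattice at an inert place, for `v(b d) = -1`: it
is a Hermitian Gauss sum over the residue field. -/
theorem setIntegral_inert_neg_one {e : E} {t m : F} (g : IsInertGen τ e t m) (hI : IsInert F E)
    {n : ℕ} (hn : Module.finrank F V = 2 * (n + 1)) (hfg : Λ.FG)
    (hΛ : IsCompactOpen (Λ : Set V)) (hdual : dualLattice H Λ = Λ)
    (hperp : perp p H Λ.toAddSubgroup = (scal (algebraMap F E d) Λ).toAddSubgroup)
    {b : F} (hb : b ≠ 0) (hbd : ord (b * d) = -1) :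
    ∫ x in (Λ : Set V), psi p F (b * herm H x) ∂μ =
      (-(resCard F : ℂ)⁻¹) ^ (n + 1) * μ.real (Λ : Set V) := by
  have := hμ.1
  have : CharZero F := charZero_of_injective_algebraMap (algebraMap ℚ_[p] F).injective
  have hπ := unif_ne_zero F
  have hB : ∀ x ∈ Λ, ∀ y ∈ Λ, H x y ∈ intE F E := fun x hx y hy => by
    rw [← hdual] at hx; exact hx y hy
  have hq : ∀ x ∈ Λ, herm H x ∈ 𝒪[F] := fun x hx => herm_mem_integer h hH (hB x hx x hx)
  have htr : ∀ x ∈ Λ, ∀ y ∈ Λ, trForm H x y ∈ 𝒪[F] := fun x hx y hy => h.trace_mem (hB x hx y hy)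
  let κ := 𝓀[F]
  let I := baseIdeal F E
  obtain ⟨hKfin, hKcard⟩ := g.card_quotient
  have hfin : Module.Finite (intE F E) Λ := Module.Finite.iff_fg.2 hfg
  obtain ⟨K, W, _, _, _, _, _, ρ, mkW, hρ, hmk, hK, hρ0, hmk0', hsmul⟩ :=
    exists_reduction (R := intE F E) (M := Λ) I hI.2 hKfin _ baseIdeal_eq_span
  have hmk0 : ∀ x : Λ, mkW x = 0 ↔ (unif F)⁻¹ • (x : V) ∈ Λ := by
    intro x
    have hcoe : ∀ y : Λ, ((algebraMap 𝒪[F] (intE F E) ⟨unif F, unif_mem F⟩ • y : Λ) : V) =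
        unif F • (y : V) := fun y => algebraMap_smul E (unif F) (y : V)
    rw [hmk0']
    constructor
    · rintro ⟨y, rfl⟩
      rw [hcoe, inv_smul_smul₀ hπ]
      exact y.2
    · intro hx
      refine ⟨⟨_, hx⟩, Subtype.ext ?_⟩
      rw [hcoe, smul_inv_smul₀ hπ]
  let res := IsLocalRing.residue 𝒪[F]
  let Q₀ : Λ → κ := fun x => res ⟨herm H (x : V), hq x x.2⟩
  -- the form on the reduction
  have hQ₀ : ∀ x y : Λ, mkW x = mkW y → Q₀ x = Q₀ y := by
    intro x y hxy
    have h1 : mkW (x - y) = 0 := (map_sub mkW x y).trans (sub_eq_zero.2 hxy)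
    have h2 := (hmk0 _).1 h1
    set z : V := (unif F)⁻¹ • ((x - y : Λ) : V) with hz
    have h3 : (x : V) = y + unif F • z := by
      rw [hz, smul_inv_smul₀ hπ]; simp
    have h4 : herm H (x : V) = herm H (y : V) +
        (unif F * (unif F * herm H z + trForm H (y : V) z)) := by
      rw [h3, herm_add h hH, map_smul (trForm H (y : V)), ← algebraMap_smul E (unif F) z,
        herm_smul h hH, h.norm_algebraMap, smul_eq_mul]
      ring
    change res _ = res _
    rw [← sub_eq_zero, ← map_sub, residue_eq_zero_iff]
    change (herm H (x : V) - herm H (y : V)) / unif F ∈ 𝒪[F]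
    rw [h4, add_sub_cancel_left, mul_div_cancel_left₀ _ hπ]
    exact add_mem (mul_mem (unif_mem F) (hq z h2)) (htr _ y.2 _ h2)
  obtain ⟨Q, hQ⟩ : ∃ Q : W → κ, ∀ x : Λ, Q (mkW x) = Q₀ x :=
    ⟨fun w => Q₀ (Function.surjInv hmk w), fun x => hQ₀ _ _ (Function.surjInv_eq hmk _)⟩
  have hmkadd : ∀ x y : Λ, mkW x + mkW y = mkW (x + y) := fun x y => (map_add mkW x y).symm
  have hQadd : ∀ x y : Λ, Q (mkW x + mkW y) - Q (mkW x) - Q (mkW y) =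
      res ⟨trForm H (x : V) y, htr x x.2 y y.2⟩ := by
    intro x y
    rw [hmkadd, hQ, hQ, hQ, ← map_sub, ← map_sub]
    refine congrArg res (Subtype.ext ?_)
    change herm H ((x : V) + y) - herm H (x : V) - herm H (y : V) = _
    rw [herm_add h hH]; ring
  have hQsmul : ∀ (z : intE F E) (x : Λ), Q (ρ z • mkW x) =
      res ⟨Algebra.norm F (z : E), h.norm_mem z.2⟩ * Q (mkW x) := by
    intro z x
    rw [← hsmul, hQ, hQ, ← map_mul]
    refine congrArg res (Subtype.ext ?_)
    exact herm_smul h hH (z : E) (x : V)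
  obtain ⟨χ, hχ1, hχ⟩ := hd.exists_residueChar hb hbd
  -- the number of elements of the reduction
  let φ : Λ.toAddSubgroup →+ W := mkW
  let u : Eˣ := Units.map (algebraMap F E : F →* E) (Units.mk0 (unif F)⁻¹ (inv_ne_zero hπ))
  have hu : (u : E) = algebraMap F E (unif F)⁻¹ := rfl
  let L : Submodule (intE F E) V := scal (u : E) Λ
  have hL : IsCompactOpen (L : Set V) := isCompactOpen_preimage_smul (p := p) F hΛ u
  have hLmem : ∀ x : V, x ∈ L ↔ (unif F)⁻¹ • x ∈ Λ := fun x => by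
    rw [mem_scal, hu, algebraMap_smul]
  have hLΛ : L.toAddSubgroup ≤ Λ.toAddSubgroup := fun x hx => by
    have := base_smul_mem_lattice (unif_mem F) ((hLmem x).1 hx)
    rwa [smul_inv_smul₀ hπ] at this
  have hker : ∀ x : Λ.toAddSubgroup, φ x = 0 ↔ (x : V) ∈ L.toAddSubgroup := fun x =>
    (hmk0 x).trans (hLmem x).symm
  have hvolL : μ.real (L : Set V) = ((resCard F : ℝ) ^ (2 * (n + 1)))⁻¹ * μ.real (Λ : Set V) := by
    rw [measureReal_scal hd h hH hμ hn hΛ, hu, h.norm_algebraMap, sq, absV_mul, absV_inv,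
      absV_eq hπ, ord_unif, zpow_neg_one, inv_inv, pow_mul, sq]
  have hvol := measureReal_fiber μ (M := Λ.toAddSubgroup) hΛ.2 φ hmk (K := L.toAddSubgroup) hL.1
    hker hLΛ
  have hvpos := measureReal_pos μ (M := Λ.toAddSubgroup) hΛ.1 hΛ.2
  have hW : Fintype.card W = resCard F ^ (2 * (n + 1)) := by
    have hN := resCard_pos F
    change μ.real (Λ : Set V) = μ.real (L : Set V) * _ at hvol
    change 0 < μ.real (Λ : Set V) at hvpos
    rw [hvolL] at hvol
    have : (Fintype.card W : ℝ) = (resCard F : ℝ) ^ (2 * (n + 1)) := by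
      field_simp at hvol
      linarith
    exact_mod_cast this
  have hsum := sum_hermitian_eq (κ := κ) (K := K) (W := W) (k := n + 1) card_residueField
    (hK.trans hKcard) hW χ hχ1 Q ?_ ?_ ?_ ?_ ?_
  · have hfib : ∀ x : Λ.toAddSubgroup, psi p F (b * herm H (x : V)) = χ (Q (φ x)) := fun x =>
      ((congrArg χ (hQ x)).trans (hχ ⟨herm H (x : V), hq x x.2⟩)).symm
    have hint := setIntegral_fiber μ (M := Λ.toAddSubgroup) hΛ.2 φ hmk (K := L.toAddSubgroup) hL.1
      hker hLΛ (fun x => psi p F (b * herm H x)) (continuous_psi_herm hd h hH b) (fun w => χ (Q w))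
      hfib
    refine hint.trans ?_
    rw [hsum]
    change ((μ.real (L : Set V) : ℝ) : ℂ) * _ = _
    have hN : (resCard F : ℂ) ≠ 0 := by exact_mod_cast (one_lt_resCard F).ne_bot
    rw [hvolL]
    push_cast
    have hpow : (-(resCard F : ℂ)⁻¹) ^ (n + 1) =
        ((resCard F : ℂ) ^ (2 * (n + 1)))⁻¹ * (-(resCard F : ℂ)) ^ (n + 1) := by
      rw [pow_mul, ← inv_pow, ← mul_pow]
      congr 1
      field_simp
    rw [hpow]
    ring
  · intro c hc
    obtain ⟨c, rfl⟩ := IsLocalRing.residue_surjective c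
    obtain ⟨hc0, hco⟩ := (residue_ne_zero_iff c).1 hc
    obtain ⟨z, hz, hzn⟩ := g.exists_norm_eq h hc0 hco
    have hz0 : ρ ⟨z, hz⟩ ≠ 0 := by
      intro h0
      rw [hρ0, mem_map_maximalIdeal_iff] at h0
      have h1 := h.norm_mem h0
      rw [Algebra.smul_def, map_mul, h.norm_algebraMap, hzn,
        mul_mem_integer_iff (pow_ne_zero _ (inv_ne_zero hπ)) hc0, ord_pow (inv_ne_zero hπ),
        ord_inv hπ, ord_unif, hco] at h1
      norm_num at h1
    refine ⟨Units.mk0 _ hz0, fun w => ?_⟩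
    obtain ⟨x, rfl⟩ := hmk w
    rw [Units.smul_mk0, hQsmul]
    have hc' : (⟨Algebra.norm F z, h.norm_mem hz⟩ : 𝒪[F]) = c := Subtype.ext hzn
    rw [hc']
  · intro z w hw
    obtain ⟨x, rfl⟩ := hmk w
    obtain ⟨y, hy⟩ := hρ (z : K)
    rw [Units.smul_def, ← hy, hQsmul, hw, mul_zero]
  · rw [← map_zero mkW, hQ]
    change res _ = 0
    rw [residue_eq_zero_iff]
    simp [herm]
  · intro w x y
    obtain ⟨w, rfl⟩ := hmk w
    obtain ⟨x, rfl⟩ := hmk x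
    obtain ⟨y, rfl⟩ := hmk y
    rw [hQadd, hQadd, hmkadd x y, hQadd, ← map_add]
    refine congrArg res (Subtype.ext ?_)
    exact (map_add (trForm H (w : V)) _ _)
  · intro w hw
    obtain ⟨x, rfl⟩ := hmk w
    by_contra! hcon
    apply hw
    refine (hmk0 x).2 ?_
    have h1 : b • (x : V) ∈ perp p H Λ.toAddSubgroup := by
      intro y hy
      have := hcon (mkW ⟨y, hy⟩)
      rw [hQadd, hχ] at this
      rw [map_smul (trForm H), LinearMap.smul_apply, smul_eq_mul]
      exact this
    rw [hperp] at h1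
    have h2 : d • b • (x : V) ∈ Λ := by
      have h1' : algebraMap F E d • b • (x : V) ∈ Λ := h1
      rwa [algebraMap_smul] at h1'
    rw [smul_smul] at h2
    have h3 : (d * b * unif F)⁻¹ ∈ 𝒪[F] := by
      have : d * b * unif F ≠ 0 := mul_ne_zero (mul_ne_zero hd.1 hb) hπ
      rw [mem_integer_iff_ord (inv_ne_zero this), ord_inv this,
        ord_mul (mul_ne_zero hd.1 hb) hπ, mul_comm d, hbd, ord_unif]
      norm_num
    have h4 := base_smul_mem_lattice h3 h2
    rw [smul_smul] at h4
    convert h4 using 2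
    have := hd.1
    field_simp

end Inert

/-! ### Integrality of the different -/

section Different

variable {p : ℕ} [hp : Fact p.Prime] {F : Type*} [Field F] [Algebra ℚ_[p] F]
  [ValuativeRel F] [TopologicalSpace F] [IsNonarchimedeanLocalField F] [ContinuousSMul ℚ_[p] F]
  [FiniteDimensional ℚ_[p] F]

theorem algebraMap_padicInt_mem_integer (z : ℤ_[p]) : algebraMap ℚ_[p] F z ∈ 𝒪[F] := by
  have hc : Continuous fun z : ℤ_[p] => algebraMap ℚ_[p] F z :=
    (continuous_algebraMap ℚ_[p] F).comp continuous_subtype_val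
  have hcl : IsClosed {z : ℤ_[p] | algebraMap ℚ_[p] F z ∈ 𝒪[F]} :=
    isCompact_integer.isClosed.preimage hc
  refine hcl.closure_subset_iff.2 ?_ (PadicInt.denseRange_natCast z)
  rintro _ ⟨k, rfl⟩
  change algebraMap ℚ_[p] F ((k : ℤ_[p]) : ℚ_[p]) ∈ 𝒪[F]
  rw [PadicInt.coe_natCast, map_natCast]
  exact natCast_mem _ k

/-- The ring of integers is a finite module over `ℤ_p`, being compact, so its elements have integral
trace. -/
theorem norm_trace_le_one {y : F} (hy : y ∈ 𝒪[F]) : ‖Algebra.trace ℚ_[p] F y‖ ≤ 1 := by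
  let alg : Algebra ℤ_[p] F := ((algebraMap ℚ_[p] F).comp (algebraMap ℤ_[p] ℚ_[p])).toAlgebra
  have htower : IsScalarTower ℤ_[p] ℚ_[p] F := IsScalarTower.of_algebraMap_eq fun _ => rfl
  have hsm : ∀ (z : ℤ_[p]) (x : F), z • x = algebraMap ℚ_[p] F z * x := fun z x =>
    Algebra.smul_def z x
  let O : Submodule ℤ_[p] F :=
    { carrier := 𝒪[F]
      zero_mem' := zero_mem 𝒪[F]
      add_mem' := fun hx hx' => add_mem (S := Subring F) hx hx'
      smul_mem' := fun z x hx => by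
        rw [hsm]; exact mul_mem (algebraMap_padicInt_mem_integer z) hx }
  let b := Module.finBasis ℚ_[p] F
  have hcont : ∀ i, Continuous (b.coord i) := fun i =>
    (b.coord i).continuous_of_finiteDimensional
  have hbdd : ∀ i, ∃ C : ℝ, ∀ x ∈ 𝒪[F], ‖b.coord i x‖ ≤ C := fun i =>
    isCompact_integer.exists_bound_of_continuousOn (hcont i).continuousOn
  choose C hC using hbdd
  obtain ⟨k, hk⟩ : ∃ k : ℕ, ∀ i, C i ≤ (p : ℝ) ^ k := by
    obtain ⟨M, hM⟩ := (Set.finite_range C).bddAbove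
    obtain ⟨k, hk⟩ := pow_unbounded_of_one_lt M (show (1 : ℝ) < p by exact_mod_cast hp.out.one_lt)
    exact ⟨k, fun i => (hM ⟨i, rfl⟩).trans hk.le⟩
  have hp0 : (p : ℚ_[p]) ≠ 0 := by exact_mod_cast hp.out.ne_zero
  have hp0' : (0 : ℝ) < p := by exact_mod_cast hp.out.pos
  have hle : O ≤ Submodule.span ℤ_[p] (Set.range fun i => ((p : ℚ_[p]) ^ k)⁻¹ • b i) := by
    intro x hx
    rw [Submodule.mem_span_range_iff_exists_fun]
    have hn : ∀ i, ‖(p : ℚ_[p]) ^ k * b.coord i x‖ ≤ 1 := fun i => by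
      rw [norm_mul, norm_pow, Padic.norm_p, inv_pow, ← div_eq_inv_mul, div_le_one (by positivity)]
      exact (hC i x hx).trans (hk i)
    let c : Fin (Module.finrank ℚ_[p] F) → ℤ_[p] := fun i => ⟨_, hn i⟩
    refine ⟨c, ?_⟩
    conv_rhs => rw [← b.sum_repr x]
    refine Finset.sum_congr rfl fun i _ => ?_
    rw [hsm, ← Algebra.smul_def, smul_smul]
    change ((p : ℚ_[p]) ^ k * b.coord i x * ((p : ℚ_[p]) ^ k)⁻¹) • b i = _
    rw [mul_right_comm, mul_inv_cancel₀ (pow_ne_zero _ hp0), one_mul, Module.Basis.coord_apply]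
  have hfgN : (Submodule.span ℤ_[p] (Set.range fun i => ((p : ℚ_[p]) ^ k)⁻¹ • b i)).FG :=
    Submodule.fg_span (Set.finite_range _)
  have hO : O.FG := Submodule.FG.of_le hfgN hle
  have hint : IsIntegral ℤ_[p] y :=
    isIntegral_of_smul_mem_submodule (N := O) (fun h0 => one_ne_zero (α := F) (by
      have : (1 : F) ∈ O := one_mem 𝒪[F]
      rwa [h0, Submodule.mem_bot] at this)) hO y fun x hx => mul_mem (S := Subring F) hy hx
  have h1 : IsIntegral ℤ_[p] (Algebra.trace ℚ_[p] F y) := Algebra.isIntegral_trace hint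
  obtain ⟨z, hz⟩ := IsIntegrallyClosed.isIntegral_iff.1 h1
  rw [← hz]
  exact z.2

theorem IsDifferent.mem_integer {d : F} (hd : IsDifferent p d) : d ∈ 𝒪[F] := by
  have := (hd.2 1).2 fun y hy => by rw [one_mul]; exact norm_trace_le_one hy
  rwa [one_mul] at this

end Different

/-! ### Quadratic exponential integrals over unimodular lattices -/

section Unramified

variable {p : ℕ} [hp : Fact p.Prime] {F : Type*} [Field F] [Algebra ℚ_[p] F]
  [ValuativeRel F] [TopologicalSpace F] [IsNonarchimedeanLocalField F]
  {E : Type*} [CommRing E] [Algebra F E] {τ : E ≃ₐ[F] E}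
  {V : Type*} [AddCommGroup V] [Module F V] [Module E V] [IsScalarTower F E V]
  {H : V →ₗ[E] V →ₛₗ[(τ : E →+* E)] E} {d : F} (hd : IsDifferent p d)
  (h : IsQuadInvolution τ) (hH : IsHermitian H) {Λ : Submodule (intE F E) V}
  [ContinuousSMul ℚ_[p] F] [FiniteDimensional ℚ_[p] F]
  [Module.Finite F V] [TopologicalSpace V]
  [IsTopologicalAddGroup V] [ContinuousSMul F V] [T2Space V]
  [MeasurableSpace F] [BorelSpace F] [MeasurableSpace V] [BorelSpace V] {μ : Measure V}
  (hμ : IsSelfDualMeasure (pairingV p H) μ)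
  (hΛ : IsCompactOpen (Λ : Set V)) (hdual : dualLattice H Λ = Λ)
  (hperp : perp p H Λ.toAddSubgroup = (scal (algebraMap F E d) Λ).toAddSubgroup)

include hd hΛ in
theorem setIntegral_psi_herm_eq_measure {b : F} (hb : ∀ x ∈ Λ, b * herm H x * d ∈ 𝒪[F]) :
    ∫ x in (Λ : Set V), psi p F (b * herm H x) ∂μ = μ.real (Λ : Set V) := by
  rw [setIntegral_congr_fun hΛ.1.measurableSet (g := fun _ => (1 : ℂ))
    (fun x hx => hd.psi_eq_one (hb x hx)), setIntegral_const]
  simp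

include h hH hdual in
theorem herm_mem_integer_of_selfDual [CharZero F] {x : V} (hx : x ∈ Λ) : herm H x ∈ 𝒪[F] :=
  herm_mem_integer h hH (by rw [← hdual] at hx; exact hx x (hdual ▸ hx))

variable (F) in
/-- The scalar `c ∈ F^×` as a unit of `E`. -/
def baseUnit (E : Type*) [CommRing E] [Algebra F E] {c : F} (hc : c ≠ 0) : Eˣ :=
  Units.map (algebraMap F E : F →* E) (Units.mk0 c hc)

theorem coe_baseUnit {c : F} (hc : c ≠ 0) : (baseUnit F E hc : E) = algebraMap F E c := rfl

include h hH hd hμ hΛ hdual hperp in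
/-- If `Nm(w) b d` is integral, only the vectors `x ∈ Λ` with `b d \bar w x ∈ Λ` contribute to
`∫_Λ ψ(b q(x)) dx`. -/
theorem setIntegral_unramified_reduce {w : E} (hw : w ∈ intE F E) {b : F}
    (hwb : Algebra.norm F w * (b * d) ∈ 𝒪[F]) :
    ∫ x in (Λ : Set V), psi p F (b * herm H x) ∂μ =
      ∫ x in ((Λ ⊓ scal (algebraMap F E (b * d) * τ w) Λ : Submodule (intE F E) V) : Set V),
        psi p F (b * herm H x) ∂μ := by
  have := hμ.1
  have : CharZero F := charZero_of_injective_algebraMap (algebraMap ℚ_[p] F).injective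
  have hP : IsCompactOpen ((scal (algebraMap F E d) Λ).toAddSubgroup : Set V) :=
    isCompactOpen_preimage_smul (p := p) F hΛ (baseUnit F E hd.1)
  refine setIntegral_psi_herm hd h hH μ (M := Λ.toAddSubgroup)
    (L := Λ.toAddSubgroup.map (DistribSMul.toAddMonoidHom V w)) hΛ hP ?_ hΛ.1 hperp.ge ?_
    (T := (scal (algebraMap F E (b * d) * τ w) Λ).toAddSubgroup)
    (hΛ.1.preimage (continuous_smul_E (p := p) F _)).measurableSet ?_
  · rintro _ ⟨x, hx, rfl⟩
    exact smul_mem_lattice hw hx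
  · rintro _ ⟨x, hx, rfl⟩
    apply hd.psi_eq_one
    change b * herm H (w • x) * d ∈ 𝒪[F]
    rw [herm_smul h hH]
    convert mul_mem hwb (herm_mem_integer_of_selfDual h hH hdual hx) using 1
    ring
  · intro x hx
    have h1 : ∀ y : V, b * trForm H x (w • y) = trForm H ((algebraMap F E b * τ w) • x) y := by
      intro y
      rw [trForm_smul_left h hH, map_mul, h.invol, AlgEquiv.commutes, mul_smul, algebraMap_smul,
        map_smul (trForm H x), smul_eq_mul]
    have h2 : x ∈ (scal (algebraMap F E (b * d) * τ w) Λ).toAddSubgroup ↔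
        (algebraMap F E b * τ w) • x ∈ perp p H Λ.toAddSubgroup := by
      rw [hperp]
      change _ • x ∈ Λ ↔ algebraMap F E d • _ • x ∈ Λ
      rw [smul_smul, map_mul, ← mul_assoc, mul_comm (algebraMap F E b)]
    rw [h2, mem_perp]
    constructor
    · rintro hx' _ ⟨y, hy, rfl⟩
      exact (congrArg (psi p F) (h1 y)).trans (hx' y hy)
    · intro hx' y hy
      rw [← h1]
      exact hx' _ ⟨y, hy, rfl⟩

include h hH hd hμ hΛ hdual hperp in
/-- The reduction for `w = π^j`: the contributing vectors form a multiple of `Λ`, and rescaling it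
to `Λ` brings `b` to an element of larger valuation. -/
theorem setIntegral_unramified_scale {n : ℕ} (hn : Module.finrank F V = 2 * (n + 1)) {b : F}
    (hb : b ≠ 0) (j : ℕ) (hj : 0 ≤ 2 * j + ord (b * d)) (hj' : j + ord (b * d) ≤ 0) :
    ∫ x in (Λ : Set V), psi p F (b * herm H x) ∂μ =
      ((resCard F : ℂ)⁻¹ ^ (-(2 * (j + ord (b * d)))).toNat) ^ (n + 1) *
      ∫ x in (Λ : Set V), psi p F (b / (unif F ^ j * (b * d)) ^ 2 * herm H x) ∂μ := by
  have hπ := unif_ne_zero F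
  have hbd : b * d ≠ 0 := mul_ne_zero hb hd.1
  set c : F := unif F ^ j * (b * d)
  have hc : c ≠ 0 := mul_ne_zero (pow_ne_zero _ hπ) hbd
  have hco : ord c = j + ord (b * d) := by
    rw [ord_mul (pow_ne_zero _ hπ) hbd, ord_pow hπ, ord_unif, mul_one]
  have hci : c⁻¹ ∈ 𝒪[F] := by
    rw [mem_integer_iff_ord (inv_ne_zero hc), ord_inv hc, hco]; omega
  rw [setIntegral_unramified_reduce hd h hH hμ hΛ hdual hperp
    (w := algebraMap F E (unif F ^ j)) (algebraMap_mem_intE (pow_mem (unif_mem F) j)) (b := b) (by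
      rw [h.norm_algebraMap, mul_mem_integer_iff (pow_ne_zero _ (pow_ne_zero _ hπ)) hbd,
        ord_pow (pow_ne_zero _ hπ), ord_pow hπ, ord_unif]
      push_cast
      omega)]
  have hset : Λ ⊓ scal (algebraMap F E (b * d) * τ (algebraMap F E (unif F ^ j))) Λ =
      scal (baseUnit F E hc : E) Λ := by
    rw [AlgEquiv.commutes, ← map_mul, mul_comm, coe_baseUnit, inf_eq_right]
    intro x hx
    rw [mem_scal, algebraMap_smul] at hx
    have := base_smul_mem_lattice hci hx
    rwa [inv_smul_smul₀ hc] at this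
  rw [hset, setIntegral_scal hd h hH hμ hn hΛ, coe_baseUnit, h.norm_algebraMap]
  congr 1
  obtain ⟨i, hi⟩ := Int.eq_ofNat_of_zero_le (a := -(j + ord (b * d))) (by omega)
  have hi2 : (-(2 * (j + ord (b * d)))).toNat = i * 2 := by omega
  rw [absV_eq (pow_ne_zero _ hc), ord_pow hc, hco, hi2,
    show -(((2 : ℕ) : ℤ) * (j + ord (b * d))) = ((i * 2 : ℕ) : ℤ) by push_cast; omega, zpow_natCast]
  push_cast
  rw [inv_pow, inv_pow]

include h hH hd hμ hΛ hdual hperp in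
/-- For `k` even the integral rescales to `v(b d) = 0`, for `k` odd to the Gauss sum `v(b d) = -1`. -/
theorem setIntegral_inert {e : E} {t m : F} (g : IsInertGen τ e t m) (hI : IsInert F E)
    {n : ℕ} (hn : Module.finrank F V = 2 * (n + 1)) (hfg : Λ.FG) {b : F} (hb : b ≠ 0) (k : ℕ)
    (hk : ord (b * d) = -k) :
    ∫ x in (Λ : Set V), psi p F (b * herm H x) ∂μ =
      ((-(resCard F : ℂ)⁻¹) ^ k) ^ (n + 1) * μ.real (Λ : Set V) := by
  have : CharZero F := charZero_of_injective_algebraMap (algebraMap ℚ_[p] F).injective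
  have hπ := unif_ne_zero F
  have hbd : b * d ≠ 0 := mul_ne_zero hb hd.1
  have hord : ∀ j : ℕ, b / (unif F ^ j * (b * d)) ^ 2 ≠ 0 ∧
      ord (b / (unif F ^ j * (b * d)) ^ 2 * d) = k - 2 * j := by
    intro j
    have hc : unif F ^ j * (b * d) ≠ 0 := mul_ne_zero (pow_ne_zero _ hπ) hbd
    refine ⟨div_ne_zero hb (pow_ne_zero _ hc), ?_⟩
    rw [div_mul_eq_mul_div, ord_div hbd (pow_ne_zero _ hc), ord_pow hc,
      ord_mul (pow_ne_zero _ hπ) hbd, ord_pow hπ, ord_unif, hk]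
    push_cast
    ring
  obtain ⟨j, rfl | rfl⟩ := k.even_or_odd'
  · obtain ⟨h0, h1⟩ := hord j
    rw [setIntegral_unramified_scale hd h hH hμ hΛ hdual hperp hn hb j (by omega) (by omega),
      setIntegral_psi_herm_eq_measure hd hΛ]
    · rw [show (-(2 * (j + ord (b * d)))).toNat = 2 * j by omega, (even_two_mul j).neg_pow]
    · intro x hx
      rw [mul_right_comm]
      refine mul_mem ?_ (herm_mem_integer_of_selfDual h hH hdual hx)
      rw [mem_integer_iff_ord (mul_ne_zero h0 hd.1), h1]
      push_cast
      omega
  · obtain ⟨h0, h1⟩ := hord (j + 1)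
    rw [setIntegral_unramified_scale hd h hH hμ hΛ hdual hperp hn hb (j + 1) (by omega)
      (by omega), setIntegral_inert_neg_one hd h hH hμ g hI hn hfg hΛ hdual hperp h0
        (by rw [h1]; push_cast; ring)]
    rw [show (-(2 * (((j + 1 : ℕ) : ℤ) + ord (b * d)))).toNat = 2 * j by omega, ← mul_assoc,
      ← mul_pow, pow_succ (-_) (2 * j), (even_two_mul j).neg_pow]

include h hH hd hμ hΛ hdual hperp in
/-- The reduction with the idempotent `w = e`, of norm `0`: the contributing vectors form `z⁻¹ Λ` with
`Nm(z) = b d`, and on it `ψ(b q)` is trivial after rescaling to `Λ`. -/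
theorem setIntegral_split {e : E} (g : IsIntGen τ e 1 0)
    {n : ℕ} (hn : Module.finrank F V = 2 * (n + 1)) {b : F} (hb : b ≠ 0) (k : ℕ)
    (hk : ord (b * d) = -k) :
    ∫ x in (Λ : Set V), psi p F (b * herm H x) ∂μ =
      ((resCard F : ℂ)⁻¹ ^ k) ^ (n + 1) * μ.real (Λ : Set V) := by
  have : CharZero F := charZero_of_injective_algebraMap (algebraMap ℚ_[p] F).injective
  have hbd : b * d ≠ 0 := mul_ne_zero hb hd.1
  have hbi : (b * d)⁻¹ ∈ 𝒪[F] := by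
    rw [mem_integer_iff_ord (inv_ne_zero hbd), ord_inv hbd, hk]; omega
  have hee : e * e = e := by rw [g.sq, map_one, map_zero, one_mul, sub_zero]
  have hte : τ e = 1 - e := by rw [g.conj, map_one]
  -- `b d` is the norm of `z`
  let z : E := algebraMap F E (b * d) + (1 - b * d) • e
  have hzn : Algebra.norm F z = b * d := by rw [g.norm_add h]; ring
  obtain ⟨u, hu⟩ : IsUnit z := by rw [h.isUnit_iff, hzn]; exact hbd
  have hez : e * z = e := by
    simp only [z, Algebra.smul_def, map_sub, map_one]
    linear_combination (1 - algebraMap F E (b * d)) * hee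
  have hez' : (1 - e) * z = algebraMap F E (b * d) * (1 - e) := by
    simp only [z, Algebra.smul_def, map_sub, map_one]
    linear_combination -(1 - algebraMap F E (b * d)) * hee
  have he1 : 1 - e ∈ intE F E := sub_mem (one_mem _) g.mem
  rw [setIntegral_unramified_reduce hd h hH hμ hΛ hdual hperp (w := e) g.mem (b := b) (by
    rw [g.norm_gen h, zero_mul]; exact zero_mem _)]
  have hset : Λ ⊓ scal (algebraMap F E (b * d) * τ e) Λ = scal (u : E) Λ := by
    ext x
    rw [Submodule.mem_inf, mem_scal, mem_scal, hu, hte]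
    have hz : z = e + algebraMap F E (b * d) * (1 - e) := by
      linear_combination hez + hez'
    constructor
    · rintro ⟨h1, h2⟩
      rw [hz, add_smul]
      exact add_mem (smul_mem_lattice g.mem h1) h2
    · intro h1
      have h2 := smul_mem_lattice g.mem h1
      rw [smul_smul, hez] at h2
      have h3 := smul_mem_lattice he1 h1
      rw [smul_smul, hez'] at h3
      refine ⟨?_, h3⟩
      have h4 := base_smul_mem_lattice hbi h3
      rw [mul_smul, algebraMap_smul, inv_smul_smul₀ hbd] at h4
      have := add_mem h2 h4
      rwa [← add_smul, add_sub_cancel, one_smul] at this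
  rw [hset, setIntegral_scal hd h hH hμ hn hΛ, hu, hzn, setIntegral_psi_herm_eq_measure hd hΛ]
  · congr 1
    rw [absV_eq hbd, hk, neg_neg, zpow_natCast]
    push_cast
    rw [inv_pow, inv_pow]
  · intro x hx
    have : b / (b * d) * herm H x * d = herm H x := by
      have := hd.1
      field_simp
    rw [this]
    exact herm_mem_integer_of_selfDual h hH hdual hx

include h hH hd hμ hΛ hperp in
theorem measureReal_selfDual {n : ℕ} (hn : Module.finrank F V = 2 * (n + 1)) :
    μ.real (Λ : Set V) = absV d ^ (n + 1) := by
  have := hμ.1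
  have h1 := measureReal_mul_perp hd h hH hμ (S := Λ.toAddSubgroup) hΛ
  rw [hperp] at h1
  change μ.real (Λ : Set V) * μ.real (scal (baseUnit F E hd.1 : E) Λ : Set V) = 1 at h1
  rw [measureReal_scal hd h hH hμ hn hΛ, coe_baseUnit, h.norm_algebraMap, sq, absV_mul] at h1
  have hdp := absV_pos hd.1
  have h2 : μ.real (Λ : Set V) * μ.real (Λ : Set V) = absV d ^ (n + 1) * absV d ^ (n + 1) := by
    rw [← mul_pow]
    field_simp at h1
    rw [← sq, ← sq, h1]
  exact (mul_self_inj measureReal_nonneg (by positivity)).1 h2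

include h hH hd hμ hΛ hdual hperp in
/-- The Weil index is the integral of `ψ(q)` over the annihilator `d⁻¹ Λ` of `Λ`. -/
theorem weilIndex_unramified {n : ℕ} (hn : Module.finrank F V = 2 * (n + 1)) {ε : ℂ}
    (hε : ∀ (b : F) (k : ℕ), b ≠ 0 → ord (b * d) = -k →
      ∫ x in (Λ : Set V), psi p F (b * herm H x) ∂μ =
        ((ε * (resCard F : ℂ)⁻¹) ^ k) ^ (n + 1) * μ.real (Λ : Set V)) :
    weilIndex p H μ = (ε ^ ord d) ^ (n + 1) := by
  have := hμ.1
  have : CharZero F := charZero_of_injective_algebraMap (algebraMap ℚ_[p] F).injective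
  have hdO := hd.mem_integer
  have hP : IsCompactOpen ((scal (algebraMap F E d) Λ).toAddSubgroup : Set V) :=
    isCompactOpen_preimage_smul (p := p) F hΛ (baseUnit F E hd.1)
  rw [weilIndex_eq hd h hH μ (M₀ := Λ.toAddSubgroup) hΛ hP hperp fun x hx =>
    hd.psi_eq_one (mul_mem (herm_mem_integer_of_selfDual h hH hdual hx) hdO)]
  change ∫ x in (scal (baseUnit F E hd.1 : E) Λ : Set V), _ ∂μ = _
  have h1 := setIntegral_scal hd h hH hμ hn hΛ (baseUnit F E hd.1) 1
  simp only [one_mul] at h1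
  obtain ⟨k, hk⟩ := Int.eq_ofNat_of_zero_le (ord_nonneg hdO)
  have hd0 := hd.1
  rw [h1, coe_baseUnit, h.norm_algebraMap, hε _ k (one_div_ne_zero (pow_ne_zero 2 hd0)) (by
    rw [show 1 / d ^ 2 * d = d⁻¹ by field_simp, ord_inv hd0, hk]),
    measureReal_selfDual hd h hH hμ hΛ hperp hn, hk]
  have hN : (resCard F : ℂ) ≠ 0 := by exact_mod_cast (one_lt_resCard F).ne_bot
  have hab : ((absV d : ℝ) : ℂ) = (resCard F : ℂ)⁻¹ ^ k := by
    rw [absV_eq hd0, hk]; push_cast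
    rw [zpow_neg, zpow_natCast, inv_pow]
  rw [sq, absV_mul]
  push_cast
  rw [hab, zpow_natCast]
  have hA : (resCard F : ℂ)⁻¹ ^ k ≠ 0 := pow_ne_zero _ (inv_ne_zero hN)
  rw [mul_pow ε]
  set A := (resCard F : ℂ)⁻¹ ^ k
  have hA2 : (A * A)⁻¹ * (ε ^ k * A * A) = ε ^ k := by field_simp
  calc _ = ((A * A)⁻¹ * (ε ^ k * A * A)) ^ (n + 1) := by
        rw [mul_pow (A * A)⁻¹, mul_pow (ε ^ k * A) A, inv_pow]
    _ = _ := by rw [hA2]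

end Unramified

/-! ### Quadratic Gauss sums -/

section QuadraticGauss

variable {κ : Type*} [Field κ] [Fintype κ] [DecidableEq κ]

variable (κ) in
/-- The quadratic character of a finite field with complex values. -/
def quadCharC : MulChar κ ℂ := (quadraticChar κ).ringHomComp (Int.castRingHom ℂ)

theorem quadCharC_apply (x : κ) : quadCharC κ x = ((quadraticChar κ x : ℤ) : ℂ) := rfl

theorem quadCharC_ne_one (hκ : ringChar κ ≠ 2) : quadCharC κ ≠ 1 :=
  (MulChar.ringHomComp_ne_one_iff (RingHom.injective_int _)).2 (quadraticChar_ne_one hκ)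

theorem quadCharC_isQuadratic : (quadCharC κ).IsQuadratic :=
  MulChar.IsQuadratic.comp (quadraticChar_isQuadratic κ) _

theorem quadCharC_mul_self {x : κ} (hx : x ≠ 0) : quadCharC κ x * quadCharC κ x = 1 := by
  rw [quadCharC_apply, ← Int.cast_mul, ← sq, quadraticChar_sq_one hx, Int.cast_one]

theorem sum_addChar_mul_sq (hκ : ringChar κ ≠ 2) {χ : AddChar κ ℂ} (hχ : χ ≠ 1) {c : κ}
    (hc : c ≠ 0) : ∑ w, χ (c * w ^ 2) = quadCharC κ c * gaussSum (quadCharC κ) χ := by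
  have hprim : χ.IsPrimitive := AddChar.IsPrimitive.of_ne_one hχ
  have h1 : ∑ w, χ (c * w ^ 2) = ∑ y, (quadCharC κ y + 1) * χ (c * y) := by
    rw [← Finset.sum_fiberwise (s := Finset.univ) (g := fun w : κ => w ^ 2)]
    refine Finset.sum_congr rfl fun y _ => ?_
    rw [Finset.sum_congr rfl (g := fun _ => χ (c * y)) fun w hw => by
      rw [(Finset.mem_filter.1 hw).2], Finset.sum_const, nsmul_eq_mul]
    congr 1
    have h2 := quadraticChar_card_sqrts hκ y
    rw [quadCharC_apply]
    have h3 : ({x | x ^ 2 = y} : Set κ).toFinset = Finset.univ.filter fun w : κ => w ^ 2 = y := by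
      ext; simp
    rw [h3] at h2
    exact_mod_cast h2
  have h2 : ∑ y, χ (c * y) = 0 := by
    have := AddChar.sum_mulShift c hprim
    rw [if_neg hc, Nat.cast_zero] at this
    rw [← this]
    exact Finset.sum_congr rfl fun y _ => by rw [mul_comm]
  rw [h1]
  simp only [add_mul, one_mul, Finset.sum_add_distrib, h2, add_zero]
  rw [gaussSum, Finset.mul_sum]
  symm
  rw [← Equiv.sum_comp (Equiv.mulLeft₀ c hc)]
  refine Finset.sum_congr rfl fun y _ => ?_
  change quadCharC κ c * (quadCharC κ (c * y) * χ (c * y)) = _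
  rw [map_mul, ← mul_assoc, ← mul_assoc, quadCharC_mul_self hc, one_mul]

end QuadraticGauss

/-! ### Quadratic exponential integrals at ramified places -/

section Ramified

variable {p : ℕ} [hp : Fact p.Prime] {F : Type*} [Field F] [Algebra ℚ_[p] F]
  [ValuativeRel F] [TopologicalSpace F] [IsNonarchimedeanLocalField F]
  {E : Type*} [CommRing E] [Algebra F E] {τ : E ≃ₐ[F] E}
  {V : Type*} [AddCommGroup V] [Module F V] [Module E V] [IsScalarTower F E V]
  {H : V →ₗ[E] V →ₛₗ[(τ : E →+* E)] E} {d : F} (hd : IsDifferent p d) (hd0 : ord d = 0)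
  (h : IsQuadInvolution τ) (hH : IsHermitian H) {e : E} {m : F} (g : IsRamGen τ e m)
  {Λ : Submodule (intE F E) V}

theorem resChar_eq (u : 𝒪[F]) : resChar u = quadCharC 𝓀[F] (IsLocalRing.residue 𝒪[F] u) := rfl

theorem scal_base_unit {u : F} (hu : u ≠ 0) (hu0 : ord u = 0) (z : E)
    (Λ : Submodule (intE F E) V) : scal (z * algebraMap F E u) Λ = scal z Λ := by
  refine scal_mul_unit (v := algebraMap F E u⁻¹)
    (algebraMap_mem_intE (integer_of_ord (Or.inr hu0.ge)))
    (algebraMap_mem_intE (integer_of_ord (Or.inr (by rw [ord_inv hu, hu0]; norm_num)))) ?_ Λ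
  rw [← map_mul, mul_inv_cancel₀ hu, map_one]

include hd hd0 h hH g in
theorem perp_ramified (S : Submodule (intE F E) V) :
    perp p H S.toAddSubgroup = (scal e (dualLattice H S)).toAddSubgroup := by
  rw [perp_eq_scal hd h hH (g.trace_dual h), scal_base_unit hd.1 hd0]

include g hH in
theorem herm_mem_of_dual_le [CharZero F] (h : IsQuadInvolution τ)
    (hle : dualLattice H Λ ≤ scal e Λ) {x : V} (hx : x ∈ dualLattice H Λ) :
    herm H x ∈ 𝒪[F] := by
  have h1 : H x (e • x) ∈ intE F E := hx _ (hle hx)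
  rw [form_smul_right, g.conj_e, ← algebraMap_herm h hH] at h1
  have h2 : -e * algebraMap F E (herm H x) = algebraMap F E 0 + (-herm H x) • e := by
    rw [map_zero, zero_add, Algebra.smul_def, map_neg]; ring
  rw [h2, g.int_iff] at h1
  simpa using h1.2

variable (e) in
/-- The uniformizer `e` as a unit of `E`. -/
def IsRamGen.unit {τ : E ≃ₐ[F] E} {m : F} (g : IsRamGen τ e m) (h : IsQuadInvolution τ) : Eˣ :=
  (g.isUnit_e h).unit

theorem IsRamGen.coe_unit : (g.unit e h : E) = e := rfl

theorem IsRamGen.mul_unit_inv : e * (((g.unit e h)⁻¹ : Eˣ) : E) = 1 := (g.unit e h).mul_inv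

theorem IsRamGen.norm_unit_zpow (k : ℤ) : Algebra.norm F ((g.unit e h ^ k : Eˣ) : E) = m ^ k := by
  have h1 : Units.map (Algebra.norm F : E →* F) (g.unit e h) = Units.mk0 m g.m_ne :=
    Units.ext (g.norm_e h)
  have h2 : ((Units.map (Algebra.norm F : E →* F) (g.unit e h ^ k) : Fˣ) : F) = m ^ k := by
    rw [map_zpow, h1, Units.val_zpow_eq_zpow_val, Units.val_mk0]
  exact h2

include g in
theorem IsRamGen.absV_m : absV m = (resCard F : ℝ)⁻¹ := by
  rw [absV_eq g.m_ne, g.ord_m, zpow_neg_one]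

variable [ContinuousSMul ℚ_[p] F] [FiniteDimensional ℚ_[p] F]
  [Module.Finite F V] [TopologicalSpace V]
  [IsTopologicalAddGroup V] [ContinuousSMul F V] [T2Space V]
  [MeasurableSpace F] [BorelSpace F] [MeasurableSpace V] [BorelSpace V] {μ : Measure V}
  (hμ : IsSelfDualMeasure (pairingV p H) μ)
  (hΛ : IsCompactOpen (Λ : Set V))

include hd hd0 h hH g hμ hΛ in
theorem dualLattice_dualLattice : dualLattice H (dualLattice H Λ) = Λ := by
  refine le_antisymm (fun x hx => ?_) (le_dualLattice_dualLattice hH Λ)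
  have h1 : x ∈ perp p H (perp p H Λ.toAddSubgroup) := by
    intro y hy
    rw [perp_ramified hd hd0 h hH g] at hy
    have h2 : H x (e • y) ∈ intE F E := hx _ hy
    rw [form_smul_right, g.conj_e, neg_mul, neg_mem_iff,
      ← g.trace_dual h] at h2
    have h3 := h2 1 (one_mem _)
    rw [one_mul] at h3
    exact hd.psi_eq_one (mul_mem h3 hd.mem_integer)
  rw [perp_perp hd h hH hμ hΛ] at h1
  exact h1

include hd hd0 h hH g hμ hΛ in
theorem isCompactOpen_dualLattice_ramified (hle : dualLattice H Λ ≤ scal e Λ) 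
    (hint : Λ ≤ dualLattice H Λ) : IsCompactOpen (dualLattice H Λ : Set V) := by
  have h1 : IsCompactOpen (scal e Λ : Set V) :=
    isCompactOpen_preimage_smul (p := p) F hΛ (g.unit e h)
  have h2 : IsOpen (dualLattice H Λ : Set V) :=
    AddSubgroup.isOpen_mono (H₁ := Λ.toAddSubgroup) (H₂ := (dualLattice H Λ).toAddSubgroup) hint hΛ.1
  have h3 : IsClosed (dualLattice H Λ : Set V) :=
    AddSubgroup.isClosed_of_isOpen (dualLattice H Λ).toAddSubgroup h2
  exact ⟨h2, h1.2.of_isClosed_subset h3 hle⟩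

include hd hd0 h hH g hμ hΛ in
/-- At a ramified place the integrals `∫_Λ ψ(b q(x)) dx` reduce to the case `v(b) = -1`. -/
theorem setIntegral_ramified_reduce {n : ℕ} (hn : Module.finrank F V = 2 * (n + 1))
    (hle : dualLattice H Λ ≤ scal e Λ) (hint : Λ ≤ dualLattice H Λ)
    {b : F} (hb : b ≠ 0) (j : ℕ) (hj : ord b = -(j + 1)) :
    ∫ x in (Λ : Set V), psi p F (b * herm H x) ∂μ =
      (((resCard F : ℂ)⁻¹) ^ j) ^ (n + 1) *
        ∫ x in (Λ : Set V), psi p F (b * m ^ j * herm H x) ∂μ := by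
  have := hμ.1
  have : CharZero F := charZero_of_injective_algebraMap (algebraMap ℚ_[p] F).injective
  have hm := g.m_ne
  have hΛ' := isCompactOpen_dualLattice_ramified hd hd0 h hH g hμ hΛ hle hint
  have hdd := dualLattice_dualLattice hd hd0 h hH g hμ hΛ
  have hP : IsCompactOpen ((scal e (dualLattice H Λ)).toAddSubgroup : Set V) :=
    isCompactOpen_preimage_smul (p := p) F hΛ' (g.unit e h)
  set u : F := b * m ^ (j + 1) with hu
  have hu0 : u ≠ 0 := mul_ne_zero hb (pow_ne_zero _ hm)
  have huo : ord u = 0 := by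
    rw [hu, ord_mul hb (pow_ne_zero _ hm), ord_pow hm, g.ord_m, hj]; push_cast; ring
  have huO : u ∈ 𝒪[F] := integer_of_ord (Or.inr huo.ge)
  let w : Eˣ := g.unit e h ^ (-(j : ℤ))
  have hw : (w : E) * e ^ j = 1 := by
    change ((g.unit e h ^ (-(j : ℤ)) : Eˣ) : E) * e ^ j = 1
    rw [zpow_neg, zpow_natCast]
    exact (g.unit e h ^ j).inv_mul
  have heτ : e * τ e = algebraMap F E m := by rw [← h.norm_eq, g.norm_e h]
  -- the annihilator of `e ^ (j + 1) Λ^∨`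
  have hwu : e * (algebraMap F E b * τ (e ^ (j + 1))) = w * algebraMap F E u := by
    have h1 : e ^ (j + 1) * τ (e ^ (j + 1)) = algebraMap F E (m ^ (j + 1)) := by
      rw [map_pow, ← mul_pow, heτ, map_pow]
    rw [hu, map_mul, ← h1]
    linear_combination (-algebraMap F E b * e * τ (e ^ (j + 1))) * hw
  have h1 := setIntegral_psi_herm hd h hH μ (M := Λ.toAddSubgroup)
    (L := (dualLattice H Λ).toAddSubgroup.map (DistribSMul.toAddMonoidHom V (e ^ (j + 1)))) hΛ hP
    (by
      rintro _ ⟨x, hx, rfl⟩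
      change e ^ (j + 1) • x ∈ Λ
      rw [pow_succ, mul_smul]
      exact smul_mem_lattice (pow_mem g.mem j) (hle hx))
    (M₀ := Λ.toAddSubgroup) hΛ.1 (perp_ramified hd hd0 h hH g Λ).ge (b := b)
    (by
      rintro _ ⟨x, hx, rfl⟩
      apply hd.psi_eq_one
      change b * herm H (e ^ (j + 1) • x) * d ∈ 𝒪[F]
      rw [herm_smul h hH, map_pow, g.norm_e h, ← mul_assoc]
      exact mul_mem (mul_mem huO (herm_mem_of_dual_le hH g h hle hx)) hd.mem_integer)
    (T := (scal (w : E) Λ).toAddSubgroup)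
    (hΛ.1.preimage (continuous_smul_E (p := p) F _)).measurableSet
    (by
      intro x _
      have h2 : ∀ y : V, b * trForm H x (e ^ (j + 1) • y) =
          trForm H ((algebraMap F E b * τ (e ^ (j + 1))) • x) y := by
        intro y
        rw [trForm_smul_left h hH, map_mul, h.invol, AlgEquiv.commutes, mul_smul, algebraMap_smul,
          map_smul (trForm H x), smul_eq_mul]
      have h3 : x ∈ (scal (w : E) Λ).toAddSubgroup ↔
          (algebraMap F E b * τ (e ^ (j + 1))) • x ∈ perp p H (dualLattice H Λ).toAddSubgroup := by
        rw [perp_ramified hd hd0 h hH g, hdd, ← scal_base_unit hu0 huo]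
        change _ • x ∈ Λ ↔ e • _ • x ∈ Λ
        rw [smul_smul, hwu]
      rw [h3, mem_perp]
      constructor
      · rintro hx' _ ⟨y, hy, rfl⟩
        exact (congrArg (psi p F) (h2 y)).trans (hx' y hy)
      · intro hx' y hy
        rw [← h2]
        exact hx' _ ⟨y, hy, rfl⟩)
  refine h1.trans ?_
  have hsub : (scal (w : E) Λ) ≤ Λ := fun x hx => by
    have h2 := smul_mem_lattice (pow_mem g.mem j) (mem_scal.1 hx)
    rwa [smul_smul, mul_comm, hw, one_smul] at h2
  have h2 : Λ.toAddSubgroup ⊓ (scal (w : E) Λ).toAddSubgroup = (scal (w : E) Λ).toAddSubgroup :=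
    inf_eq_right.2 hsub
  rw [h2]
  refine (setIntegral_scal hd h hH hμ hn hΛ w b).trans ?_
  rw [g.norm_unit_zpow h, zpow_neg, zpow_natCast, div_inv_eq_mul, absV_inv]
  congr 1
  have : absV (m ^ j) = ((resCard F : ℝ)⁻¹) ^ j := by
    rw [absV_eq (pow_ne_zero _ hm), ord_pow hm, g.ord_m, mul_one, zpow_neg, zpow_natCast, inv_pow]
  rw [this]
  push_cast
  rw [← inv_pow, inv_inv]

include hd hd0 h hH g hμ hΛ in
theorem weilIndex_ramified {n : ℕ} (hn : Module.finrank F V = 2 * (n + 1))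
    (hle : dualLattice H Λ ≤ scal e Λ) (hint : Λ ≤ dualLattice H Λ) :
    weilIndex p H μ = (resCard F : ℂ) ^ (n + 1) *
      ∫ x in (Λ : Set V), psi p F (m⁻¹ * herm H x) ∂μ := by
  have := hμ.1
  have : CharZero F := charZero_of_injective_algebraMap (algebraMap ℚ_[p] F).injective
  have hΛ' := isCompactOpen_dualLattice_ramified hd hd0 h hH g hμ hΛ hle hint
  have hP : IsCompactOpen ((scal e Λ).toAddSubgroup : Set V) :=
    isCompactOpen_preimage_smul (p := p) F hΛ (g.unit e h)
  rw [weilIndex_eq hd h hH μ (M₀ := (dualLattice H Λ).toAddSubgroup) hΛ' hP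
    (by rw [perp_ramified hd hd0 h hH g, dualLattice_dualLattice hd hd0 h hH g hμ hΛ])
    fun x hx => hd.psi_eq_one (mul_mem (herm_mem_of_dual_le hH g h hle hx) hd.mem_integer)]
  have h1 := setIntegral_scal hd h hH hμ hn hΛ (g.unit e h) 1
  simp only [one_mul] at h1
  refine h1.trans ?_
  rw [g.coe_unit h, g.norm_e h, g.absV_m, one_div]
  push_cast
  rw [inv_pow, inv_inv]

include hd hd0 h hH g hμ hΛ in
theorem measureReal_ramified {n : ℕ} (hn : Module.finrank F V = 2 * (n + 1))
    (hΛ' : IsCompactOpen (dualLattice H Λ : Set V)) :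
    μ.real (Λ : Set V) * ((resCard F : ℝ) ^ (n + 1) * μ.real (dualLattice H Λ : Set V)) = 1 := by
  have h1 := measureReal_mul_perp hd h hH hμ (S := Λ.toAddSubgroup) hΛ
  rw [perp_ramified hd hd0 h hH g] at h1
  have h2 := measureReal_scal hd h hH hμ hn hΛ' (g.unit e h)
  rw [g.coe_unit h, g.norm_e h, g.absV_m, inv_pow, inv_inv] at h2
  rw [← h2]
  exact h1

include hd hd0 h hH g hμ hΛ in
/-- The case `Λ^∨ = e⁻¹ Λ`. -/
theorem ramified_modular {n : ℕ} (hn : Module.finrank F V = 2 * (n + 1))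
    (hmod : dualLattice H Λ = scal e Λ) :
    μ.real (Λ : Set V) = ((resCard F : ℝ)⁻¹) ^ (n + 1) ∧ weilIndex p H μ = 1 ∧
      (∀ b ∈ 𝒪[F], ∫ x in (Λ : Set V), psi p F (b * herm H x) ∂μ = μ.real (Λ : Set V)) ∧
      ∀ (b : F) (j : ℕ), b ≠ 0 → ord b = -(j + 1) →
        ∫ x in (Λ : Set V), psi p F (b * herm H x) ∂μ =
          (((resCard F : ℂ)⁻¹) ^ j) ^ (n + 1) * μ.real (Λ : Set V) := by
  have := hμ.1
  have : CharZero F := charZero_of_injective_algebraMap (algebraMap ℚ_[p] F).injective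
  have hm := g.m_ne
  have hN : (resCard F : ℂ) ≠ 0 := by exact_mod_cast (one_lt_resCard F).ne_bot
  have hNp := resCard_pos F
  have hint : Λ ≤ dualLattice H Λ := by
    rw [hmod]; exact fun x hx => smul_mem_lattice g.mem hx
  have hΛ' := isCompactOpen_dualLattice_ramified hd hd0 h hH g hμ hΛ hmod.le hint
  have hvol : μ.real (Λ : Set V) = ((resCard F : ℝ)⁻¹) ^ (n + 1) := by
    have h1 := measureReal_ramified hd hd0 h hH g hμ hΛ hn hΛ'
    rw [hmod] at h1
    have h2 := measureReal_scal hd h hH hμ hn hΛ (g.unit e h)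
    rw [g.coe_unit h, g.norm_e h, g.absV_m, inv_pow, inv_inv] at h2
    rw [h2] at h1
    refine (mul_self_inj measureReal_nonneg (by positivity)).1 ?_
    rw [inv_pow]
    field_simp
    linear_combination h1
  -- `q` takes values in `m 𝒪_F` on `Λ = e Λ^∨`
  have hq : ∀ x ∈ Λ, ∃ y ∈ 𝒪[F], herm H x = m * y := by
    intro x hx
    have he := g.mul_unit_inv h
    have hy : (((g.unit e h)⁻¹ : Eˣ) : E) • x ∈ dualLattice H Λ := by
      rw [hmod, mem_scal, smul_smul, he, one_smul]
      exact hx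
    refine ⟨_, herm_mem_of_dual_le hH g h hmod.le hy, ?_⟩
    exact Eq.trans (by rw [smul_smul, he, one_smul]) ((herm_smul h hH e _).trans (by rw [g.norm_e h]))
  have hG : ∀ b : F, b * m ∈ 𝒪[F] →
      ∫ x in (Λ : Set V), psi p F (b * herm H x) ∂μ = μ.real (Λ : Set V) := by
    intro b hb
    apply setIntegral_psi_herm_eq_measure hd hΛ
    intro x hx
    obtain ⟨y, hy, hxy⟩ := hq x hx
    rw [hxy, ← mul_assoc]
    exact mul_mem (mul_mem hb hy) hd.mem_integer
  have hmO : m ∈ 𝒪[F] := integer_of_ord (Or.inr (by rw [g.ord_m]; norm_num))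
  refine ⟨hvol, ?_, fun b hb => hG b (mul_mem hb hmO), fun b j hb hj => ?_⟩
  · rw [weilIndex_ramified hd hd0 h hH g hμ hΛ hn hmod.le hint, hG _ (by
      rw [inv_mul_cancel₀ hm]; exact one_mem _), hvol]
    push_cast
    rw [← mul_pow, mul_inv_cancel₀ hN, one_pow]
  · rw [setIntegral_ramified_reduce hd hd0 h hH g hμ hΛ hn hmod.le hint hb j hj, hG]
    refine integer_of_ord (Or.inr ?_)
    rw [ord_mul (mul_ne_zero hb (pow_ne_zero _ hm)) hm, ord_mul hb (pow_ne_zero _ hm), ord_pow hm,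
      g.ord_m, hj]
    omega

end Ramified

/-! ### Almost modular lattices at ramified places -/

section AlmostModular

variable {p : ℕ} [hp : Fact p.Prime] {F : Type*} [Field F] [Algebra ℚ_[p] F]
  [ValuativeRel F] [TopologicalSpace F] [IsNonarchimedeanLocalField F]
  {E : Type*} [CommRing E] [Algebra F E] {τ : E ≃ₐ[F] E}
  {V : Type*} [AddCommGroup V] [Module F V] [Module E V] [IsScalarTower F E V]
  {H : V →ₗ[E] V →ₛₗ[(τ : E →+* E)] E}
  (h : IsQuadInvolution τ) (hH : IsHermitian H) {e : E} {m : F} (g : IsRamGen τ e m)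
  {Λ : Submodule (intE F E) V}

include g h in
theorem IsRamGen.trace_mul {z : E} (hz : z ∈ intE F E) :
    ∃ y ∈ 𝒪[F], Algebra.trace F E (e * z) = m * y := by
  obtain ⟨x, y, rfl⟩ := g.rep z
  obtain ⟨hx, hy⟩ := (g.int_iff x y).1 hz
  refine ⟨-2 * y, mul_mem (neg_mem two_mem_integer) hy, ?_⟩
  rw [g.gen_mul, g.trace_add h]
  ring

include g in
theorem IsRamGen.div_mem : m / unif F ∈ 𝒪[F] := by
  rw [div_unif_mem_iff g.m_ne, g.ord_m]

include g in
theorem IsRamGen.residue_mul (y : 𝒪[F]) (hm : m ∈ 𝒪[F]) :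
    IsLocalRing.residue 𝒪[F] (⟨m, hm⟩ * y) = 0 := by
  rw [residue_eq_zero_iff]
  change m * (y : F) / unif F ∈ 𝒪[F]
  rw [mul_div_right_comm]
  exact mul_mem g.div_mem y.2

include g in
/-- A nonunit of `𝒪_F` is a multiple of `m`. -/
theorem IsRamGen.exists_eq_mul {x : 𝒪[F]} (hx : IsLocalRing.residue 𝒪[F] x = 0) :
    ∃ y ∈ 𝒪[F], (x : F) = m * y := by
  rw [residue_eq_zero_iff] at hx
  refine ⟨(x : F) / unif F * (unif F / m), mul_mem hx ?_, ?_⟩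
  · refine integer_of_ord (Or.inr ?_)
    rw [ord_div (unif_ne_zero F) g.m_ne, ord_unif, g.ord_m, sub_self]
  · have := unif_ne_zero F
    have := g.m_ne
    field_simp

include g h in
/-- The uniformizer `e` lies in the Jacobson radical of `𝒪_E`. -/
theorem IsRamGen.one_sub_unit {z : E} (hz : z ∈ intE F E) :
    ∃ w ∈ intE F E, w * (1 - z * e) = 1 := by
  have h1 : 1 - z * e ∈ intE F E := sub_mem (one_mem _) (mul_mem hz g.mem)
  have h2 : ∃ y ∈ 𝒪[F], Algebra.norm F (1 - z * e) = 1 - m * y := by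
    obtain ⟨x, y, rfl⟩ := g.rep z
    obtain ⟨hx, hy⟩ := (g.int_iff x y).1 hz
    refine ⟨-2 * y - (m * y ^ 2 + x ^ 2), sub_mem (mul_mem (neg_mem two_mem_integer) hy)
      (add_mem (mul_mem g.coeff_mem.2 (pow_mem hy 2)) (pow_mem hx 2)), ?_⟩
    have h3 : 1 - (algebraMap F E x + y • e) * e =
        algebraMap F E (1 + m * y) + (-x) • e := by
      rw [mul_comm, g.gen_mul, neg_smul, map_add, map_one, neg_mul, map_neg]
      ring
    rw [h3, g.norm_add h]
    ring
  obtain ⟨y, hy, h2⟩ := h2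
  obtain ⟨h3, h4⟩ := unit_of_not_div (x := 1 - m * y) (sub_mem (one_mem _)
      (mul_mem g.coeff_mem.2 hy)) (fun h5 => by
    have h6 := add_mem h5 (mul_mem g.div_mem hy)
    rw [← mul_div_right_comm, ← add_div, sub_add_cancel] at h6
    exact not_div_of_unit one_ne_zero ord_one h6)
  refine ⟨τ (1 - z * e) * algebraMap F E (1 - m * y)⁻¹, mul_mem (conj_mem_intE h1)
    (algebraMap_mem_intE (integer_of_ord (Or.inr (by rw [ord_inv h3, h4, neg_zero])))), ?_⟩
  rw [mul_right_comm, mul_comm (τ _), ← h.norm_eq, h2, ← map_mul, mul_inv_cancel₀ h3, map_one]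

include g h in
theorem le_dualLattice_of_covBy (hcov : dualLattice H Λ ⋖ scal e Λ) : Λ ≤ dualLattice H Λ := by
  intro y hy
  have hye := g.mul_unit_inv h
  set x : V := (((g.unit e h)⁻¹ : Eˣ) : E) • y with hx
  have hxy : e • x = y := by rw [hx, smul_smul, hye, one_smul]
  have hxM : x ∈ scal e Λ := by rw [mem_scal, hxy]; exact hy
  by_contra hy'
  have h1 : y ∈ scal e Λ := smul_mem_lattice g.mem hy
  rcases hcov.eq_or_eq (c := dualLattice H Λ ⊔ Submodule.span _ {y}) le_sup_left
    (sup_le hcov.le ((Submodule.span_singleton_le_iff_mem _ _).2 h1)) with h2 | h2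
  · exact hy' (h2 ▸ Submodule.mem_sup_right (Submodule.mem_span_singleton_self y))
  · rw [← h2] at hxM
    obtain ⟨l, hl, w, hw, hlw⟩ := Submodule.mem_sup.1 hxM
    obtain ⟨z, rfl⟩ := Submodule.mem_span_singleton.1 hw
    obtain ⟨w, hw, hw1⟩ := g.one_sub_unit h z.2
    have h3 : l = (1 - (z : E) * e) • x := by
      rw [sub_smul, one_smul, mul_smul, hxy, ← hlw]
      exact (add_sub_cancel_right _ _).symm
    have h4 := smul_mem_lattice hw hl
    rw [h3, smul_smul, hw1, one_smul] at h4
    apply hy'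
    rw [← hxy]
    exact smul_mem_lattice g.mem h4

include g h hH in
/-- An almost modular lattice is `Λ = e Λ^∨ + 𝒪_F x₀` with `q(x₀)` a unit. -/
theorem exists_generator_almostModular [CharZero F] (hcov : dualLattice H Λ ⋖ scal e Λ) :
    ∃ x₀ ∈ Λ, ∃ c : 𝒪[F], IsLocalRing.residue 𝒪[F] c ≠ 0 ∧ herm H x₀ = c ∧
      ∀ x ∈ Λ, ∃ y ∈ dualLattice H Λ, ∃ α : 𝒪[F], x = e • y + (α : F) • x₀ := by
  have hint := le_dualLattice_of_covBy h g hcov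
  have hue := g.mul_unit_inv h
  obtain ⟨x₁, hx₁, hx₁'⟩ := SetLike.exists_of_lt hcov.lt
  have hx₀ : e • x₁ ∈ Λ := hx₁
  have hrep : ∀ x ∈ Λ, ∃ y ∈ dualLattice H Λ, ∃ α : 𝒪[F], x = e • y + (α : F) • (e • x₁) := by
    intro x hx
    set x' : V := (((g.unit e h)⁻¹ : Eˣ) : E) • x with hx'
    have hxx : e • x' = x := by rw [hx', smul_smul, hue, one_smul]
    have hxM : x' ∈ scal e Λ := by rw [mem_scal, hxx]; exact hx
    rcases hcov.eq_or_eq (c := dualLattice H Λ ⊔ Submodule.span _ {x₁}) le_sup_left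
      (sup_le hcov.le ((Submodule.span_singleton_le_iff_mem _ _).2 hx₁)) with h2 | h2
    · exact absurd (h2 ▸ Submodule.mem_sup_right (Submodule.mem_span_singleton_self x₁)) hx₁'
    · rw [← h2] at hxM
      obtain ⟨l, hl, w, hw, hlw⟩ := Submodule.mem_sup.1 hxM
      obtain ⟨z, rfl⟩ := Submodule.mem_span_singleton.1 hw
      obtain ⟨α, β, hαβ⟩ := g.rep (z : E)
      have hz := z.2
      rw [hαβ, g.int_iff] at hz
      refine ⟨l + β • (e • x₁), add_mem hl (hint (base_smul_mem_lattice hz.2 hx₀)), ⟨α, hz.1⟩, ?_⟩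
      have h3 : (z • x₁ : V) = (z : E) • x₁ := rfl
      rw [← hxx, ← hlw, h3, hαβ]
      simp only [smul_add, add_smul, algebraMap_smul, smul_assoc]
      rw [smul_comm β e, smul_comm α e, smul_smul]
      abel
  have hcO : herm H (e • x₁) ∈ 𝒪[F] := herm_mem_of_dual_le hH g h hcov.le (hint hx₀)
  refine ⟨e • x₁, hx₀, ⟨_, hcO⟩, fun hc => hx₁' ?_, rfl, hrep⟩
  intro y hy
  obtain ⟨y', hy', α, rfl⟩ := hrep y hy
  rw [map_add]
  refine add_mem ?_ ?_
  · have h1 : H x₁ (e • y') = -H (e • x₁) y' := by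
      rw [form_smul_right, form_smul_left, g.conj_e]; ring
    rw [h1, neg_mem_iff, hH.symm y']
    exact conj_mem_intE (hy' _ hx₀)
  · obtain ⟨w, hw, hcw⟩ := g.exists_eq_mul hc
    have h1 : e * H x₁ (e • x₁) = e * (-e * algebraMap F E w) := by
      rw [← form_smul_left, ← algebraMap_herm h hH]
      have h2 : herm H (e • x₁) = m * w := hcw
      rw [h2, map_mul]
      linear_combination (algebraMap F E w) * g.sq_eq
    have h2 := (g.isUnit_e h).mul_left_cancel h1
    rw [← algebraMap_smul E (α : F), form_smul_right, h2]
    exact mul_mem (conj_mem_intE (algebraMap_mem_intE α.2))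
      (mul_mem (neg_mem g.mem) (algebraMap_mem_intE hw))

variable {d : F} (hd : IsDifferent p d) (hd0 : ord d = 0)

section

variable {x₀ : V} {c : 𝒪[F]} (hc : IsLocalRing.residue 𝒪[F] c ≠ 0) (hqc : herm H x₀ = c)
  (hx₀ : x₀ ∈ Λ) (hint : Λ ≤ dualLattice H Λ)
  (hrep : ∀ x ∈ Λ, ∃ y ∈ dualLattice H Λ, ∃ α : 𝒪[F], x = e • y + (α : F) • x₀)

include h hx₀ in
theorem trForm_mem_integer_of_dual {y : V} (hy : y ∈ dualLattice H Λ) : trForm H y x₀ ∈ 𝒪[F] :=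
  h.trace_mem (hy _ hx₀)

include h g hx₀ in
theorem trForm_gen_smul {y : V} (hy : y ∈ dualLattice H Λ) :
    ∃ z ∈ 𝒪[F], trForm H (e • y) x₀ = m * z := by
  obtain ⟨z, hz, hz'⟩ := g.trace_mul h (hy _ hx₀)
  exact ⟨z, hz, by rw [trForm_apply, form_smul_left, hz']⟩

variable [CharZero F]

include h g hH hqc hx₀ in
theorem herm_almostModular (hle : dualLattice H Λ ≤ scal e Λ) {y : V}
    (hy : y ∈ dualLattice H Λ) (α : 𝒪[F]) :
    ∃ z ∈ 𝒪[F], herm H (e • y + (α : F) • x₀) = c * (α : F) ^ 2 + m * z := by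
  obtain ⟨z, hz, hz'⟩ := trForm_gen_smul h g hx₀ hy
  refine ⟨herm H y + α * z, add_mem (herm_mem_of_dual_le hH g h hle hy) (mul_mem α.2 hz), ?_⟩
  rw [herm_add h hH, map_smul, hz', herm_smul h hH, g.norm_e h, ← algebraMap_smul E (α : F),
    herm_smul h hH, h.norm_algebraMap, hqc, smul_eq_mul]
  ring

variable (H Λ) in
/-- The reduction `x ↦ tr ⟨x, x₀⟩` of an almost modular lattice, with values in the residue
field. -/
def almostModularRed (h : IsQuadInvolution τ) (hx₀ : x₀ ∈ Λ) (hint : Λ ≤ dualLattice H Λ) :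
    Λ.toAddSubgroup →+ 𝓀[F] where
  toFun x := IsLocalRing.residue 𝒪[F] ⟨trForm H x x₀, trForm_mem_integer_of_dual h hx₀ (hint x.2)⟩
  map_zero' := by
    rw [← map_zero (IsLocalRing.residue 𝒪[F])]
    congr 1
    exact Subtype.ext (by simp)
  map_add' x y := by
    rw [← map_add]
    congr 1
    exact Subtype.ext (by simp)

include g hH hqc in
theorem almostModularRed_apply (x : Λ.toAddSubgroup) {y : V} (hy : y ∈ dualLattice H Λ) {α : 𝒪[F]}
    (hx : (x : V) = e • y + (α : F) • x₀) :
    almostModularRed H Λ h hx₀ hint x = IsLocalRing.residue 𝒪[F] (2 * c * α) := by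
  obtain ⟨z, hz, hz'⟩ := trForm_gen_smul h g hx₀ hy
  have h1 : (⟨trForm H x x₀, trForm_mem_integer_of_dual h hx₀ (hint x.2)⟩ : 𝒪[F]) =
      ⟨m, g.coeff_mem.2⟩ * ⟨z, hz⟩ + 2 * c * α := by
    apply Subtype.ext
    change trForm H x x₀ = m * z + 2 * (c : F) * α
    rw [hx, map_add, LinearMap.add_apply, hz', map_smul, LinearMap.smul_apply, trForm_self h hH,
      hqc, smul_eq_mul]
    ring
  change IsLocalRing.residue 𝒪[F] _ = _
  rw [h1, map_add, g.residue_mul, zero_add]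

include g hH hc hqc hrep in
theorem almostModularRed_surjective :
    Function.Surjective (almostModularRed H Λ h hx₀ hint) := by
  intro w
  obtain ⟨u, hu⟩ := IsLocalRing.residue_surjective
    (w / IsLocalRing.residue 𝒪[F] (2 * c))
  have h2 : IsLocalRing.residue 𝒪[F] (2 * c) ≠ 0 := by
    rw [map_mul]
    exact mul_ne_zero ((IsLocalRing.residue_ne_zero_iff_isUnit _).2 g.two) hc
  refine ⟨⟨(u : F) • x₀, base_smul_mem_lattice u.2 hx₀⟩, ?_⟩
  rw [almostModularRed_apply h hH g hqc hx₀ hint _ (zero_mem _) (α := u) (by simp), map_mul, hu,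
    mul_div_cancel₀ _ h2]

include g hH hc hqc hrep in
theorem almostModularRed_eq_zero_iff (x : Λ.toAddSubgroup) :
    almostModularRed H Λ h hx₀ hint x = 0 ↔
      (x : V) ∈ (scal (((g.unit e h)⁻¹ : Eˣ) : E) (dualLattice H Λ)).toAddSubgroup := by
  have hue := g.mul_unit_inv h
  constructor
  · intro h0
    obtain ⟨y, hy, α, hx⟩ := hrep x x.2
    rw [almostModularRed_apply h hH g hqc hx₀ hint x hy hx, map_mul, map_mul, mul_eq_zero,
      mul_eq_zero, or_iff_right (not_or.2
      ⟨(IsLocalRing.residue_ne_zero_iff_isUnit _).2 g.two, hc⟩)] at h0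
    obtain ⟨w, hw, hαw⟩ := g.exists_eq_mul h0
    change (((g.unit e h)⁻¹ : Eˣ) : E) • (x : V) ∈ dualLattice H Λ
    have h1 : (α : F) • x₀ = e • (-e * algebraMap F E w) • x₀ := by
      rw [← algebraMap_smul E (α : F), smul_smul, hαw, map_mul]
      congr 1
      linear_combination (algebraMap F E w) * g.sq_eq
    rw [hx, h1, ← smul_add, smul_smul, mul_comm, hue, one_smul]
    exact add_mem hy (hint (smul_mem_lattice (mul_mem (neg_mem g.mem) (algebraMap_mem_intE hw)) hx₀))
  · intro hx
    have hx' : (((g.unit e h)⁻¹ : Eˣ) : E) • (x : V) ∈ dualLattice H Λ := hx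
    rw [almostModularRed_apply h hH g hqc hx₀ hint x hx' (α := 0)
      (by rw [smul_smul, hue, one_smul]; simp), mul_zero, map_zero]

variable [ContinuousSMul ℚ_[p] F] [FiniteDimensional ℚ_[p] F]
  [Module.Finite F V] [TopologicalSpace V]
  [IsTopologicalAddGroup V] [ContinuousSMul F V] [T2Space V]
  [MeasurableSpace F] [BorelSpace F] [MeasurableSpace V] [BorelSpace V] {μ : Measure V}
  (hμ : IsSelfDualMeasure (pairingV p H) μ)
  (hΛ : IsCompactOpen (Λ : Set V))

include hd hd0 h hH g hμ hΛ hc hqc hx₀ hrep hint in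
theorem measureReal_almostModular {n : ℕ} (hn : Module.finrank F V = 2 * (n + 1))
    (hle : dualLattice H Λ ≤ scal e Λ) :
    μ.real (scal (((g.unit e h)⁻¹ : Eˣ) : E) (dualLattice H Λ) : Set V) =
        μ.real (Λ : Set V) * (resCard F : ℝ)⁻¹ ∧
      μ.real (Λ : Set V) ^ 2 * (resCard F : ℝ) ^ (2 * n + 1) = 1 := by
  have := hμ.1
  have hNp := resCard_pos F
  have hΛ' := isCompactOpen_dualLattice_ramified hd hd0 h hH g hμ hΛ hle hint
  have hK : IsCompactOpen (scal (((g.unit e h)⁻¹ : Eˣ) : E) (dualLattice H Λ) : Set V) :=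
    isCompactOpen_preimage_smul (p := p) F hΛ' _
  have h1 := measureReal_fiber μ (M := Λ.toAddSubgroup) hΛ.2 (almostModularRed H Λ h hx₀ hint)
    (almostModularRed_surjective h hH g hc hqc hx₀ hint hrep)
    (K := (scal (((g.unit e h)⁻¹ : Eˣ) : E) (dualLattice H Λ)).toAddSubgroup) hK.1
    (almostModularRed_eq_zero_iff h hH g hc hqc hx₀ hint hrep)
    (fun x hx => by
      have h2 : e • (((g.unit e h)⁻¹ : Eˣ) : E) • x ∈ Λ := hle hx
      rwa [smul_smul, g.mul_unit_inv h, one_smul] at h2)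
  rw [card_residueField] at h1
  have h2 : μ.real (scal (((g.unit e h)⁻¹ : Eˣ) : E) (dualLattice H Λ) : Set V) =
      μ.real (Λ : Set V) * (resCard F : ℝ)⁻¹ := by
    rw [eq_mul_inv_iff_mul_eq₀ hNp.ne']; exact h1.symm
  refine ⟨h2, ?_⟩
  have h3 := measureReal_scal hd h hH hμ hn hΛ' (g.unit e h)⁻¹
  have h4 : Algebra.norm F (((g.unit e h)⁻¹ : Eˣ) : E) = m⁻¹ := by
    have := g.norm_unit_zpow h (-1)
    rwa [zpow_neg_one, zpow_neg_one] at this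
  rw [h4, absV_inv, g.absV_m, inv_inv, h2] at h3
  have h5 := measureReal_ramified hd hd0 h hH g hμ hΛ hn hΛ'
  have h6 : μ.real (dualLattice H Λ : Set V) = (resCard F : ℝ) ^ n * μ.real (Λ : Set V) := by
    field_simp at h3
    rw [pow_succ] at h3
    refine mul_right_cancel₀ hNp.ne' ?_
    linear_combination -h3
  rw [h6] at h5
  rw [← h5]
  ring

include hd hd0 h hH g hμ hΛ hc hqc hx₀ hrep hint in
/-- On an almost modular lattice the integral of `ψ(u m⁻¹ q)` is a quadratic Gauss sum. -/
theorem setIntegral_almostModular {n : ℕ} (hn : Module.finrank F V = 2 * (n + 1))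
    (hle : dualLattice H Λ ≤ scal e Λ) {χ : AddChar 𝓀[F] ℂ} (hχ1 : χ ≠ 1)
    (hχ : ∀ x : 𝒪[F], χ (IsLocalRing.residue 𝒪[F] x) = psi p F (m⁻¹ * x))
    {u : 𝒪[F]} (hu : IsLocalRing.residue 𝒪[F] u ≠ 0) :
    ∫ x in (Λ : Set V), psi p F (u * m⁻¹ * herm H x) ∂μ =
      (μ.real (Λ : Set V) * (resCard F : ℝ)⁻¹ : ℝ) *
        (resChar u * resChar c * gaussSum (quadCharC 𝓀[F]) χ) := by
  have := hμ.1
  have hm := g.m_ne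
  have hΛ' := isCompactOpen_dualLattice_ramified hd hd0 h hH g hμ hΛ hle hint
  have hK : IsCompactOpen (scal (((g.unit e h)⁻¹ : Eˣ) : E) (dualLattice H Λ) : Set V) :=
    isCompactOpen_preimage_smul (p := p) F hΛ' _
  have h2 : IsLocalRing.residue 𝒪[F] (2 * c) ≠ 0 := by
    rw [map_mul]
    exact mul_ne_zero ((IsLocalRing.residue_ne_zero_iff_isUnit _).2 g.two) hc
  have h1 := setIntegral_fiber μ (M := Λ.toAddSubgroup) hΛ.2 (almostModularRed H Λ h hx₀ hint)
    (almostModularRed_surjective h hH g hc hqc hx₀ hint hrep)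
    (K := (scal (((g.unit e h)⁻¹ : Eˣ) : E) (dualLattice H Λ)).toAddSubgroup) hK.1
    (almostModularRed_eq_zero_iff h hH g hc hqc hx₀ hint hrep)
    (fun x hx => by
      have h2 : e • (((g.unit e h)⁻¹ : Eˣ) : E) • x ∈ Λ := hle hx
      rwa [smul_smul, g.mul_unit_inv h, one_smul] at h2)
    (fun x => psi p F (u * m⁻¹ * herm H x)) (continuous_psi_herm hd h hH _)
    (fun w => χ (IsLocalRing.residue 𝒪[F] (u * c) *
      ((IsLocalRing.residue 𝒪[F] (2 * c))⁻¹ * w) ^ 2)) (by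
      intro x
      obtain ⟨y, hy, α, hx⟩ := hrep x x.2
      obtain ⟨z, hz, hq⟩ := herm_almostModular h hH g hqc hx₀ hle hy α
      rw [almostModularRed_apply h hH g hqc hx₀ hint x hy hx, map_mul (IsLocalRing.residue _) (2 * c),
        inv_mul_cancel_left₀ h2, ← map_pow, ← map_mul, hχ, hx, hq]
      have h3 : (u : F) * m⁻¹ * (c * (α : F) ^ 2 + m * z) =
          m⁻¹ * ((u * c * α ^ 2 : 𝒪[F]) : F) + u * z := by
        push_cast
        field_simp
      rw [h3, AddChar.map_add_eq_mul, hd.psi_eq_one (mul_mem (mul_mem u.2 hz) hd.mem_integer),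
        mul_one])
  refine h1.trans ?_
  rw [← (measureReal_almostModular h hH g hd hd0 hc hqc hx₀ hint hrep hμ hΛ hn hle).1]
  congr 1
  refine (Equiv.sum_comp (Equiv.mulLeft₀ _ (inv_ne_zero h2))
    (fun w => χ (IsLocalRing.residue 𝒪[F] (u * c) * w ^ 2))).trans ?_
  rw [sum_addChar_mul_sq g.ringChar_ne_two hχ1 (by rw [map_mul]; exact mul_ne_zero hu hc), map_mul,
    map_mul]
  rfl

end

include g hd hd0 in
theorem exists_residueChar_ramified :
    ∃ χ : AddChar 𝓀[F] ℂ, χ ≠ 1 ∧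
      ∀ x : 𝒪[F], χ (IsLocalRing.residue 𝒪[F] x) = psi p F (m⁻¹ * x) :=
  hd.exists_residueChar (inv_ne_zero g.m_ne) (by
    rw [ord_mul (inv_ne_zero g.m_ne) hd.1, ord_inv g.m_ne, g.ord_m, hd0, add_zero])

theorem resChar_mul_self {u : 𝒪[F]} (hu : IsLocalRing.residue 𝒪[F] u ≠ 0) :
    resChar u * resChar u = 1 := quadCharC_mul_self hu

theorem resChar_ne_zero {u : 𝒪[F]} (hu : IsLocalRing.residue 𝒪[F] u ≠ 0) : resChar u ≠ 0 :=
  left_ne_zero_of_mul_eq_one (resChar_mul_self hu)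

theorem resChar_mul (u v : 𝒪[F]) : resChar (u * v) = resChar u * resChar v := by
  rw [resChar_eq, resChar_eq, resChar_eq, map_mul, map_mul]

include g in
theorem gaussSum_quadCharC_sq {χ : AddChar 𝓀[F] ℂ} (hχ1 : χ ≠ 1) :
    gaussSum (quadCharC 𝓀[F]) χ ^ 2 = resChar (-1 : 𝒪[F]) * resCard F := by
  have h1 : Fintype.card 𝓀[F] = resCard F := by rw [resCard, Nat.card_eq_fintype_card]
  rw [gaussSum_sq (quadCharC_ne_one g.ringChar_ne_two) quadCharC_isQuadratic
    (AddChar.IsPrimitive.of_ne_one hχ1), h1, resChar_eq, map_neg (IsLocalRing.residue _), map_one]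

variable [ContinuousSMul ℚ_[p] F] [FiniteDimensional ℚ_[p] F]
  [Module.Finite F V] [TopologicalSpace V]
  [IsTopologicalAddGroup V] [ContinuousSMul F V] [T2Space V]
  [MeasurableSpace F] [BorelSpace F] [MeasurableSpace V] [BorelSpace V] {μ : Measure V}
  (hμ : IsSelfDualMeasure (pairingV p H) μ)
  (hΛ : IsCompactOpen (Λ : Set V))

include hd hd0 h hH g hμ hΛ in
/-- The quadratic exponential integrals of an almost modular lattice. The unit `c` is the value of
`q` at a generator of `Λ / e Λ^∨`. -/
theorem ramified_almostModular {n : ℕ} (hn : Module.finrank F V = 2 * (n + 1))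
    (hcov : dualLattice H Λ ⋖ scal e Λ) {χ : AddChar 𝓀[F] ℂ} (hχ1 : χ ≠ 1)
    (hχ : ∀ x : 𝒪[F], χ (IsLocalRing.residue 𝒪[F] x) = psi p F (m⁻¹ * x)) :
    ∃ x₀ ∈ Λ, ∃ c : 𝒪[F], IsLocalRing.residue 𝒪[F] c ≠ 0 ∧ herm H x₀ = c ∧
      (∀ x ∈ Λ, ∃ α : 𝒪[F], ∃ z ∈ 𝒪[F], herm H x = c * (α : F) ^ 2 + m * z) ∧
      μ.real (Λ : Set V) ^ 2 * (resCard F : ℝ) ^ (2 * n + 1) = 1 ∧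
      weilIndex p H μ = (resCard F : ℂ) ^ n * μ.real (Λ : Set V) *
        (resChar c * gaussSum (quadCharC 𝓀[F]) χ) ∧
      weilIndex p H μ ^ 2 = eta E (-1 : F) ∧
      (∀ b ∈ 𝒪[F], ∫ x in (Λ : Set V), psi p F (b * herm H x) ∂μ = μ.real (Λ : Set V)) ∧
      ∀ (b : F) (j : ℕ) (u : 𝒪[F]), IsLocalRing.residue 𝒪[F] u ≠ 0 → b * m ^ (j + 1) = u →
        ∫ x in (Λ : Set V), psi p F (b * herm H x) ∂μ =
          resChar u * weilIndex p H μ * ((resCard F : ℂ)⁻¹ ^ (j + 1)) ^ (n + 1) := by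
  have := hμ.1
  have : CharZero F := charZero_of_injective_algebraMap (algebraMap ℚ_[p] F).injective
  have hm := g.m_ne
  have hN : (resCard F : ℂ) ≠ 0 := by exact_mod_cast (one_lt_resCard F).ne_bot
  have hle := hcov.le
  have hint := le_dualLattice_of_covBy h g hcov
  obtain ⟨x₀, hx₀, c, hc, hqc, hrep⟩ := exists_generator_almostModular h hH g hcov
  have hvol := (measureReal_almostModular h hH g hd hd0 hc hqc hx₀ hint hrep hμ hΛ hn hle).2
  have hG : ∀ u : 𝒪[F], IsLocalRing.residue 𝒪[F] u ≠ 0 → _ := fun u hu =>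
    setIntegral_almostModular h hH g hd hd0 hc hqc hx₀ hint hrep hμ hΛ hn hle hχ1 hχ hu
  have hγ : weilIndex p H μ = (resCard F : ℂ) ^ n * μ.real (Λ : Set V) *
      (resChar c * gaussSum (quadCharC 𝓀[F]) χ) := by
    have h1 := hG 1 (by rw [map_one]; exact one_ne_zero)
    have h2 : resChar (1 : 𝒪[F]) = 1 := by rw [resChar_eq, map_one, map_one]
    rw [OneMemClass.coe_one, one_mul, h2, one_mul] at h1
    rw [weilIndex_ramified hd hd0 h hH g hμ hΛ hn hle hint, h1]
    push_cast
    field_simp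
    ring
  refine ⟨x₀, hx₀, c, hc, hqc, fun x hx => ?_, hvol, hγ, ?_, fun b hb => ?_, fun b j u hu hb => ?_⟩
  · obtain ⟨y, hy, α, rfl⟩ := hrep x hx
    obtain ⟨z, hz, hq⟩ := herm_almostModular h hH g hqc hx₀ hle hy α
    exact ⟨α, z, hz, hq⟩
  · have h1 := g.eta_eq h (-1) (by rw [map_neg, map_one]; exact neg_ne_zero.2 one_ne_zero) 0
    rw [zpow_zero, mul_one] at h1
    have h1' : eta E (-1 : F) = resChar (-1 : 𝒪[F]) := h1
    have h2 : ((μ.real (Λ : Set V) : ℂ)) ^ 2 * (resCard F : ℂ) ^ (2 * n + 1) = 1 := by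
      exact_mod_cast hvol
    rw [hγ, h1']
    have h3 := gaussSum_quadCharC_sq g hχ1
    have h4 := resChar_mul_self hc
    calc _ = ((μ.real (Λ : Set V) : ℂ)) ^ 2 * (resCard F : ℂ) ^ (2 * n) *
          (resChar c * resChar c) * gaussSum (quadCharC 𝓀[F]) χ ^ 2 := by ring
      _ = (((μ.real (Λ : Set V) : ℂ)) ^ 2 * (resCard F : ℂ) ^ (2 * n + 1)) *
          resChar (-1 : 𝒪[F]) := by rw [h3, h4]; ring
      _ = _ := by rw [h2, one_mul]
  · refine setIntegral_psi_herm_eq_measure hd hΛ fun x hx => ?_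
    exact mul_mem (mul_mem hb (herm_mem_of_dual_le hH g h hle (hint hx))) hd.mem_integer
  · obtain ⟨hu0, huo⟩ := (residue_ne_zero_iff u).1 hu
    have hb0 : b ≠ 0 := by rintro rfl; rw [zero_mul] at hb; exact hu0 hb.symm
    have hbo : ord b = -(j + 1) := by
      have h1 := congrArg ord hb
      rw [ord_mul hb0 (pow_ne_zero _ hm), ord_pow hm, g.ord_m, huo] at h1
      push_cast at h1
      linarith
    have h1 : b * m ^ j = u * m⁻¹ := by rw [← hb, pow_succ]; field_simp
    rw [setIntegral_ramified_reduce hd hd0 h hH g hμ hΛ hn hle hint hb0 j hbo, h1, hG u hu, hγ]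
    have h2 : (resCard F : ℂ) ^ n * (resCard F : ℂ)⁻¹ ^ (n + 1) = (resCard F : ℂ)⁻¹ := by
      rw [pow_succ, ← mul_assoc, ← mul_pow, mul_inv_cancel₀ hN, one_pow, one_mul]
    rw [pow_succ (resCard F : ℂ)⁻¹ j, mul_pow _ (resCard F : ℂ)⁻¹ (n + 1)]
    push_cast
    linear_combination (-(((resCard F : ℂ)⁻¹ ^ j) ^ (n + 1) * μ.real (Λ : Set V) *
      (resChar u * resChar c * gaussSum (quadCharC 𝓀[F]) χ))) * h2

end AlmostModular

/-! ### Orthogonal bases of Hermitian spaces -/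

section OrthogonalBasis

variable {F : Type*} [Field F] [CharZero F] {E : Type*} [CommRing E] [Algebra F E] {τ : E ≃ₐ[F] E}
  {V : Type*} [AddCommGroup V] [Module F V] [Module E V] [IsScalarTower F E V]
  {H : V →ₗ[E] V →ₛₗ[(τ : E →+* E)] E} (h : IsQuadInvolution τ) (hH : IsHermitian H)
  (hE : IsField E)

include h hH in
theorem herm_eq_zero_iff {x : V} : herm H x = 0 ↔ H x x = 0 := by
  rw [← algebraMap_herm h hH, map_eq_zero_iff _ h.algebraMap_injective]

include hH in
theorem form_eq_zero_symm {x y : V} (hxy : H x y = 0) : H y x = 0 := by rw [hH.symm x y, hxy, map_zero]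

include h hH in
theorem isUnit_form_self {x : V} (hx : herm H x ≠ 0) : IsUnit (H x x) := by
  rw [← algebraMap_herm h hH]
  exact (isUnit_iff_ne_zero.2 hx).map _

include h hH hE in
/-- Polarization: a Hermitian form whose quadratic form vanishes on a submodule vanishes on it. -/
theorem form_eq_zero_of_isotropic {W : Submodule E V} (hW : ∀ x ∈ W, herm H x = 0) {x y : V}
    (hx : x ∈ W) (hy : y ∈ W) : H x y = 0 := by
  by_contra hxy
  have h1 := hW _ (W.add_mem hx (W.smul_mem (H x y) hy))
  have hu : IsUnit (H x y) := by
    obtain ⟨z, hz⟩ := hE.mul_inv_cancel hxy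
    exact IsUnit.of_mul_eq_one z hz
  rw [herm_add h hH, hW _ hx, hW _ (W.smul_mem _ hy), zero_add, zero_add, trForm_apply,
    form_smul_right, mul_comm, ← h.norm_eq, ← mul_one (algebraMap F E _), ← Algebra.smul_def,
    map_smul] at h1
  have h2 : Algebra.trace F E (1 : E) = 2 := h.algebraMap_injective (by
    rw [h.trace_eq, map_one, map_ofNat]; norm_num)
  rw [h2, smul_eq_mul, mul_eq_zero, or_iff_left two_ne_zero] at h1
  exact (h.isUnit_iff _).1 hu h1

variable [Module.Free E V] [Module.Finite E V]

include h hH hE in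
theorem exists_orthogonal_basis {n : ℕ} (hV : Module.finrank E V = n + 1) :
    ∃ B : Module.Basis (Fin (n + 1)) E V, (∀ i, herm H (B i) ≠ 0) ∧
      ∀ i j, i ≠ j → H (B i) (B j) = 0 := by
  have := h.nontrivial
  obtain ⟨S, hS, hmax⟩ := zorn_subset
    {S : Set V | (∀ x ∈ S, herm H x ≠ 0) ∧ S.Pairwise fun x y => H x y = 0} (by
      intro c hc hchain
      refine ⟨⋃₀ c, ⟨?_, hchain.pairwise_sUnion.2 fun s hs => (hc hs).2⟩,
        fun s hs => Set.subset_sUnion_of_mem hs⟩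
      rintro x ⟨s, hs, hxs⟩
      exact (hc hs).1 x hxs)
  have hiso : ∀ x, (∀ y ∈ S, H x y = 0) → herm H x = 0 := by
    intro x hx
    by_contra hq
    have h1 : insert x S ∈
        {S : Set V | (∀ x ∈ S, herm H x ≠ 0) ∧ S.Pairwise fun x y => H x y = 0} := by
      refine ⟨?_, hS.2.insert fun y hy _ => ⟨hx y hy, form_eq_zero_symm hH (hx y hy)⟩⟩
      rintro y (rfl | hy)
      · exact hq
      · exact hS.1 y hy
    have h2 : x ∈ S := hmax h1 (Set.subset_insert x S) (Set.mem_insert x S)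
    exact hq ((herm_eq_zero_iff h hH).2 (hx x h2))
  have hli : LinearIndependent E ((↑) : S → V) := by
    rw [linearIndependent_iff']
    intro s f hf i hi
    have h1 : H (∑ j ∈ s, f j • (j : V)) i = 0 := by rw [hf, map_zero, LinearMap.zero_apply]
    rw [map_sum, LinearMap.sum_apply, Finset.sum_eq_single i (fun j _ hji => by
      rw [form_smul_left, hS.2 j.2 i.2 fun h2 => hji (Subtype.ext h2), mul_zero])
      (fun h2 => absurd hi h2), form_smul_left] at h1
    exact (isUnit_form_self h hH (hS.1 i i.2)).mul_left_eq_zero.1 h1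
  have hfin : Fintype S := hli.setFinite.fintype
  -- the component of `x` orthogonal to `S`
  let pr : V → V := fun x => x - ∑ y : S, (H x y * Ring.inverse (H y y)) • (y : V)
  have hpr : ∀ x, ∀ y ∈ S, H (pr x) y = 0 := by
    intro x y hy
    have h1 := isUnit_form_self h hH (hS.1 y hy)
    rw [map_sub, LinearMap.sub_apply, map_sum, LinearMap.sum_apply,
      Finset.sum_eq_single (⟨y, hy⟩ : S) (fun j _ hji => by
      rw [form_smul_left, hS.2 j.2 hy fun h2 => hji (Subtype.ext h2), mul_zero])
      (fun h2 => absurd (Finset.mem_univ _) h2), form_smul_left, mul_assoc,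
      Ring.inverse_mul_cancel _ h1, mul_one, sub_self]
  let W : Submodule E V :=
    { carrier := {x | ∀ y ∈ S, H x y = 0}
      zero_mem' := fun y _ => by rw [map_zero, LinearMap.zero_apply]
      add_mem' := fun {x x'} hx hx' y hy => by
        rw [map_add, LinearMap.add_apply, hx y hy, hx' y hy, add_zero]
      smul_mem' := fun z x hx y hy => by rw [form_smul_left, hx y hy, mul_zero] }
  have hpr0 : ∀ x, pr x = 0 := by
    intro x
    refine hH.nondeg _ fun y => ?_
    have h1 : H (pr x) (pr y) = 0 :=
      form_eq_zero_of_isotropic h hH hE (W := W) (fun x hx => hiso x hx) (hpr x) (hpr y)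
    have h2 : H (pr x) (∑ w : S, (H y w * Ring.inverse (H w w)) • (w : V)) = 0 := by
      rw [map_sum]
      exact Finset.sum_eq_zero fun w _ => by rw [form_smul_right, hpr x w w.2, mul_zero]
    have h3 : y = pr y + ∑ w : S, (H y w * Ring.inverse (H w w)) • (w : V) :=
      (sub_add_cancel _ _).symm
    rw [h3, map_add, h1, h2, add_zero]
  have hspan : ⊤ ≤ Submodule.span E (Set.range ((↑) : S → V)) := by
    intro x _
    have h1 : x = ∑ y : S, (H x y * Ring.inverse (H y y)) • (y : V) := sub_eq_zero.1 (hpr0 x)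
    rw [h1]
    exact Submodule.sum_mem _ fun y _ => Submodule.smul_mem _ _ (Submodule.subset_span ⟨y, rfl⟩)
  let B := Module.Basis.mk hli hspan
  have hcard : Fintype.card S = Fintype.card (Fin (n + 1)) := by
    rw [← Module.finrank_eq_card_basis B, hV, Fintype.card_fin]
  refine ⟨B.reindex (Fintype.equivOfCardEq hcard), fun i => ?_, fun i j hij => ?_⟩
  · rw [Module.Basis.reindex_apply, Module.Basis.mk_apply]
    exact hS.1 _ (Subtype.coe_prop _)
  · rw [Module.Basis.reindex_apply, Module.Basis.reindex_apply, Module.Basis.mk_apply,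
      Module.Basis.mk_apply]
    exact hS.2 (Subtype.coe_prop _) (Subtype.coe_prop _) fun h1 =>
      hij ((Fintype.equivOfCardEq hcard).symm.injective (Subtype.ext h1))

omit [Module.Free E V] [Module.Finite E V] in
include h hH in
/-- The determinant of a Hermitian form is well defined modulo norms. -/
theorem IsHermDet.eq_norm_mul {n : ℕ} {B : Module.Basis (Fin (n + 1)) E V}
    (hB : ∀ i j, i ≠ j → H (B i) (B j) = 0) {dV : F} (hdV : IsHermDet n H dV) :
    ∃ z : Eˣ, dV = Algebra.norm F (z : E) * ∏ i, herm H (B i) := by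
  obtain ⟨B', hB'⟩ := hdV
  let P := B.toMatrix B'
  have hinv := B.invertibleToMatrix B'
  have hP : IsUnit P.det := (Matrix.isUnit_iff_isUnit_det _).1 (isUnit_of_invertible P)
  have h1 : (Matrix.of fun i j => H (B' i) (B' j)) =
      P.transpose * Matrix.diagonal (fun k => H (B k) (B k)) * P.map τ := by
    ext i j
    have h2 : ∀ i, B' i = ∑ k, P k i • B k := fun i => (B.sum_toMatrix_smul_self B' i).symm
    rw [Matrix.of_apply, Matrix.mul_apply]
    conv_lhs => rw [h2 i, h2 j]
    rw [map_sum]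
    refine Finset.sum_congr rfl fun k _ => ?_
    rw [map_sum, LinearMap.sum_apply, Finset.sum_eq_single k (fun l _ hl => by
      rw [form_smul_left, form_smul_right, hB l k hl, mul_zero, mul_zero])
      (fun h2 => absurd (Finset.mem_univ _) h2), form_smul_left, form_smul_right,
      Matrix.mul_diagonal, Matrix.transpose_apply, Matrix.map_apply]
    ring
  have h2 : (P.map τ).det = τ P.det := (AlgEquiv.map_det τ P).symm
  refine ⟨hP.unit, h.algebraMap_injective ?_⟩
  rw [hB', h1, Matrix.det_mul, Matrix.det_mul, Matrix.det_transpose, Matrix.det_diagonal, h2,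
    map_mul, h.norm_eq, map_prod, IsUnit.unit_spec]
  simp only [algebraMap_herm h hH]
  ring

end OrthogonalBasis

/-! ### The Weil index of a Hermitian space at ramified places -/

section UnitBasis

variable {p : ℕ} [hp : Fact p.Prime] {F : Type*} [Field F] [Algebra ℚ_[p] F]
  [ValuativeRel F] [TopologicalSpace F] [IsNonarchimedeanLocalField F]
  {E : Type*} [CommRing E] [Algebra F E] {τ : E ≃ₐ[F] E}
  {V : Type*} [AddCommGroup V] [Module F V] [Module E V] [IsScalarTower F E V]
  {H : V →ₗ[E] V →ₛₗ[(τ : E →+* E)] E}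
  (h : IsQuadInvolution τ) (hH : IsHermitian H) {e : E} {m : F} (g : IsRamGen τ e m)

include g h hH in
theorem exists_orthogonal_unit_basis [CharZero F] [Module.Free E V] [Module.Finite E V]
    (hE : IsField E) {n : ℕ} (hV : Module.finrank E V = n + 1) :
    ∃ (B : Module.Basis (Fin (n + 1)) E V) (c : Fin (n + 1) → 𝒪[F]),
      (∀ i, IsLocalRing.residue 𝒪[F] (c i) ≠ 0) ∧ (∀ i, herm H (B i) = c i) ∧
      ∀ i j, i ≠ j → H (B i) (B j) = 0 := by
  obtain ⟨B, hB, hB'⟩ := exists_orthogonal_basis h hH hE hV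
  let B' := B.unitsSMul fun i => g.unit e h ^ (-ord (herm H (B i)))
  have hBi : ∀ i, B' i = ((g.unit e h ^ (-ord (herm H (B i))) : Eˣ) : E) • B i := fun i =>
    Module.Basis.unitsSMul_apply i
  have hq : ∀ i, herm H (B' i) = m ^ (-ord (herm H (B i))) * herm H (B i) := fun i => by
    rw [hBi, herm_smul h hH, g.norm_unit_zpow h]
  have hq0 : ∀ i, herm H (B' i) ≠ 0 := fun i => by
    rw [hq]; exact mul_ne_zero (zpow_ne_zero _ g.m_ne) (hB i)
  have hqo : ∀ i, ord (herm H (B' i)) = 0 := fun i => by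
    rw [hq, ord_mul (zpow_ne_zero _ g.m_ne) (hB i), ord_zpow g.m_ne, g.ord_m]; ring
  refine ⟨B', fun i => ⟨_, integer_of_ord (Or.inr (hqo i).ge)⟩, fun i =>
    (residue_ne_zero_iff _).2 ⟨hq0 i, hqo i⟩, fun i => rfl, fun i j hij => ?_⟩
  rw [hBi, hBi, form_smul_left, form_smul_right, hB' i j hij, mul_zero, mul_zero]

theorem addChar_map_sum {A ι : Type*} [AddCommGroup A] (χ : AddChar A ℂ) (s : Finset ι) (f : ι → A) :
    χ (∑ i ∈ s, f i) = ∏ i ∈ s, χ (f i) := by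
  classical
  induction s using Finset.induction_on with
  | empty => simp
  | insert i s hi ih =>
    rw [Finset.sum_insert hi, Finset.prod_insert hi, AddChar.map_add_eq_mul, ih]

variable {n : ℕ} {B : Module.Basis (Fin (n + 1)) E V} {c : Fin (n + 1) → 𝒪[F]}
  (hc : ∀ i, IsLocalRing.residue 𝒪[F] (c i) ≠ 0) (hBc : ∀ i, herm H (B i) = c i)
  (hB : ∀ i j, i ≠ j → H (B i) (B j) = 0)

variable (F B) in
/-- The `𝒪_E`-lattice spanned by a basis. -/
def basisLattice : Submodule (intE F E) V := Submodule.span (intE F E) (Set.range B)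

theorem mem_basisLattice (h : IsQuadInvolution τ) (x : V) :
    x ∈ basisLattice F B ↔ ∀ i, B.repr x i ∈ intE F E := by
  have := h.nontrivial
  constructor
  · intro hx i
    refine Submodule.span_induction (p := fun x _ => B.repr x i ∈ intE F E) ?_ ?_ ?_ ?_ hx
    · rintro _ ⟨j, rfl⟩
      rw [B.repr_self, Finsupp.single_apply]
      split_ifs
      · exact one_mem _
      · exact zero_mem _
    · rw [map_zero]; exact zero_mem _
    · intro x y _ _ hx hy
      rw [map_add]; exact add_mem hx hy
    · intro z x _ hx
      have h1 : B.repr (z • x) = (z : E) • B.repr x := map_smul B.repr (z : E) x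
      rw [h1]
      exact mul_mem z.2 hx
  · intro hx
    rw [← B.sum_repr x]
    exact Submodule.sum_mem _ fun i _ => smul_mem_lattice (hx i) (Submodule.subset_span ⟨i, rfl⟩)

theorem isLattice_basisLattice : IsLattice (basisLattice F B) := by
  refine ⟨Submodule.fg_span (Set.finite_range _), top_le_iff.1 ?_⟩
  rw [← B.span_eq]
  exact Submodule.span_mono Submodule.subset_span

include h hH hBc hB in
theorem form_basis [CharZero F] (x y : V) :
    H x y = ∑ i, B.repr x i * τ (B.repr y i) * algebraMap F E (c i) := by
  conv_lhs => rw [← B.sum_repr x, ← B.sum_repr y, map_sum]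
  refine Finset.sum_congr rfl fun k _ => ?_
  rw [map_sum, LinearMap.sum_apply, Finset.sum_eq_single k (fun l _ hl => by
      rw [form_smul_left, form_smul_right, hB l k hl, mul_zero, mul_zero])
      (fun h2 => absurd (Finset.mem_univ _) h2), form_smul_left, form_smul_right,
      ← algebraMap_herm h hH, hBc]
  ring

include h hH hBc hB in
theorem herm_basis [CharZero F] (x : V) :
    herm H x = ∑ i, (c i : F) * Algebra.norm F (B.repr x i) := by
  apply h.algebraMap_injective
  rw [algebraMap_herm h hH, form_basis h hH hBc hB, map_sum]
  exact Finset.sum_congr rfl fun i _ => by rw [map_mul, h.norm_eq, mul_comm]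

include h hH hc hBc hB in
theorem dualLattice_basisLattice [CharZero F] :
    dualLattice H (basisLattice F B) = basisLattice F B := by
  have := h.nontrivial
  ext x
  rw [mem_basisLattice h]
  constructor
  · intro hx i
    have h1 := hx (B i) (Submodule.subset_span ⟨i, rfl⟩)
    rw [form_basis h hH hBc hB, Finset.sum_eq_single i (fun j _ hj => by
      rw [B.repr_self, Finsupp.single_eq_of_ne hj, map_zero, mul_zero, zero_mul])
      (fun h2 => absurd (Finset.mem_univ _) h2), B.repr_self, Finsupp.single_eq_same, map_one,
      mul_one] at h1
    obtain ⟨hc0, hco⟩ := (residue_ne_zero_iff (c i)).1 (hc i)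
    have h2 := mul_mem h1 (algebraMap_mem_intE (E := E) (x := (c i : F)⁻¹)
      (integer_of_ord (Or.inr (by rw [ord_inv hc0, hco, neg_zero]))))
    rwa [mul_assoc, ← map_mul, mul_inv_cancel₀ hc0, map_one, mul_one] at h2
  · intro hx y hy
    rw [mem_basisLattice h] at hy
    rw [form_basis h hH hBc hB]
    exact sum_mem fun i _ => mul_mem (mul_mem (hx i) (conj_mem_intE (hy i)))
      (algebraMap_mem_intE (c i).2)

variable (B) in
/-- Reduction of the traces of the coordinates with respect to a basis. -/
def basisRed (h : IsQuadInvolution τ) :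
    (basisLattice F B).toAddSubgroup →+ (Fin (n + 1) → 𝓀[F]) where
  toFun x i := IsLocalRing.residue 𝒪[F]
    ⟨Algebra.trace F E (B.repr x i), h.trace_mem ((mem_basisLattice h _).1 x.2 i)⟩
  map_zero' := by
    funext i
    rw [Pi.zero_apply, ← map_zero (IsLocalRing.residue 𝒪[F])]
    congr 1
    exact Subtype.ext (by simp)
  map_add' x y := by
    funext i
    rw [Pi.add_apply, ← map_add]
    congr 1
    exact Subtype.ext (by simp)

include g in
theorem basisRed_apply (x : (basisLattice F B).toAddSubgroup) (i : Fin (n + 1)) {α : 𝒪[F]} {β : F}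
    (hx : B.repr x i = algebraMap F E α + β • e) :
    basisRed B h x i = IsLocalRing.residue 𝒪[F] (2 * α) := by
  change IsLocalRing.residue 𝒪[F] _ = _
  congr 1
  apply Subtype.ext
  change Algebra.trace F E (B.repr x i) = 2 * (α : F)
  rw [hx, g.trace_add h]
  ring

include g in
theorem basisRed_surjective : Function.Surjective (basisRed (F := F) B h) := by
  intro w
  have h2 : IsLocalRing.residue 𝒪[F] 2 ≠ 0 := (IsLocalRing.residue_ne_zero_iff_isUnit _).2 g.two
  choose u hu using fun i => IsLocalRing.residue_surjective (w i / IsLocalRing.residue 𝒪[F] 2)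
  have hr : ∀ i, B.repr (∑ i, algebraMap F E (u i : F) • B i) i = algebraMap F E (u i : F) :=
    fun i => by rw [B.repr_sum_self]
  refine ⟨⟨∑ i, algebraMap F E (u i : F) • B i, (mem_basisLattice h _).2 fun i => ?_⟩, ?_⟩
  · rw [hr]; exact algebraMap_mem_intE (u i).2
  · funext i
    rw [basisRed_apply h g _ i (α := u i) (β := 0) (by rw [hr, zero_smul, add_zero]), map_mul, hu,
      mul_div_cancel₀ _ h2]

include g in
theorem basisRed_eq_zero_iff (x : (basisLattice F B).toAddSubgroup) :
    basisRed B h x = 0 ↔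
      (x : V) ∈ (scal (((g.unit e h)⁻¹ : Eˣ) : E) (basisLattice F B)).toAddSubgroup := by
  have hue := g.mul_unit_inv h
  have h2 : IsLocalRing.residue 𝒪[F] 2 ≠ 0 := (IsLocalRing.residue_ne_zero_iff_isUnit _).2 g.two
  have hx := (mem_basisLattice h _).1 x.2
  change _ ↔ (((g.unit e h)⁻¹ : Eˣ) : E) • (x : V) ∈ basisLattice F B
  rw [mem_basisLattice h, funext_iff]
  refine forall_congr' fun i => ?_
  obtain ⟨α, β, hαβ⟩ := g.rep (B.repr x i)
  have h3 := hx i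
  rw [hαβ, g.int_iff] at h3
  rw [map_smul, Finsupp.smul_apply, smul_eq_mul, basisRed_apply h g x i (α := ⟨α, h3.1⟩) hαβ,
    Pi.zero_apply, map_mul, mul_eq_zero, or_iff_right h2]
  constructor
  · intro h0
    obtain ⟨w, hw, hαw⟩ := g.exists_eq_mul h0
    have h4 : B.repr x i = e * (algebraMap F E β + (-w) • e) := by
      rw [hαβ, g.gen_mul]
      change α = m * w at hαw
      rw [hαw]; ring_nf
    rw [h4, mul_comm, mul_right_comm, hue, one_mul, g.int_iff]
    exact ⟨h3.2, neg_mem hw⟩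
  · intro h0
    obtain ⟨a, b, hab⟩ := g.rep ((((g.unit e h)⁻¹ : Eˣ) : E) * B.repr x i)
    rw [hab] at h0
    have hb := ((g.int_iff a b).1 h0).2
    have h4 : B.repr x i = e * (algebraMap F E a + b • e) := by
      rw [← hab, ← mul_assoc, hue, one_mul]
    have h5 := basisRed_apply h g x i (α := ⟨m, g.coeff_mem.2⟩ * ⟨-b, neg_mem hb⟩) (β := a) (by
      rw [h4, g.gen_mul]
      congr 2
      change -m * b = m * -b
      ring)
    rw [basisRed_apply h g x i (α := ⟨α, h3.1⟩) hαβ, map_mul, map_mul _ 2, g.residue_mul, mul_zero,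
      mul_eq_zero, or_iff_right h2] at h5
    exact h5

variable {d : F} (hd : IsDifferent p d) (hd0 : ord d = 0)
  [ContinuousSMul ℚ_[p] F] [FiniteDimensional ℚ_[p] F]
  [Module.Finite F V] [TopologicalSpace V]
  [IsTopologicalAddGroup V] [ContinuousSMul F V] [T2Space V]
  [MeasurableSpace F] [BorelSpace F] [MeasurableSpace V] [BorelSpace V] {μ : Measure V}
  (hμ : IsSelfDualMeasure (pairingV p H) μ)

include hd hd0 h hH g hμ hc hBc hB in
/-- The Weil index of the diagonal Hermitian form with unit coefficients `c i` is a product of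
Gauss sums. -/
theorem weilIndex_diagonal (hn : Module.finrank F V = 2 * (n + 1)) {χ : AddChar 𝓀[F] ℂ}
    (hχ1 : χ ≠ 1) (hχ : ∀ x : 𝒪[F], χ (IsLocalRing.residue 𝒪[F] x) = psi p F (m⁻¹ * x)) :
    ∃ v : ℝ, 0 < v ∧ v ^ 2 * (resCard F : ℝ) ^ (n + 1) = 1 ∧
      weilIndex p H μ = v * (resChar (∏ i, c i) * gaussSum (quadCharC 𝓀[F]) χ ^ (n + 1)) := by
  have := hμ.1
  have : CharZero F := charZero_of_injective_algebraMap (algebraMap ℚ_[p] F).injective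
  have hm := g.m_ne
  have hN : (resCard F : ℂ) ≠ 0 := by exact_mod_cast (one_lt_resCard F).ne_bot
  have hΛ : IsCompactOpen (basisLattice F B : Set V) :=
    IsLattice.isCompactOpen (p := p) g.toIsIntGen isLattice_basisLattice
  have hdual := dualLattice_basisLattice h hH hc hBc hB
  have hle : dualLattice H (basisLattice F B) ≤ scal e (basisLattice F B) := by
    rw [hdual]; exact fun x hx => smul_mem_lattice g.mem hx
  have h2 : IsLocalRing.residue 𝒪[F] 2 ≠ 0 := (IsLocalRing.residue_ne_zero_iff_isUnit _).2 g.two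
  have hK : IsCompactOpen (scal (((g.unit e h)⁻¹ : Eˣ) : E) (basisLattice F B) : Set V) :=
    isCompactOpen_preimage_smul (p := p) F hΛ _
  have hKle : (scal (((g.unit e h)⁻¹ : Eˣ) : E) (basisLattice F B)).toAddSubgroup ≤
      (basisLattice F B).toAddSubgroup := fun x hx => by
    have h2 := smul_mem_lattice g.mem (mem_scal.1 hx)
    rwa [smul_smul, g.mul_unit_inv h, one_smul] at h2
  have hvol := measureReal_ramified hd hd0 h hH g hμ hΛ hn (hdual.symm ▸ hΛ)
  rw [hdual] at hvol
  have hKvol := measureReal_fiber μ hΛ.2 (basisRed B h) (basisRed_surjective h g) hK.1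
    (basisRed_eq_zero_iff h g) hKle
  rw [Fintype.card_pi_const, card_residueField] at hKvol
  have h1 := setIntegral_fiber μ hΛ.2 (basisRed B h) (basisRed_surjective h g) hK.1
    (basisRed_eq_zero_iff h g) hKle
    (fun x => psi p F (m⁻¹ * herm H x)) (continuous_psi_herm hd h hH _)
    (fun w => ∏ i, χ (IsLocalRing.residue 𝒪[F] (c i) *
      ((IsLocalRing.residue 𝒪[F] 2)⁻¹ * w i) ^ 2)) (by
      intro x
      have hx := (mem_basisLattice h _).1 x.2
      choose α β hαβ using fun i => g.exists_int_rep (B.repr x i) (hx i)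
      have hq : herm H x = ((∑ i, c i * α i ^ 2 : 𝒪[F]) : F) +
          m * ((∑ i, c i * β i ^ 2 : 𝒪[F]) : F) := by
        rw [herm_basis h hH hBc hB]
        push_cast
        rw [Finset.mul_sum, ← Finset.sum_add_distrib]
        refine Finset.sum_congr rfl fun i _ => ?_
        rw [hαβ, g.norm_add h]
        ring
      have h3 : m⁻¹ * herm H x = m⁻¹ * ((∑ i, c i * α i ^ 2 : 𝒪[F]) : F) +
          ((∑ i, c i * β i ^ 2 : 𝒪[F]) : F) := by
        rw [hq]; field_simp
      rw [h3, AddChar.map_add_eq_mul, hd.psi_eq_one (mul_mem (Subtype.coe_prop _) hd.mem_integer),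
        mul_one, ← hχ, map_sum, addChar_map_sum]
      refine Finset.prod_congr rfl fun i _ => ?_
      rw [basisRed_apply h g x i (α := α i) (hαβ i), map_mul _ 2, inv_mul_cancel_left₀ h2,
        map_mul, map_pow])
  have h4 : ∀ i, ∑ w, χ (IsLocalRing.residue 𝒪[F] (c i) *
      ((IsLocalRing.residue 𝒪[F] 2)⁻¹ * w) ^ 2) =
      resChar (c i) * gaussSum (quadCharC 𝓀[F]) χ := fun i => by
    refine (Equiv.sum_comp (Equiv.mulLeft₀ _ (inv_ne_zero h2))
      (fun w => χ (IsLocalRing.residue 𝒪[F] (c i) * w ^ 2))).trans ?_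
    rw [sum_addChar_mul_sq g.ringChar_ne_two hχ1 (hc i)]
    rfl
  have h5 : resChar (∏ i, c i) = ∏ i, resChar (c i) := by
    simp only [resChar_eq, map_prod]
  refine ⟨μ.real (basisLattice F B : Set V), measureReal_pos μ
    (M := (basisLattice F B).toAddSubgroup) hΛ.1 hΛ.2, by rw [← hvol]; ring, ?_⟩
  have hKvol' : (μ.real (basisLattice F B : Set V) : ℂ) =
      μ.real (scal (((g.unit e h)⁻¹ : Eˣ) : E) (basisLattice F B) : Set V) *
        (resCard F : ℂ) ^ (n + 1) := by
    have h6 := congrArg (fun t : ℝ => (t : ℂ)) hKvol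
    push_cast at h6
    exact h6
  rw [weilIndex_ramified hd hd0 h hH g hμ hΛ hn hle hdual.ge]
  have h6 := h1.trans (congrArg _ ((Fintype.prod_sum _).symm.trans
    (Finset.prod_congr rfl fun i _ => h4 i)))
  refine (congrArg _ h6).trans ?_
  rw [hKvol', Finset.prod_mul_distrib, Finset.prod_const, Finset.card_univ, Fintype.card_fin, h5]
  have h7 : ((scal (((g.unit e h)⁻¹ : Eˣ) : E) (basisLattice F B)).toAddSubgroup : Set V) =
    (scal (((g.unit e h)⁻¹ : Eˣ) : E) (basisLattice F B) : Set V) := rfl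
  rw [h7]
  ring

include hd hd0 h hH g hμ in
/-- The class modulo norms of the value `c` of `q` at a generator of `Λ / e Λ^∨`, for an almost
modular lattice `Λ` in odd dimension: comparing the Weil index computed from `Λ` with the one
computed from an orthogonal basis gives `c ∈ (-1)^{n/2} d_V Nm(E^×)`. -/
theorem resChar_eq_of_isHermDet [Module.Free E V] [Module.Finite E V] (hE : IsField E)
    (hV : Module.finrank E V = n + 1)
    (hn : Module.finrank F V = 2 * (n + 1)) (hev : Even n) {χ : AddChar 𝓀[F] ℂ}
    (hχ1 : χ ≠ 1) (hχ : ∀ x : 𝒪[F], χ (IsLocalRing.residue 𝒪[F] x) = psi p F (m⁻¹ * x))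
    {c : 𝒪[F]} {v : ℝ} (hv : 0 < v) (hv2 : v ^ 2 * (resCard F : ℝ) ^ (2 * n + 1) = 1)
    (hγ : weilIndex p H μ = (resCard F : ℂ) ^ n * v *
      (resChar c * gaussSum (quadCharC 𝓀[F]) χ)) {dV : F} (hdV : IsHermDet n H dV) :
    ∃ (z : Eˣ) (u : 𝒪[F]), IsLocalRing.residue 𝒪[F] u ≠ 0 ∧ resChar u = resChar c ∧
      (-1) ^ (n / 2) * dV = Algebra.norm F (z : E) * u := by
  have : CharZero F := charZero_of_injective_algebraMap (algebraMap ℚ_[p] F).injective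
  have hNp := resCard_pos F
  obtain ⟨B, a, ha, hBa, hB⟩ := exists_orthogonal_unit_basis h hH g hE hV
  obtain ⟨w, hw, hw2, hγ'⟩ := weilIndex_diagonal h hH g ha hBa hB hd hd0 hμ hn hχ1 hχ
  obtain ⟨z, hz⟩ := hdV.eq_norm_mul h hH hB
  obtain ⟨k, rfl⟩ := hev.two_dvd
  rw [Nat.mul_div_cancel_left _ two_pos]
  have hG := gaussSum_quadCharC_sq g hχ1
  have hm1 : IsLocalRing.residue 𝒪[F] (-1) ≠ 0 := by
    rw [map_neg (IsLocalRing.residue _), map_one]; exact neg_ne_zero.2 one_ne_zero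
  have hG0 : gaussSum (quadCharC 𝓀[F]) χ ≠ 0 := fun h0 => by
    rw [h0, zero_pow two_ne_zero] at hG
    exact mul_ne_zero (resChar_ne_zero hm1) (by exact_mod_cast hNp.ne') hG.symm
  -- both Weil indices carry the same positive factor
  have hvw : (resCard F : ℝ) ^ (2 * k) * v = w * (resCard F : ℝ) ^ k := by
    refine (sq_eq_sq₀ (by positivity) (by positivity)).1 ?_
    have h1 : ((resCard F : ℝ) ^ (2 * k) * v) ^ 2 * resCard F = 1 := by rw [← hv2]; ring
    have h2 : (w * (resCard F : ℝ) ^ k) ^ 2 * resCard F = 1 := by rw [← hw2]; ring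
    exact mul_right_cancel₀ hNp.ne' (h1.trans h2.symm)
  have hvw0 : (w : ℂ) * (resCard F : ℂ) ^ k ≠ 0 := by
    exact_mod_cast (mul_pos hw (pow_pos hNp k)).ne'
  have hvw' : (resCard F : ℂ) ^ (2 * k) * v = w * (resCard F : ℂ) ^ k := by exact_mod_cast hvw
  rw [hγ', hvw', pow_succ, pow_mul, hG, mul_pow] at hγ
  have h3 : resChar (∏ i, a i) * resChar (-1 : 𝒪[F]) ^ k = resChar c := by
    refine mul_left_cancel₀ (mul_ne_zero hvw0 hG0) ?_
    linear_combination hγ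
  have h4 : ∀ j : ℕ, resChar ((-1 : 𝒪[F]) ^ j) = resChar (-1 : 𝒪[F]) ^ j := fun j => by
    rw [resChar_eq, resChar_eq, map_pow, map_pow]
  refine ⟨z, (-1) ^ k * ∏ i, a i, ?_, ?_, ?_⟩
  · rw [map_mul, map_pow, map_prod]
    exact mul_ne_zero (pow_ne_zero _ hm1) (Finset.prod_ne_zero_iff.2 fun i _ => ha i)
  · rw [resChar_mul, h4, ← h3, mul_comm]
  · rw [hz]
    push_cast
    rw [Finset.prod_congr rfl fun i _ => hBa i]
    ring

end UnitBasis

/-! ### The modulus function on `w n(b)` -/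

section Modulus

variable {F : Type*} [Field F] [ValuativeRel F] [TopologicalSpace F] [IsNonarchimedeanLocalField F]
  {E : Type*} [CommRing E] [Algebra F E] {τ : E ≃ₐ[F] E} (h : IsQuadInvolution τ)

theorem mem_maxCompact_of_det {g : Matrix (Fin 2) (Fin 2) E} (hg : g ∈ U11 τ)
    (hint : ∀ i j, g i j ∈ intE F E) (hdet : g.det = 1) : g ∈ maxCompact τ := by
  let A : Matrix (Fin 2) (Fin 2) (intE F E) := Matrix.of fun i j => ⟨g i j, hint i j⟩
  have hA : A.map (algebraMap (intE F E) E) = g := by ext i j; rfl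
  have h1 : A.det = 1 := by
    apply Subtype.ext
    have h2 := RingHom.map_det (algebraMap (intE F E) E) A
    rw [RingHom.mapMatrix_apply, hA, hdet] at h2
    exact h2
  exact ⟨hg, Matrix.GeneralLinearGroup.mk'' A (h1 ▸ isUnit_one), hA⟩

/-- The entries of a matrix in `K` and the inverse of its determinant are integral. -/
theorem det_unit_of_mem_maxCompact {k : Matrix (Fin 2) (Fin 2) E} (hk : k ∈ maxCompact τ) :
    (∀ i j, k i j ∈ intE F E) ∧ ∃ v ∈ intE F E, k.det * v = 1 := by
  obtain ⟨_, A, rfl⟩ := hk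
  refine ⟨fun i j => (A.1 i j).2, ((A⁻¹ : GL (Fin 2) (intE F E)).1.det : E), Subtype.coe_prop _, ?_⟩
  have h1 := RingHom.map_det (algebraMap (intE F E) E) A.1
  rw [RingHom.mapMatrix_apply] at h1
  rw [← h1]
  have h2 : A.1.det * (A⁻¹ : GL (Fin 2) (intE F E)).1.det = 1 := by
    rw [← Matrix.det_mul, ← Units.val_mul, mul_inv_cancel, Units.val_one, Matrix.det_one]
  exact congrArg Subtype.val h2

theorem modulus_eq {g : Matrix (Fin 2) (Fin 2) E} {t : ℝ}
    (hex : ∃ (b : F) (a : Eˣ) (k : Matrix (Fin 2) (Fin 2) E), k ∈ maxCompact τ ∧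
      g = nMat E b * mMat τ a * k)
    (huniq : ∀ (b : F) (a : Eˣ) (k : Matrix (Fin 2) (Fin 2) E), k ∈ maxCompact τ →
      g = nMat E b * mMat τ a * k → Real.sqrt (absV (Algebra.norm F (a : E))) = t) :
    modulus τ g = t := by
  have h1 : ∃ t : ℝ, ∃ (b : F) (a : Eˣ) (k : Matrix (Fin 2) (Fin 2) E), k ∈ maxCompact τ ∧
      g = nMat E b * mMat τ a * k ∧ t = Real.sqrt (absV (Algebra.norm F (a : E))) := by
    obtain ⟨b, a, k, hk, hg⟩ := hex
    exact ⟨_, b, a, k, hk, hg, rfl⟩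
  rw [modulus, dif_pos h1]
  obtain ⟨b, a, k, hk, hg, ht⟩ := h1.choose_spec
  rw [ht, huniq b a k hk hg]

/-- The bottom row in an Iwasawa decomposition of `w n(b)`. -/
theorem bottom_row {b β : F} {a : Eˣ} {k : Matrix (Fin 2) (Fin 2) E}
    (hg : wMat E * nMat E b = nMat E β * mMat τ a * k) :
    k 1 0 = -τ a ∧ k 1 1 = -(τ a * algebraMap F E b) := by
  have h10 := congrFun (congrFun hg 1) 0
  have h11 := congrFun (congrFun hg 1) 1
  simp only [wMat, nMat, mMat, Matrix.mul_apply, Fin.sum_univ_two, Matrix.of_apply,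
    Matrix.cons_val', Matrix.cons_val_zero, Matrix.cons_val_one, Matrix.cons_val_fin_one,
    mul_zero, zero_mul, mul_one, one_mul, add_zero, zero_add] at h10 h11
  have h1 : τ (a : E) * τ ((a⁻¹ : Eˣ) : E) = 1 := by
    rw [← map_mul, Units.mul_inv, map_one]
  constructor
  · linear_combination (-τ (a : E)) * h10 - k 1 0 * h1
  · linear_combination (-τ (a : E)) * h11 - k 1 1 * h1

include h in
theorem modulus_of_integer {b : F} (hb : b ∈ 𝒪[F]) : modulus τ (wMat E * nMat E b) = 1 := by
  have hb' : algebraMap F E b ∈ intE F E := algebraMap_mem_intE hb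
  refine modulus_eq ⟨0, 1, wMat E * nMat E b, mem_maxCompact_of_det ?_ ?_ ?_, ?_⟩ ?_
  · simp only [U11, Set.mem_ofPred_eq]
    ext i j
    fin_cases i <;> fin_cases j <;>
      simp [wMat, nMat, Matrix.mul_apply, Fin.sum_univ_two, Algebra.smul_def (R := F) (A := E)]
  · intro i j
    fin_cases i <;> fin_cases j <;>
      simp [wMat, nMat, Matrix.mul_apply, Fin.sum_univ_two, hb', zero_mem, one_mem]
  · simp [wMat, nMat, Matrix.det_fin_two]
  · simp [nMat, mMat, ← Matrix.one_fin_two]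
  · intro β a k hk hg
    obtain ⟨h10, h11⟩ := bottom_row hg
    obtain ⟨hint, v, hv, hdet⟩ := det_unit_of_mem_maxCompact hk
    rw [Matrix.det_fin_two, h10, h11] at hdet
    have hτa : τ (a : E) ∈ intE F E := by rw [← neg_mem_iff, ← h10]; exact hint 1 0
    have h1 := h.unit_norm hτa
      (w := (k 0 1 - k 0 0 * algebraMap F E b) * v)
      (mul_mem (sub_mem (hint 0 1) (mul_mem (hint 0 0) hb')) hv) (by linear_combination hdet)
    rw [h.norm_conj] at h1
    rw [absV_eq_one_iff.2 h1, Real.sqrt_one]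

include h in
theorem modulus_of_notMem_integer {b : F} (hb : b ∉ 𝒪[F]) :
    modulus τ (wMat E * nMat E b) = (absV b)⁻¹ := by
  have hb0 : b ≠ 0 := by rintro rfl; exact hb (zero_mem _)
  have hbo : b⁻¹ ∈ 𝒪[F] := by
    rw [mem_integer_iff_ord hb0] at hb
    exact integer_of_ord (Or.inr (by rw [ord_inv hb0]; omega))
  have hb' : algebraMap F E b⁻¹ ∈ intE F E := algebraMap_mem_intE hbo
  have hbb : algebraMap F E b⁻¹ * algebraMap F E b = 1 := by
    rw [← map_mul, inv_mul_cancel₀ hb0, map_one]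
  refine modulus_eq ⟨-b⁻¹, ⟨algebraMap F E b⁻¹, algebraMap F E b, hbb, by rw [mul_comm, hbb]⟩,
    !![-1, 0; -algebraMap F E b⁻¹, -1], mem_maxCompact_of_det ?_ ?_ ?_, ?_⟩ ?_
  · simp only [U11, Set.mem_ofPred_eq]
    ext i j
    fin_cases i <;> fin_cases j <;>
      simp [-map_inv₀, wMat, Matrix.mul_apply, Fin.sum_univ_two, Algebra.smul_def (R := F) (A := E)]
  · intro i j
    fin_cases i <;> fin_cases j <;> simp [-map_inv₀, hb', zero_mem, one_mem]
  · simp [Matrix.det_fin_two]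
  · ext i j
    fin_cases i <;> fin_cases j <;>
      simp [-map_inv₀, wMat, nMat, mMat, Matrix.mul_apply, Fin.sum_univ_two, hbb,
        Algebra.smul_def (R := F) (A := E), mul_comm (algebraMap F E b)]
  · intro β a k hk hg
    obtain ⟨h10, h11⟩ := bottom_row hg
    obtain ⟨hint, v, hv, hdet⟩ := det_unit_of_mem_maxCompact hk
    have hy : τ (a : E) * algebraMap F E b ∈ intE F E := by
      rw [← neg_mem_iff, ← h11]; exact hint 1 1
    rw [Matrix.det_fin_two, h10, h11] at hdet
    have h1 := h.unit_norm hy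
      (w := (k 0 1 * algebraMap F E b⁻¹ - k 0 0) * v)
      (mul_mem (sub_mem (mul_mem (hint 0 1) hb') (hint 0 0)) hv)
      (by linear_combination hdet + (k 0 1 * τ (a : E) * v) * hbb)
    rw [map_mul, h.norm_conj, h.norm_algebraMap] at h1
    have h2 := absV_eq_one_iff.2 h1
    rw [sq, absV_mul, absV_mul] at h2
    have hp := absV_pos hb0
    have h3 : absV (Algebra.norm F (a : E)) = (absV b)⁻¹ ^ 2 := by
      field_simp
      linear_combination h2
    rw [h3, Real.sqrt_sq (inv_nonneg.2 hp.le)]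

end Modulus

/-! ### Balls and shells in `F` -/

section Shells

variable {p : ℕ} [hp : Fact p.Prime] {F : Type*} [Field F] [Algebra ℚ_[p] F]
  [ValuativeRel F] [TopologicalSpace F] [IsNonarchimedeanLocalField F]

variable (F) in
/-- The fractional ideal `π⁻ᵏ 𝒪_F`. -/
def ball (k : ℕ) : AddSubgroup F := 𝒪[F].toAddSubgroup.comap (AddMonoidHom.mulLeft (unif F ^ k))

theorem mem_ball {k : ℕ} {b : F} : b ∈ ball F k ↔ unif F ^ k * b ∈ 𝒪[F] := Iff.rfl

theorem mem_ball_iff_ord {k : ℕ} {b : F} (hb : b ≠ 0) : b ∈ ball F k ↔ -(k : ℤ) ≤ ord b := by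
  have h1 := unif_ne_zero F
  rw [mem_ball, mul_mem_integer_iff (pow_ne_zero _ h1) hb, ord_pow h1, ord_unif]
  constructor <;> intro h <;> linarith

theorem coe_ball_zero : (ball F 0 : Set F) = 𝒪[F] := by
  ext b
  rw [SetLike.mem_coe, mem_ball, pow_zero, one_mul, SetLike.mem_coe]

theorem ball_mono {j k : ℕ} (hjk : j ≤ k) : ball F j ≤ ball F k := by
  intro b hb
  rcases eq_or_ne b 0 with rfl | hb0
  · exact zero_mem _
  · rw [mem_ball_iff_ord hb0] at hb ⊢
    have : (j : ℤ) ≤ k := by exact_mod_cast hjk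
    linarith

theorem isOpen_ball (k : ℕ) : IsOpen (ball F k : Set F) :=
  isOpen_integer.preimage (continuous_const.mul continuous_id)

theorem isCompact_ball (k : ℕ) : IsCompact (ball F k : Set F) := by
  have h1 := pow_ne_zero k (unif_ne_zero F)
  have h2 : (ball F k : Set F) = (fun b => (unif F ^ k)⁻¹ * b) '' (𝒪[F] : Set F) := by
    ext b
    constructor
    · intro hb
      exact ⟨unif F ^ k * b, hb, inv_mul_cancel_left₀ h1 b⟩
    · rintro ⟨b, hb, rfl⟩
      rw [SetLike.mem_coe, mem_ball, mul_inv_cancel_left₀ h1]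
      exact hb
  rw [h2]
  exact isCompact_integer.image (continuous_const.mul continuous_id)

variable (F) in
/-- The partition of `F` into `𝒪_F` and the sets `{v(b) = -k}` with `k ≥ 1`. -/
def shell : ℕ → Set F
  | 0 => 𝒪[F]
  | k + 1 => {b | b ≠ 0 ∧ ord b = -((k : ℤ) + 1)}

theorem shell_zero : shell F 0 = (ball F 0 : Set F) := coe_ball_zero.symm

theorem mem_shell_succ {k : ℕ} {b : F} :
    b ∈ shell F (k + 1) ↔ b ≠ 0 ∧ ord b = -((k : ℤ) + 1) := Iff.rfl

theorem shell_succ (k : ℕ) : shell F (k + 1) = (ball F (k + 1) : Set F) \ ball F k := by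
  ext b
  rw [mem_shell_succ, Set.mem_sdiff, SetLike.mem_coe, SetLike.mem_coe]
  rcases eq_or_ne b 0 with rfl | hb
  · simp [zero_mem]
  · rw [mem_ball_iff_ord hb, mem_ball_iff_ord hb]
    push_cast
    constructor
    · rintro ⟨_, h⟩; constructor <;> omega
    · rintro ⟨h1, h2⟩; exact ⟨hb, by omega⟩

theorem shell_subset_ball (k : ℕ) : shell F k ⊆ ball F k := by
  cases k with
  | zero => rw [shell_zero]
  | succ k => rw [shell_succ]; exact Set.sdiff_subset

theorem iUnion_shell : ⋃ k, shell F k = Set.univ := by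
  refine Set.eq_univ_of_forall fun b => Set.mem_iUnion.2 ?_
  by_cases hb : b ∈ 𝒪[F]
  · exact ⟨0, hb⟩
  · have hb0 : b ≠ 0 := by rintro rfl; exact hb (zero_mem _)
    rw [mem_integer_iff_ord hb0] at hb
    refine ⟨(-ord b).toNat - 1 + 1, mem_shell_succ.2 ⟨hb0, by omega⟩⟩

theorem pairwise_disjoint_shell : Pairwise (Function.onFun Disjoint (shell F)) := by
  have key : ∀ j k, j < k → Disjoint (shell F j) (shell F k) := by
    intro j k hjk
    obtain ⟨k, rfl⟩ : ∃ i, k = i + 1 := ⟨k - 1, by omega⟩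
    rw [shell_succ]
    exact Set.disjoint_sdiff_right.mono_left
      ((shell_subset_ball j).trans (ball_mono (by omega)))
  intro j k hjk
  rcases lt_or_gt_of_ne hjk with h | h
  · exact key j k h
  · exact (key k j h).symm

variable [MeasurableSpace F] [BorelSpace F]

theorem measurableSet_ball (k : ℕ) : MeasurableSet (ball F k : Set F) := (isOpen_ball k).measurableSet

theorem measurableSet_shell (k : ℕ) : MeasurableSet (shell F k) := by
  cases k with
  | zero => rw [shell_zero]; exact measurableSet_ball 0
  | succ k => rw [shell_succ]; exact (measurableSet_ball _).diff (measurableSet_ball _)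

variable [ContinuousSMul ℚ_[p] F] [FiniteDimensional ℚ_[p] F] (ν : Measure F) [ν.IsAddHaarMeasure]

theorem setIntegral_shell_succ {f : F → ℂ} (hf : Continuous f) (k : ℕ) :
    ∫ b in shell F (k + 1), f b ∂ν = ∫ b in (ball F (k + 1) : Set F), f b ∂ν -
      ∫ b in (ball F k : Set F), f b ∂ν := by
  have h1 := hf.continuousOn.integrableOn_compact (μ := ν) (isCompact_ball (k + 1))
  rw [shell_succ, eq_sub_iff_add_eq, ← setIntegral_union Set.disjoint_sdiff_left
    (measurableSet_ball k) (h1.mono_set Set.sdiff_subset) (h1.mono_set (ball_mono (Nat.le_succ k))),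
    Set.sdiff_union_of_subset (ball_mono (Nat.le_succ k))]

include p in
theorem measureReal_ball (k : ℕ) :
    ν.real (ball F k : Set F) = (resCard F : ℝ) ^ k * ν.real (𝒪[F] : Set F) := by
  have h1 := unif_ne_zero F
  have h2 := scalesBy_smul p ν (pow_ne_zero k h1)
  have h3 := absV_pos (pow_ne_zero k h1)
  rw [Module.finrank_self, pow_one] at h2
  have h4 := h2.measureReal (inv_pos.2 h3) (continuous_const_smul _) isOpen_integer.measurableSet
  rw [absV_eq (pow_ne_zero k h1), ord_pow h1, ord_unif, mul_one, zpow_neg, inv_inv,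
    zpow_natCast] at h4
  exact h4

variable {d : F} (hd : IsDifferent p d)

include hd in
/-- The integral of a character over `π⁻ᵏ 𝒪_F`. -/
theorem setIntegral_ball_of_mem {a : F} {k : ℕ} (ha : a ≠ 0) (hk : (k : ℤ) ≤ ord a + ord d) :
    ∫ b in (ball F k : Set F), psi p F (-(a * b)) ∂ν = ν.real (ball F k : Set F) := by
  rw [setIntegral_congr_fun (measurableSet_ball k) (g := fun _ => 1), setIntegral_const]
  · simp
  · intro b hb
    apply hd.psi_eq_one
    rw [neg_mul, neg_mem_iff]
    rcases eq_or_ne b 0 with rfl | hb0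
    · rw [mul_zero, zero_mul]; exact zero_mem _
    · have h1 := (mem_ball_iff_ord hb0).1 hb
      rw [mul_mem_integer_iff (mul_ne_zero ha hb0) hd.1, ord_mul ha hb0]
      linarith

include hd in
theorem exists_psi_ne_one {c : F} (hc : c ≠ 0) {j : ℤ} (hj : ord c + j + ord d < 0) :
    ∃ l : F, l ≠ 0 ∧ j ≤ ord l ∧ psi p F (-(c * l)) ≠ 1 := by
  have hcj : c * unif F ^ j ≠ 0 := mul_ne_zero hc (zpow_ne_zero _ (unif_ne_zero F))
  have h1 : ¬ (c * unif F ^ j * d ∈ 𝒪[F]) := by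
    rw [mul_mem_integer_iff hcj hd.1, ord_mul hc (zpow_ne_zero _ (unif_ne_zero F)),
      ord_unif_zpow]
    linarith
  rw [← hd.psi_iff] at h1
  push Not at h1
  obtain ⟨y, hy, hy1⟩ := h1
  have hy0 : y ≠ 0 := by rintro rfl; simp at hy1
  refine ⟨unif F ^ j * -y, mul_ne_zero (zpow_ne_zero _ (unif_ne_zero F)) (neg_ne_zero.2 hy0), ?_, ?_⟩
  · rw [ord_mul (zpow_ne_zero _ (unif_ne_zero F)) (neg_ne_zero.2 hy0), ord_unif_zpow, ord_neg]
    linarith [ord_nonneg hy]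
  · convert hy1 using 2
    ring

include hd in
theorem setIntegral_ball_of_notMem {a : F} {k : ℕ} (ha : a ≠ 0) (hk : ord a + ord d < k) :
    ∫ b in (ball F k : Set F), psi p F (-(a * b)) ∂ν = 0 := by
  obtain ⟨l, hl0, hl, hl1⟩ := exists_psi_ne_one hd ha (j := -(k : ℤ)) (by linarith)
  refine setIntegral_eq_zero_of_translate ν (measurableSet_ball k) _ ((mem_ball_iff_ord hl0).2 hl)
    hl1 fun b _ => ?_
  rw [mul_add, neg_add, AddChar.map_add_eq_mul]

include hd in
/-- The self-dual measure of `𝒪_F` is `|d|^{1/2}`. -/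
theorem measureReal_integer_sq {ν : Measure F}
    (hν : IsSelfDualMeasure (fun x y : F => addChar p (x * y)) ν) :
    ν.real (𝒪[F] : Set F) ^ 2 = absV d := by
  have := hν.1
  have hdO := hd.mem_integer
  obtain ⟨δ, hδ⟩ := Int.eq_ofNat_of_zero_le (ord_nonneg hdO)
  have h0 : ν.real (𝒪[F] : Set F) = ν.real (ball F 0 : Set F) := by rw [coe_ball_zero]
  have h1 : ∀ x : F, fourier (fun x y : F => addChar p (x * y)) ν ((ball F 0 : Set F).indicator 1) x
      = (ball F δ : Set F).indicator (fun _ => (ν.real (𝒪[F] : Set F) : ℂ)) x := by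
    intro x
    have h2 : fourier (fun x y : F => addChar p (x * y)) ν ((ball F 0 : Set F).indicator 1) x =
        ∫ b in (ball F 0 : Set F), psi p F (-(-x * b)) ∂ν := by
      rw [← integral_indicator (measurableSet_ball 0)]
      refine integral_congr_ae (Eventually.of_forall fun b => ?_)
      by_cases hb : b ∈ (ball F 0 : Set F)
      · simp only [Set.indicator_of_mem hb, Pi.one_apply, one_mul, neg_mul, neg_neg]
        rfl
      · simp only [Set.indicator_of_notMem hb, zero_mul]
    rw [h2, h0]
    rcases eq_or_ne x 0 with rfl | hx
    · rw [Set.indicator_of_mem (zero_mem (ball F δ))]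
      simp
    · by_cases hxδ : x ∈ (ball F δ : Set F)
      · rw [Set.indicator_of_mem hxδ]
        rw [SetLike.mem_coe, mem_ball_iff_ord hx] at hxδ
        exact setIntegral_ball_of_mem ν hd (neg_ne_zero.2 hx) (by rw [ord_neg]; push_cast; linarith)
      · rw [Set.indicator_of_notMem hxδ]
        rw [SetLike.mem_coe, mem_ball_iff_ord hx] at hxδ
        exact setIntegral_ball_of_notMem ν hd (neg_ne_zero.2 hx)
          (by rw [ord_neg]; push_cast; linarith)
  have hSB := isSchwartzBruhat_indicator (isOpen_ball (F := F) 0) (isCompact_ball 0)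
  have h3 := hν.2 _ hSB 0
  rw [neg_zero, Set.indicator_of_mem (zero_mem (ball F 0)), fourier] at h3
  simp only [h1] at h3
  have h4 : (fun y => (ball F δ : Set F).indicator (fun _ => (ν.real (𝒪[F] : Set F) : ℂ)) y *
      addChar p (0 * y)) = (ball F δ : Set F).indicator (fun _ => (ν.real (𝒪[F] : Set F) : ℂ)) := by
    funext y
    rw [zero_mul, addChar_eq_psi, AddChar.map_zero_eq_one, mul_one]
  rw [h4, integral_indicator (measurableSet_ball δ), setIntegral_const, measureReal_ball (p := p)] at h3
  rw [absV_eq hd.1, hδ, zpow_neg]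
  refine eq_inv_of_mul_eq_one_left ?_
  have h5 : (((resCard F : ℝ) ^ δ * ν.real (𝒪[F] : Set F) * ν.real (𝒪[F] : Set F) : ℝ) : ℂ) = 1 := by
    rw [Complex.ofReal_mul]
    exact h3
  have h6 := Complex.ofReal_eq_one.1 h5
  rw [← h6]
  norm_cast
  ring

end Shells

/-! ### The Whittaker integral as a sum over shells -/

section Whittaker

variable {p : ℕ} [hp : Fact p.Prime] {F : Type*} [Field F] [Algebra ℚ_[p] F]
  [ValuativeRel F] [TopologicalSpace F] [IsNonarchimedeanLocalField F]

theorem resCard_ne_zero : (resCard F : ℂ) ≠ 0 := by exact_mod_cast (one_lt_resCard F).ne_bot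

theorem inv_pow_cpow (k : ℕ) (s : ℂ) :
    ((((resCard F : ℝ)⁻¹ ^ k : ℝ)) : ℂ) ^ s = (resCard F : ℂ) ^ (-(k * s)) := by
  have h1 : ((((resCard F : ℝ)⁻¹ ^ k : ℝ)) : ℂ) = (((resCard F ^ k : ℕ)) : ℂ)⁻¹ := by
    push_cast; rw [inv_pow]
  rw [h1, Complex.inv_cpow _ _ (by rw [Complex.natCast_arg]; exact Real.pi_pos.ne),
    Complex.cpow_neg, Complex.natCast_cpow_natCast_mul]
  push_cast
  rfl

theorem norm_inv_pow_cpow (k : ℕ) (s : ℂ) :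
    ‖((((resCard F : ℝ)⁻¹ ^ k : ℝ)) : ℂ) ^ s‖ = ((resCard F : ℝ) ^ (-s.re)) ^ k := by
  have hN := resCard_pos F
  rw [Complex.norm_cpow_eq_rpow_re_of_pos (by positivity), ← Real.rpow_natCast,
    ← Real.rpow_mul (by positivity), mul_comm, Real.rpow_mul (by positivity), Real.rpow_natCast,
    Real.inv_rpow hN.le, Real.rpow_neg hN.le]

variable {E : Type*} [CommRing E] [Algebra F E] {τ : E ≃ₐ[F] E} (h : IsQuadInvolution τ)

include h in
theorem modulus_of_mem_shell {k : ℕ} {b : F} (hb : b ∈ shell F k) :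
    modulus τ (wMat E * nMat E b) = (resCard F : ℝ)⁻¹ ^ k := by
  cases k with
  | zero => rw [modulus_of_integer h hb, pow_zero]
  | succ k =>
    obtain ⟨hb0, hbo⟩ := mem_shell_succ.1 hb
    rw [modulus_of_notMem_integer h (by rw [mem_integer_iff_ord hb0]; omega), absV_eq hb0, hbo,
      neg_neg, inv_pow]
    norm_cast

variable {V : Type*} [AddCommGroup V] [Module F V] [Module E V] [IsScalarTower F E V]
  {H : V →ₗ[E] V →ₛₗ[(τ : E →+* E)] E} (hH : IsHermitian H) {d : F} (hd : IsDifferent p d)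
  [ContinuousSMul ℚ_[p] F] [FiniteDimensional ℚ_[p] F]
  [Module.Finite F V] [TopologicalSpace V]
  [IsTopologicalAddGroup V] [ContinuousSMul F V] [T2Space V]
  [MeasurableSpace F] [BorelSpace F] [MeasurableSpace V] [BorelSpace V] {μ : Measure V}
  {Λ : Submodule (intE F E) V} (hΛ : IsCompactOpen (Λ : Set V)) {ν : Measure F}

include hΛ in
theorem weilW_weilN_zero (b : F) :
    weilW p H μ (weilN p H b (Set.indicator (Λ : Set V) 1)) 0 =
      weilIndex p H μ * ∫ x in (Λ : Set V), psi p F (b * herm H x) ∂μ := by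
  rw [weilW, fourier, ← integral_indicator hΛ.1.measurableSet]
  congr 1
  refine integral_congr_ae (Eventually.of_forall fun x => ?_)
  have h1 : pairingV p H (0 : V) x = 1 := by
    rw [pairingV_eq, map_zero, LinearMap.zero_apply, AddChar.map_zero_eq_one]
  simp only [weilN, h1, mul_one, addChar_eq_psi]
  by_cases hx : x ∈ (Λ : Set V)
  · rw [Set.indicator_of_mem hx, Set.indicator_of_mem hx, Pi.one_apply, mul_one]
  · rw [Set.indicator_of_notMem hx, Set.indicator_of_notMem hx, mul_zero]

include hd h hH hΛ in
theorem continuous_setIntegral_psi_herm [μ.IsAddHaarMeasure] :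
    Continuous fun b : F => ∫ x in (Λ : Set V), psi p F (b * herm H x) ∂μ := by
  have := secondCountable_field p F
  have := locallyCompact_space p F V
  refine continuous_parametric_integral_of_continuous
    (f := fun (b : F) (x : V) => psi p F (b * herm H x)) ?_ hΛ.2
  exact hd.continuous_psi.comp
    (continuous_fst.mul ((continuous_herm (p := p) h hH).comp continuous_snd))

include hd h hH hΛ in
/-- If `∫_Λ ψ(b q)` decays like `|b|^{-(n+1)}` and the shell integrals `c k` vanish for large `k`,
then the Whittaker integral converges for `Re s > -n` and is the Dirichlet polynomial with
coefficients `c k`. -/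
theorem isWhittaker_of_shells [μ.IsAddHaarMeasure] [ν.IsAddHaarMeasure] {n : ℕ} {a : F}
    {c : ℕ → ℂ} {K : ℕ} {C : ℝ}
    (hc : ∀ k, ∫ b in shell F k, weilIndex p H μ *
      (∫ x in (Λ : Set V), psi p F (b * herm H x) ∂μ) * psi p F (-(a * b)) ∂ν = c k)
    (hK : ∀ k, K < k → c k = 0)
    (hC : ∀ k, ∀ b ∈ shell F k, ‖∫ x in (Λ : Set V), psi p F (b * herm H x) ∂μ‖ ≤
      C * ((resCard F : ℝ)⁻¹ ^ (n + 1)) ^ k) :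
    IsWhittaker p H ν μ (Set.indicator (Λ : Set V) 1) a (-n)
      fun s => ∑ k ∈ Finset.range (K + 1), (resCard F : ℂ) ^ (-(k * s)) * c k := by
  have hN := resCard_pos F
  have hN0 := resCard_ne_zero (F := F)
  refine ⟨?_, fun s hs => ?_⟩
  · refine Differentiable.fun_sum fun k _ => Differentiable.mul_const ?_ _
    exact (differentiable_id.const_mul _).neg.const_cpow (Or.inl hN0)
  let G : F → ℂ := fun b => weilIndex p H μ *
    (∫ x in (Λ : Set V), psi p F (b * herm H x) ∂μ) * psi p F (-(a * b))
  have hGc : Continuous G := (continuous_const.mul (continuous_setIntegral_psi_herm h hH hd hΛ)).mul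
    (hd.continuous_psi.comp (continuous_const.mul continuous_id).neg)
  have hf : ∀ k, ∀ b ∈ shell F k, whittakerIntegrand p H μ (Set.indicator (Λ : Set V) 1) a s b =
      ((((resCard F : ℝ)⁻¹ ^ k : ℝ)) : ℂ) ^ s * G b := by
    intro k b hb
    rw [whittakerIntegrand, modulus_of_mem_shell h hb, weilW_weilN_zero hΛ, addChar_eq_psi,
      mul_assoc]
  have hGi : ∀ k, IntegrableOn G (shell F k) ν := fun k =>
    (hGc.continuousOn.integrableOn_compact (isCompact_ball k)).mono_set (shell_subset_ball k)
  have hfi : ∀ k, IntegrableOn (whittakerIntegrand p H μ (Set.indicator (Λ : Set V) 1) a s)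
      (shell F k) ν := fun k =>
    IntegrableOn.congr_fun ((hGi k).const_mul _) (fun b hb => (hf k b hb).symm) (measurableSet_shell k)
  have hint : IntegrableOn (whittakerIntegrand p H μ (Set.indicator (Λ : Set V) 1) a s)
      (⋃ k, shell F k) ν := by
    refine integrableOn_iUnion_of_summable_integral_norm hfi ?_
    set A : ℝ := (resCard F : ℝ) ^ (-s.re)
    have hA : 0 < A := Real.rpow_pos_of_pos hN _
    -- the ratio of the majorant is `N ^ (-(Re s + n))`
    have hρ : A * (resCard F : ℝ)⁻¹ ^ n < 1 := by
      have h1 : A < (resCard F : ℝ) ^ (n : ℝ) :=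
        Real.rpow_lt_rpow_of_exponent_lt (by exact_mod_cast one_lt_resCard F) (by linarith)
      rw [Real.rpow_natCast] at h1
      rw [inv_pow, ← div_eq_mul_inv]
      exact (div_lt_one (by positivity)).2 h1
    refine Summable.of_nonneg_of_le (fun k => integral_nonneg fun _ => norm_nonneg _) (fun k => ?_)
      ((summable_geometric_of_lt_one (by positivity) hρ).mul_left
        (‖weilIndex p H μ‖ * C * ν.real (𝒪[F] : Set F)))
    have hCk : 0 ≤ C * ((resCard F : ℝ)⁻¹ ^ (n + 1)) ^ k := by
      have h2 : (shell F k).Nonempty := by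
        cases k with
        | zero => exact ⟨0, zero_mem 𝒪[F]⟩
        | succ k => exact ⟨unif F ^ (-((k : ℤ) + 1)), zpow_ne_zero _ (unif_ne_zero F),
            ord_unif_zpow _⟩
      obtain ⟨b, hb⟩ := h2
      exact (norm_nonneg _).trans (hC k b hb)
    have h1 : ∀ b ∈ shell F k,
        ‖‖whittakerIntegrand p H μ (Set.indicator (Λ : Set V) 1) a s b‖‖ ≤
        A ^ k * (‖weilIndex p H μ‖ * (C * ((resCard F : ℝ)⁻¹ ^ (n + 1)) ^ k)) := by
      intro b hb
      rw [norm_norm, hf k b hb, norm_mul, norm_inv_pow_cpow, norm_mul, norm_mul, norm_psi, mul_one]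
      gcongr
      exact hC k b hb
    have h2 := norm_setIntegral_le_of_norm_le_const (μ := ν)
      ((measure_mono (shell_subset_ball k)).trans_lt (isCompact_ball k).measure_lt_top) h1
    have h3 : ν.real (shell F k) ≤ (resCard F : ℝ) ^ k * ν.real (𝒪[F] : Set F) := by
      rw [← measureReal_ball (p := p)]
      exact measureReal_mono (shell_subset_ball k) (isCompact_ball k).measure_ne_top
    refine ((le_abs_self _).trans h2).trans ((mul_le_mul_of_nonneg_left h3
      (mul_nonneg (by positivity) (mul_nonneg (norm_nonneg _) hCk))).trans_eq ?_)
    rw [pow_succ, mul_pow, mul_pow, inv_pow _ k]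
    field_simp
  rw [iUnion_shell, integrableOn_univ] at hint
  refine ⟨hint, ?_⟩
  have hsum := hasSum_integral_iUnion (μ := ν)
    (f := whittakerIntegrand p H μ (Set.indicator (Λ : Set V) 1) a s) (fun k => measurableSet_shell k)
    pairwise_disjoint_shell (by rw [iUnion_shell, integrableOn_univ]; exact hint)
  rw [iUnion_shell, setIntegral_univ] at hsum
  have hterm : ∀ k, ∫ b in shell F k, whittakerIntegrand p H μ (Set.indicator (Λ : Set V) 1) a s b ∂ν
      = (resCard F : ℂ) ^ (-(k * s)) * c k := by
    intro k
    rw [setIntegral_congr_fun (measurableSet_shell k) (hf k), integral_const_mul, hc k,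
      inv_pow_cpow]
  rw [← hsum.tsum_eq, tsum_eq_sum (s := Finset.range (K + 1)) fun k hk => by
    rw [hterm, hK k (by simpa using hk), mul_zero]]
  exact (Finset.sum_congr rfl fun k _ => hterm k).symm

end Whittaker

/-! ### Radial integrands -/

/-- Summation by parts for the shell sums. -/
theorem shell_sum_eq (Y q t : ℂ) (δ r : ℕ) :
    1 + ∑ k ∈ Finset.range (r + δ), (1 - t) * Y ^ (k + 1) * q ^ (k + 1 - δ)
        - t * Y ^ (r + δ + 1) * q ^ (r + 1) =
      Y ^ δ * ((1 - t * (q * Y)) * ∑ j ∈ Finset.range (r + 1), (q * Y) ^ j) +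
        (1 - t * Y) * ∑ k ∈ Finset.range δ, Y ^ k := by
  induction r with
  | zero =>
    have h1 : ∑ k ∈ Finset.range (0 + δ), (1 - t) * Y ^ (k + 1) * q ^ (k + 1 - δ) =
        (1 - t) * (Y * ∑ k ∈ Finset.range δ, Y ^ k) := by
      rw [zero_add, Finset.mul_sum, Finset.mul_sum]
      refine Finset.sum_congr rfl fun k hk => ?_
      rw [Nat.sub_eq_zero_of_le (by have := Finset.mem_range.1 hk; omega), pow_zero, pow_succ]
      ring
    have h2 := mul_neg_geom_sum Y δ
    rw [h1]
    simp only [zero_add, Finset.sum_range_one, pow_zero, pow_one]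
    linear_combination -h2
  | succ r ih =>
    have h1 : r + δ + 1 - δ = r + 1 := by omega
    rw [show r + 1 + δ = r + δ + 1 by ring, Finset.sum_range_succ, Finset.sum_range_succ _ (r + 1), h1]
    rw [show r + 1 + 1 = r + 2 by ring, show r + δ + 1 + 1 = r + δ + 2 by ring]
    simp only [mul_pow] at ih ⊢
    linear_combination ih

section Radial

variable {p : ℕ} [hp : Fact p.Prime] {F : Type*} [Field F] [Algebra ℚ_[p] F]
  [ValuativeRel F] [TopologicalSpace F] [IsNonarchimedeanLocalField F]
  {E : Type*} [CommRing E] [Algebra F E] {τ : E ≃ₐ[F] E} (h : IsQuadInvolution τ)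
  {V : Type*} [AddCommGroup V] [Module F V] [Module E V] [IsScalarTower F E V]
  {H : V →ₗ[E] V →ₛₗ[(τ : E →+* E)] E} (hH : IsHermitian H) {d : F} (hd : IsDifferent p d)
  [ContinuousSMul ℚ_[p] F] [FiniteDimensional ℚ_[p] F]
  [Module.Finite F V] [TopologicalSpace V]
  [IsTopologicalAddGroup V] [ContinuousSMul F V] [T2Space V]
  [MeasurableSpace F] [BorelSpace F] [MeasurableSpace V] [BorelSpace V] {μ : Measure V}
  {Λ : Submodule (intE F E) V} (hΛ : IsCompactOpen (Λ : Set V)) {ν : Measure F}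

theorem resCard_cpow_shell (k : ℕ) (s : ℂ) :
    (resCard F : ℂ) ^ (-(k * s)) * (resCard F : ℂ) ^ k = ((resCard F : ℂ) ^ (1 - s)) ^ k := by
  rw [← Complex.cpow_nat_mul, ← Complex.cpow_natCast (resCard F : ℂ) k,
    ← Complex.cpow_add _ _ resCard_ne_zero]
  congr 1
  ring

variable [μ.IsAddHaarMeasure] [ν.IsAddHaarMeasure] {n : ℕ} {a : F} (ha : a ≠ 0) {g : ℕ → ℂ} {C : ℝ}
  (hG : ∀ k, ∀ b ∈ shell F k, ∫ x in (Λ : Set V), psi p F (b * herm H x) ∂μ = g k)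
  (hC : ∀ k, ‖g k‖ ≤ C * ((resCard F : ℝ)⁻¹ ^ (n + 1)) ^ k)

include hd ha hG in
theorem setIntegral_shell_radial (k : ℕ) :
    ∫ b in shell F k, weilIndex p H μ *
      (∫ x in (Λ : Set V), psi p F (b * herm H x) ∂μ) * psi p F (-(a * b)) ∂ν =
    weilIndex p H μ * g k * ∫ b in shell F k, psi p F (-(a * b)) ∂ν := by
  rw [← integral_const_mul]
  exact setIntegral_congr_fun (measurableSet_shell k) fun b hb => by
    simp only [hG k b hb]

include hd ha in
theorem setIntegral_shell_psi (k : ℕ) :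
    ∫ b in shell F k, psi p F (-(a * b)) ∂ν =
      if (k : ℤ) ≤ ord a + ord d then
        (if k = 0 then 1 else 1 - (resCard F : ℂ)⁻¹) * (resCard F : ℂ) ^ k * ν.real (𝒪[F] : Set F)
      else if (k : ℤ) = ord a + ord d + 1 ∧ k ≠ 0 then
        -(resCard F : ℂ)⁻¹ * (resCard F : ℂ) ^ k * ν.real (𝒪[F] : Set F)
      else 0 := by
  have hN := resCard_ne_zero (F := F)
  have hc : Continuous fun b : F => psi p F (-(a * b)) :=
    hd.continuous_psi.comp (continuous_const.mul continuous_id).neg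
  cases k with
  | zero =>
    rw [shell_zero]
    split_ifs with h1 h2 h2
    · rw [setIntegral_ball_of_mem ν hd ha h1, measureReal_ball (p := p)]
      simp
    · exact absurd rfl h2
    · exact absurd rfl h2.2
    · exact setIntegral_ball_of_notMem ν hd ha (not_le.1 h1)
  | succ k =>
    have hN' : (resCard F : ℂ)⁻¹ * (resCard F : ℂ) ^ (k + 1) = (resCard F : ℂ) ^ k := by
      rw [pow_succ]; field_simp
    rw [setIntegral_shell_succ ν hc]
    split_ifs with h1 h2 h2
    · exact h2.elim
    · rw [setIntegral_ball_of_mem ν hd ha h1, setIntegral_ball_of_mem ν hd ha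
        (by push_cast at h1; linarith), measureReal_ball (p := p), measureReal_ball (p := p)]
      push_cast
      linear_combination (ν.real (𝒪[F] : Set F) : ℂ) * hN'
    · rw [setIntegral_ball_of_notMem ν hd ha (not_le.1 h1), setIntegral_ball_of_mem ν hd ha
        (by have := h2.1; push_cast at this; linarith), measureReal_ball (p := p)]
      push_cast
      linear_combination (ν.real (𝒪[F] : Set F) : ℂ) * hN'
    · rw [setIntegral_ball_of_notMem ν hd ha (not_le.1 h1), setIntegral_ball_of_notMem ν hd ha,
        sub_zero]
      rw [not_and_or, not_not, or_iff_left (Nat.succ_ne_zero k)] at h2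
      push_cast at h1 h2 ⊢
      omega

include hd h hH hΛ ha hG hC in
theorem isWhittaker_radial_zero (hM : ord a + ord d < 0) :
    IsWhittaker p H ν μ (Set.indicator (Λ : Set V) 1) a (-n) fun _ => 0 := by
  have h1 := isWhittaker_of_shells (ν := ν) (a := a) (c := fun _ => 0) (K := 0) h hH hd hΛ
    (fun k => by
      rw [setIntegral_shell_radial hd ha hG, setIntegral_shell_psi hd ha, if_neg (by omega),
        if_neg (by omega), mul_zero])
    (fun _ _ => rfl) (fun k b hb => (congrArg norm (hG k b hb)).trans_le (hC k))
  simpa using h1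

include hd h hH hΛ ha hG hC in
/-- The Whittaker function when `∫_Λ ψ(b q)` only depends on `|b|`. -/
theorem isWhittaker_radial {M : ℕ} (hM : ord a + ord d = M) :
    IsWhittaker p H ν μ (Set.indicator (Λ : Set V) 1) a (-n) fun s =>
      weilIndex p H μ * ν.real (𝒪[F] : Set F) *
        (g 0 + ∑ k ∈ Finset.range M, (1 - (resCard F : ℂ)⁻¹) *
            ((resCard F : ℂ) ^ (1 - s)) ^ (k + 1) * g (k + 1)
          - (resCard F : ℂ)⁻¹ * ((resCard F : ℂ) ^ (1 - s)) ^ (M + 1) * g (M + 1)) := by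
  have h1 := isWhittaker_of_shells (ν := ν) (a := a) (K := M + 1) h hH hd hΛ
    (fun k => (setIntegral_shell_radial hd ha hG k).trans
      (congrArg _ (setIntegral_shell_psi hd ha k)))
    (fun k hk => by rw [if_neg (by omega), if_neg (by omega), mul_zero])
    (fun k b hb => (congrArg norm (hG k b hb)).trans_le (hC k))
  convert h1 using 1
  funext s
  rw [Finset.sum_range_succ, Finset.sum_range_succ', if_pos (by rw [hM]; simp), if_pos rfl,
    if_neg (by rw [hM]; push_cast; omega), if_pos (by rw [hM]; push_cast; omega)]
  have h2 : ∀ k ∈ Finset.range M, (resCard F : ℂ) ^ (-(((k + 1 : ℕ) : ℂ) * s)) *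
      (weilIndex p H μ * g (k + 1) * if ((k + 1 : ℕ) : ℤ) ≤ ord a + ord d then
        (if k + 1 = 0 then 1 else 1 - (resCard F : ℂ)⁻¹) * (resCard F : ℂ) ^ (k + 1) *
          ν.real (𝒪[F] : Set F)
      else if ((k + 1 : ℕ) : ℤ) = ord a + ord d + 1 ∧ k + 1 ≠ 0 then
        -(resCard F : ℂ)⁻¹ * (resCard F : ℂ) ^ (k + 1) * ν.real (𝒪[F] : Set F)
      else 0) = weilIndex p H μ * ν.real (𝒪[F] : Set F) * ((1 - (resCard F : ℂ)⁻¹) *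
        ((resCard F : ℂ) ^ (1 - s)) ^ (k + 1) * g (k + 1)) := by
    intro k hk
    rw [if_pos (by rw [hM]; have := Finset.mem_range.1 hk; push_cast; omega),
      if_neg (Nat.succ_ne_zero k), ← resCard_cpow_shell]
    ring
  rw [Finset.sum_congr rfl h2, ← Finset.mul_sum, ← resCard_cpow_shell (M + 1)]
  simp
  ring

end Radial

/-! ### Closed forms and central derivatives -/

section ClosedForm

/-- The function `A (Y^δ (1 - X / N) ∑_{j ≤ r} X^j + (1 - Y / N) ∑_{k < δ} Y^k)` of `s`, where
`X = κ N^{-(s + n)}` and `Y = N^{1 - s}`. -/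
def whittakerModel (N : ℕ) (κ A : ℂ) (n δ r : ℕ) (s : ℂ) : ℂ :=
  A * (((N : ℂ) ^ (1 - s)) ^ δ * ((1 - (N : ℂ)⁻¹ * (κ * (N : ℂ) ^ (-(s + n)))) *
      ∑ j ∈ Finset.range (r + 1), (κ * (N : ℂ) ^ (-(s + n))) ^ j) +
    (1 - (N : ℂ)⁻¹ * (N : ℂ) ^ (1 - s)) * ∑ k ∈ Finset.range δ, ((N : ℂ) ^ (1 - s)) ^ k)

variable {N : ℕ} (hN : 1 < N) (κ A : ℂ) (n δ r : ℕ)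

theorem whittakerModel_eq {s : ℂ} (hX : κ * (N : ℂ) ^ (-(s + n)) ≠ 1) (hY : (N : ℂ) ^ (1 - s) ≠ 1) :
    whittakerModel N κ A n δ r s =
      A * (((N : ℂ) ^ (1 - s)) ^ δ * ((1 - (N : ℂ)⁻¹ * (κ * (N : ℂ) ^ (-(s + n)))) *
        (1 - (κ * (N : ℂ) ^ (-(s + n))) ^ (r + 1))) / (1 - κ * (N : ℂ) ^ (-(s + n))) +
      (1 - (N : ℂ)⁻¹ * (N : ℂ) ^ (1 - s)) * (1 - ((N : ℂ) ^ (1 - s)) ^ δ) /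
        (1 - (N : ℂ) ^ (1 - s))) := by
  have h1 := mul_neg_geom_sum (κ * (N : ℂ) ^ (-(s + n))) (r + 1)
  have h2 := mul_neg_geom_sum ((N : ℂ) ^ (1 - s)) δ
  have hX' : 1 - κ * (N : ℂ) ^ (-(s + n)) ≠ 0 := sub_ne_zero.2 hX.symm
  have hY' : 1 - (N : ℂ) ^ (1 - s) ≠ 0 := sub_ne_zero.2 hY.symm
  rw [whittakerModel, ← h1, ← h2]
  field_simp

theorem whittakerModel_zero (h0 : N ≠ 0) : whittakerModel N κ A n δ r 0 =
    A * (N : ℂ) ^ δ * ((1 - (N : ℂ)⁻¹ * (κ * (N : ℂ) ^ (-(n : ℂ)))) *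
      ∑ j ∈ Finset.range (r + 1), (κ * (N : ℂ) ^ (-(n : ℂ))) ^ j) := by
  have h1 : (N : ℂ) ≠ 0 := by exact_mod_cast h0
  rw [whittakerModel, sub_zero, Complex.cpow_one, inv_mul_cancel₀ h1, zero_add]
  ring

theorem hasDerivAt_geom_sum (x : ℂ) (m : ℕ) : ∃ S' : ℂ,
    HasDerivAt (fun x : ℂ => ∑ j ∈ Finset.range (m + 1), x ^ j) S' x ∧
      (1 - x) * S' = ∑ j ∈ Finset.range (m + 1), x ^ j - (m + 1) * x ^ m := by
  have h1 : HasDerivAt (fun x : ℂ => ∑ j ∈ Finset.range (m + 1), x ^ j)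
      (∑ j ∈ Finset.range (m + 1), (j : ℂ) * x ^ (j - 1)) x :=
    HasDerivAt.fun_sum fun j _ => hasDerivAt_pow j x
  refine ⟨_, h1, ?_⟩
  have h2 : HasDerivAt (fun x : ℂ => (1 - x) * ∑ j ∈ Finset.range (m + 1), x ^ j) _ x :=
    ((hasDerivAt_id x).const_sub 1).mul h1
  have h3 : HasDerivAt (fun x : ℂ => (1 - x) * ∑ j ∈ Finset.range (m + 1), x ^ j)
      (-(((m + 1 : ℕ) : ℂ) * x ^ m)) x := by
    have h4 := (hasDerivAt_pow (m + 1) x).const_sub 1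
    rw [Nat.add_sub_cancel] at h4
    simpa only [mul_neg_geom_sum] using h4
  have h5 := h2.unique h3
  simp only [id] at h5
  push_cast at h5
  linear_combination h5

include hN in
/-- The derivative at `s = 0` of the model function. The summand with factor `1 - Y / N` vanishes
at `s = 0`, so only its first factor is differentiated. -/
theorem deriv_whittakerModel (hX : κ * (N : ℂ) ^ (-(n : ℂ)) ≠ 1)
    (hX' : (N : ℂ)⁻¹ * (κ * (N : ℂ) ^ (-(n : ℂ))) ≠ 1) :
    deriv (whittakerModel N κ A n δ r) 0 + r / 2 * Real.log N * whittakerModel N κ A n δ r 0 =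
      ((N : ℂ)⁻¹ * (κ * (N : ℂ) ^ (-(n : ℂ))) * Real.log N /
          (1 - (N : ℂ)⁻¹ * (κ * (N : ℂ) ^ (-(n : ℂ)))) - δ * Real.log N) *
        whittakerModel N κ A n δ r 0 +
      A * (N : ℂ) ^ δ * ((1 - (N : ℂ)⁻¹ * (κ * (N : ℂ) ^ (-(n : ℂ)))) /
        (2 * (1 - κ * (N : ℂ) ^ (-(n : ℂ))) ^ 2)) *
        (r * (1 - (κ * (N : ℂ) ^ (-(n : ℂ))) ^ (r + 2)) -
          (r + 2) * (κ * (N : ℂ) ^ (-(n : ℂ)) - (κ * (N : ℂ) ^ (-(n : ℂ))) ^ (r + 1))) *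
        Real.log N +
      A * (((N : ℂ) ^ δ - 1) / (N - 1)) * Real.log N := by
  have hN0 : (N : ℂ) ≠ 0 := by exact_mod_cast (by omega : N ≠ 0)
  have hN1 : (N : ℂ) - 1 ≠ 0 := sub_ne_zero.2 (by exact_mod_cast hN.ne')
  have hlog : Complex.log N = (Real.log N : ℂ) := Complex.natCast_log.symm
  set L : ℂ := (Real.log N : ℂ)
  set X : ℂ := κ * (N : ℂ) ^ (-(n : ℂ)) with hXdef
  have hdX : HasDerivAt (fun s : ℂ => κ * (N : ℂ) ^ (-(s + n))) (-(L * X)) 0 := by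
    have h1 := ((((hasDerivAt_id (0 : ℂ)).add_const (n : ℂ)).neg).const_cpow
      (c := (N : ℂ)) (Or.inl hN0)).const_mul κ
    simp only [id, Pi.neg_apply, zero_add, hlog] at h1
    refine h1.congr_deriv ?_
    rw [hXdef]
    ring
  have hdY : HasDerivAt (fun s : ℂ => (N : ℂ) ^ (1 - s)) (-(L * N)) 0 := by
    have h1 := ((hasDerivAt_id (0 : ℂ)).const_sub 1).const_cpow (c := (N : ℂ)) (Or.inl hN0)
    simp only [id, sub_zero, Complex.cpow_one, hlog] at h1
    refine h1.congr_deriv ?_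
    ring
  have hX0 : κ * (N : ℂ) ^ (-((0 : ℂ) + n)) = X := by rw [zero_add]
  have hY0 : (N : ℂ) ^ (1 - (0 : ℂ)) = N := by rw [sub_zero, Complex.cpow_one]
  obtain ⟨S', hS', hS'eq⟩ := hasDerivAt_geom_sum X r
  have hdS : HasDerivAt (fun s : ℂ => ∑ j ∈ Finset.range (r + 1), (κ * (N : ℂ) ^ (-(s + n))) ^ j)
      (S' * -(L * X)) 0 := by
    rw [← hX0] at hS'
    exact HasDerivAt.comp (0 : ℂ) hS' hdX
  have hdP : HasDerivAt (fun s : ℂ => 1 - (N : ℂ)⁻¹ * (κ * (N : ℂ) ^ (-(s + n))))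
      (-((N : ℂ)⁻¹ * -(L * X))) 0 := (hdX.const_mul _).const_sub 1
  have hdQ : HasDerivAt (fun s : ℂ => 1 - (N : ℂ)⁻¹ * (N : ℂ) ^ (1 - s))
      (-((N : ℂ)⁻¹ * -(L * N))) 0 := (hdY.const_mul _).const_sub 1
  have hdT : DifferentiableAt ℂ (fun s : ℂ => ∑ k ∈ Finset.range δ, ((N : ℂ) ^ (1 - s)) ^ k) 0 :=
    DifferentiableAt.fun_sum fun k _ => hdY.differentiableAt.pow k
  have hdYδ : HasDerivAt (fun s : ℂ => ((N : ℂ) ^ (1 - s)) ^ δ) (-(δ * L) * (N : ℂ) ^ δ) 0 := by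
    have h1 := hdY.pow δ
    rw [hY0] at h1
    refine h1.congr_deriv ?_
    cases δ with
    | zero => simp
    | succ m => rw [Nat.add_sub_cancel, pow_succ]; ring
  have hW := ((hdYδ.mul (hdP.mul hdS)).add (hdQ.mul hdT.hasDerivAt)).const_mul A
  have hW' : deriv (whittakerModel N κ A n δ r) 0 = _ := hW.deriv
  rw [hW', whittakerModel_zero κ A n δ r (by omega)]
  simp only [hX0, hY0, Pi.mul_apply]
  have hT := mul_neg_geom_sum (N : ℂ) δ
  have hS := mul_neg_geom_sum X (r + 1)
  have hTeq : ∑ k ∈ Finset.range δ, (N : ℂ) ^ k = ((N : ℂ) ^ δ - 1) / (N - 1) := by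
    rw [eq_div_iff hN1]; linear_combination -hT
  have hX1 : 1 - X ≠ 0 := sub_ne_zero.2 hX.symm
  have hX2 : 1 - (N : ℂ)⁻¹ * X ≠ 0 := sub_ne_zero.2 hX'.symm
  rw [hTeq, inv_mul_cancel₀ hN0, sub_self, zero_mul, add_zero]
  set S : ℂ := ∑ j ∈ Finset.range (r + 1), X ^ j
  set T : ℂ := ((N : ℂ) ^ δ - 1) / (N - 1)
  have hN' : (N : ℂ)⁻¹ * -(L * N) = -L := by field_simp
  have key : r / 2 * S - X * S' = (r * (1 - X ^ (r + 2)) - (r + 2) * (X - X ^ (r + 1))) /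
      (2 * (1 - X) ^ 2) := by
    rw [eq_div_iff (mul_ne_zero two_ne_zero (pow_ne_zero 2 hX1))]
    linear_combination (r * (1 - X) - 2 * X) * hS - 2 * X * (1 - X) * hS'eq
  have h3 : A * (N : ℂ) ^ δ * ((1 - (N : ℂ)⁻¹ * X) / (2 * (1 - X) ^ 2)) *
      (r * (1 - X ^ (r + 2)) - (r + 2) * (X - X ^ (r + 1))) * L =
      A * (N : ℂ) ^ δ * (1 - (N : ℂ)⁻¹ * X) * (r / 2 * S - X * S') * L := by
    rw [key]; ring
  have h4 : (N : ℂ)⁻¹ * X * L / (1 - (N : ℂ)⁻¹ * X) * (1 - (N : ℂ)⁻¹ * X) = (N : ℂ)⁻¹ * X * L :=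
    div_mul_cancel₀ _ hX2
  rw [h3, hN']
  linear_combination (-(A * (N : ℂ) ^ δ * S)) * h4

end ClosedForm

section EulerFactor

theorem logDeriv_eulerFactor {N : ℕ} (hN : N ≠ 0) (κ z : ℂ) (hz : κ * (N : ℂ) ^ (-z) ≠ 1) :
    logDeriv (fun s : ℂ => (1 - κ * (N : ℂ) ^ (-s))⁻¹) z =
      -(κ * (N : ℂ) ^ (-z) * Real.log N / (1 - κ * (N : ℂ) ^ (-z))) := by
  have hN0 : (N : ℂ) ≠ 0 := by exact_mod_cast hN
  have hz' : 1 - κ * (N : ℂ) ^ (-z) ≠ 0 := sub_ne_zero.2 hz.symm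
  have h1 := (((((hasDerivAt_id z).neg).const_cpow (c := (N : ℂ)) (Or.inl hN0)).const_mul
    κ).const_sub 1).inv (by simpa using hz')
  have h2 : deriv (fun s : ℂ => (1 - κ * (N : ℂ) ^ (-s))⁻¹) z = _ := h1.deriv
  rw [logDeriv_apply, h2, Complex.natCast_log]
  simp only [Pi.neg_apply, id]
  field_simp

variable {F : Type*} [Field F] [ValuativeRel F] [TopologicalSpace F] [IsNonarchimedeanLocalField F]

theorem absV_cpow {x : F} (hx : x ≠ 0) (z : ℂ) :
    (absV x : ℂ) ^ z = (resCard F : ℂ) ^ (-(ord x * z)) := by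
  have hN : (0 : ℝ) < resCard F := resCard_pos F
  rw [absV_eq hx, ← Real.rpow_intCast, ← Complex.cpow_mul_ofReal_nonneg hN.le,
    Complex.ofReal_natCast]
  congr 1
  push_cast
  ring

theorem log_absV {x : F} (hx : x ≠ 0) : Real.log (absV x) = -ord x * Real.log (resCard F) := by
  rw [absV_eq hx, Real.log_zpow]
  push_cast
  rfl

end EulerFactor

section UnramifiedForm

variable {F : Type*} [Field F] [ValuativeRel F] [TopologicalSpace F] [IsNonarchimedeanLocalField F]
  {d : F} (hd0 : d ≠ 0) {δ : ℕ} (hδ : ord d = δ) {κ : ℂ} (hκ : κ = 1 ∨ κ = -1) (γ : ℂ) (n r : ℕ)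

include hκ in
theorem sign_mul_cpow_ne_one {z : ℂ} (hz : z.re ≠ 0) : κ * (resCard F : ℂ) ^ (-z) ≠ 1 := by
  intro h
  have h1 := congrArg norm h
  have hκ1 : ‖κ‖ = 1 := by rcases hκ with rfl | rfl <;> simp
  rw [norm_mul, hκ1, one_mul, norm_one, Complex.norm_natCast_cpow_of_pos
    (by exact_mod_cast resCard_pos F)] at h1
  have hN : (1 : ℝ) < resCard F := by exact_mod_cast one_lt_resCard F
  have h2 := congrArg Real.log h1
  rw [Real.log_rpow (by linarith), Real.log_one, mul_eq_zero, Complex.neg_re, neg_eq_zero] at h2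
  exact h2.elim hz (Real.log_pos hN).ne'

include hd0 hδ in
/-- The model function in terms of powers of `|d|`. -/
theorem whittakerModel_unramified {s : ℂ} (hX : κ * (resCard F : ℂ) ^ (-(s + n)) ≠ 1)
    (hY : (resCard F : ℂ) ^ (-(s - 1)) ≠ 1) :
    whittakerModel (resCard F) κ (γ * (absV d : ℂ) ^ ((n : ℂ) + 3 / 2)) n δ r s =
      γ * ((absV d : ℂ) ^ (s + n + 1 / 2) * ((1 - κ * (resCard F : ℂ) ^ (-(s + n + 1))) *
          (1 - κ ^ (r + 1) * (resCard F : ℂ) ^ (-((r + 1) * (s + n))))) /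
            (1 - κ * (resCard F : ℂ) ^ (-(s + n))) +
        (absV d : ℂ) ^ ((n : ℂ) + 3 / 2) * ((1 - (resCard F : ℂ) ^ (-s)) *
          (1 - (absV d : ℂ) ^ (s - 1))) / (1 - (resCard F : ℂ) ^ (-(s - 1)))) := by
  have hN := resCard_ne_zero (F := F)
  have hY' : (resCard F : ℂ) ^ (1 - s) ≠ 1 := by rwa [neg_sub] at hY
  rw [whittakerModel_eq _ _ _ _ _ hX hY', neg_sub, absV_cpow hd0, absV_cpow hd0, absV_cpow hd0, hδ]
  have h1 : (resCard F : ℂ) ^ (-(((δ : ℤ) : ℂ) * (s + n + 1 / 2))) =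
      (resCard F : ℂ) ^ (-(((δ : ℤ) : ℂ) * (n + 3 / 2))) * ((resCard F : ℂ) ^ (1 - s)) ^ δ := by
    rw [← Complex.cpow_nat_mul, ← Complex.cpow_add _ _ hN]
    congr 1; push_cast; ring
  have h2 : (resCard F : ℂ) ^ (-(((δ : ℤ) : ℂ) * (s - 1))) = ((resCard F : ℂ) ^ (1 - s)) ^ δ := by
    rw [← Complex.cpow_nat_mul]
    congr 1; push_cast; ring
  have h3 : (resCard F : ℂ) ^ (-(s + n + 1)) = (resCard F : ℂ)⁻¹ * (resCard F : ℂ) ^ (-(s + n)) := by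
    rw [← Complex.cpow_neg_one, ← Complex.cpow_add _ _ hN]
    congr 1; ring
  have h4 : (resCard F : ℂ) ^ (-((r + 1) * (s + n))) = ((resCard F : ℂ) ^ (-(s + n))) ^ (r + 1) := by
    rw [← Complex.cpow_nat_mul]
    congr 1; push_cast; ring
  have h5 : (resCard F : ℂ) ^ (-s) = (resCard F : ℂ)⁻¹ * (resCard F : ℂ) ^ (1 - s) := by
    rw [← Complex.cpow_neg_one, ← Complex.cpow_add _ _ hN]
    congr 1; ring
  rw [h1, h2, h3, h4, h5]
  simp only [mul_pow]
  ring

include hd0 hδ hκ in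
/-- The central derivative of the model function in terms of powers of `|d|`. -/
theorem deriv_whittakerModel_unramified (hn : 1 ≤ n) :
    deriv (whittakerModel (resCard F) κ (γ * (absV d : ℂ) ^ ((n : ℂ) + 3 / 2)) n δ r) 0 +
        r / 2 * Real.log (resCard F) *
          whittakerModel (resCard F) κ (γ * (absV d : ℂ) ^ ((n : ℂ) + 3 / 2)) n δ r 0 =
      (-logDeriv (fun s : ℂ => (1 - κ * (resCard F : ℂ) ^ (-s))⁻¹) (n + 1) + Real.log (absV d)) *
        whittakerModel (resCard F) κ (γ * (absV d : ℂ) ^ ((n : ℂ) + 3 / 2)) n δ r 0 +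
      γ * ((absV d : ℂ) ^ ((n : ℂ) + 1 / 2) *
        ((1 - κ * (resCard F : ℂ) ^ (-((n : ℂ) + 1))) /
          (2 * (1 - κ * (resCard F : ℂ) ^ (-(n : ℂ))) ^ 2)) *
        (r * (1 - κ ^ r * (resCard F : ℂ) ^ (-((r + 2) * (n : ℂ)))) -
          (r + 2) * (κ * (resCard F : ℂ) ^ (-(n : ℂ)) -
            κ ^ (r + 1) * (resCard F : ℂ) ^ (-((r + 1) * (n : ℂ))))) * Real.log (resCard F) +
        (absV d : ℂ) ^ ((n : ℂ) + 1 / 2) * ((1 - (absV d : ℂ)) / (resCard F - 1)) *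
          Real.log (resCard F)) := by
  have hN := resCard_ne_zero (F := F)
  have h3 : (resCard F : ℂ) ^ (-((n : ℂ) + 1)) = (resCard F : ℂ)⁻¹ * (resCard F : ℂ) ^ (-(n : ℂ)) := by
    rw [← Complex.cpow_neg_one, ← Complex.cpow_add _ _ hN]
    congr 1; ring
  have hX : κ * (resCard F : ℂ) ^ (-(n : ℂ)) ≠ 1 :=
    sign_mul_cpow_ne_one hκ (by rw [Complex.natCast_re]; exact_mod_cast (by omega : n ≠ 0))
  have hX' : κ * (resCard F : ℂ) ^ (-((n : ℂ) + 1)) ≠ 1 :=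
    sign_mul_cpow_ne_one hκ (by
      rw [Complex.add_re, Complex.natCast_re, Complex.one_re]; positivity)
  have h6 : (absV d : ℂ) ^ ((n : ℂ) + 1 / 2) =
      (absV d : ℂ) ^ ((n : ℂ) + 3 / 2) * (resCard F : ℂ) ^ δ := by
    rw [absV_cpow hd0, absV_cpow hd0, ← Complex.cpow_natCast, ← Complex.cpow_add _ _ hN, hδ]
    congr 1; push_cast; ring
  have h7 : (absV d : ℂ) * (resCard F : ℂ) ^ δ = 1 := by
    rw [← Complex.cpow_one (absV d : ℂ), absV_cpow hd0, ← Complex.cpow_natCast,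
      ← Complex.cpow_add _ _ hN, hδ]
    simp
  have h8 : (resCard F : ℂ) ^ (-((r + 2) * (n : ℂ))) = ((resCard F : ℂ) ^ (-(n : ℂ))) ^ (r + 2) := by
    rw [← Complex.cpow_nat_mul]
    congr 1; push_cast; ring
  have h9 : (resCard F : ℂ) ^ (-((r + 1) * (n : ℂ))) = ((resCard F : ℂ) ^ (-(n : ℂ))) ^ (r + 1) := by
    rw [← Complex.cpow_nat_mul]
    congr 1; push_cast; ring
  have hκ2 : κ ^ 2 = 1 := by rcases hκ with rfl | rfl <;> norm_num
  have hN0 : resCard F ≠ 0 := by exact_mod_cast hN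
  rw [logDeriv_eulerFactor hN0 κ _ hX', log_absV hd0, hδ, h3, h6, h8, h9,
    deriv_whittakerModel (one_lt_resCard F) κ _ n δ r hX
      (by rw [h3] at hX'; convert hX' using 1; ring)]
  simp only [mul_pow, pow_add κ r 2, hκ2]
  push_cast
  have h10 : (absV d : ℂ) ^ ((n : ℂ) + 3 / 2) * (((resCard F : ℂ) ^ δ - 1) / (resCard F - 1)) =
      (absV d : ℂ) ^ ((n : ℂ) + 3 / 2) * (resCard F : ℂ) ^ δ *
        ((1 - (absV d : ℂ)) / (resCard F - 1)) := by
    rw [← mul_div_assoc, ← mul_div_assoc]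
    congr 1
    linear_combination (absV d : ℂ) ^ ((n : ℂ) + 3 / 2) * h7
  linear_combination γ * Complex.log (resCard F) * h10

end UnramifiedForm

/-! ### Whittaker functions of unimodular and of modular lattices -/

section RadialExamples

variable {p : ℕ} [hp : Fact p.Prime] {F : Type*} [Field F] [Algebra ℚ_[p] F]
  [ValuativeRel F] [TopologicalSpace F] [IsNonarchimedeanLocalField F]
  {E : Type*} [CommRing E] [Algebra F E] {τ : E ≃ₐ[F] E} (h : IsQuadInvolution τ)
  {V : Type*} [AddCommGroup V] [Module F V] [Module E V] [IsScalarTower F E V]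
  {H : V →ₗ[E] V →ₛₗ[(τ : E →+* E)] E} (hH : IsHermitian H) {d : F} (hd : IsDifferent p d)
  [ContinuousSMul ℚ_[p] F] [FiniteDimensional ℚ_[p] F]
  [Module.Finite F V] [TopologicalSpace V]
  [IsTopologicalAddGroup V] [ContinuousSMul F V] [T2Space V]
  [MeasurableSpace F] [BorelSpace F] [MeasurableSpace V] [BorelSpace V] {μ : Measure V}
  {Λ : Submodule (intE F E) V} (hΛ : IsCompactOpen (Λ : Set V)) {ν : Measure F}

theorem resCard_inv_pow_le (n : ℕ) {k l δ : ℕ} (hk : k ≤ l + δ) :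
    ((resCard F : ℝ)⁻¹ ^ (n + 1)) ^ l ≤
      ((resCard F : ℝ) ^ (n + 1)) ^ δ * ((resCard F : ℝ)⁻¹ ^ (n + 1)) ^ k := by
  have hN := resCard_pos F
  have h1 : (resCard F : ℝ)⁻¹ ^ (n + 1) ≤ 1 := pow_le_one₀ (by positivity)
    (inv_le_one_of_one_le₀ (by exact_mod_cast (one_lt_resCard F).le))
  have h2 := pow_le_pow_of_le_one (by positivity) h1 hk
  rw [pow_add] at h2
  refine le_trans (le_of_eq ?_) (mul_le_mul_of_nonneg_left h2 (by positivity))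
  rw [mul_comm, mul_assoc, ← mul_pow, ← mul_pow, inv_mul_cancel₀ hN.ne', one_pow, one_pow, mul_one]

variable [μ.IsAddHaarMeasure]

theorem mul_absV_pow {v D : ℝ} (hD : 0 < D) (hv0 : 0 ≤ v) (hv : v ^ 2 = D) (n : ℕ) :
    (v : ℂ) * ((D ^ (n + 1) : ℝ) : ℂ) = (D : ℂ) ^ ((n : ℂ) + 3 / 2) := by
  have h1 : (v : ℂ) = (D : ℂ) ^ (1 / 2 : ℂ) := by
    rw [← Real.sqrt_sq hv0, hv, Real.sqrt_eq_rpow, Complex.ofReal_cpow hD.le]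
    norm_num
  rw [h1, Complex.ofReal_pow, ← Complex.cpow_natCast,
    ← Complex.cpow_add _ _ (by exact_mod_cast hD.ne')]
  congr 1
  push_cast
  ring

include hd h hH hΛ in
/-- The Whittaker function attached to a lattice `Λ` on which `∫_Λ ψ(b q)` is
`(ε / N)^{(n + 1) k} vol(Λ)` for `v(b d) = -k ≤ 0`. -/
theorem isWhittaker_unramified (hν : IsSelfDualMeasure (fun x y : F => addChar p (x * y)) ν)
    {ε : ℂ} (hε1 : ε = 1 ∨ ε = -1) {n : ℕ} {a : F} (ha : a ≠ 0)
    (hvol : μ.real (Λ : Set V) = absV d ^ (n + 1))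
    (hint : ∀ b : F, b * d ∈ 𝒪[F] →
      ∫ x in (Λ : Set V), psi p F (b * herm H x) ∂μ = μ.real (Λ : Set V))
    (hε : ∀ (b : F) (k : ℕ), b ≠ 0 → ord (b * d) = -k →
      ∫ x in (Λ : Set V), psi p F (b * herm H x) ∂μ =
        ((ε * (resCard F : ℂ)⁻¹) ^ k) ^ (n + 1) * μ.real (Λ : Set V))
    {δ : ℕ} (hδ : ord d = δ) :
    ∃ W : ℂ → ℂ, IsWhittaker p H ν μ (Set.indicator (Λ : Set V) 1) a (-n) W ∧
      (∀ s, W s ≠ 0 → -ord d ≤ ord a) ∧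
      ∀ r : ℕ, ord a = r → W = whittakerModel (resCard F) (ε ^ (n + 1))
        (weilIndex p H μ * (absV d : ℂ) ^ ((n : ℂ) + 3 / 2)) n δ r := by
  have := hν.1
  have hN := resCard_pos F
  have hN0 := resCard_ne_zero (F := F)
  set q : ℂ := (ε * (resCard F : ℂ)⁻¹) ^ (n + 1) with hq
  have hnormε : ‖ε‖ = 1 := by rcases hε1 with rfl | rfl <;> simp
  have hnormq : ‖q‖ = (resCard F : ℝ)⁻¹ ^ (n + 1) := by
    rw [hq, norm_pow, norm_mul, hnormε, one_mul, norm_inv, Complex.norm_natCast]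
  have hG : ∀ k, ∀ b ∈ shell F k, ∫ x in (Λ : Set V), psi p F (b * herm H x) ∂μ =
      q ^ (k - δ) * μ.real (Λ : Set V) := by
    intro k b hb
    cases k with
    | zero =>
      rw [Nat.zero_sub, pow_zero, one_mul]
      exact hint b (mul_mem hb hd.mem_integer)
    | succ k =>
      obtain ⟨hb0, hb⟩ := mem_shell_succ.1 hb
      have h1 : ord (b * d) = -((k : ℤ) + 1) + δ := by rw [ord_mul hb0 hd.1, hb, hδ]
      rcases le_total (k + 1) δ with hk | hk
      · rw [Nat.sub_eq_zero_of_le hk, pow_zero, one_mul]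
        exact hint b (integer_of_ord (Or.inr (by rw [h1]; omega)))
      · rw [hε b (k + 1 - δ) hb0 (by rw [h1]; push_cast [hk]; ring), hq, ← pow_mul, ← pow_mul,
          mul_comm (n + 1)]
  have hC : ∀ k, ‖q ^ (k - δ) * (μ.real (Λ : Set V) : ℂ)‖ ≤
      (μ.real (Λ : Set V) * ((resCard F : ℝ) ^ (n + 1)) ^ δ) *
        ((resCard F : ℝ)⁻¹ ^ (n + 1)) ^ k := by
    intro k
    rw [norm_mul, norm_pow, hnormq, Complex.norm_real, Real.norm_of_nonneg measureReal_nonneg,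
      mul_comm, mul_assoc]
    exact mul_le_mul_of_nonneg_left (resCard_inv_pow_le n (by omega)) measureReal_nonneg
  rcases lt_or_ge (ord a + ord d) 0 with hneg | hnn
  · exact ⟨_, isWhittaker_radial_zero h hH hd hΛ ha hG hC hneg, fun s hs => absurd rfl hs,
      fun r hr => by omega⟩
  · obtain ⟨M, hM⟩ := Int.eq_ofNat_of_zero_le hnn
    refine ⟨_, isWhittaker_radial h hH hd hΛ ha hG hC hM, fun s _ => by omega, fun r hr => ?_⟩
    obtain rfl : M = r + δ := by omega
    funext s
    set Y := (resCard F : ℂ) ^ (1 - s)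
    have hqY : ε ^ (n + 1) * (resCard F : ℂ) ^ (-(s + n)) = q * Y := by
      have h1 : (resCard F : ℂ) ^ (-(s + n)) = (resCard F : ℂ)⁻¹ ^ (n + 1) * Y := by
        rw [inv_pow, ← Complex.cpow_natCast, ← Complex.cpow_neg, ← Complex.cpow_add _ _ hN0]
        congr 1
        push_cast
        ring
      rw [h1, hq, mul_pow]
      ring
    rw [whittakerModel, hqY, ← shell_sum_eq, ← mul_absV_pow (absV_pos hd.1)
      measureReal_nonneg (measureReal_integer_sq hd hν), ← hvol,
      show r + δ + 1 - δ = r + 1 by omega, Nat.zero_sub, pow_zero]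
    simp only [mul_sub, mul_add, Finset.mul_sum]
    congr 1
    · congr 1
      · ring
      · exact Finset.sum_congr rfl fun k _ => by ring
    · ring

include hd h hH hΛ in
/-- The Whittaker function attached to a lattice `Λ` with `vol(Λ) = N^{-(n + 1)}` on which
`∫_Λ ψ(b q)` is `N^{-(n + 1) j} vol(Λ)` for `v(b) = -(j + 1)`. -/
theorem isWhittaker_modular (hν : IsSelfDualMeasure (fun x y : F => addChar p (x * y)) ν)
    {n : ℕ} {a : F} (ha : a ≠ 0) (hd0 : ord d = 0) (hγ : weilIndex p H μ = 1)
    (hvol : μ.real (Λ : Set V) = (resCard F : ℝ)⁻¹ ^ (n + 1))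
    (hint : ∀ b ∈ 𝒪[F], ∫ x in (Λ : Set V), psi p F (b * herm H x) ∂μ = μ.real (Λ : Set V))
    (hε : ∀ (b : F) (j : ℕ), b ≠ 0 → ord b = -(j + 1) →
      ∫ x in (Λ : Set V), psi p F (b * herm H x) ∂μ =
        (((resCard F : ℂ)⁻¹) ^ j) ^ (n + 1) * μ.real (Λ : Set V)) :
    ∃ W : ℂ → ℂ, IsWhittaker p H ν μ (Set.indicator (Λ : Set V) 1) a (-n) W ∧
      (∀ s, W s ≠ 0 → 0 ≤ ord a) ∧
      ∀ r : ℕ, ord a = r → W = fun s => whittakerModel (resCard F) 1 1 n 0 r s -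
        (1 - (resCard F : ℂ)⁻¹ ^ (n + 1)) := by
  have := hν.1
  have hN := resCard_pos F
  have hN0 := resCard_ne_zero (F := F)
  have hv : ν.real (𝒪[F] : Set F) = 1 := by
    have h1 := measureReal_integer_sq hd hν
    rw [absV_eq_one_iff.2 ⟨hd.1, hd0⟩] at h1
    exact (pow_eq_one_iff_of_nonneg measureReal_nonneg two_ne_zero).1 h1
  set q : ℂ := (resCard F : ℂ)⁻¹ ^ (n + 1) with hq
  have hvol' : ((μ.real (Λ : Set V) : ℝ) : ℂ) = q := by rw [hvol, hq]; push_cast; rfl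
  have hnormq : ‖q‖ = (resCard F : ℝ)⁻¹ ^ (n + 1) := by
    rw [hq, norm_pow, norm_inv, Complex.norm_natCast]
  have hG : ∀ k, ∀ b ∈ shell F k, ∫ x in (Λ : Set V), psi p F (b * herm H x) ∂μ =
      q ^ (k - 1 + 1) := by
    intro k b hb
    cases k with
    | zero => rw [hint b hb, hvol', Nat.zero_sub, zero_add, pow_one]
    | succ k =>
      obtain ⟨hb0, hb⟩ := mem_shell_succ.1 hb
      rw [hε b k hb0 hb, hvol', hq, Nat.add_sub_cancel, ← pow_mul, ← pow_mul, ← pow_add]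
      congr 1
      ring
  have hC : ∀ k, ‖q ^ (k - 1 + 1)‖ ≤ (((resCard F : ℝ) ^ (n + 1)) ^ 0) *
        ((resCard F : ℝ)⁻¹ ^ (n + 1)) ^ k := by
    intro k
    rw [norm_pow, hnormq]
    exact resCard_inv_pow_le n (by omega)
  rcases lt_or_ge (ord a + ord d) 0 with hneg | hnn
  · exact ⟨_, isWhittaker_radial_zero h hH hd hΛ ha hG hC hneg, fun s hs => absurd rfl hs,
      fun r hr => by omega⟩
  · obtain ⟨M, hM⟩ := Int.eq_ofNat_of_zero_le hnn
    refine ⟨_, isWhittaker_radial h hH hd hΛ ha hG hC hM, fun s _ => by omega, fun r hr => ?_⟩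
    obtain rfl : M = r := by omega
    funext s
    set Y := (resCard F : ℂ) ^ (1 - s)
    have hqY : 1 * (resCard F : ℂ) ^ (-(s + n)) = q * Y := by
      have h1 : (resCard F : ℂ) ^ (-(s + n)) = (resCard F : ℂ)⁻¹ ^ (n + 1) * Y := by
        rw [inv_pow, ← Complex.cpow_natCast, ← Complex.cpow_neg, ← Complex.cpow_add _ _ hN0]
        congr 1
        push_cast
        ring
      rw [h1, hq, one_mul]
    rw [whittakerModel, hqY, ← shell_sum_eq, hγ, hv]
    simp only [Nat.sub_zero, Nat.add_sub_cancel, Nat.zero_sub, add_zero, zero_add, one_mul,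
      Complex.ofReal_one, pow_one]
    ring

end RadialExamples

/-! ### Whittaker functions of almost modular lattices -/

section ShellGaussSums

variable {p : ℕ} [hp : Fact p.Prime] {F : Type*} [Field F] [Algebra ℚ_[p] F]
  [ValuativeRel F] [TopologicalSpace F] [IsNonarchimedeanLocalField F]
  {E : Type*} [CommRing E] [Algebra F E] {τ : E ≃ₐ[F] E}
  {e : E} {m : F} (g : IsRamGen τ e m)

include g

theorem IsRamGen.ord_mul_zpow {x : F} (hx : x ≠ 0) (k : ℤ) : ord (x * m ^ k) = ord x + k := by
  rw [ord_mul hx (zpow_ne_zero _ g.m_ne), ord_zpow g.m_ne, g.ord_m, mul_one]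

theorem IsRamGen.mul_pow_mem {k : ℕ} {b : F} (hb : b ∈ ball F k) : b * m ^ k ∈ 𝒪[F] := by
  rcases eq_or_ne b 0 with rfl | hb0
  · rw [zero_mul]; exact zero_mem _
  · rw [mem_ball_iff_ord hb0] at hb
    refine integer_of_ord (Or.inr ?_)
    rw [← zpow_natCast, g.ord_mul_zpow hb0]
    linarith

/-- Reduction `b ↦ b mᵏ` modulo the maximal ideal, on `π⁻ᵏ 𝒪_F`. -/
def IsRamGen.ballRed (k : ℕ) : ball F k →+ 𝓀[F] where
  toFun b := IsLocalRing.residue 𝒪[F] ⟨b * m ^ k, g.mul_pow_mem b.2⟩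
  map_zero' := by
    rw [← map_zero (IsLocalRing.residue 𝒪[F])]
    exact congrArg _ (Subtype.ext (zero_mul _))
  map_add' b b' := by
    rw [← map_add]
    exact congrArg _ (Subtype.ext (add_mul _ _ _))

theorem IsRamGen.ballRed_surjective (k : ℕ) : Function.Surjective (g.ballRed k) := by
  intro w
  obtain ⟨u, rfl⟩ := IsLocalRing.residue_surjective w
  have hm := pow_ne_zero k g.m_ne
  refine ⟨⟨u * (m ^ k)⁻¹, ?_⟩, congrArg (IsLocalRing.residue 𝒪[F]) (Subtype.ext ?_)⟩
  · rcases eq_or_ne (u : F) 0 with hu | hu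
    · rw [hu, zero_mul]; exact zero_mem _
    · have h1 := ord_nonneg u.2
      rw [mem_ball_iff_ord (mul_ne_zero hu (inv_ne_zero hm)), ← zpow_natCast, ← zpow_neg,
        g.ord_mul_zpow hu]
      linarith
  · exact inv_mul_cancel_right₀ hm _

theorem IsRamGen.ballRed_ne_zero_iff (k : ℕ) (b : ball F (k + 1)) :
    g.ballRed (k + 1) b ≠ 0 ↔ (b : F) ∈ shell F (k + 1) := by
  rw [IsRamGen.ballRed, AddMonoidHom.coe_mk, ZeroHom.coe_mk, residue_ne_zero_iff, mem_shell_succ]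
  rcases eq_or_ne (b : F) 0 with hb | hb
  · simp [hb]
  · change (b : F) * m ^ (k + 1) ≠ 0 ∧ ord ((b : F) * m ^ (k + 1)) = 0 ↔ _
    rw [← zpow_natCast, g.ord_mul_zpow hb]
    push_cast
    refine ⟨fun h => ⟨hb, by linarith [h.2]⟩, fun h => ⟨mul_ne_zero hb (zpow_ne_zero _ g.m_ne),
      by linarith [h.2]⟩⟩

theorem IsRamGen.ballRed_eq_zero_iff (k : ℕ) (b : ball F (k + 1)) :
    g.ballRed (k + 1) b = 0 ↔ (b : F) ∈ ball F k := by
  have h1 := g.ballRed_ne_zero_iff k b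
  rw [shell_succ, Set.mem_sdiff] at h1
  have h2 := b.2
  simp only [SetLike.mem_coe] at h1
  tauto

/-- Also valid for nonunits `t`, where both sides vanish. -/
theorem IsRamGen.gaussSum_mulShift {χ : AddChar 𝓀[F] ℂ} (t : 𝒪[F]) :
    ∑ w, quadCharC 𝓀[F] w * χ (IsLocalRing.residue 𝒪[F] t * w) =
      resChar t * gaussSum (quadCharC 𝓀[F]) χ := by
  rw [resChar_eq]
  rcases eq_or_ne (IsLocalRing.residue 𝒪[F] t) 0 with h0 | h0
  · have h1 := MulChar.sum_eq_zero_of_ne_one (quadCharC_ne_one g.ringChar_ne_two)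
    rw [h0, MulChar.map_zero, zero_mul]
    simpa using h1
  · have h1 := _root_.gaussSum_mulShift (quadCharC 𝓀[F]) χ (Units.mk0 _ h0)
    rw [Units.val_mk0] at h1
    have h2 := quadCharC_mul_self h0
    change gaussSum (quadCharC 𝓀[F]) (χ.mulShift (IsLocalRing.residue 𝒪[F] t)) = _
    rw [← h1, ← mul_assoc, h2, one_mul]

variable {d : F} (hd : IsDifferent p d) (hd0 : ord d = 0)
  [ContinuousSMul ℚ_[p] F] [FiniteDimensional ℚ_[p] F] [MeasurableSpace F] [BorelSpace F]
  {ν : Measure F} [ν.IsAddHaarMeasure] {χ : AddChar 𝓀[F] ℂ}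
  (hχ : ∀ x : 𝒪[F], χ (IsLocalRing.residue 𝒪[F] x) = psi p F (m⁻¹ * x))
  {G : F → ℂ} (hG : Continuous G) {j : ℕ} {A : ℂ}
  (hGA : ∀ b : ball F (j + 1), (b : F) ∈ shell F (j + 1) →
    G b = A * quadCharC 𝓀[F] (g.ballRed (j + 1) b))

include hGA in
theorem IsRamGen.indicator_shell (b : ball F (j + 1)) :
    (shell F (j + 1)).indicator G b = A * quadCharC 𝓀[F] (g.ballRed (j + 1) b) := by
  by_cases hb : (b : F) ∈ shell F (j + 1)
  · rw [Set.indicator_of_mem hb, hGA b hb]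
  · rw [Set.indicator_of_notMem hb, not_ne_iff.1 (mt (g.ballRed_ne_zero_iff j b).1 hb),
      MulChar.map_zero, mul_zero]

theorem IsRamGen.setIntegral_shell_eq (f : F → ℂ) :
    ∫ b in shell F (j + 1), f b ∂ν =
      ∫ b in (ball F (j + 1) : Set F), (shell F (j + 1)).indicator f b ∂ν := by
  rw [setIntegral_indicator (measurableSet_shell _),
    Set.inter_eq_right.2 (shell_subset_ball (j + 1))]

include hd hχ hG hGA in
/-- The integral over a shell of the quadratic character against an additive character of small
conductor is a Gauss sum over the residue field. -/
theorem IsRamGen.setIntegral_shell_quadChar {t a : F} (ht : t ∈ 𝒪[F])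
    (hat : a = -(t * m ^ j)) :
    ∫ b in shell F (j + 1), G b * psi p F (-(a * b)) ∂ν =
      A * (ν.real (ball F j : Set F) * (resChar ⟨t, ht⟩ * gaussSum (quadCharC 𝓀[F]) χ)) := by
  have hc : Continuous fun b : F => G b * psi p F (-(a * b)) :=
    hG.mul (hd.continuous_psi.comp (continuous_const.mul continuous_id).neg)
  rw [g.setIntegral_shell_eq, setIntegral_fiber_of_integrableOn ν (g.ballRed (j + 1))
    (g.ballRed_surjective _) (isOpen_ball j) (g.ballRed_eq_zero_iff j) (ball_mono (Nat.le_succ j)) _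
    ((hc.continuousOn.integrableOn_compact (isCompact_ball _)).indicator (measurableSet_shell _))
    (fun w => A * (quadCharC 𝓀[F] w * χ (IsLocalRing.residue 𝒪[F] ⟨t, ht⟩ * w)))]
  · rw [← Finset.mul_sum, g.gaussSum_mulShift]
    ring
  · intro b
    have h1 : (shell F (j + 1)).indicator (fun b : F => G b * psi p F (-(a * b))) b =
        (shell F (j + 1)).indicator G b * psi p F (-(a * b)) :=
      Set.indicator_mul_left _ _ _
    rw [h1, g.indicator_shell hGA b, mul_assoc]
    congr 2
    rw [IsRamGen.ballRed, AddMonoidHom.coe_mk, ZeroHom.coe_mk, ← map_mul, hχ]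
    congr 1
    change -(a * (b : F)) = m⁻¹ * (t * ((b : F) * m ^ (j + 1)))
    have := g.m_ne
    rw [hat, pow_succ]
    field_simp

include hd hd0 hG hGA in
/-- The quadratic character is orthogonal to additive characters of large conductor. -/
theorem IsRamGen.setIntegral_shell_quadChar_eq_zero {a : F} (ha : a ≠ 0) (hj : ord a < j) :
    ∫ b in shell F (j + 1), G b * psi p F (-(a * b)) ∂ν = 0 := by
  obtain ⟨l, hl0, hl, hl1⟩ := exists_psi_ne_one hd ha (j := -j) (by omega)
  have hlj : l ∈ ball F j := (mem_ball_iff_ord hl0).2 hl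
  have hlj' : l ∈ ball F (j + 1) := ball_mono (Nat.le_succ j) hlj
  rw [g.setIntegral_shell_eq]
  refine setIntegral_eq_zero_of_translate ν (measurableSet_ball _) _ hlj' hl1 fun b hb => ?_
  have h1 : ∀ b : F, (shell F (j + 1)).indicator (fun b : F => G b * psi p F (-(a * b))) b =
      (shell F (j + 1)).indicator G b * psi p F (-(a * b)) := fun b =>
    Set.indicator_mul_left _ _ _
  have h2 := g.indicator_shell hGA ⟨b, hb⟩
  have h3 := g.indicator_shell hGA (⟨b, hb⟩ + ⟨l, hlj'⟩)
  rw [map_add, (g.ballRed_eq_zero_iff j ⟨l, hlj'⟩).2 hlj, add_zero] at h3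
  change (shell F (j + 1)).indicator G (b + l) = _ at h3
  change (shell F (j + 1)).indicator G b = _ at h2
  rw [h1, h1, h2, h3, mul_add, neg_add, AddChar.map_add_eq_mul]
  ring

end ShellGaussSums

section AlmostModularWhittaker

variable {p : ℕ} [hp : Fact p.Prime] {F : Type*} [Field F] [Algebra ℚ_[p] F]
  [ValuativeRel F] [TopologicalSpace F] [IsNonarchimedeanLocalField F]
  {E : Type*} [CommRing E] [Algebra F E] {τ : E ≃ₐ[F] E} (h : IsQuadInvolution τ)
  {V : Type*} [AddCommGroup V] [Module F V] [Module E V] [IsScalarTower F E V]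
  {H : V →ₗ[E] V →ₛₗ[(τ : E →+* E)] E} (hH : IsHermitian H)
  {e : E} {m : F} (g : IsRamGen τ e m) {Λ : Submodule (intE F E) V}

include g in
/-- Every `a ∈ F^×` is `α m^{v(a)}` with a unit `α`. -/
theorem IsRamGen.exists_unit_mul_zpow {a : F} (ha : a ≠ 0) :
    ∃ α : 𝒪[F], IsLocalRing.residue 𝒪[F] α ≠ 0 ∧ a = α * m ^ ord a := by
  have hm := zpow_ne_zero (ord a) g.m_ne
  have h1 : a * m ^ (-ord a) ≠ 0 := mul_ne_zero ha (zpow_ne_zero _ g.m_ne)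
  have h2 : ord (a * m ^ (-ord a)) = 0 := by rw [g.ord_mul_zpow ha]; ring
  refine ⟨⟨a * m ^ (-ord a), integer_of_ord (Or.inr h2.ge)⟩, (residue_ne_zero_iff _).2 ⟨h1, h2⟩, ?_⟩
  change a = a * m ^ (-ord a) * m ^ ord a
  rw [zpow_neg, inv_mul_cancel_right₀ hm]

theorem resChar_eq_one_or {u : 𝒪[F]} (hu : IsLocalRing.residue 𝒪[F] u ≠ 0) :
    resChar u = 1 ∨ resChar u = -1 := mul_self_eq_one_iff.1 (resChar_mul_self hu)

theorem isSquare_of_resChar {u : 𝒪[F]} (hu : IsLocalRing.residue 𝒪[F] u ≠ 0) (h1 : resChar u = 1) :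
    IsSquare (IsLocalRing.residue 𝒪[F] u) := by
  rw [resChar] at h1
  exact (quadraticChar_one_iff_isSquare hu).1 (by exact_mod_cast h1)

theorem residue_mul_ne_zero {u v : 𝒪[F]} (hu : IsLocalRing.residue 𝒪[F] u ≠ 0)
    (hv : IsLocalRing.residue 𝒪[F] v ≠ 0) : IsLocalRing.residue 𝒪[F] (u * v) ≠ 0 := by
  rw [map_mul]; exact mul_ne_zero hu hv

include g h in
/-- Norm classes in terms of the residual quadratic character. -/
theorem IsRamGen.exists_norm_mul_iff {α u : 𝒪[F]} (hα : IsLocalRing.residue 𝒪[F] α ≠ 0)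
    (hu : IsLocalRing.residue 𝒪[F] u ≠ 0) (k : ℤ) (z₀ : Eˣ) :
    (∃ z : Eˣ, (α : F) * m ^ k = Algebra.norm F (z : E) * (Algebra.norm F (z₀ : E) * u)) ↔
      resChar u * resChar α = 1 := by
  have hu0 := ((residue_ne_zero_iff u).1 hu).1
  rw [← resChar_mul, ← g.eta_eq h _ (residue_mul_ne_zero hu hα) k]
  have h1 : eta E (((u * α : 𝒪[F]) : F) * m ^ k) = 1 ↔
      ∃ z : Eˣ, Algebra.norm F (z : E) = ((u * α : 𝒪[F]) : F) * m ^ k := by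
    rw [eta]
    split_ifs with h2
    · exact ⟨fun _ => h2, fun _ => rfl⟩
    · exact ⟨fun h3 => by norm_num at h3, fun h3 => absurd h3 h2⟩
  rw [h1]
  have hub : IsUnit (algebraMap F E (u : F)) := (IsUnit.mk0 _ hu0).map _
  have hun : Algebra.norm F ((hub.unit : Eˣ) : E) = (u : F) ^ 2 := h.norm_algebraMap _
  have hun' : Algebra.norm F ((hub.unit⁻¹ : Eˣ) : E) * (u : F) ^ 2 = 1 := by
    rw [← hun, ← map_mul, Units.inv_mul, map_one]
  have hz' : Algebra.norm F ((z₀⁻¹ : Eˣ) : E) * Algebra.norm F (z₀ : E) = 1 := by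
    rw [← map_mul, Units.inv_mul, map_one]
  constructor
  · rintro ⟨z, hz⟩
    refine ⟨z * z₀ * hub.unit, ?_⟩
    rw [Units.val_mul, Units.val_mul, map_mul, map_mul, hun]
    change _ = (u : F) * α * m ^ k
    linear_combination -(u : F) * hz
  · rintro ⟨z, hz⟩
    refine ⟨z * z₀⁻¹ * hub.unit⁻¹, ?_⟩
    rw [Units.val_mul, Units.val_mul, map_mul, map_mul, hz]
    change _ = (u : F) * α * m ^ k * _ * _ * _
    linear_combination -((α : F) * m ^ k) * hun' - (α : F) * m ^ k *
      Algebra.norm F ((hub.unit⁻¹ : Eˣ) : E) * (u : F) ^ 2 * hz'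

include g h hH in
/-- The unit values of `q` on an almost modular lattice. -/
theorem exists_herm_eq_iff [CharZero F] {x₀ : V} (hx₀ : x₀ ∈ Λ) {c : 𝒪[F]}
    (hc : IsLocalRing.residue 𝒪[F] c ≠ 0) (hqc : herm H x₀ = c)
    (hq : ∀ x ∈ Λ, ∃ α : 𝒪[F], ∃ z ∈ 𝒪[F], herm H x = c * (α : F) ^ 2 + m * z)
    {α : 𝒪[F]} (hα : IsLocalRing.residue 𝒪[F] α ≠ 0) :
    (∃ x ∈ Λ, herm H x = α) ↔ resChar c * resChar α = 1 := by
  have hm := g.coeff_mem.2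
  obtain ⟨hc0, hco⟩ := (residue_ne_zero_iff c).1 hc
  rw [← resChar_mul]
  constructor
  · rintro ⟨x, hx, hxα⟩
    obtain ⟨β, z, hz, hβ⟩ := hq x hx
    have h1 : α = c * β ^ 2 + ⟨m, hm⟩ * ⟨z, hz⟩ := Subtype.ext (hxα.symm.trans hβ)
    have h2 : IsLocalRing.residue 𝒪[F] α = IsLocalRing.residue 𝒪[F] (c * β ^ 2) := by
      rw [h1, map_add, g.residue_mul, add_zero]
    have h3 : IsLocalRing.residue 𝒪[F] (c * β) ≠ 0 := by
      intro h3
      rw [h2, pow_two, ← mul_assoc, map_mul, h3, zero_mul] at hα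
      exact hα rfl
    rw [← resChar_mul_self h3, ← resChar_mul, resChar_eq, resChar_eq, map_mul, h2, ← map_mul]
    congr 2
    ring
  · intro h1
    have hcα := residue_mul_ne_zero hc hα
    obtain ⟨β, hβ⟩ := g.exists_sq_eq hcα (isSquare_of_resChar hcα h1)
    have hβ' : (β : F) ^ 2 = c * α := congrArg Subtype.val hβ
    have hmem : (β : F) * (c : F)⁻¹ ∈ 𝒪[F] := mul_mem β.2
      (integer_of_ord (Or.inr (by rw [ord_inv hc0, hco, neg_zero])))
    refine ⟨((β : F) * (c : F)⁻¹) • x₀, base_smul_mem_lattice hmem hx₀, ?_⟩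
    rw [← algebraMap_smul E, herm_smul h hH, h.norm_algebraMap, hqc, mul_pow, hβ']
    field_simp

variable {d : F} (hd : IsDifferent p d) (hd0 : ord d = 0)
  [ContinuousSMul ℚ_[p] F] [FiniteDimensional ℚ_[p] F]
  [Module.Finite F V] [TopologicalSpace V]
  [IsTopologicalAddGroup V] [ContinuousSMul F V] [T2Space V]
  [MeasurableSpace F] [BorelSpace F] [MeasurableSpace V] [BorelSpace V] {μ : Measure V}
  (hΛ : IsCompactOpen (Λ : Set V)) {ν : Measure F} [μ.IsAddHaarMeasure]

include hd hd0 h hH hΛ g in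
/-- The Whittaker function of an almost modular lattice: only the shells `v(b) = 0` and
`v(b) = -(v(a) + 1)` contribute. -/
theorem isWhittaker_almostModular (hν : IsSelfDualMeasure (fun x y : F => addChar p (x * y)) ν)
    {χ : AddChar 𝓀[F] ℂ} (hχ1 : χ ≠ 1)
    (hχ : ∀ x : 𝒪[F], χ (IsLocalRing.residue 𝒪[F] x) = psi p F (m⁻¹ * x))
    {n : ℕ} {a : F} (ha : a ≠ 0) {α : 𝒪[F]}
    (haα : a = α * m ^ ord a) {c : 𝒪[F]}
    (hvol : μ.real (Λ : Set V) ^ 2 * (resCard F : ℝ) ^ (2 * n + 1) = 1)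
    (hγ : weilIndex p H μ = (resCard F : ℂ) ^ n * μ.real (Λ : Set V) *
        (resChar c * gaussSum (quadCharC 𝓀[F]) χ))
    (hint : ∀ b ∈ 𝒪[F], ∫ x in (Λ : Set V), psi p F (b * herm H x) ∂μ = μ.real (Λ : Set V))
    (hε : ∀ (b : F) (j : ℕ) (u : 𝒪[F]), IsLocalRing.residue 𝒪[F] u ≠ 0 → b * m ^ (j + 1) = u →
        ∫ x in (Λ : Set V), psi p F (b * herm H x) ∂μ =
          resChar u * weilIndex p H μ * ((resCard F : ℂ)⁻¹ ^ (j + 1)) ^ (n + 1)) :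
    ∃ W : ℂ → ℂ, IsWhittaker p H ν μ (Set.indicator (Λ : Set V) 1) a (-n) W ∧
      (∀ s, W s ≠ 0 → 0 ≤ ord a) ∧
      ∀ r : ℕ, ord a = r → W = fun s : ℂ => weilIndex p H μ *
        ((resCard F : ℂ) ^ (-((n : ℂ) + 1 / 2)) +
          resChar c * resChar α * (resCard F : ℂ) ^ (-(((r : ℂ) + 1) * (s + n)) - 1 / 2)) := by
  have := hν.1
  have hN := resCard_pos F
  have hN0 := resCard_ne_zero (F := F)
  have hv : ν.real (𝒪[F] : Set F) = 1 := by
    have h1 := measureReal_integer_sq hd hν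
    rw [absV_eq_one_iff.2 ⟨hd.1, hd0⟩] at h1
    exact (pow_eq_one_iff_of_nonneg measureReal_nonneg two_ne_zero).1 h1
  set γ := weilIndex p H μ with hγdef
  set v := μ.real (Λ : Set V) with hvdef
  set G : F → ℂ := fun b => γ * ∫ x in (Λ : Set V), psi p F (b * herm H x) ∂μ with hGdef
  have hG : Continuous G := continuous_const.mul (continuous_setIntegral_psi_herm h hH hd hΛ)
  -- the value of `v`, from its square
  have hvN : (v : ℂ) = (resCard F : ℂ) ^ (-((n : ℂ) + 1 / 2)) := by
    have h1 : v = (resCard F : ℝ) ^ (-((n : ℝ) + 1 / 2)) := by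
      refine (pow_left_inj₀ measureReal_nonneg (by positivity) two_ne_zero).1 ?_
      rw [← Real.rpow_natCast ((resCard F : ℝ) ^ (-((n : ℝ) + 1 / 2))) 2, ← Real.rpow_mul hN.le, eq_comm]
      have h2 : (resCard F : ℝ) ^ (-((n : ℝ) + 1 / 2) * (2 : ℕ)) =
          ((resCard F : ℝ) ^ (2 * n + 1))⁻¹ := by
        rw [← Real.rpow_natCast, ← Real.rpow_neg hN.le]
        congr 1
        push_cast
        ring
      rw [h2]
      exact (eq_inv_of_mul_eq_one_left hvol).symm
    rw [h1, Complex.ofReal_cpow hN.le]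
    push_cast
    rfl
  have hGA : ∀ j : ℕ, ∀ b : ball F (j + 1), (b : F) ∈ shell F (j + 1) → G b =
      γ * (γ * ((resCard F : ℂ)⁻¹ ^ (j + 1)) ^ (n + 1)) *
        quadCharC 𝓀[F] (g.ballRed (j + 1) b) := by
    intro j b hb
    have h1 := hε b j ⟨(b : F) * m ^ (j + 1), g.mul_pow_mem b.2⟩
      ((g.ballRed_ne_zero_iff j b).2 hb) rfl
    rw [hGdef]
    simp only [h1, resChar_eq]
    rw [IsRamGen.ballRed, AddMonoidHom.coe_mk, ZeroHom.coe_mk]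
    ring
  have hC : ∀ k, ∀ b ∈ shell F k, ‖∫ x in (Λ : Set V), psi p F (b * herm H x) ∂μ‖ ≤
      max v ‖γ‖ * ((resCard F : ℝ)⁻¹ ^ (n + 1)) ^ k := by
    intro k b hb
    cases k with
    | zero =>
      rw [hint b hb, pow_zero, mul_one, Complex.norm_real, Real.norm_of_nonneg measureReal_nonneg]
      exact le_max_left _ _
    | succ j =>
      have hb' := shell_subset_ball (j + 1) hb
      have h0 := (g.ballRed_ne_zero_iff j ⟨b, hb'⟩).2 hb
      rw [hε b j ⟨b * m ^ (j + 1), g.mul_pow_mem hb'⟩ h0 rfl, norm_mul, norm_mul]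
      have h1 : ‖resChar ⟨b * m ^ (j + 1), g.mul_pow_mem hb'⟩‖ = 1 := by
        rcases resChar_eq_one_or h0 with h1 | h1 <;> rw [h1] <;> simp
      rw [h1, one_mul, norm_pow, norm_pow, norm_inv, Complex.norm_natCast, ← pow_mul, ← pow_mul,
        mul_comm (j + 1)]
      exact mul_le_mul_of_nonneg_right (le_max_right _ _) (by positivity)
  have hc0 : ∫ b in shell F 0, γ * (∫ x in (Λ : Set V), psi p F (b * herm H x) ∂μ) *
      psi p F (-(a * b)) ∂ν = γ * v * ∫ b in (ball F 0 : Set F), psi p F (-(a * b)) ∂ν := by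
    rw [← shell_zero, ← integral_const_mul]
    exact setIntegral_congr_fun (measurableSet_shell 0) fun b hb => by
      simp only [hint b hb]
  rcases lt_or_ge (ord a) 0 with hneg | hnn
  · have h1 := isWhittaker_of_shells (ν := ν) (a := a) (c := fun _ => 0) (K := 0) h hH hd hΛ
      (fun k => by
        cases k with
        | zero =>
          refine hc0.trans ?_
          rw [setIntegral_ball_of_notMem ν hd ha (by push_cast; omega), mul_zero]
        | succ j =>
          exact g.setIntegral_shell_quadChar_eq_zero hd hd0 hG (hGA j) ha (by omega))
      (fun _ _ => rfl) hC
    exact ⟨_, h1, fun s hs => absurd (by simp) hs, fun r hr => by omega⟩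
  obtain ⟨r, hr⟩ := Int.eq_ofNat_of_zero_le hnn
  have hsh : ∀ k, ∫ b in shell F k, γ * (∫ x in (Λ : Set V), psi p F (b * herm H x) ∂μ) *
      psi p F (-(a * b)) ∂ν = if k = 0 then γ * v else if k = r + 1 then
        γ * (γ * ((resCard F : ℂ)⁻¹ ^ (r + 1)) ^ (n + 1)) * ((resCard F : ℂ) ^ r *
          (resChar (-α) * gaussSum (quadCharC 𝓀[F]) χ)) else 0 := by
    intro k
    cases k with
    | zero =>
      rw [if_pos rfl]
      refine hc0.trans ?_
      rw [setIntegral_ball_of_mem ν hd ha (by push_cast; omega), coe_ball_zero, hv,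
        Complex.ofReal_one, mul_one]
    | succ j =>
      rw [if_neg (Nat.succ_ne_zero j)]
      rcases lt_or_ge r j with hj | hj
      · rw [if_neg (by omega)]
        exact g.setIntegral_shell_quadChar_eq_zero hd hd0 hG (hGA j) ha (by omega)
      · have hm := g.coeff_mem.2
        have ht : -(α : F) * m ^ (r - j) ∈ 𝒪[F] := mul_mem (neg_mem α.2) (pow_mem hm _)
        refine (g.setIntegral_shell_quadChar hd hχ hG (hGA j) ht ?_).trans ?_
        · rw [mul_assoc, ← pow_add, Nat.sub_add_cancel hj]
          rw [hr, zpow_natCast] at haα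
          linear_combination haα
        · rw [measureReal_ball (p := p), hv]
          rcases hj.eq_or_lt with rfl | hj
          · rw [if_pos rfl]
            have h2 : (⟨-(α : F) * m ^ (j - j), ht⟩ : 𝒪[F]) = -α := Subtype.ext (by simp)
            rw [h2]
            push_cast
            ring
          · rw [if_neg (by omega)]
            have h2 : (⟨-(α : F) * m ^ (r - j), ht⟩ : 𝒪[F]) =
                ⟨m, hm⟩ * (-α * ⟨m, hm⟩ ^ (r - j - 1)) := Subtype.ext (by
              change -(α : F) * m ^ (r - j) = m * (-(α : F) * m ^ (r - j - 1))
              rw [show r - j = r - j - 1 + 1 by omega, pow_succ, Nat.add_sub_cancel]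
              ring)
            rw [h2, resChar_eq, g.residue_mul, MulChar.map_zero]
            ring
  refine ⟨_, isWhittaker_of_shells h hH hd hΛ hsh (K := r + 1)
    (fun k hk => by rw [if_neg (by omega), if_neg (by omega)]) hC, fun _ _ => hnn, fun r' hr' => ?_⟩
  obtain rfl : r = r' := by omega
  funext s
  rw [Finset.sum_range_succ, Finset.sum_range_succ', if_neg (Nat.succ_ne_zero _), if_pos rfl,
    if_pos rfl]
  rw [Finset.sum_eq_zero fun k hk => by
    rw [if_neg (Nat.succ_ne_zero k), if_neg (by have := Finset.mem_range.1 hk; omega), mul_zero]]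
  have hgs := gaussSum_quadCharC_sq g hχ1
  have hneg1 : resChar (-1 : 𝒪[F]) * resChar (-1 : 𝒪[F]) = 1 := resChar_mul_self (by
    rw [map_neg, map_one]; exact neg_ne_zero.2 one_ne_zero)
  have hnegα : resChar (-α) = resChar (-1 : 𝒪[F]) * resChar α := by rw [← resChar_mul, neg_one_mul]
  have hpow : (resCard F : ℂ) ^ (-(((r : ℂ) + 1) * (s + n)) - 1 / 2) =
      (resCard F : ℂ) ^ (-(((r + 1 : ℕ) : ℂ) * s)) * ((v : ℂ) * ((resCard F : ℂ)⁻¹) ^ (r * n)) := by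
    rw [hvN, inv_pow, ← Complex.cpow_natCast, ← Complex.cpow_neg, ← Complex.cpow_add _ _ hN0,
      ← Complex.cpow_add _ _ hN0]
    congr 1
    push_cast
    ring
  have hpow' : ((resCard F : ℂ)⁻¹ ^ (r + 1)) ^ (n + 1) * (resCard F : ℂ) ^ (n + 1 + r) =
      (resCard F : ℂ)⁻¹ ^ (r * n) := by
    rw [← pow_mul, show (r + 1) * (n + 1) = r * n + (n + 1 + r) by ring, pow_add, mul_assoc,
      ← mul_pow, inv_mul_cancel₀ hN0, one_pow, mul_one]
  have h0 : (resCard F : ℂ) ^ (-(((0 : ℕ) : ℂ) * s)) = 1 := by simp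
  rw [hpow, ← hpow', ← hvN, h0, hnegα]
  have hc1 : γ * ((resCard F : ℂ)⁻¹ ^ (r + 1)) ^ (n + 1) * ((resCard F : ℂ) ^ r *
      (resChar (-1 : 𝒪[F]) * resChar α * gaussSum (quadCharC 𝓀[F]) χ)) =
      resChar c * resChar α * (v * (((resCard F : ℂ)⁻¹ ^ (r + 1)) ^ (n + 1) *
        (resCard F : ℂ) ^ (n + 1 + r))) := by
    rw [hγ]
    linear_combination (resCard F : ℂ) ^ n * v * resChar c * resChar α *
      ((resCard F : ℂ)⁻¹ ^ (r + 1)) ^ (n + 1) * (resCard F : ℂ) ^ r * resChar (-1 : 𝒪[F]) * hgs +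
      (resCard F : ℂ) ^ n * v * resChar c * resChar α *
      ((resCard F : ℂ)⁻¹ ^ (r + 1)) ^ (n + 1) * (resCard F : ℂ) ^ r * resCard F * hneg1
  linear_combination γ * (resCard F : ℂ) ^ (-(((r + 1 : ℕ) : ℂ) * s)) * hc1

end AlmostModularWhittaker

/-! ### The explicit formulas -/

section Formulas

variable {F : Type*} [Field F] [ValuativeRel F] [TopologicalSpace F] [IsNonarchimedeanLocalField F]
  {E : Type*} [CommRing E] [Algebra F E] {τ : E ≃ₐ[F] E}

theorem localZeta_eq : localZeta F = fun s => (1 - 1 * (resCard F : ℂ) ^ (-s))⁻¹ := by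
  funext s
  rw [localZeta, one_mul]

theorem localL_eta_unramified {ε : ℂ} (hη : ∀ x : F, x ≠ 0 → eta E x = ε ^ ord x) (k : ℕ) :
    localL (fun x : F => eta E x ^ k) = fun s => (1 - ε ^ k * (resCard F : ℂ) ^ (-s))⁻¹ := by
  funext s
  have h1 : ∀ u : F, absV u = 1 → eta E u ^ k = 1 := fun u hu => by
    obtain ⟨hu0, hu1⟩ := absV_eq_one_iff.1 hu
    rw [hη u hu0, hu1, zpow_zero, one_pow]
  rw [localL, if_pos h1, hη _ (unif_ne_zero F), ord_unif, zpow_one]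

/-- An odd power of `η` is ramified, so its Euler factor is trivial. -/
theorem IsRamGen.localL_eta {e : E} {m : F} (g : IsRamGen τ e m) (h : IsQuadInvolution τ) {k : ℕ}
    (hk : Odd k) (s : ℂ) : localL (fun x : F => eta E x ^ k) s = 1 := by
  rw [localL, if_neg]
  obtain ⟨w, hw⟩ := quadraticChar_exists_neg_one g.ringChar_ne_two
  obtain ⟨u, rfl⟩ := IsLocalRing.residue_surjective w
  have hu : IsLocalRing.residue 𝒪[F] u ≠ 0 := by
    intro hu
    rw [hu, quadraticChar_zero] at hw
    norm_num at hw
  intro hall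
  have h1 := g.eta_eq h u hu 0
  rw [zpow_zero, mul_one, resChar, hw] at h1
  have h2 := hall u (absV_eq_one_iff.2 ((residue_ne_zero_iff u).1 hu))
  rw [h1] at h2
  push_cast at h2
  rw [hk.neg_one_pow] at h2
  norm_num at h2

variable {d a : F} (hd0 : d ≠ 0) {δ : ℕ} (hδ : ord d = δ) (ha : a ≠ 0) {n r : ℕ} (hr : ord a = r)
  (hn : 1 ≤ n) {γ : ℂ} {L W : ℂ → ℂ}

include hd0 hδ ha hr hn in
/-- The formulas at an unramified place with `η(ϖ)^{n + 1} = 1`. -/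
theorem formulas_unramified_pos (hγ : γ = 1)
    (hL : L = fun s => (1 - 1 * (resCard F : ℂ) ^ (-s))⁻¹)
    (hW : W = whittakerModel (resCard F) 1 (γ * (absV d : ℂ) ^ ((n : ℂ) + 3 / 2)) n δ r) :
    (∀ s : ℂ, (resCard F : ℂ) ^ (-(s + n)) ≠ 1 → (resCard F : ℂ) ^ (-(s - 1)) ≠ 1 →
      W s =
        (absV d : ℂ) ^ (s + n + 1 / 2) *
          ((1 - (resCard F : ℂ) ^ (-(s + n + 1))) *
            (1 - (resCard F : ℂ) ^ (-((ord a + 1) * (s + n))))) /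
            (1 - (resCard F : ℂ) ^ (-(s + n)))
        + (absV d : ℂ) ^ ((n : ℂ) + 3 / 2) *
          ((1 - (resCard F : ℂ) ^ (-s)) * (1 - (absV d : ℂ) ^ (s - 1))) /
            (1 - (resCard F : ℂ) ^ (-(s - 1)))) ∧
    deriv W 0 - 1 / 2 * (Real.log (absV a) : ℂ) * W 0 =
      (-logDeriv L (n + 1) + (Real.log (absV d) : ℂ)) * W 0
      + (absV d : ℂ) ^ ((n : ℂ) + 1 / 2) *
        ((1 - (resCard F : ℂ) ^ (-((n : ℂ) + 1))) / (2 * (1 - (resCard F : ℂ) ^ (-(n : ℂ))) ^ 2)) *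
        (ord a * (1 - (resCard F : ℂ) ^ (-((ord a + 2) * (n : ℂ))))
          - (ord a + 2) * ((resCard F : ℂ) ^ (-(n : ℂ)) -
            (resCard F : ℂ) ^ (-((ord a + 1) * (n : ℂ))))) * (Real.log (resCard F) : ℂ)
      + (absV d : ℂ) ^ ((n : ℂ) + 1 / 2) * ((1 - (absV d : ℂ)) / (resCard F - 1)) *
        (Real.log (resCard F) : ℂ) := by
  subst hW hγ hL
  refine ⟨fun s hX hY => ?_, ?_⟩
  · rw [whittakerModel_unramified hd0 hδ 1 n r (by rwa [one_mul]) hY, hr]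
    simp only [one_mul, one_pow, Int.cast_natCast]
  · have h1 := deriv_whittakerModel_unramified hd0 hδ (Or.inl rfl) 1 n r hn
    rw [log_absV ha, hr]
    simp only [one_mul, one_pow, Int.cast_natCast] at h1 ⊢
    push_cast at h1 ⊢
    linear_combination h1

include hd0 hδ ha hr hn in
/-- The formulas at an inert place, for even `n`. -/
theorem formulas_unramified_neg
    (hL : L = fun s => (1 - -1 * (resCard F : ℂ) ^ (-s))⁻¹)
    (hW : W = whittakerModel (resCard F) (-1) (γ * (absV d : ℂ) ^ ((n : ℂ) + 3 / 2)) n δ r) :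
    (∀ s : ℂ, (resCard F : ℂ) ^ (-(s + n)) ≠ -1 → (resCard F : ℂ) ^ (-(s - 1)) ≠ 1 →
      W s = γ * (
        (absV d : ℂ) ^ (s + n + 1 / 2) *
          ((1 + (resCard F : ℂ) ^ (-(s + n + 1))) *
            (1 - (-1) ^ (ord a + 1) * (resCard F : ℂ) ^ (-((ord a + 1) * (s + n))))) /
            (1 + (resCard F : ℂ) ^ (-(s + n)))
        + (absV d : ℂ) ^ ((n : ℂ) + 3 / 2) *
          ((1 - (resCard F : ℂ) ^ (-s)) * (1 - (absV d : ℂ) ^ (s - 1))) /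
            (1 - (resCard F : ℂ) ^ (-(s - 1))))) ∧
    deriv W 0 - 1 / 2 * (Real.log (absV a) : ℂ) * W 0 =
      (-logDeriv L (n + 1) + (Real.log (absV d) : ℂ)) * W 0
      + γ * ((absV d : ℂ) ^ ((n : ℂ) + 1 / 2) *
        ((1 + (resCard F : ℂ) ^ (-((n : ℂ) + 1))) / (2 * (1 + (resCard F : ℂ) ^ (-(n : ℂ))) ^ 2)) *
        (ord a * (1 - (-1) ^ ord a * (resCard F : ℂ) ^ (-((ord a + 2) * (n : ℂ))))
          + (ord a + 2) * ((resCard F : ℂ) ^ (-(n : ℂ)) -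
            (-1) ^ ord a * (resCard F : ℂ) ^ (-((ord a + 1) * (n : ℂ))))) *
        (Real.log (resCard F) : ℂ)
      + (absV d : ℂ) ^ ((n : ℂ) + 1 / 2) * ((1 - (absV d : ℂ)) / (resCard F - 1)) *
        (Real.log (resCard F) : ℂ)) := by
  subst hW hL
  have hz : (-1 : ℂ) ^ ((r : ℤ) + 1) = (-1) ^ (r + 1) := by
    rw [← zpow_natCast]; push_cast; rfl
  refine ⟨fun s hX hY => ?_, ?_⟩
  · rw [whittakerModel_unramified hd0 hδ γ n r (by rwa [neg_one_mul, ne_eq, neg_eq_iff_eq_neg]) hY,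
      hr, hz]
    simp only [neg_one_mul, sub_neg_eq_add, Int.cast_natCast]
  · have h1 := deriv_whittakerModel_unramified hd0 hδ (Or.inr rfl) γ n r hn
    rw [log_absV ha, hr, zpow_natCast]
    simp only [neg_one_mul, sub_neg_eq_add, pow_succ, Int.cast_natCast] at h1 ⊢
    push_cast at h1 ⊢
    linear_combination h1

include ha hr hn in
/-- The formulas at a ramified place, for odd `n`. -/
theorem formulas_modular
    (hW : W = fun s => whittakerModel (resCard F) 1 1 n 0 r s -
      (1 - (resCard F : ℂ)⁻¹ ^ (n + 1))) :
    (∀ s : ℂ, (resCard F : ℂ) ^ (-(s + n)) ≠ 1 →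
      W s = (1 - (resCard F : ℂ) ^ (-(s + n + 1))) *
          (1 - (resCard F : ℂ) ^ (-((ord a + 1) * (s + n)))) /
          (1 - (resCard F : ℂ) ^ (-(s + n))) - (1 - (resCard F : ℂ) ^ (-((n : ℂ) + 1)))) ∧
    deriv W 0 - 1 / 2 * (Real.log (absV a) : ℂ) * W 0 =
      -logDeriv (localZeta F) (n + 1) * W 0
      - ord a / 2 * (1 - (resCard F : ℂ) ^ (-((n : ℂ) + 1))) * (Real.log (resCard F) : ℂ)
      + (resCard F : ℂ) ^ (-((n : ℂ) + 1)) * (Real.log (resCard F) : ℂ)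
      + (1 - (resCard F : ℂ) ^ (-((n : ℂ) + 1))) / (2 * (1 - (resCard F : ℂ) ^ (-(n : ℂ))) ^ 2) *
        (ord a - (ord a + 2) * (resCard F : ℂ) ^ (-(n : ℂ))
          + (ord a + 2) * (resCard F : ℂ) ^ (-((ord a + 1) * (n : ℂ)))
          - ord a * (resCard F : ℂ) ^ (-((ord a + 2) * (n : ℂ)))) *
        (Real.log (resCard F) : ℂ) := by
  subst hW
  have hN := resCard_ne_zero (F := F)
  have hq : (resCard F : ℂ)⁻¹ ^ (n + 1) = (resCard F : ℂ) ^ (-((n : ℂ) + 1)) := by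
    rw [inv_pow, ← Complex.cpow_natCast, ← Complex.cpow_neg]
    push_cast
    rfl
  refine ⟨fun s hX => ?_, ?_⟩
  · have h1 := mul_neg_geom_sum ((resCard F : ℂ) ^ (-(s + n))) (r + 1)
    have h3 : (resCard F : ℂ) ^ (-(s + n + 1)) =
        (resCard F : ℂ)⁻¹ * (resCard F : ℂ) ^ (-(s + n)) := by
      rw [← Complex.cpow_neg_one, ← Complex.cpow_add _ _ hN]
      congr 1; ring
    have h4 : (resCard F : ℂ) ^ (-((r + 1) * (s + n))) =
        ((resCard F : ℂ) ^ (-(s + n))) ^ (r + 1) := by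
      rw [← Complex.cpow_nat_mul]
      congr 1; push_cast; ring
    have hX' : 1 - (resCard F : ℂ) ^ (-(s + n)) ≠ 0 := sub_ne_zero.2 hX.symm
    change whittakerModel (resCard F) 1 1 n 0 r s - _ = _
    rw [hr, Int.cast_natCast, h3, h4, ← h1, hq, whittakerModel]
    simp only [one_mul, pow_zero, Finset.range_zero, Finset.sum_empty, mul_zero, add_zero]
    field_simp
  · have hone : absV (1 : F) = 1 := absV_eq_one_iff.2 ⟨one_ne_zero, ord_one⟩
    have h1 := deriv_whittakerModel_unramified (d := (1 : F)) (δ := 0) one_ne_zero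
      (by rw [ord_one]; rfl) (Or.inl rfl) 1 n r hn
    have hX' : (1 : ℂ) * (resCard F : ℂ) ^ (-((n : ℂ) + 1)) ≠ 1 :=
      sign_mul_cpow_ne_one (Or.inl rfl) (by
        rw [Complex.add_re, Complex.natCast_re, Complex.one_re]; positivity)
    have hLD := logDeriv_eulerFactor (by exact_mod_cast hN) 1 _ hX'
    have h2 : 1 - (resCard F : ℂ) ^ (-((n : ℂ) + 1)) ≠ 0 := by
      rw [one_mul] at hX'
      exact sub_ne_zero.2 hX'.symm
    have h3 : logDeriv (localZeta F) (n + 1) * (1 - (resCard F : ℂ) ^ (-((n : ℂ) + 1))) =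
        -((resCard F : ℂ) ^ (-((n : ℂ) + 1)) * Real.log (resCard F)) := by
      rw [localZeta_eq, hLD, one_mul]
      field_simp
    -- the unramified formula with `|d| = 1`; the constant `1 - N^{-(n + 1)}` contributes `h3`
    rw [← localZeta_eq, hone] at h1
    simp only [Complex.ofReal_one, Complex.one_cpow, mul_one, one_mul, one_pow, Real.log_one,
      Complex.ofReal_zero, add_zero, sub_self, zero_div, zero_mul] at h1
    rw [log_absV ha, hr, hq, deriv_sub_const]
    simp only [Int.cast_natCast]
    push_cast at h1 h3 ⊢
    linear_combination h1 - h3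

include ha hr in
/-- The central derivative at a ramified place, for even `n`. -/
theorem formulas_almostModular {ε : ℂ}
    (hW : W = fun s : ℂ => γ * ((resCard F : ℂ) ^ (-((n : ℂ) + 1 / 2)) +
      ε * (resCard F : ℂ) ^ (-(((r : ℂ) + 1) * (s + n)) - 1 / 2))) :
    deriv W 0 - 1 / 2 * (Real.log (absV a) : ℂ) * W 0 =
      γ * (-(ε * ((ord a + 2) / 2)) * (resCard F : ℂ) ^ (-((ord a + 1) * (n : ℂ)) - 1 / 2)
        + ord a / 2 * (resCard F : ℂ) ^ (-((n : ℂ) + 1 / 2))) * (Real.log (resCard F) : ℂ) := by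
  have hN := resCard_ne_zero (F := F)
  have h1 := (((((((hasDerivAt_id (0 : ℂ)).add_const (n : ℂ)).const_mul ((r : ℂ) + 1)).neg).sub_const
    (1 / 2 : ℂ)).const_cpow (c := (resCard F : ℂ)) (Or.inl hN)).const_mul ε).const_add
    ((resCard F : ℂ) ^ (-((n : ℂ) + 1 / 2))) |>.const_mul γ
  have h2 : deriv W 0 = γ * (ε * ((resCard F : ℂ) ^ (-(((r : ℂ) + 1) * (0 + n)) - 1 / 2) *
      Complex.log (resCard F) * -(((r : ℂ) + 1) * 1))) := by rw [hW]; exact h1.deriv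
  rw [h2, hW, log_absV ha, hr]
  simp only [zero_add, Int.cast_natCast, ← Complex.natCast_log]
  push_cast
  ring

end Formulas

/-! ### The cases split, inert and ramified -/

section Cases

theorem IsSplit.not_isField {F : Type*} [Field F] {E : Type*} [CommRing E] [Algebra F E]
    (hS : IsSplit F E) : ¬ IsField E := by
  obtain ⟨φ⟩ := hS
  intro hE
  have h1 : φ.symm (1, 0) ≠ 0 := fun h => by simpa using congrArg (fun z => (φ z).1) h
  obtain ⟨z, hz⟩ := hE.mul_inv_cancel h1
  have h2 := congrArg (fun z => (φ z).2) hz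
  simp at h2

variable {p : ℕ} [hp : Fact p.Prime] {F : Type*} [Field F] [Algebra ℚ_[p] F]
  [ValuativeRel F] [TopologicalSpace F] [IsNonarchimedeanLocalField F]
  {E : Type*} [CommRing E] [Algebra F E] {τ : E ≃ₐ[F] E} (h : IsQuadInvolution τ)
  {V : Type*} [AddCommGroup V] [Module F V] [Module E V] [IsScalarTower F E V]
  {H : V →ₗ[E] V →ₛₗ[(τ : E →+* E)] E} (hH : IsHermitian H) {d : F} (hd : IsDifferent p d)
  [ContinuousSMul ℚ_[p] F] [FiniteDimensional ℚ_[p] F]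
  [Module.Finite F V] [TopologicalSpace V]
  [IsTopologicalAddGroup V] [ContinuousSMul F V] [T2Space V]
  [MeasurableSpace F] [BorelSpace F] [MeasurableSpace V] [BorelSpace V] {μ : Measure V}
  (hμ : IsSelfDualMeasure (pairingV p H) μ)
  {Λ : Submodule (intE F E) V} {ν : Measure F}
  (hν : IsSelfDualMeasure (fun x y : F => addChar p (x * y)) ν)
  {n : ℕ} (hn : Module.finrank F V = 2 * (n + 1)) {a : F} (ha : a ≠ 0)

include h hH hd hμ hν hn ha in
/-- At an unramified place, with `ε = η(ϖ)`, the Weil index is `η(d)^{n + 1}` and the Whittaker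
function is the model function with `κ = ε^{n + 1}`. -/
theorem whittaker_unramified (hΛ : IsCompactOpen (Λ : Set V)) (hdual : dualLattice H Λ = Λ)
    (hperp : perp p H Λ.toAddSubgroup = (scal (algebraMap F E d) Λ).toAddSubgroup)
    {ε : ℂ} (hε1 : ε = 1 ∨ ε = -1) (hη : ∀ x : F, x ≠ 0 → eta E x = ε ^ ord x)
    (hε : ∀ (b : F) (k : ℕ), b ≠ 0 → ord (b * d) = -k →
      ∫ x in (Λ : Set V), psi p F (b * herm H x) ∂μ =
        ((ε * (resCard F : ℂ)⁻¹) ^ k) ^ (n + 1) * μ.real (Λ : Set V))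
    {δ : ℕ} (hδ : ord d = δ) :
    weilIndex p H μ = eta E d ^ (n + 1) ∧
    ∃ W : ℂ → ℂ, IsWhittaker p H ν μ (Set.indicator (Λ : Set V) 1) a (-n) W ∧
      (∀ s, W s ≠ 0 → -ord d ≤ ord a) ∧
      ∀ r : ℕ, ord a = r → W = whittakerModel (resCard F) (ε ^ (n + 1))
        (weilIndex p H μ * (absV d : ℂ) ^ ((n : ℂ) + 3 / 2)) n δ r := by
  have : CharZero F := charZero_of_injective_algebraMap (algebraMap ℚ_[p] F).injective
  have := hμ.1
  refine ⟨?_, isWhittaker_unramified h hH hd hΛ hν hε1 ha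
    (measureReal_selfDual hd h hH hμ hΛ hperp hn) (fun b hb => ?_) hε hδ⟩
  · rw [weilIndex_unramified hd h hH hμ hΛ hdual hperp hn hε, hη d hd.1]
  · refine setIntegral_psi_herm_eq_measure hd hΛ fun x hx => ?_
    rw [mul_right_comm]
    exact mul_mem hb (herm_mem_integer_of_selfDual h hH hdual hx)

end Cases

end LocalWhittaker

end

open LocalWhittaker in
theorem mainTheorem7
    -- the local field `F`, a finite extension of `ℚ_p`
    (p : ℕ) [Fact p.Prime]
    {F : Type*} [Field F] [ValuativeRel F] [TopologicalSpace F] [IsNonarchimedeanLocalField F]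
    [Algebra ℚ_[p] F] [ContinuousSMul ℚ_[p] F] [FiniteDimensional ℚ_[p] F]
    [MeasurableSpace F] [BorelSpace F]
    -- the quadratic algebra `E` with its involution `τ`
    {E : Type*} [CommRing E] [Algebra F E] (hE : Module.finrank F E = 2)
    (τ : E ≃ₐ[F] E) (hτ : τ ≠ AlgEquiv.refl)
    -- the Hermitian space `V` of dimension `n + 1`
    (n : ℕ) (hn : 1 ≤ n)
    {V : Type*} [AddCommGroup V] [Module F V] [Module E V] [IsScalarTower F E V]
    [Module.Free E V] [Module.Finite E V] (hV : Module.finrank E V = n + 1)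
    [TopologicalSpace V] [IsTopologicalAddGroup V] [ContinuousSMul F V] [T2Space V]
    [MeasurableSpace V] [BorelSpace V]
    (H : V →ₗ[E] V →ₛₗ[(τ : E →+* E)] E) (hH : IsHermitian H)
    -- the self-dual measures on `F` and `V`
    (μF : Measure F) (hμF : IsSelfDualMeasure (fun x y : F => addChar p (x * y)) μF)
    (μV : Measure V) (hμV : IsSelfDualMeasure (pairingV p H) μV)
    -- a generator `d` of the different of `F / ℚ_p`, and the lattice `Λ`
    (d : F) (hd : IsDifferent p d)
    (Λ : Submodule (intE F E) V) (hΛ : IsLattice Λ)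
    (a : F) (ha : a ≠ 0) :
    let N : ℂ := (resCard F : ℂ)
    let logN : ℂ := (Real.log (resCard F) : ℂ)
    let r : ℤ := ord a
    let D : ℂ := (absV d : ℂ)
    let logD : ℂ := (Real.log (absV d) : ℂ)
    let loga : ℂ := (Real.log (absV a) : ℂ)
    let γ : ℂ := weilIndex p H μV
    let Φ : V → ℂ := Set.indicator (Λ : Set V) 1
    let LL : ℂ := logDeriv (localL (fun x : F => eta E x ^ (n + 1))) (n + 1)
    let ZZ : ℂ := logDeriv (localZeta F) (n + 1)
    -- unramified places
    ((IsSplit F E ∨ IsInert F E) → IsSelfDualLattice H Λ →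
      γ = eta E d ^ (n + 1) ∧
      ((Odd n ∨ IsSplit F E) → γ = 1 ∧ ZZ = LL) ∧
      ∃ W : ℂ → ℂ, IsWhittaker p H μF μV Φ a (-n) W ∧
        (∀ s, W s ≠ 0 → -ord d ≤ ord a) ∧
        (a ∈ 𝒪[F] → (Odd n ∨ IsSplit F E) →
          (∀ s : ℂ, N ^ (-(s + n)) ≠ 1 → N ^ (-(s - 1)) ≠ 1 →
            W s =
              D ^ (s + n + 1 / 2) *
                ((1 - N ^ (-(s + n + 1))) * (1 - N ^ (-((r + 1) * (s + n))))) /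
                  (1 - N ^ (-(s + n)))
              + D ^ ((n : ℂ) + 3 / 2) *
                ((1 - N ^ (-s)) * (1 - D ^ (s - 1))) / (1 - N ^ (-(s - 1)))) ∧
          deriv W 0 - 1 / 2 * loga * W 0 =
            (-LL + logD) * W 0
            + D ^ ((n : ℂ) + 1 / 2) *
              ((1 - N ^ (-((n : ℂ) + 1))) / (2 * (1 - N ^ (-(n : ℂ))) ^ 2)) *
              (r * (1 - N ^ (-((r + 2) * (n : ℂ))))
                - (r + 2) * (N ^ (-(n : ℂ)) - N ^ (-((r + 1) * (n : ℂ))))) * logN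
            + D ^ ((n : ℂ) + 1 / 2) * ((1 - D) / (N - 1)) * logN) ∧
        (a ∈ 𝒪[F] → Even n → IsInert F E →
          (∀ s : ℂ, N ^ (-(s + n)) ≠ -1 → N ^ (-(s - 1)) ≠ 1 →
            W s = γ * (
              D ^ (s + n + 1 / 2) *
                ((1 + N ^ (-(s + n + 1))) *
                  (1 - (-1) ^ (r + 1) * N ^ (-((r + 1) * (s + n))))) /
                  (1 + N ^ (-(s + n)))
              + D ^ ((n : ℂ) + 3 / 2) *
                ((1 - N ^ (-s)) * (1 - D ^ (s - 1))) / (1 - N ^ (-(s - 1))))) ∧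
          deriv W 0 - 1 / 2 * loga * W 0 =
            (-LL + logD) * W 0
            + γ * (D ^ ((n : ℂ) + 1 / 2) *
              ((1 + N ^ (-((n : ℂ) + 1))) / (2 * (1 + N ^ (-(n : ℂ))) ^ 2)) *
              (r * (1 - (-1) ^ r * N ^ (-((r + 2) * (n : ℂ))))
                + (r + 2) * (N ^ (-(n : ℂ)) - (-1) ^ r * N ^ (-((r + 1) * (n : ℂ))))) * logN
            + D ^ ((n : ℂ) + 1 / 2) * ((1 - D) / (N - 1)) * logN)))
    ∧
    -- ramified places
    (IsRamified F E → p ≠ 2 → absV d = 1 →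
      ∀ ϖ : intE F E, Irreducible ϖ →
      (Odd n → IsModular ϖ H Λ →
        γ = 1 ∧
        ∃ W : ℂ → ℂ, IsWhittaker p H μF μV Φ a (-n) W ∧
          (∀ s, W s ≠ 0 → 0 ≤ ord a) ∧
          (a ∈ 𝒪[F] →
            (∀ s : ℂ, N ^ (-(s + n)) ≠ 1 →
              W s = (1 - N ^ (-(s + n + 1))) * (1 - N ^ (-((r + 1) * (s + n)))) /
                  (1 - N ^ (-(s + n))) - (1 - N ^ (-((n : ℂ) + 1)))) ∧
            deriv W 0 - 1 / 2 * loga * W 0 =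
              -ZZ * W 0 - r / 2 * (1 - N ^ (-((n : ℂ) + 1))) * logN
              + N ^ (-((n : ℂ) + 1)) * logN
              + (1 - N ^ (-((n : ℂ) + 1))) / (2 * (1 - N ^ (-(n : ℂ))) ^ 2) *
                (r - (r + 2) * N ^ (-(n : ℂ)) + (r + 2) * N ^ (-((r + 1) * (n : ℂ)))
                  - r * N ^ (-((r + 2) * (n : ℂ)))) * logN)) ∧
      (Even n → IsAlmostModular ϖ H Λ →
        γ ^ 2 = eta E (-1 : F) ∧
        (∀ s : ℂ, localL (fun x : F => eta E x ^ (n + 1)) s = 1) ∧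
        ∃ W : ℂ → ℂ, IsWhittaker p H μF μV Φ a (-n) W ∧
          (∀ s, W s ≠ 0 → 0 ≤ ord a) ∧
          ∀ dV : F, IsHermDet n H dV →
            (a ∈ 𝒪[F] →
              (¬ (∃ z : Eˣ, a = Algebra.norm F (z : E) * ((-1) ^ (n / 2) * dV)) →
                (∀ s : ℂ, W s = γ * (N ^ (-((n : ℂ) + 1 / 2))
                  - N ^ (-((r + 1) * (s + n)) - 1 / 2))) ∧
                deriv W 0 - 1 / 2 * loga * W 0 =
                  γ * ((r + 2) / 2 * N ^ (-((r + 1) * (n : ℂ)) - 1 / 2)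
                    + r / 2 * N ^ (-((n : ℂ) + 1 / 2))) * logN) ∧
              ((∃ z : Eˣ, a = Algebra.norm F (z : E) * ((-1) ^ (n / 2) * dV)) →
                (∀ s : ℂ, W s = γ * (N ^ (-((n : ℂ) + 1 / 2))
                  + N ^ (-((r + 1) * (s + n)) - 1 / 2))) ∧
                deriv W 0 - 1 / 2 * loga * W 0 =
                  γ * (-((r + 2) / 2) * N ^ (-((r + 1) * (n : ℂ)) - 1 / 2)
                    + r / 2 * N ^ (-((n : ℂ) + 1 / 2))) * logN)) ∧
            (r = 0 → ((∃ x ∈ Λ, herm H x = a) ↔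
              ∃ z : Eˣ, a = Algebra.norm F (z : E) * ((-1) ^ (n / 2) * dV))))) := by
  intro N logN r D logD loga γ Φ LL ZZ
  have hchar : CharZero F := charZero_of_injective_algebraMap (algebraMap ℚ_[p] F).injective
  have hfinE : Module.Finite F E := Module.finite_of_finrank_pos (by omega)
  have hfinV : Module.Finite F V := Module.Finite.trans E V
  have hntE : Nontrivial E := Module.nontrivial_of_finrank_pos (R := F) (by omega)
  have hfr : Module.finrank F V = 2 * (n + 1) := by
    rw [← Module.finrank_mul_finrank F E V, hE, hV]
  have hquad : IsReduced E → ∃ (δ : E) (D : F) (b : Module.Basis (Fin 2) F E), D ≠ 0 ∧ b 0 = 1 ∧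
      b 1 = δ ∧ δ * δ = algebraMap F E D ∧ τ δ = -δ := fun hred => exists_sqrt_gen hE hred τ hτ
  have hinvol : IsReduced E → IsQuadInvolution τ := fun hred => by
    obtain ⟨δ, D, b, -, hb0, hb1, hD, hτδ⟩ := hquad hred
    exact isQuadInvolution_of_sqrt hb0 hb1 hD hτδ
  have hr : a ∈ 𝒪[F] → ∃ r : ℕ, ord a = r := fun haO => Int.eq_ofNat_of_zero_le (ord_nonneg haO)
  obtain ⟨δ, hδ⟩ := Int.eq_ofNat_of_zero_le (ord_nonneg hd.mem_integer)
  refine ⟨fun hv hself => ?_, fun hR hp2 hD ϖ hϖ => ?_⟩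
  · -- the split and the inert case differ in the sign `ε = η(ϖ)`
    obtain ⟨h, ε, hε1, hεS, hεI, hη, hγ, W, hW, hW0, hWr⟩ : ∃ (_ : IsQuadInvolution τ) (ε : ℂ),
        (ε = 1 ∨ ε = -1) ∧ (IsSplit F E → ε = 1) ∧ (IsInert F E → ε = -1) ∧
        (∀ x : F, x ≠ 0 → eta E x = ε ^ ord x) ∧
        weilIndex p H μV = eta E d ^ (n + 1) ∧
        ∃ W : ℂ → ℂ, IsWhittaker p H μF μV (Set.indicator (Λ : Set V) 1) a (-n) W ∧
          (∀ s, W s ≠ 0 → -ord d ≤ ord a) ∧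
          ∀ r : ℕ, ord a = r → W = whittakerModel (resCard F) (ε ^ (n + 1))
            (weilIndex p H μV * (absV d : ℂ) ^ ((n : ℂ) + 3 / 2)) n δ r := by
      have hself' : dualLattice H Λ = Λ := hself
      rcases hv with hS | hI
      · have h := hinvol (isReduced_of_isSplit hS)
        obtain ⟨e, g⟩ := hS.exists_intGen hE hτ
        have hperp := perp_eq_scal hd h hH (g.trace_dual h (by norm_num) (by norm_num)) Λ
        rw [one_mul, hself'] at hperp
        have hη : ∀ x : F, x ≠ 0 → eta E x = (1 : ℂ) ^ ord x := fun x hx => by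
          rw [g.eta_split h hx, one_zpow]
        have hcpt := hΛ.isCompactOpen (p := p) g
        exact ⟨h, 1, Or.inl rfl, fun _ => rfl, fun hI => absurd hI.1 hS.not_isField, hη,
          whittaker_unramified h hH hd hμV hμF hfr ha hcpt hself' hperp (Or.inl rfl) hη
            (fun b k hb hk => by
              rw [one_mul]
              exact setIntegral_split hd h hH hμV hcpt hself' hperp g hfr hb k hk) hδ⟩
      · have hred := isReduced_of_isField hI.1
        have h := hinvol hred
        obtain ⟨δ', -, b, -, hb0, hb1, -, -⟩ := hquad hred
        obtain ⟨e, t, m, g⟩ := hI.exists_intGen h ⟨δ', b, hb0, hb1⟩ hτ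
        have hperp := perp_eq_scal hd h hH (g.trace_dual h g.disc.1 (integer_of_ord (Or.inr (by
          rw [ord_inv g.disc.1, g.disc.2, neg_zero])))) Λ
        rw [one_mul, hself'] at hperp
        have hη : ∀ x : F, x ≠ 0 → eta E x = (-1 : ℂ) ^ ord x := fun x hx => g.eta_eq h hx
        have hcpt := hΛ.isCompactOpen (p := p) g.toIsIntGen
        exact ⟨h, -1, Or.inr rfl, fun hS => absurd hI.1 hS.not_isField, fun _ => rfl, hη,
          whittaker_unramified h hH hd hμV hμF hfr ha hcpt hself' hperp (Or.inr rfl) hη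
            (fun b k hb hk => by
              rw [neg_one_mul]
              exact setIntegral_inert hd h hH hμV hcpt hself' hperp g hI hfr hΛ.1 hb k hk) hδ⟩
    have hκ : Odd n ∨ IsSplit F E → ε ^ (n + 1) = 1 := by
      rintro (hodd | hS)
      · rcases hε1 with rfl | rfl
        · exact one_pow _
        · exact (Odd.add_one hodd).neg_one_pow
      · rw [hεS hS, one_pow]
    have hγ1 : Odd n ∨ IsSplit F E → weilIndex p H μV = 1 := fun hc => by
      rw [hγ, hη d hd.1, ← zpow_natCast, zpow_comm, zpow_natCast, hκ hc, one_zpow]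
    have hL := localL_eta_unramified hη (n + 1)
    refine ⟨hγ, fun hc => ⟨hγ1 hc, ?_⟩, W, hW, hW0, fun haO hc => ?_, fun haO hev hI => ?_⟩
    · rw [hκ hc] at hL
      change logDeriv (localZeta F) (n + 1) =
        logDeriv (localL (fun x : F => eta E x ^ (n + 1))) (n + 1)
      rw [hL, localZeta_eq]
    · obtain ⟨r, hr⟩ := hr haO
      have hWr := hWr r hr
      rw [hκ hc] at hL hWr
      exact formulas_unramified_pos hd.1 hδ ha hr hn (hγ1 hc) hL hWr
    · obtain ⟨r, hr⟩ := hr haO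
      have hWr := hWr r hr
      rw [hεI hI, hev.add_one.neg_one_pow] at hL hWr
      exact formulas_unramified_neg hd.1 hδ ha hr hn hL hWr
  · have hred := isReduced_of_isField hR.1
    have h := hinvol hred
    obtain ⟨e, m, g⟩ := hR.exists_intGen h (hquad hred) (isUnit_two p hp2)
    have hd0 : ord d = 0 := (absV_eq_one_iff.1 hD).2
    have hcpt := hΛ.isCompactOpen (p := p) g.toIsIntGen
    have hscal : invScale ϖ Λ = scal e Λ := by
      obtain ⟨u, v, hu, hv, huv, hϖe⟩ := g.irreducible_eq h ϖ hϖ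
      rw [invScale_eq_scal, hϖe, scal_mul_unit hu hv huv]
    have := hμV.1
    refine ⟨fun hodd hmod => ?_, fun hev hmod => ?_⟩
    · obtain ⟨hvol, hγ, hint, hε⟩ := ramified_modular hd hd0 h hH g hμV hcpt hfr
        (hscal ▸ hmod : dualLattice H Λ = scal e Λ)
      obtain ⟨W, hW, hW0, hWr⟩ := isWhittaker_modular h hH hd hcpt hμF ha hd0 hγ hvol hint hε
      refine ⟨hγ, W, hW, hW0, fun haO => ?_⟩
      obtain ⟨r, hr⟩ := hr haO
      exact formulas_modular ha hr hn (hWr r hr)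
    · obtain ⟨χ, hχ1, hχ⟩ := exists_residueChar_ramified g hd hd0
      obtain ⟨x₀, hx₀, c, hc, hqc, hq, hvol, hγ, hγ2, hint, hε⟩ :=
        ramified_almostModular h hH g hd hd0 hμV hcpt hfr
          (hscal ▸ hmod : dualLattice H Λ ⋖ scal e Λ) hχ1 hχ
      obtain ⟨α, hα, haα⟩ := g.exists_unit_mul_zpow ha
      obtain ⟨W, hW, hW0, hWr⟩ := isWhittaker_almostModular h hH g hd hd0 hcpt hμF hχ1 hχ ha haα
        hvol hγ hint hε
      have hv0 : 0 < μV.real (Λ : Set V) := by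
        refine lt_of_le_of_ne measureReal_nonneg fun h0 => ?_
        rw [← h0] at hvol
        norm_num at hvol
      refine ⟨hγ2, g.localL_eta h hev.add_one, W, hW, hW0, fun dV hdV => ?_⟩
      obtain ⟨z₀, u, hu, huc, hdVu⟩ := resChar_eq_of_isHermDet h hH g hd hd0 hμV hR.1 hV hfr hev
        hχ1 hχ hv0 hvol hγ hdV
      have hnorm : (∃ z : Eˣ, a = Algebra.norm F (z : E) * ((-1) ^ (n / 2) * dV)) ↔
          resChar c * resChar α = 1 := by
        rw [hdVu, ← huc, ← g.exists_norm_mul_iff h hα hu (ord a) z₀, ← haα]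
      rw [hnorm]
      refine ⟨fun haO => ?_, fun hr0 => ?_⟩
      · obtain ⟨r, hr⟩ := hr haO
        have hWr := hWr r hr
        have hder := formulas_almostModular ha hr hWr
        have hra : ((ord a : ℤ) : ℂ) = (r : ℂ) := by rw [hr, Int.cast_natCast]
        refine ⟨fun hne => ?_, fun heq => ?_⟩
        · have hneg : resChar c * resChar α = -1 := by
            rw [← resChar_mul] at hne ⊢
            exact (resChar_eq_one_or (residue_mul_ne_zero hc hα)).resolve_left hne
          rw [hneg] at hWr hder
          refine ⟨fun s => ?_, ?_⟩
          · change W s = weilIndex p H μV * _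
            rw [hWr, ← hra]
            ring
          · refine hder.trans ?_
            change weilIndex p H μV * _ * _ = weilIndex p H μV * _ * _
            ring
        · rw [heq] at hWr hder
          refine ⟨fun s => ?_, ?_⟩
          · change W s = weilIndex p H μV * _
            rw [hWr, ← hra]
            ring
          · refine hder.trans ?_
            change weilIndex p H μV * _ * _ = weilIndex p H μV * _ * _
            ring
      · have haα' : a = α := by
          change ord a = 0 at hr0
          rw [haα, hr0, zpow_zero, mul_one]
        rw [haα']
        exact exists_herm_eq_iff h hH g hx₀ hc hqc hq hα
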